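/- Subsequence indexing is the problem of preprocessing a string $T$ of length $n$ over the alphabet $\{0,\dots,\sigma-1\}$, $\sigma\ge 1$, into a data structure that answers queries "is $Q$ a subsequence of $T$?" for arbitrary strings $Q$ over the same alphabet; $m$ denotes the length of $Q$. The model is the deterministic word RAM with logarithmic-sized words: word size $w\ge k\log_2(n+\sigma+1)$ for a suitable constant $k\ge 1$, $m<2^w$, unit-cost arithmetic, bitwise and comparison operations on words, and space measured in words of memory. Factors and terms in the bounds are read as at least $1$ (that is, $n$, $m$, $\log\log\sigma$ stand for $n+1$, $m+1$, $1+\log_2\log_2\sigma$, the last one being $1$ for $\sigma=1$). (1) For every constant $\varepsilon>0$, subsequence indexing can be solved with $O(n\sigma^{\varepsilon})$ preprocessing time and space and $O(m)$ query time, where the algorithm, $k$ and the constants in the $O$-bounds depend only on $\varepsilon$. (2) For alphabets of size polynomially bounded in $n$, i.e. $\sigma\le (n+1)^c$ for an arbitrary constant $c$, subsequence indexing can be solved with $O(n)$ preprocessing time and space and $O(m\log\log\sigma)$ query time, where the algorithm, $k$ and the constants in the $O$-bounds depend only on $c$. -/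

import Mathlib

/-! A word RAM with `w`-bit words, programmed in a structured imperative language.
A machine has finitely many registers per program (only those which the program mentions matter),
a random-access memory of `S` words, and a read-only random-access input. All stored values are
words, that is natural numbers below `2 ^ w`, and arithmetic is modulo `2 ^ w`. -/

namespace WordRAM

/-- The unit-cost word operations. -/
inductive BinOp where
  | add | sub | mul | div | mod | and | or | xor | shl | shr | lt | eq

/-- Meaning of the operations on `w`-bit words (`x / 0 = 0` and `x % 0 = x`;
comparisons return `1` for true and `0` for false). -/
def BinOp.eval (w : ℕ) : BinOp → ℕ → ℕ → ℕ
  | .add, x, y => (x + y) % 2 ^ w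
  | .sub, x, y => (x + (2 ^ w - y)) % 2 ^ w
  | .mul, x, y => (x * y) % 2 ^ w
  | .div, x, y => x / y
  | .mod, x, y => x % y
  | .and, x, y => x &&& y
  | .or, x, y => x ||| y
  | .xor, x, y => x ^^^ y
  | .shl, x, y => (x <<< y) % 2 ^ w
  | .shr, x, y => x >>> y
  | .lt, x, y => if x < y then 1 else 0
  | .eq, x, y => if x = y then 1 else 0

/-- Expressions over constants and registers (no memory access inside expressions). -/
inductive Expr where
  | const (c : ℕ)
  | reg (r : ℕ)
  | bin (o : BinOp) (a b : Expr)

/-- Value of an expression under the register contents `ρ`. -/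
def Expr.eval (w : ℕ) (ρ : ℕ → ℕ) : Expr → ℕ
  | .const c => c % 2 ^ w
  | .reg r => ρ r
  | .bin o a b => o.eval w (a.eval w ρ) (b.eval w ρ)

/-- Time to evaluate an expression: one unit per node of its syntax tree. -/
def Expr.cost : Expr → ℕ
  | .const _ => 1
  | .reg _ => 1
  | .bin _ a b => a.cost + b.cost + 1

/-- Programs. -/
inductive Prog where
  | skip
  /-- `r := e` -/
  | assign (r : ℕ) (e : Expr)
  /-- `r := memory[e]` -/
  | load (r : ℕ) (e : Expr)
  /-- `memory[a] := e` -/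
  | store (a e : Expr)
  /-- `r := input[e]` -/
  | read (r : ℕ) (e : Expr)
  | seq (p q : Prog)
  /-- if `e ≠ 0` then `p` else `q` -/
  | ite (e : Expr) (p q : Prog)
  /-- while `e ≠ 0` do `p` -/
  | loop (e : Expr) (p : Prog)

/-- Contents of the registers and of the memory. -/
structure State where
  reg : ℕ → ℕ
  mem : ℕ → ℕ

/-- `Exec w S inp p s t s'`: on a machine with `w`-bit words, `S` words of memory and read-only
input `inp`, program `p` started in state `s` halts in state `s'` after exactly `t` time units.
There is no such run if the program does not halt, accesses a memory address that is not
below `S`, or reads beyond the end of the input. -/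
inductive Exec (w S : ℕ) (inp : List ℕ) : Prog → State → ℕ → State → Prop
  | skip (s : State) : Exec w S inp .skip s 1 s
  | assign (s : State) (r : ℕ) (e : Expr) :
      Exec w S inp (.assign r e) s (e.cost + 1)
        ⟨Function.update s.reg r (e.eval w s.reg), s.mem⟩
  | load (s : State) (r : ℕ) (e : Expr) (h : e.eval w s.reg < S) :
      Exec w S inp (.load r e) s (e.cost + 1)
        ⟨Function.update s.reg r (s.mem (e.eval w s.reg)), s.mem⟩
  | store (s : State) (a e : Expr) (h : a.eval w s.reg < S) :
      Exec w S inp (.store a e) s (a.cost + e.cost + 1)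
        ⟨s.reg, Function.update s.mem (a.eval w s.reg) (e.eval w s.reg)⟩
  | read (s : State) (r : ℕ) (e : Expr) (h : e.eval w s.reg < inp.length) :
      Exec w S inp (.read r e) s (e.cost + 1)
        ⟨Function.update s.reg r (inp[e.eval w s.reg]'h), s.mem⟩
  | seq {p q : Prog} {s s₁ s₂ : State} {t₁ t₂ : ℕ}
      (h₁ : Exec w S inp p s t₁ s₁) (h₂ : Exec w S inp q s₁ t₂ s₂) :
      Exec w S inp (.seq p q) s (t₁ + t₂) s₂
  | ite_true {e : Expr} {p q : Prog} {s s' : State} {t : ℕ}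
      (he : e.eval w s.reg ≠ 0) (h : Exec w S inp p s t s') :
      Exec w S inp (.ite e p q) s (e.cost + 1 + t) s'
  | ite_false {e : Expr} {p q : Prog} {s s' : State} {t : ℕ}
      (he : e.eval w s.reg = 0) (h : Exec w S inp q s t s') :
      Exec w S inp (.ite e p q) s (e.cost + 1 + t) s'
  | loop_done {e : Expr} {p : Prog} {s : State} (he : e.eval w s.reg = 0) :
      Exec w S inp (.loop e p) s (e.cost + 1) s
  | loop_step {e : Expr} {p : Prog} {s s₁ s₂ : State} {t₁ t₂ : ℕ}
      (he : e.eval w s.reg ≠ 0) (h₁ : Exec w S inp p s t₁ s₁)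
      (h₂ : Exec w S inp (.loop e p) s₁ t₂ s₂) :
      Exec w S inp (.loop e p) s (e.cost + 1 + t₁ + t₂) s₂

/-- Start of preprocessing: length of the text in register `0`, size of the alphabet in
register `1`, all other registers and the memory zero. -/
def preStart (n σ : ℕ) : State :=
  ⟨fun r => if r = 0 then n else if r = 1 then σ else 0, fun _ => 0⟩

/-- Start of a query: length of the query string in register `0`, all other registers zero,
the memory as given. -/
def queryStart (m : ℕ) (mem : ℕ → ℕ) : State :=
  ⟨fun r => if r = 0 then m else 0, mem⟩

end WordRAM

open WordRAM in
/-- The pair of programs `pre`, `qry` solves subsequence indexing on the text `T` over the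
alphabet `{0, …, σ - 1}`, on a word RAM with `w`-bit words, with preprocessing time and space
(in words) at most `f` and with time at most `g m` for a query string of length `m`:

* within time `f`, using at most `f` words of memory, `pre` turns `T` into a data structure
  (the memory contents it leaves behind);
* from the data structure alone and from any string `Q` whose length fits into a word, within
  time `g |Q|` and in the same memory, `qry` outputs in register `0` whether `Q` is a
  subsequence of `T` (`1` for yes, `0` for no), and leaves the data structure intact, so that
  any sequence of queries can be answered. -/
def SolvesSubsequenceIndexing (pre qry : Prog) (w : ℕ) {σ : ℕ} (T : List (Fin σ))
    (f : ℝ) (g : ℕ → ℝ) : Prop :=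
  ∃ (S t : ℕ) (D : State),
    (S : ℝ) ≤ f ∧ (t : ℝ) ≤ f ∧
    Exec w S (T.map Fin.val) pre (preStart T.length σ) t D ∧
    ∀ Q : List (Fin σ), Q.length < 2 ^ w →
      ∃ (u : ℕ) (R : State),
        (u : ℝ) ≤ g Q.length ∧
        Exec w S (Q.map Fin.val) qry (queryStart Q.length D.mem) u R ∧
        R.mem = D.mem ∧
        (Q.Sublist T → R.reg 0 = 1) ∧ (¬ Q.Sublist T → R.reg 0 = 0)

/-! A position in the text is represented by the length of the suffix that starts there. The cursor
`cur` of a query means that the suffix of length `cur - 1` is still available, so it starts at `n +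
1`, and `0` means failure. Greedy matching replaces `cur` by `step L cur a`, the leftmost occurrence
of the next letter `a` in what remains. `foldl_step_ne_zero_iff` shows that a nonzero final cursor
is equivalent to being a subsequence. Both claims thus reduce to a data structure for `step`;
`solves_of_vc` packages this reduction. Running times and the absence of overflow are proved along
with correctness by a verification condition calculus (`vc_sound`, `vc_loop`, `vc_forUp`).

First claim. As functions of the letter, `step L (r + 2)` and `step L (r + 1)` differ in at most one
value. All of them are therefore stored as versions of one persistent trie over the letters, of
constant height `d + 1 > 1 / ε` and fan-out `B = O(σ ^ (1 / (d + 1)))`. A new version copies the `d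
+ 1` nodes on one path (`Repr.insert`), at a cost of `O(B)` for constant `d`. A query walks down `d
+ 1` levels.

Second claim. Positions are cut into blocks of length `ℓ = min σ (n + 2)`. A table keeps `step` at
the start of each block, in `O(n)` words altogether. Inside a block every position becomes an
integer key made of its letter and its number, and a step becomes a predecessor search among these
keys (`block_step`). The keys have `D = c + 2` digits of `ρ` bits, where `2 ^ ρ = O(ℓ)`, and are
radix sorted in linear time. Every `d`-th key, for `d = D * ρ ^ 2`, is a sample. All bit prefixes of
the samples go into a perfect hash table. A search finds the longest prefix of the query key in the
table, with `D` probes at digit boundaries and a bisection inside one digit. This yields the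
preceding sample, and a bisection among `d` consecutive keys finishes the search. Both bisections
take `O(log ρ)`, which is `O(log log σ)` after the convention for small alphabets.

The hash table has to be built deterministically in time `O(2 ^ ρ)`. A prefix is named by a pair of
`ρ`-bit words: its depth together with the first sample sharing the digit-aligned part, and the bits
of its last digit (`prefix_eq_iff`, `key_inj`). Such pairs are hashed by double displacement. A
displacement gives each group of elements an offset that is xored to their values. The offset is
chosen bit by bit by conditional expectations over a tree of counters (`vc_chooseDisp`), so a group
collides with earlier groups no more often than on average. A first displacement leaves at most `M ^
2 / 2 ^ ρ` ordered collisions. This makes large groups rare enough (`decay_of_sum_le`) for a second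
displacement, treating large groups first, to have no collisions at all (`DispInv.insert`,
`vc_buildHash`). The construction costs `O(ρ)` per prefix. The sampling rate makes the number of
prefixes `O(2 ^ ρ / ρ)`, so the total per block is linear. -/

namespace WordRAM

/-! ### Verification conditions for word RAM programs -/

/-- The truth value of `x < y` as a word. -/
def ltVal (x y : ℕ) : ℕ := if x < y then 1 else 0

/-- The truth value of `x = y` as a word. -/
def eqVal (x y : ℕ) : ℕ := if x = y then 1 else 0

@[simp] theorem ltVal_eq_zero {x y : ℕ} : ltVal x y = 0 ↔ y ≤ x := by
  unfold ltVal; split_ifs <;> simp <;> omega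

theorem ltVal_eq_one {x y : ℕ} : ltVal x y = 1 ↔ x < y := by
  unfold ltVal; split_ifs <;> simp <;> omega

@[simp] theorem eqVal_eq_zero {x y : ℕ} : eqVal x y = 0 ↔ x ≠ y := by
  unfold eqVal; split_ifs <;> simp_all

/-- Value of a word operation over the natural numbers, without reduction modulo `2 ^ w`. -/
@[simp] def BinOp.val : BinOp → ℕ → ℕ → ℕ
  | .add, x, y => x + y
  | .sub, x, y => x - y
  | .mul, x, y => x * y
  | .div, x, y => x / y
  | .mod, x, y => x % y
  | .and, x, y => x &&& y
  | .or, x, y => x ||| y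
  | .xor, x, y => x ^^^ y
  | .shl, x, y => x * 2 ^ y
  | .shr, x, y => x / 2 ^ y
  | .lt, x, y => ltVal x y
  | .eq, x, y => eqVal x y

/-- The operation neither overflows nor underflows on `w`-bit words. -/
@[simp] def BinOp.Ok (w : ℕ) : BinOp → ℕ → ℕ → Prop
  | .add, x, y => x + y < 2 ^ w
  | .sub, x, y => y ≤ x ∧ x < 2 ^ w
  | .mul, x, y => x * y < 2 ^ w
  | .shl, x, y => x * 2 ^ y < 2 ^ w
  | _, _, _ => True

theorem BinOp.eval_eq_val {w : ℕ} {o : BinOp} {x y : ℕ} (h : o.Ok w x y) :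
    o.eval w x y = o.val x y := by
  cases o <;> simp only [BinOp.Ok] at h <;>
    simp only [BinOp.eval, BinOp.val, ltVal, eqVal, Nat.shiftLeft_eq, Nat.shiftRight_eq_div_pow]
  · exact Nat.mod_eq_of_lt h
  · have : x + (2 ^ w - y) = (x - y) + 2 ^ w := by omega
    rw [this, Nat.add_mod_right]
    exact Nat.mod_eq_of_lt (by omega)
  · exact Nat.mod_eq_of_lt h
  · exact Nat.mod_eq_of_lt h

/-- Value of an expression over the natural numbers. -/
@[simp] def Expr.val (ρ : ℕ → ℕ) : Expr → ℕ
  | .const c => c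
  | .reg r => ρ r
  | .bin o a b => o.val (a.val ρ) (b.val ρ)

/-- No overflow occurs in the evaluation of the expression. -/
@[simp] def Expr.Ok (w : ℕ) (ρ : ℕ → ℕ) : Expr → Prop
  | .const c => c < 2 ^ w
  | .reg _ => True
  | .bin o a b => a.Ok w ρ ∧ b.Ok w ρ ∧ o.Ok w (a.val ρ) (b.val ρ)

theorem Expr.eval_eq_val {w : ℕ} {ρ : ℕ → ℕ} {e : Expr} (h : e.Ok w ρ) :
    e.eval w ρ = e.val ρ := by
  induction e with
  | const c => exact Nat.mod_eq_of_lt h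
  | reg r => rfl
  | bin o a b iha ihb =>
    obtain ⟨ha, hb, ho⟩ := h
    simp only [Expr.eval, Expr.val, iha ha, ihb hb]
    exact BinOp.eval_eq_val ho

attribute [simp] Expr.cost

instance : Add Expr := ⟨.bin .add⟩
instance : Sub Expr := ⟨.bin .sub⟩
instance : Mul Expr := ⟨.bin .mul⟩
instance : Div Expr := ⟨.bin .div⟩
instance : Mod Expr := ⟨.bin .mod⟩
instance : XorOp Expr := ⟨.bin .xor⟩
instance (n : ℕ) : OfNat Expr n := ⟨.const (OfNat.ofNat n)⟩

@[simp] theorem Expr.add_def (a b : Expr) : a + b = .bin .add a b := rfl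
@[simp] theorem Expr.sub_def (a b : Expr) : a - b = .bin .sub a b := rfl
@[simp] theorem Expr.mul_def (a b : Expr) : a * b = .bin .mul a b := rfl
@[simp] theorem Expr.div_def (a b : Expr) : a / b = .bin .div a b := rfl
@[simp] theorem Expr.mod_def (a b : Expr) : a % b = .bin .mod a b := rfl
@[simp] theorem Expr.xor_def (a b : Expr) : a ^^^ b = .bin .xor a b := rfl
@[simp] theorem Expr.ofNat_def (n : ℕ) : (OfNat.ofNat n : Expr) = .const (OfNat.ofNat n) := rfl

/-- The expression `2 ^ a`. -/
abbrev Expr.two_pow (a : Expr) : Expr := .bin .shl 1 a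

/-- Sequential composition. -/
infixr:60 " ;; " => Prog.seq

/-- May the program write to the register? -/
def Prog.writes : Prog → ℕ → Bool
  | .skip, _ => false
  | .assign r _, x => x == r
  | .load r _, x => x == r
  | .store _ _, _ => false
  | .read r _, x => x == r
  | .seq p q, x => p.writes x || q.writes x
  | .ite _ p q, x => p.writes x || q.writes x
  | .loop _ p, x => p.writes x

/-- May the program write to the memory? -/
def Prog.stores : Prog → Bool
  | .store _ _ => true
  | .seq p q => p.stores || q.stores
  | .ite _ p q => p.stores || q.stores
  | .loop _ p => p.stores
  | _ => false

theorem Exec.frame {w S : ℕ} {inp : List ℕ} {p : Prog} {s s' : State} {t : ℕ}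
    (h : Exec w S inp p s t s') {r : ℕ} (hr : p.writes r = false) : s'.reg r = s.reg r := by
  induction h with
  | skip => rfl
  | assign => simp_all [Prog.writes]
  | load => simp_all [Prog.writes]
  | store => rfl
  | read => simp_all [Prog.writes]
  | seq _ _ ih₁ ih₂ =>
    simp only [Prog.writes, Bool.or_eq_false_iff] at hr
    rw [ih₂ hr.2, ih₁ hr.1]
  | ite_true _ _ ih =>
    simp only [Prog.writes, Bool.or_eq_false_iff] at hr
    exact ih hr.1
  | ite_false _ _ ih =>
    simp only [Prog.writes, Bool.or_eq_false_iff] at hr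
    exact ih hr.2
  | loop_done => rfl
  | loop_step _ _ _ ih₁ ih₂ =>
    rw [ih₂ hr, ih₁ (by simpa [Prog.writes] using hr)]

theorem Exec.mem_eq {w S : ℕ} {inp : List ℕ} {p : Prog} {s s' : State} {t : ℕ}
    (h : Exec w S inp p s t s') (hr : p.stores = false) : s'.mem = s.mem := by
  induction h with
  | store => simp [Prog.stores] at hr
  | seq _ _ ih₁ ih₂ =>
    simp only [Prog.stores, Bool.or_eq_false_iff] at hr
    rw [ih₂ hr.2, ih₁ hr.1]
  | ite_true _ _ ih =>
    simp only [Prog.stores, Bool.or_eq_false_iff] at hr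
    exact ih hr.1
  | ite_false _ _ ih =>
    simp only [Prog.stores, Bool.or_eq_false_iff] at hr
    exact ih hr.2
  | loop_step _ _ _ ih₁ ih₂ =>
    rw [ih₂ hr, ih₁ (by simpa [Prog.stores] using hr)]
  | _ => rfl

/-- The letter at a position of the input, `0` beyond its end. -/
def readAt (l : List ℕ) (i : ℕ) : ℕ := l.getD i 0

theorem readAt_eq {l : List ℕ} {i : ℕ} (h : i < l.length) : readAt l i = l[i] :=
  List.getD_eq_getElem _ _ h

/-- Verification conditions for: the program halts without overflow after some time `t` in some
state `s'` with `Q t s'`. -/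
@[simp] def vc (w S : ℕ) (inp : List ℕ) : Prog → State → (ℕ → State → Prop) → Prop
  | .skip, s, Q => Q 1 s
  | .assign r e, s, Q =>
      e.Ok w s.reg ∧ Q (e.cost + 1) ⟨Function.update s.reg r (e.val s.reg), s.mem⟩
  | .load r e, s, Q =>
      e.Ok w s.reg ∧ e.val s.reg < S ∧
        Q (e.cost + 1) ⟨Function.update s.reg r (s.mem (e.val s.reg)), s.mem⟩
  | .store a e, s, Q =>
      a.Ok w s.reg ∧ e.Ok w s.reg ∧ a.val s.reg < S ∧
        Q (a.cost + e.cost + 1) ⟨s.reg, Function.update s.mem (a.val s.reg) (e.val s.reg)⟩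
  | .read r e, s, Q =>
      e.Ok w s.reg ∧ e.val s.reg < inp.length ∧
        Q (e.cost + 1) ⟨Function.update s.reg r (readAt inp (e.val s.reg)), s.mem⟩
  | .seq p q, s, Q => vc w S inp p s fun t s' => vc w S inp q s' fun t' s'' => Q (t + t') s''
  | .ite e p q, s, Q =>
      e.Ok w s.reg ∧
        (e.val s.reg ≠ 0 → vc w S inp p s fun t s' => Q (e.cost + 1 + t) s') ∧
        (e.val s.reg = 0 → vc w S inp q s fun t s' => Q (e.cost + 1 + t) s')
  | .loop e p, s, Q => ∃ t s', Exec w S inp (.loop e p) s t s' ∧ Q t s'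

variable {w S : ℕ} {inp : List ℕ}

/-- The loop clause of `vc` asks for an execution outright, so this induction needs no invariants.
They enter only through `vc_loop` and the rules derived from it. -/
theorem vc_sound {p : Prog} {s : State} {Q : ℕ → State → Prop} (h : vc w S inp p s Q) :
    ∃ t s', Exec w S inp p s t s' ∧ Q t s' := by
  induction p generalizing s Q with
  | skip => exact ⟨_, _, .skip s, h⟩
  | assign r e =>
    refine ⟨_, _, .assign s r e, ?_⟩
    rw [Expr.eval_eq_val h.1]
    exact h.2
  | load r e =>
    have he := Expr.eval_eq_val h.1
    refine ⟨_, _, .load s r e (he ▸ h.2.1), ?_⟩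
    rw [he]
    exact h.2.2
  | store a e =>
    have ha := Expr.eval_eq_val h.1
    refine ⟨_, _, .store s a e (ha ▸ h.2.2.1), ?_⟩
    rw [ha, Expr.eval_eq_val h.2.1]
    exact h.2.2.2
  | read r e =>
    have he := Expr.eval_eq_val h.1
    refine ⟨_, _, .read s r e (he ▸ h.2.1), ?_⟩
    have h2 := h.2.2
    rw [readAt_eq h.2.1] at h2
    simpa only [he] using h2
  | seq p q ihp ihq =>
    obtain ⟨t, s₁, h₁, h₂⟩ := ihp h
    obtain ⟨t', s₂, h₃, h₄⟩ := ihq h₂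
    exact ⟨_, _, .seq h₁ h₃, h₄⟩
  | ite e p q ihp ihq =>
    obtain ⟨he, hp, hq⟩ := h
    have hev := Expr.eval_eq_val he
    by_cases h0 : e.val s.reg = 0
    · obtain ⟨t, s₁, h₁, h₂⟩ := ihq (hq h0)
      exact ⟨_, _, .ite_false (hev.trans h0) h₁, h₂⟩
    · obtain ⟨t, s₁, h₁, h₂⟩ := ihp (hp h0)
      exact ⟨_, _, .ite_true (by rwa [hev]) h₁, h₂⟩
  | loop e p _ => exact h

/-- Registers which the program does not mention as targets are the same in both states. -/
def Frame (p : Prog) (s s' : State) : Prop := ∀ r, p.writes r = false → s'.reg r = s.reg r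

theorem Frame.refl (p : Prog) (s : State) : Frame p s s := fun _ _ => rfl

theorem Frame.trans {p : Prog} {s s' s'' : State} (h : Frame p s s') (h' : Frame p s' s'') :
    Frame p s s'' := fun r hr => (h' r hr).trans (h r hr)

/-- The rule of consequence, with the register frame and the memory frame for free. -/
theorem vc_conseq {p : Prog} {s : State} {Q Q' : ℕ → State → Prop} (h : vc w S inp p s Q)
    (hQ : ∀ t s', Frame p s s' → (p.stores = false → s'.mem = s.mem) → Q t s' → Q' t s') :
    vc w S inp p s Q' := by
  induction p generalizing s Q Q' with
  | skip => exact hQ _ _ (Frame.refl _ _) (fun _ => rfl) h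
  | assign r e =>
    refine ⟨h.1, hQ _ _ (fun x hx => ?_) (fun _ => rfl) h.2⟩
    simp_all [Prog.writes]
  | load r e =>
    refine ⟨h.1, h.2.1, hQ _ _ (fun x hx => ?_) (fun _ => rfl) h.2.2⟩
    simp_all [Prog.writes]
  | store a e =>
    refine ⟨h.1, h.2.1, h.2.2.1, hQ _ _ (fun x hx => rfl) (fun h => ?_) h.2.2.2⟩
    simp [Prog.stores] at h
  | read r e =>
    refine ⟨h.1, h.2.1, hQ _ _ (fun x hx => ?_) (fun _ => rfl) h.2.2⟩
    simp_all [Prog.writes]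
  | seq p q ihp ihq =>
    refine ihp h fun t s₁ f₁ m₁ h₁ => ihq h₁ fun t' s₂ f₂ m₂ h₂ => hQ _ _ (fun r hr => ?_) ?_ h₂
    · simp only [Prog.writes, Bool.or_eq_false_iff] at hr
      rw [f₂ r hr.2, f₁ r hr.1]
    · intro hs
      simp only [Prog.stores, Bool.or_eq_false_iff] at hs
      rw [m₂ hs.2, m₁ hs.1]
  | ite e p q ihp ihq =>
    refine ⟨h.1, fun h0 => ihp (h.2.1 h0) fun t s₁ f₁ m₁ h₁ => hQ _ _ (fun r hr => ?_) ?_ h₁,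
      fun h0 => ihq (h.2.2 h0) fun t s₁ f₁ m₁ h₁ => hQ _ _ (fun r hr => ?_) ?_ h₁⟩
    · simp only [Prog.writes, Bool.or_eq_false_iff] at hr
      exact f₁ r hr.1
    · intro hs
      simp only [Prog.stores, Bool.or_eq_false_iff] at hs
      exact m₁ hs.1
    · simp only [Prog.writes, Bool.or_eq_false_iff] at hr
      exact f₁ r hr.2
    · intro hs
      simp only [Prog.stores, Bool.or_eq_false_iff] at hs
      exact m₁ hs.2
  | loop e p _ =>
    obtain ⟨t, s', h₁, h₂⟩ := h
    exact ⟨t, s', h₁, hQ _ _ (fun r hr => h₁.frame hr) (fun hs => h₁.mem_eq hs) h₂⟩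

/-- Cuts a verification at a semicolon. Registers that `p` does not write, and the memory if `p`
never stores, come out unchanged for free and need not be listed in `Q'`. -/
theorem vc_seq {p q : Prog} {s : State} {Q Q' : ℕ → State → Prop} (h : vc w S inp p s Q')
    (hq : ∀ t s', Frame p s s' → (p.stores = false → s'.mem = s.mem) → Q' t s' →
      vc w S inp q s' fun t' s'' => Q (t + t') s'') :
    vc w S inp (.seq p q) s Q := by
  rw [vc]
  exact vc_conseq h hq

/-- The rule for loops: an invariant on the time spent and the state, and a measure that
decreases. -/
theorem vc_loop {e : Expr} {p : Prog} {s₀ : State} {Q : ℕ → State → Prop}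
    (I : ℕ → State → Prop) (μ : State → ℕ) (h0 : I 0 s₀)
    (hok : ∀ t s, Frame p s₀ s → I t s → e.Ok w s.reg)
    (hstep : ∀ t s, Frame p s₀ s → I t s → e.val s.reg ≠ 0 →
      vc w S inp p s fun t' s' => I (t + (e.cost + 1) + t') s' ∧ μ s' < μ s)
    (hdone : ∀ t s, Frame p s₀ s → I t s → e.val s.reg = 0 → Q (t + (e.cost + 1)) s) :
    vc w S inp (.loop e p) s₀ Q := by
  suffices H : ∀ (m : ℕ) (t : ℕ) (s : State), μ s ≤ m → Frame p s₀ s → I t s →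
      ∃ t' s', Exec w S inp (.loop e p) s t' s' ∧ Q (t + t') s' by
    obtain ⟨t, s', h₁, h₂⟩ := H _ 0 s₀ le_rfl (Frame.refl _ _) h0
    exact ⟨t, s', h₁, by simpa using h₂⟩
  intro m
  induction m using Nat.strong_induction_on with
  | _ m ih =>
    intro t s hm hf hI
    have hev := Expr.eval_eq_val (hok t s hf hI)
    by_cases he : e.val s.reg = 0
    · exact ⟨_, _, .loop_done (hev.trans he), hdone t s hf hI he⟩
    · obtain ⟨t₁, s₁, h₁, hI₁, hμ⟩ := vc_sound (hstep t s hf hI he)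
      obtain ⟨t₂, s₂, h₂, hQ⟩ := ih (μ s₁) (by omega) _ s₁ le_rfl
        (hf.trans fun r hr => h₁.frame hr) hI₁
      refine ⟨_, _, .loop_step (by rwa [hev]) h₁ h₂, ?_⟩
      convert hQ using 1
      ring

/-- `for i := 0, …, reg b - 1 do p`. -/
def forUp (i b : ℕ) (p : Prog) : Prog :=
  .assign i 0 ;; .loop (.bin .lt (.reg i) (.reg b)) (p ;; .assign i (.reg i + 1))

/-- The constants are costs of the loop overhead: each round pays 4 for the test and 4 for the
increment, and outside the rounds there are 2 for the initial assignment and 4 for the last test. -/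
theorem vc_forUp {i b : ℕ} {p : Prog} {s : State} {Q : ℕ → State → Prop}
    (I : ℕ → ℕ → State → Prop) (hib : b ≠ i) (hi : p.writes i = false) (hb : p.writes b = false)
    (hw : s.reg b < 2 ^ w) (hw1 : 1 < 2 ^ w)
    (h0 : I 0 0 ⟨Function.update s.reg i 0, s.mem⟩)
    (hstep : ∀ k t s', k < s.reg b → s'.reg i = k →
      (∀ r, r ≠ i → p.writes r = false → s'.reg r = s.reg r) → I k t s' →
      vc w S inp p s' fun t' s'' =>
        I (k + 1) (t + t' + 8) ⟨Function.update s''.reg i (k + 1), s''.mem⟩)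
    (hdone : ∀ t s', s'.reg i = s.reg b →
      (∀ r, r ≠ i → p.writes r = false → s'.reg r = s.reg r) → I (s.reg b) t s' →
      Q (t + 6) s') :
    vc w S inp (forUp i b p) s Q := by
  have hfr : ∀ s' : State, Frame (p ;; .assign i (.reg i + 1))
      ⟨Function.update s.reg i 0, s.mem⟩ s' →
      ∀ r, r ≠ i → p.writes r = false → s'.reg r = s.reg r := by
    intro s' h r hr hp
    rw [h r (by simp [Prog.writes, hp, hr])]
    simp [hr]
  simp only [forUp, vc, Expr.ofNat_def, Expr.Ok, Expr.val, Expr.cost]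
  refine ⟨by omega, ?_⟩
  refine vc_loop (fun t s' => s'.reg i ≤ s.reg b ∧ I (s'.reg i) t s')
    (fun s' => s.reg b - s'.reg i) ?_ ?_ ?_ ?_
  · simpa using h0
  · intro t s' _ _
    simp
  · intro t s' hf ⟨hle, hI⟩ he
    have hfb : s'.reg b = s.reg b := hfr s' hf b hib hb
    have hlt : s'.reg i < s.reg b := by
      by_contra hc
      simp [hfb, hc] at he
    refine vc_seq (hstep _ t s' hlt rfl (hfr s' hf) hI) ?_
    intro t' s'' hf' _ hI'
    have hi' : s''.reg i = s'.reg i := hf' i hi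
    simp only [vc, Expr.Ok, Expr.val, BinOp.Ok, BinOp.val, hi',
      Expr.cost, Function.update_self]
    refine ⟨⟨trivial, hw1, by omega⟩, ⟨by omega, ?_⟩, by omega⟩
    convert hI' using 1
    ring
  · intro t s' hf ⟨hle, hI⟩ he
    have hfb : s'.reg b = s.reg b := hfr s' hf b hib hb
    have heq : s'.reg i = s.reg b := by
      by_contra hc
      have : s'.reg i < s.reg b := by omega
      simp [hfb] at he
      omega
    have := hdone t s' heq (hfr s' hf) (heq ▸ hI)
    convert this using 1
    simp only [OfNat.ofNat, Expr.cost]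
    ring

/-- The rule for counting loops with a uniform bound on the time of the body. -/
theorem vc_forUp_le {i b : ℕ} {p : Prog} {s : State} {Q : ℕ → State → Prop}
    (B : ℕ) (J : ℕ → State → Prop) (hib : b ≠ i) (hi : p.writes i = false)
    (hb : p.writes b = false) (hw : s.reg b < 2 ^ w) (hw1 : 1 < 2 ^ w)
    (h0 : J 0 ⟨Function.update s.reg i 0, s.mem⟩)
    (hstep : ∀ k s', k < s.reg b → s'.reg i = k →
      (∀ r, r ≠ i → p.writes r = false → s'.reg r = s.reg r) → J k s' →
      vc w S inp p s' fun t' s'' =>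
        t' ≤ B ∧ J (k + 1) ⟨Function.update s''.reg i (k + 1), s''.mem⟩)
    (hdone : ∀ t s', t ≤ s.reg b * (B + 8) + 6 → s'.reg i = s.reg b →
      (∀ r, r ≠ i → p.writes r = false → s'.reg r = s.reg r) → J (s.reg b) s' → Q t s') :
    vc w S inp (forUp i b p) s Q := by
  refine vc_forUp (fun k t s' => t ≤ k * (B + 8) ∧ J k s') hib hi hb hw hw1 ⟨by omega, h0⟩ ?_ ?_
  · intro k t s' hk hi' hf ⟨ht, hJ⟩
    refine vc_conseq (hstep k s' hk hi' hf hJ) ?_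
    rintro t' s'' _ _ ⟨h₁, h₂⟩
    refine ⟨?_, h₂⟩
    rw [Nat.add_mul]
    omega
  · intro t s' hi' hf ⟨ht, hJ⟩
    exact hdone _ s' (by omega) hi' hf hJ

end WordRAM

/-! ### Greedy matching and the common form of the queries -/

namespace WordRAM

/-- The last occurrence of the letter `a` among the positions `r < cur` of the text, where
position `r ≥ 1` is the one at which a suffix of length `r` starts; `0` if there is none. -/
def step (L : List ℕ) (cur a : ℕ) : ℕ :=
  Nat.findGreatest (fun r => 1 ≤ r ∧ readAt L (L.length - r) = a) (cur - 1)

theorem step_le (L : List ℕ) (cur a : ℕ) : step L cur a ≤ cur - 1 := Nat.findGreatest_le _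

theorem step_zero (L : List ℕ) (a : ℕ) : step L 0 a = 0 := rfl

theorem step_one (L : List ℕ) (a : ℕ) : step L 1 a = 0 := rfl

theorem step_succ_succ (L : List ℕ) (r a : ℕ) : step L (r + 2) a =
    if readAt L (L.length - (r + 1)) = a then r + 1 else step L (r + 1) a := by
  simp [step, Nat.findGreatest_succ]

/-- One criterion covers both outcomes: for `r = 0` the first two hypotheses are void and the third
says that the letter does not occur. -/
theorem step_eq_of {L : List ℕ} {cur a r : ℕ} (hr : r ≠ 0 → r < cur)
    (h : r ≠ 0 → readAt L (L.length - r) = a)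
    (h' : ∀ r', r < r' → r' < cur → readAt L (L.length - r') ≠ a) : step L cur a = r := by
  rw [step, Nat.findGreatest_eq_iff]
  refine ⟨?_, fun h0 => ⟨by omega, h h0⟩, fun r' h1 h2 h3 => h' r' h1 (by omega) h3.2⟩
  rcases Nat.eq_zero_or_pos r with h0 | h0
  · omega
  · have := hr (by omega); omega

theorem foldl_step_zero (L q : List ℕ) : q.foldl (step L) 0 = 0 := by
  induction q with
  | nil => rfl
  | cons a q ih => simpa [step_zero] using ih

theorem step_ne_zero_spec {L : List ℕ} {cur a : ℕ} (h : step L cur a ≠ 0) :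
    step L cur a < cur ∧ readAt L (L.length - step L cur a) = a := by
  have h1 := Nat.findGreatest_of_ne_zero (P := fun r => 1 ≤ r ∧ readAt L (L.length - r) = a)
    (n := cur - 1) rfl h
  have := step_le L cur a
  exact ⟨by omega, h1.2⟩

/-- Taking the leftmost occurrence of each letter is optimal. By induction on the cursor, the first
letter of the available suffix either equals the next letter and may be used for it, or cannot be
used and is dropped. The cursor exceeds the length of the suffix by one, so that the value `0` is
free to mean failure even for an empty remaining suffix. -/
theorem foldl_step_ne_zero_iff (L : List ℕ) (q : List ℕ) (cur : ℕ) (h1 : 1 ≤ cur)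
    (hcur : cur ≤ L.length + 1) :
    q.foldl (step L) cur ≠ 0 ↔ q.Sublist (L.drop (L.length + 1 - cur)) := by
  induction cur using Nat.strong_induction_on generalizing q with
  | _ cur ih =>
    cases q with
    | nil => simp; omega
    | cons a q =>
      obtain ⟨c, rfl⟩ : ∃ c, cur = c + 1 := ⟨cur - 1, by omega⟩
      cases c with
      | zero => simp [step_one, foldl_step_zero]
      | succ r =>
        have hlt : L.length + 1 - (r + 1 + 1) < L.length := by omega
        have e1 : L.length - (r + 1) = L.length + 1 - (r + 1 + 1) := by omega
        have e2 : L.length + 1 - (r + 1 + 1) + 1 = L.length + 1 - (r + 1) := by omega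
        have e3 : readAt L (L.length - (r + 1)) = L[L.length + 1 - (r + 1 + 1)] := by
          rw [e1, readAt_eq hlt]
        rw [List.drop_eq_getElem_cons hlt, e2, List.foldl_cons, step_succ_succ, e3]
        split_ifs with hc
        · rw [ih (r + 1) (by omega) q (by omega) (by omega), hc, List.cons_sublist_cons]
        · have := ih (r + 1) (by omega) (a :: q) (by omega) (by omega)
          rw [List.foldl_cons] at this
          rw [this]
          constructor
          · exact fun h => h.cons _
          · intro h
            cases h with
            | cons _ h => exact h
            | cons_cons _ h => exact absurd rfl hc

/-- The query program: `init` loads the parameters and sets register `1` to the length of the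
text plus one; `body` performs a step on register `1` with the letter in register `3`. -/
def queryProg (init body : Prog) : Prog :=
  init ;; forUp 2 0 (.read 3 (.reg 2) ;; body) ;; .assign 0 (.bin .lt 0 (.reg 1))

/-- Both data structures share this loop and differ only in `body`, which performs one step. The
property `P` carries what the structure guarantees; by `hP` it depends only on the memory and on
registers outside `1`, `2`, `3` that the body leaves alone. The 10 per letter is the loop overhead 8
plus 2 for reading the letter. -/
theorem vc_queryProg {w S : ℕ} {L Q mem} {init body : Prog} {P : State → Prop} {B₀ B σ : ℕ}
    (hw : 1 < 2 ^ w) (hQ : Q.length < 2 ^ w) (hσ : ∀ a ∈ Q, a < σ)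
    (h0 : body.writes 0 = false) (h2 : body.writes 2 = false)
    (hi : init.stores = false) (hb : body.stores = false)
    (hP : ∀ s s' : State, P s → s'.mem = s.mem → (∀ r, r ≠ 1 → r ≠ 2 → r ≠ 3 →
      body.writes r = false → s'.reg r = s.reg r) → P s')
    (hinit : vc w S Q init (queryStart Q.length mem) fun t s => t ≤ B₀ ∧
      s.reg 0 = Q.length ∧ s.reg 1 = L.length + 1 ∧ P s)
    (hbody : ∀ s, P s → s.reg 1 ≤ L.length + 1 → s.reg 3 < σ → vc w S Q body s fun t s' =>
      t ≤ B ∧ s'.reg 1 = step L (s.reg 1) (s.reg 3)) :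
    vc w S Q (queryProg init body) (queryStart Q.length mem) fun t s =>
      t ≤ B₀ + Q.length * (B + 10) + 10 ∧ s.mem = mem ∧
      (Q.Sublist L → s.reg 0 = 1) ∧ (¬ Q.Sublist L → s.reg 0 = 0) := by
  refine vc_seq hinit ?_
  rintro t s _ hm ⟨ht, hs0, hs1, hPs⟩
  have hm := hm hi
  rw [vc]
  refine vc_forUp_le (B + 2) (fun k s' => s'.mem = mem ∧ P s' ∧
    s'.reg 1 = (Q.take k).foldl (step L) (L.length + 1)) (by decide) ?_ ?_ (by omega) hw ?_ ?_ ?_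
  · simpa [Prog.writes] using h2
  · simpa [Prog.writes] using h0
  · refine ⟨hm, ?_, by simpa using hs1⟩
    refine hP s _ hPs rfl fun r _ hr _ _ => ?_
    simp [hr]
  · rintro k s' hk hk2 hfr ⟨hm', hPs', hs1'⟩
    rw [hs0] at hk
    have hgt : readAt Q k = Q[k] := readAt_eq hk
    simp only [vc, Expr.Ok, Expr.val, hk2, Expr.cost]
    refine ⟨trivial, hk, ?_⟩
    -- The cursor never grows, so it stays in the range for which the data structure answers.
    have hle : s'.reg 1 ≤ L.length + 1 := by
      rw [hs1']
      generalize Q.take k = q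
      suffices ∀ c ≤ L.length + 1, q.foldl (step L) c ≤ L.length + 1 from this _ le_rfl
      induction q with
      | nil => simp
      | cons a q ih =>
        intro c hc
        have := step_le L c a
        exact ih _ (by omega)
    refine vc_conseq (hbody _ ?_ (by simpa using hle) ?_) ?_
    · refine hP s' _ hPs' rfl fun r _ _ hr _ => ?_
      simp [hr]
    · simp only [Function.update_self, hgt]
      exact hσ _ (List.getElem_mem hk)
    · rintro t' s'' hf hmm ⟨ht', hs''⟩
      have hmm := hmm hb
      refine ⟨by omega, hmm.trans hm', ?_, ?_⟩
      · refine hP s' _ hPs' hmm fun r _ hr hr' hrw => ?_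
        have := hf r hrw
        simpa [hr, hr'] using this
      · have h1 : (1 : ℕ) ≠ 3 := by decide
        have h2 : (1 : ℕ) ≠ 2 := by decide
        simp only [ne_eq, h1, h2, not_false_eq_true, Function.update_of_ne,
          Function.update_self] at hs'' ⊢
        rw [hs'', hs1', hgt, ← List.take_append_getElem hk, List.foldl_append]
        rfl
  · rintro t' s' ht' _ _ ⟨hm', _, hs1'⟩
    rw [hs0] at ht' hs1'
    simp only [List.take_length] at hs1'
    have := foldl_step_ne_zero_iff L Q (L.length + 1) (by omega) le_rfl
    simp only [Nat.sub_self, List.drop_zero, ← hs1'] at this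
    simp only [vc, Expr.Ok, Expr.val, BinOp.Ok, BinOp.val, Expr.cost,
      Function.update_self]
    refine ⟨⟨by omega, trivial, trivial⟩, ?_, hm', ?_, ?_⟩
    · have : B + 2 + 8 = B + 10 := rfl
      rw [this] at ht'
      omega
    · intro h
      exact ltVal_eq_one.2 (Nat.pos_of_ne_zero (this.2 h))
    · intro h
      rw [ltVal_eq_zero]
      by_contra h'
      exact h (this.1 (by omega))

/-- The reduction of the claim to verification conditions. -/
theorem solves_of_vc {pre init body : Prog} {w σ : ℕ} {T : List (Fin σ)} {f : ℝ} {g : ℕ → ℝ}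
    (S tp : ℕ) (hS : (S : ℝ) ≤ f) (htp : (tp : ℝ) ≤ f) (P : State → Prop)
    (B₀ B : ℕ) (hw : 1 < 2 ^ w) (hg : ∀ m : ℕ, ((B₀ + m * (B + 10) + 10 : ℕ) : ℝ) ≤ g m)
    (h0 : body.writes 0 = false) (h2 : body.writes 2 = false)
    (hi : init.stores = false) (hb : body.stores = false)
    (hP : ∀ s s' : State, P s → s'.mem = s.mem → (∀ r, r ≠ 1 → r ≠ 2 → r ≠ 3 →
      body.writes r = false → s'.reg r = s.reg r) → P s')
    (hpre : vc w S (T.map Fin.val) pre (preStart T.length σ) fun t D => t ≤ tp ∧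
      ∀ Q : List ℕ, Q.length < 2 ^ w →
        vc w S Q init (queryStart Q.length D.mem) (fun t s => t ≤ B₀ ∧
          s.reg 0 = Q.length ∧ s.reg 1 = T.length + 1 ∧ P s) ∧
        ∀ s, P s → s.reg 1 ≤ T.length + 1 → s.reg 3 < σ → vc w S Q body s fun t s' =>
          t ≤ B ∧ s'.reg 1 = step (T.map Fin.val) (s.reg 1) (s.reg 3)) :
    SolvesSubsequenceIndexing pre (queryProg init body) w T f g := by
  obtain ⟨t, D, hex, ht, hq⟩ := vc_sound hpre
  refine ⟨S, t, D, hS, le_trans (by exact_mod_cast ht) htp, hex, fun Q hQ => ?_⟩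
  obtain ⟨h₁, h₂⟩ := hq (Q.map Fin.val) (by simpa using hQ)
  have h₃ := vc_queryProg (L := T.map Fin.val) (Q := Q.map Fin.val) (mem := D.mem) (σ := σ) hw
    (by simpa using hQ) (by simp) h0 h2 hi
    hb hP (by simpa using h₁) (by simpa using h₂)
  obtain ⟨u, R, hex', hu, hm, hy, hn⟩ := vc_sound h₃
  have hsub : (Q.map Fin.val).Sublist (T.map Fin.val) ↔ Q.Sublist T := by
    constructor
    · intro h
      obtain ⟨l, hl, he⟩ := List.sublist_map_iff.1 h
      rwa [List.map_injective_iff.2 Fin.val_injective he]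
    · exact fun h => h.map _
  rw [List.length_map] at hu hex'
  exact ⟨u, R, le_trans (by exact_mod_cast hu) (hg Q.length), hex', hm,
    fun h => hy (hsub.2 h), fun h => hn (fun h' => h (hsub.1 h'))⟩

end WordRAM

/-! ### The persistent trie -/

namespace WordRAM

section Trie

variable {M M' : ℕ → ℕ} {B bnd : ℕ}

/-- In the memory `M`, the pointer `p` is the root of a trie of fan-out `B` and height `h` which
represents the function `f`; all nodes lie below `bnd`. The least significant digits of the keys
are at the root. -/
def Repr (M : ℕ → ℕ) (B bnd : ℕ) : ℕ → ℕ → (ℕ → ℕ) → Prop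
  | 0, p, f => p = f 0
  | h + 1, p, f => p + B ≤ bnd ∧ ∀ c < B, Repr M B bnd h (M (p + c + 3)) fun q => f (c + B * q)

/-- The node reached from `p` after following `j` digits of `q`. -/
def walk (M : ℕ → ℕ) (B : ℕ) : ℕ → ℕ → ℕ → ℕ
  | 0, p, _ => p
  | j + 1, p, q => walk M B j (M (p + q % B + 3)) (q / B)

/-- `walk` is defined by splitting off its first digit, while the loops extend a walk at its end. -/
theorem walk_succ (j p q : ℕ) :
    walk M B (j + 1) p q = M (walk M B j p q + q / B ^ j % B + 3) := by
  induction j generalizing p q with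
  | zero => simp [walk]
  | succ j ih =>
    rw [walk, ih, walk, Nat.div_div_eq_div_mul, pow_succ']

theorem Repr.walk_eq (hB : 0 < B) {h p q : ℕ} {f : ℕ → ℕ} (hr : Repr M B bnd h p f)
    (hq : q < B ^ h) : walk M B h p q = f q := by
  induction h generalizing p q f with
  | zero =>
    have : q = 0 := by simpa using hq
    rw [this]; exact hr
  | succ h ih =>
    rw [walk, ih (hr.2 _ (Nat.mod_lt _ hB)), Nat.mod_add_div]
    exact Nat.div_lt_of_lt_mul (by rwa [pow_succ'] at hq)

theorem Repr.walk_add_le (hB : 0 < B) {h p q j : ℕ} {f : ℕ → ℕ} (hr : Repr M B bnd h p f)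
    (hj : j < h) : walk M B j p q + B ≤ bnd := by
  induction h generalizing p q f j with
  | zero => omega
  | succ h ih =>
    cases j with
    | zero => exact hr.1
    | succ j =>
      rw [walk]
      exact ih (hr.2 _ (Nat.mod_lt _ hB)) (by omega)

theorem Repr.mono {h p bnd' : ℕ} {f : ℕ → ℕ} (hr : Repr M B bnd h p f) (hb : bnd ≤ bnd')
    (hM : ∀ a < bnd, M' (a + 3) = M (a + 3)) : Repr M' B bnd' h p f := by
  induction h generalizing p f with
  | zero => exact hr
  | succ h ih =>
    have := hr.1
    refine ⟨by omega, fun c hc => ?_⟩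
    rw [hM _ (by omega)]
    exact ih (hr.2 c hc)

/-- In zeroed memory every child pointer is `0` and the node at `0` is its own child. It serves as
the empty trie of every height at once, and read as a leaf it is the value `0`. -/
theorem repr_zero (hM : ∀ a < bnd, M (a + 3) = 0) {h p : ℕ} (hb : p + B ≤ bnd)
    (hp : h = 0 → p = 0) : Repr M B bnd h p fun _ => 0 := by
  induction h generalizing p with
  | zero => exact hp rfl
  | succ h ih =>
    refine ⟨hb, fun c hc => ?_⟩
    rw [hM _ (by omega)]
    exact ih (by omega) (fun _ => rfl)

/-- Insertion of a key by copying its path. -/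
theorem Repr.insert (hB : 0 < B) {h p p' q v bnd' : ℕ} {f : ℕ → ℕ} (hr : Repr M B bnd (h + 1) p f)
    (hb : bnd ≤ bnd') (hb' : p' + (h + 1) * B ≤ bnd') (hM : ∀ a < bnd, M' (a + 3) = M (a + 3))
    (hq : q < B ^ (h + 1))
    (hM' : ∀ j ≤ h, ∀ c < B, M' (p' + j * B + c + 3) = if c = q / B ^ j % B then
      (if j = h then v else p' + (j + 1) * B) else M (walk M B j p q + c + 3)) :
    Repr M' B bnd' (h + 1) p' fun a => if a = q then v else f a := by
  induction h generalizing p p' q f with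
  | zero =>
    refine ⟨by omega, fun c hc => ?_⟩
    have h1 := hM' 0 le_rfl c hc
    have hqB : q < B := by simpa using hq
    simp only [zero_mul, add_zero, pow_zero, Nat.div_one, if_true, Nat.mod_eq_of_lt hqB, walk] at h1
    simp only [Repr, mul_zero, add_zero]
    rw [h1]
    split_ifs with h2
    · rfl
    · simpa [Repr] using hr.2 c hc
  | succ h ih =>
    have e : (h + 1 + 1) * B = B + (h + 1) * B := by ring
    refine ⟨by rw [e] at hb'; omega, fun c hc => ?_⟩
    have h1 := hM' 0 (by omega) c hc
    simp only [zero_mul, add_zero, pow_zero, Nat.div_one, walk, zero_add, one_mul,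
      (Nat.succ_ne_zero h).symm, if_false] at h1
    rw [h1]
    have hdm := Nat.mod_add_div q B
    split_ifs with h2
    -- On the path, the keys below child `c` are those with lowest digit `c`, and the modified one
    -- among them has the remaining digits `q / B`.
    · have h3 : ∀ a, (c + B * a = q ↔ a = q / B) := by
        intro a
        constructor
        · intro h3
          rw [← h3, Nat.add_mul_div_left _ _ hB, Nat.div_eq_of_lt hc, zero_add]
        · rintro rfl
          rw [h2, hdm]
      simp only [h3]
      subst h2
      refine ih (hr.2 _ hc) (by rw [e] at hb'; omega) ?_ ?_
      · exact Nat.div_lt_of_lt_mul (by rwa [pow_succ'] at hq)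
      · intro j hj c' hc'
        have h4 := hM' (j + 1) (by omega) c' hc'
        have e1 : p' + (j + 1) * B = p' + B + j * B := by ring
        have e2 : p' + (j + 1 + 1) * B = p' + B + (j + 1) * B := by ring
        rw [e1, pow_succ', ← Nat.div_div_eq_div_mul, walk, e2] at h4
        rw [h4]
        simp only [Nat.add_right_cancel_iff]
    · have h3 : ∀ a, c + B * a ≠ q := by
        intro a h3
        apply h2
        rw [← h3, Nat.add_mul_mod_self_left, Nat.mod_eq_of_lt hc]
      simp only [h3, if_false]
      -- Off the path the copied node keeps the old pointer, so the old subtree is shared.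
      exact (hr.2 c hc).mono hb hM

end Trie

/-- The expression `(reg 2) ^ d`. -/
def powExpr : ℕ → Expr
  | 0 => 1
  | d + 1 => powExpr d * .reg 2

theorem powExpr_val (ρ : ℕ → ℕ) (d : ℕ) : (powExpr d).val ρ = ρ 2 ^ d := by
  induction d with
  | zero => rfl
  | succ d ih => simp [powExpr, ih, pow_succ]

theorem powExpr_cost (d : ℕ) : (powExpr d).cost = 2 * d + 1 := by
  induction d with
  | zero => rfl
  | succ d ih => simp [powExpr, ih]; ring

theorem powExpr_ok {w : ℕ} {ρ : ℕ → ℕ} (hw : 1 < 2 ^ w) (h1 : 1 ≤ ρ 2) {d : ℕ}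
    (h : ρ 2 ^ d < 2 ^ w) : (powExpr d).Ok w ρ := by
  induction d with
  | zero => simpa [powExpr] using hw
  | succ d ih =>
    have h2 : ρ 2 ^ d ≤ ρ 2 ^ (d + 1) := Nat.pow_le_pow_right h1 (by omega)
    simp only [powExpr, Expr.mul_def, Expr.Ok, BinOp.Ok, powExpr_val, Expr.val]
    exact ⟨ih (by omega), trivial, by rwa [← pow_succ]⟩

/-- Doubling finds the least power of two whose `d`-th power reaches `σ`; this is the fan-out. Words
`0`, `1`, `2` of the memory keep the fan-out, the size of one copied path and the initial cursor `n
+ 1`. Trie addresses are shifted by 3 to make room for them. -/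
def trieInit (d : ℕ) : Prog :=
  .assign 4 (.const d) ;; .assign 2 1 ;;
  .loop (.bin .lt (powExpr d) (.reg 1)) (.assign 2 (.reg 2 + .reg 2)) ;;
  .assign 5 (.reg 4 * .reg 2) ;;
  .store 0 (.reg 2) ;; .store 1 (.reg 5) ;; .store 2 (.reg 0 + 1)

def trieCopy : Prog :=
  forUp 8 2 (.load 13 (.reg 10 + .reg 8 + 3) ;; .store (.reg 9 + .reg 8 + 3) (.reg 13))

/-- Register `9` is the new node, `10` the old one, `11` the remaining digits of the key. The new
node's child on the path is directed to the place where the next copy will be put, and register `12`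
remembers this slot. -/
def trieLevel : Prog :=
  trieCopy ;;
  .assign 14 (.reg 11 % .reg 2) ;;
  .assign 12 (.reg 9 + .reg 14 + 3) ;;
  .load 10 (.reg 10 + .reg 14 + 3) ;;
  .assign 9 (.reg 9 + .reg 2) ;;
  .store (.reg 12) (.reg 9) ;;
  .assign 11 (.reg 11 / .reg 2)

/-- In round `i` the version for cursor `i + 2` is made from the one for `i + 1`. Version `cur` has
its root at `cur` times the size of a path, so no table of roots is needed. The final store replaces
the pointer left by the last level by the value `i + 1`. -/
def trieInsert : Prog :=
  .read 11 (.reg 0 - (.reg 6 + 1)) ;;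
  .assign 10 ((.reg 6 + 1) * .reg 5) ;;
  .assign 9 (.reg 10 + .reg 5) ;;
  forUp 7 4 trieLevel ;;
  .store (.reg 12) (.reg 6 + 1)

/-- Preprocessing: a persistent trie of height `d`, with one version for each suffix. -/
def triePre (d : ℕ) : Prog := trieInit d ;; forUp 6 0 trieInsert

def trieQueryInit (d : ℕ) : Prog :=
  .load 4 0 ;; .load 5 1 ;; .load 1 2 ;; .assign 6 (.const d)

def trieQueryBody : Prog :=
  .assign 7 (.reg 1 * .reg 5) ;;
  forUp 8 6 (.load 7 (.reg 7 + .reg 3 % .reg 4 + 3) ;; .assign 3 (.reg 3 / .reg 4)) ;;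
  .assign 1 (.reg 7)

variable {w S : ℕ} {inp : List ℕ}

theorem vc_trieCopy {s : State} {B p o : ℕ} (h2 : s.reg 2 = B) (h9 : s.reg 9 = p)
    (h10 : s.reg 10 = o) (hop : o + B ≤ p) (hS : p + B + 3 ≤ S) (hSw : S ≤ 2 ^ w) :
    vc w S inp trieCopy s fun t s' => t ≤ B * 22 + 6 ∧
      ∀ a, s'.mem a = if p + 3 ≤ a ∧ a < p + B + 3 then s.mem (a - p + o) else s.mem a := by
  refine vc_forUp_le 14 (fun k s' => ∀ a, s'.mem a =
    if p + 3 ≤ a ∧ a < p + k + 3 then s.mem (a - p + o) else s.mem a)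
    (by decide) rfl rfl (by omega) (by omega) ?_ ?_ ?_
  · intro a
    rw [if_neg (by omega)]
  · intro k s' hk h8 hf hm
    have f9 : s'.reg 9 = p := (hf 9 (by decide) rfl).trans h9
    have f10 : s'.reg 10 = o := (hf 10 (by decide) rfl).trans h10
    simp [h8, f9, f10]
    refine ⟨by omega, by omega, ⟨by omega, by omega⟩, by omega, ?_⟩
    intro a
    rcases eq_or_ne a (p + k + 3) with rfl | ha
    · simp only [Function.update_self]
      rw [hm, if_neg (by omega), if_pos (by omega)]
      congr 1; omega
    · simp only [ha, ne_eq, not_false_eq_true, Function.update_of_ne]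
      rw [hm]
      congr 1
      simp only [eq_iff_iff]
      omega
  · intro t s' ht _ _ hm
    rw [h2] at ht hm
    exact ⟨ht, hm⟩

theorem vc_trieLevel {s : State} {B p o q : ℕ} (h2 : s.reg 2 = B) (h9 : s.reg 9 = p)
    (h10 : s.reg 10 = o) (h11 : s.reg 11 = q) (hB : 0 < B) (hop : o + B ≤ p)
    (hS : p + B + 3 ≤ S) (hSw : S ≤ 2 ^ w) (hw : 3 < 2 ^ w) :
    vc w S inp trieLevel s fun t s' => t ≤ B * 22 + 40 ∧ s'.reg 9 = p + B ∧
      s'.reg 10 = s.mem (o + q % B + 3) ∧ s'.reg 11 = q / B ∧ s'.reg 12 = p + q % B + 3 ∧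
      ∀ a, s'.mem a = if p + 3 ≤ a ∧ a < p + B + 3 then
        (if a = p + q % B + 3 then p + B else s.mem (a - p + o)) else s.mem a := by
  have hq := Nat.mod_lt q hB
  refine vc_seq (vc_trieCopy h2 h9 h10 hop hS hSw) ?_
  rintro t s' hf _ ⟨ht, hm⟩
  have f2 : s'.reg 2 = B := (hf 2 rfl).trans h2
  have f9 : s'.reg 9 = p := (hf 9 rfl).trans h9
  have f10 : s'.reg 10 = o := (hf 10 rfl).trans h10
  have f11 : s'.reg 11 = q := (hf 11 rfl).trans h11
  simp [f2, f9, f10, f11]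
  refine ⟨⟨by omega, hw, by omega⟩, ⟨by omega, hw, by omega⟩, by omega, by omega, by omega,
    by omega, ?_, ?_⟩
  · rw [hm, if_neg (by omega)]
  · intro a
    rcases eq_or_ne a (p + q % B + 3) with rfl | ha
    · rw [Function.update_self, if_pos (by omega), if_pos rfl]
    · rw [Function.update_of_ne ha, hm]
      simp [ha]

theorem vc_trieInsert {s : State} {B d n i : ℕ} {f : ℕ → ℕ} (h0 : s.reg 0 = n) (h2 : s.reg 2 = B)
    (h4 : s.reg 4 = d + 1)
    (h5 : s.reg 5 = (d + 1) * B) (h6 : s.reg 6 = i) (hi : i < n) (hn : inp.length = n)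
    (hB : 0 < B) (hq : readAt inp (n - (i + 1)) < B ^ (d + 1))
    (hS : (i + 3) * ((d + 1) * B) + 3 ≤ S) (hSw : S ≤ 2 ^ w) (hw : 3 < 2 ^ w)
    (hdw : d + 1 < 2 ^ w) (hnw : n < 2 ^ w)
    (hr : Repr s.mem B ((i + 2) * ((d + 1) * B)) (d + 1) ((i + 1) * ((d + 1) * B)) f) :
    vc w S inp trieInsert s fun t s' => t ≤ (d + 1) * (B * 22 + 48) + 30 ∧
      (∀ a < (i + 2) * ((d + 1) * B) + 3, s'.mem a = s.mem a) ∧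
      Repr s'.mem B ((i + 3) * ((d + 1) * B)) (d + 1) ((i + 2) * ((d + 1) * B))
        fun a => if a = readAt inp (n - (i + 1)) then i + 1 else f a := by
  set q := readAt inp (n - (i + 1)) with hqd
  set E := (d + 1) * B with hE
  have e2 : (i + 2) * E = (i + 1) * E + E := by ring
  have e3 : (i + 3) * E = (i + 2) * E + E := by ring
  set o := (i + 1) * E with ho
  set p := (i + 2) * E with hp
  have hw0 : w ≠ 0 := by rintro rfl; simp at hw
  unfold trieInsert
  simp [h0, h5, h6, hn, ← hqd, ← ho]
  refine ⟨⟨⟨by omega, by omega⟩, by omega, hnw⟩, by omega, ⟨⟨by omega, by omega⟩, by omega⟩,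
    by omega, ?_⟩
  -- After `k` levels the first `k` nodes of the path are copied, register `10` is the old node at
  -- depth `k`, and nothing below the new version has changed, so the old walk can be read from the
  -- initial memory.
  refine vc_conseq (vc_forUp_le (B * 22 + 40) (fun k s' =>
    s'.reg 9 = p + k * B ∧ s'.reg 10 = walk s.mem B k o q ∧ s'.reg 11 = q / B ^ k ∧
    (∀ j, k = j + 1 → s'.reg 12 = p + j * B + q / B ^ j % B + 3) ∧
    (∀ a < p + 3, s'.mem a = s.mem a) ∧
    ∀ j < k, ∀ c < B, s'.mem (p + j * B + c + 3) = if c = q / B ^ j % B then p + (j + 1) * B else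
      s.mem (walk s.mem B j o q + c + 3)) (Q := fun t s' => t ≤ (d + 1) * (B * 22 + 48) + 6 ∧
    s'.reg 12 = p + d * B + q / B ^ d % B + 3 ∧ (∀ a < p + 3, s'.mem a = s.mem a) ∧
    ∀ j < d + 1, ∀ c < B, s'.mem (p + j * B + c + 3) = if c = q / B ^ j % B then p + (j + 1) * B
      else s.mem (walk s.mem B j o q + c + 3)) (by decide) rfl rfl (by simpa [h4] using hdw)
      (by omega) ?_ ?_ ?_) ?_
  · simp [walk, e2]
  · intro k s' hk hk' hf ⟨h9', h10', h11', h12', hlo, hhi⟩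
    simp [h4] at hk
    have f2 : s'.reg 2 = B := by simpa [h2] using hf 2 (by decide) rfl
    have hwk := hr.walk_add_le hB (q := q) (j := k) (by omega)
    have hkB : k * B + B ≤ E := by
      rw [hE, ← Nat.succ_mul]; exact Nat.mul_le_mul_right _ (Nat.succ_le_succ hk)
    have hmo : ∀ a < p + 3, s'.mem a = s.mem a := hlo
    have hq' := Nat.mod_lt (q / B ^ k) hB
    refine vc_conseq (vc_trieLevel f2 h9' h10' h11' hB (by omega) (by omega) hSw hw) ?_
    rintro t s'' hf' _ ⟨ht, g9, g10, g11, g12, hm⟩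
    refine ⟨ht, ?_, ?_, ?_, ?_, ?_, ?_⟩
    · simp [g9]; ring
    · simp [g10]
      rw [walk_succ, hmo _ (by omega)]
    · simp [g11, pow_succ, Nat.div_div_eq_div_mul]
    · intro j hj
      obtain rfl : j = k := by omega
      simp [g12]
    · intro a ha
      simp only
      rw [hm, if_neg (by omega), hmo a ha]
    · intro j hj c hc
      simp only
      rcases Nat.lt_succ_iff_lt_or_eq.1 hj with hj | rfl
      · have : j * B + B ≤ k * B := by
          rw [← Nat.succ_mul]; exact Nat.mul_le_mul_right _ hj
        rw [hm, if_neg (by omega), hhi j hj c hc]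
      · rw [hm, if_pos (by omega)]
        have e : (p + j * B + c + 3 = p + j * B + q / B ^ j % B + 3) ↔ c = q / B ^ j % B := by omega
        simp only [e]
        split_ifs with hc'
        · ring
        · rw [hmo _ (by omega)]
          congr 1; omega
  · intro t s' ht _ _ ⟨_, _, _, h12', hlo, hhi⟩
    simp [h4] at ht h12' hhi
    exact ⟨by omega, h12', hlo, fun j hj => hhi j (by omega)⟩
  · rintro t s' hf _ ⟨ht, h12', hlo, hhi⟩
    have f6 : s'.reg 6 = i := by simpa [h6] using hf 6 rfl
    have hq' := Nat.mod_lt (q / B ^ d) hB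
    have hdB : d * B + B = E := by rw [hE]; ring
    simp [f6, h12']
    refine ⟨⟨by omega, by omega⟩, by omega, by omega, fun a ha => ?_, ?_⟩
    · rw [Function.update_of_ne (by omega), hlo a ha]
    · refine hr.insert hB (by omega) (by omega) ?_ hq ?_
      · intro a ha
        rw [Function.update_of_ne (by omega), hlo _ (by omega)]
      · intro j hj c hc
        -- Only at the last level `j = d` does the final store matter: there the slot on the path
        -- holds a value and not a pointer.
        rcases Nat.lt_or_ge j d with hjd | hjd
        · have : j * B + B ≤ d * B := by
            rw [← Nat.succ_mul]; exact Nat.mul_le_mul_right _ hjd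
          rw [Function.update_of_ne (by omega), hhi j (by omega) c hc, if_neg (by omega : j ≠ d)]
        · obtain rfl : j = d := by omega
          by_cases hc' : c = q / B ^ j % B
          · rw [if_pos hc', if_pos rfl, hc', Function.update_self]
          · rw [Function.update_of_ne (by omega), hhi j (by omega) c hc, if_neg hc', if_neg hc']

theorem vc_trieInit {n σ d Bmax : ℕ} (hσ : 2 ^ (d + 1) * σ < 2 ^ w) (h1 : 1 ≤ Bmax)
    (hBmax : ∀ B, B ^ (d + 1) < σ → 2 * B ≤ Bmax) (hn : n + 1 < 2 ^ w)
    (hS : (d + 1) * Bmax + 3 ≤ S) (hSw : S ≤ 2 ^ w) :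
    vc w S inp (trieInit (d + 1)) (preStart n σ) fun t s => t ≤ Bmax * (4 * d + 24) + 40 ∧
      ∃ B, 0 < B ∧ B ≤ Bmax ∧ σ ≤ B ^ (d + 1) ∧ s.reg 0 = n ∧ s.reg 2 = B ∧ s.reg 4 = d + 1 ∧
        s.reg 5 = (d + 1) * B ∧ s.mem 0 = B ∧ s.mem 1 = (d + 1) * B ∧ s.mem 2 = n + 1 ∧
        ∀ a, s.mem (a + 3) = 0 := by
  have hd1 : d + 1 ≤ (d + 1) * Bmax := Nat.le_mul_of_pos_right _ h1
  have hw0 : w ≠ 0 := by rintro rfl; omega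
  have hw1 : 1 < 2 ^ w := by omega
  simp only [trieInit, vc, Expr.ofNat_def, Expr.Ok, Expr.val, Expr.cost]
  refine ⟨by omega, by omega, ?_⟩
  -- Register `2` grows by at least one in each round, which pays for the round; this crude charge
  -- suffices since a bound linear in the fan-out is affordable.
  refine vc_loop (fun t s' => t ≤ s'.reg 2 * (2 * d + 12) ∧ 1 ≤ s'.reg 2 ∧ s'.reg 2 ≤ Bmax ∧
    s'.reg 2 ^ (d + 1) < 2 ^ w ∧ s'.mem = fun _ => 0) (fun s' => 2 ^ w - s'.reg 2) ?_ ?_ ?_ ?_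
  · simpa [preStart, hw0] using h1
  · rintro t s' _ ⟨_, h2, _, h3, _⟩
    simpa using powExpr_ok hw1 h2 h3
  · rintro t s' hf ⟨ht, h2, _, h3, hm⟩ he
    have f1 : s'.reg 1 = σ := by simpa [preStart] using hf 1 rfl
    have he' : s'.reg 2 ^ (d + 1) < σ := by simpa [powExpr_val, f1] using he
    have h5 : (s'.reg 2 + s'.reg 2) ^ (d + 1) = 2 ^ (d + 1) * s'.reg 2 ^ (d + 1) := by
      rw [← two_mul, mul_pow]
    have h6 : 2 ^ (d + 1) * s'.reg 2 ^ (d + 1) < 2 ^ w :=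
      lt_of_le_of_lt (Nat.mul_le_mul_left _ he'.le) hσ
    have h7 := hBmax _ he'
    have h8 : s'.reg 2 ≤ s'.reg 2 ^ (d + 1) := Nat.le_self_pow (by omega) _
    have h8' : s'.reg 2 + s'.reg 2 ≤ (s'.reg 2 + s'.reg 2) ^ (d + 1) := Nat.le_self_pow (by omega) _
    simp [powExpr_cost, h5, hm, h6]
    refine ⟨by omega, ⟨?_, by omega, by omega⟩, by omega⟩
    have h9 : 1 * (2 * d + 12) ≤ s'.reg 2 * (2 * d + 12) := Nat.mul_le_mul_right _ h2
    rw [Nat.add_mul]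
    omega
  · rintro t s' hf ⟨ht, h2, h3, _, hm⟩ he
    have f1 : s'.reg 1 = σ := by simpa [preStart] using hf 1 rfl
    have f0 : s'.reg 0 = n := by simpa [preStart] using hf 0 rfl
    have f4 : s'.reg 4 = d + 1 := by simpa [preStart] using hf 4 rfl
    have he' : σ ≤ s'.reg 2 ^ (d + 1) := by simpa [powExpr_val, f1] using he
    have hB1 : s'.reg 2 * (2 * d + 12) ≤ Bmax * (2 * d + 12) := Nat.mul_le_mul_right _ h3
    have hB2 : (d + 1) * s'.reg 2 ≤ (d + 1) * Bmax := Nat.mul_le_mul_left _ h3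
    have hB3 : 1 * (2 * d + 12) ≤ Bmax * (2 * d + 12) := Nat.mul_le_mul_right _ h1
    have hB4 : Bmax * (4 * d + 24) = 2 * (Bmax * (2 * d + 12)) := by ring
    simp [f0, f4, hm, powExpr_cost]
    exact ⟨by omega, by omega, by omega, by omega, by omega, ⟨by omega, by omega⟩, by omega,
      by omega, by omega, h3, he'⟩

/-- The text is read from its end. By `step_succ_succ`, moving the cursor from `i + 1` to `i + 2`
changes the answer for one letter only, so one insertion per position produces all versions. -/
theorem vc_triePre {n σ d Bmax : ℕ} (hσ : 2 ^ (d + 1) * σ < 2 ^ w) (h1 : 1 ≤ Bmax)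
    (hBmax : ∀ B, B ^ (d + 1) < σ → 2 * B ≤ Bmax) (hn : n + 1 < 2 ^ w)
    (hS : (n + 2) * ((d + 1) * Bmax) + 3 ≤ S) (hSw : S ≤ 2 ^ w)
    (hinp : inp.length = n) (hinp' : ∀ i < n, readAt inp i < σ) :
    vc w S inp (triePre (d + 1)) (preStart n σ) fun t s =>
      t ≤ Bmax * (4 * d + 24) + n * ((d + 1) * (Bmax * 22 + 48) + 40) + 50 ∧
      ∃ B, 0 < B ∧ B ≤ Bmax ∧ σ ≤ B ^ (d + 1) ∧
        s.mem 0 = B ∧ s.mem 1 = (d + 1) * B ∧ s.mem 2 = n + 1 ∧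
        ∀ cur ≤ n + 1, Repr s.mem B ((n + 2) * ((d + 1) * B)) (d + 1) (cur * ((d + 1) * B))
          (step inp cur) := by
  have hS' : (d + 1) * Bmax ≤ (n + 2) * ((d + 1) * Bmax) := Nat.le_mul_of_pos_left _ (by omega)
  have hd1 : d + 1 ≤ (d + 1) * Bmax := Nat.le_mul_of_pos_right _ h1
  refine vc_seq (vc_trieInit hσ h1 hBmax hn (by omega) hSw) ?_
  rintro t s hf _ ⟨ht, B, hB, hBm, hσB, r0, r2, r4, r5, m0, m1, m2, mz⟩
  have hEm : (d + 1) * B ≤ (d + 1) * Bmax := Nat.mul_le_mul_left _ hBm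
  have hBE : B ≤ (d + 1) * B := Nat.le_mul_of_pos_left _ (by omega)
  refine vc_forUp_le ((d + 1) * (Bmax * 22 + 48) + 30) (fun i s' =>
    s'.mem 0 = B ∧ s'.mem 1 = (d + 1) * B ∧ s'.mem 2 = n + 1 ∧ ∀ cur ≤ i + 1,
      Repr s'.mem B ((i + 2) * ((d + 1) * B)) (d + 1) (cur * ((d + 1) * B)) (step inp cur))
    (by decide) rfl rfl (by omega) (by omega) ?_ ?_ ?_
  · refine ⟨m0, m1, m2, fun cur hcur => ?_⟩
    -- No text is available for the cursors `0` and `1`, so both versions are the zero function and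
    -- need no work in zeroed memory.
    have : step inp cur = fun _ => 0 := by
      rcases (by omega : cur = 0 ∨ cur = 1) with rfl | rfl <;> rfl
    rw [this]
    refine repr_zero (fun a _ => mz a) ?_ (by omega)
    have : cur * ((d + 1) * B) ≤ 1 * ((d + 1) * B) := Nat.mul_le_mul_right _ hcur
    omega
  · rintro i s' hi hi6 hf' ⟨m0', m1', m2', hr⟩
    rw [r0] at hi
    have f0 : s'.reg 0 = n := (hf' 0 (by decide) rfl).trans r0
    have f2 : s'.reg 2 = B := (hf' 2 (by decide) rfl).trans r2
    have f4 : s'.reg 4 = d + 1 := (hf' 4 (by decide) rfl).trans r4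
    have f5 : s'.reg 5 = (d + 1) * B := (hf' 5 (by decide) rfl).trans r5
    have hiS : (i + 3) * ((d + 1) * B) ≤ (n + 2) * ((d + 1) * Bmax) :=
      Nat.mul_le_mul (by omega) hEm
    have h33 : 3 * ((d + 1) * B) ≤ (i + 3) * ((d + 1) * B) := Nat.mul_le_mul_right _ (by omega)
    refine vc_conseq (vc_trieInsert f0 f2 f4 f5 hi6 hi hinp hB
      (lt_of_lt_of_le (hinp' _ (by omega)) hσB) (by omega) hSw (by omega) (by omega) (by omega)
      (hr (i + 1) le_rfl)) ?_
    rintro t' s'' _ _ ⟨ht', hlo, hr'⟩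
    refine ⟨?_, ?_, ?_, ?_, ?_⟩
    · have : (d + 1) * (B * 22 + 48) ≤ (d + 1) * (Bmax * 22 + 48) :=
        Nat.mul_le_mul_left _ (by omega)
      omega
    · simp only; rw [hlo _ (by omega), m0']
    · simp only; rw [hlo _ (by omega), m1']
    · simp only; rw [hlo _ (by omega), m2']
    · intro cur hcur
      have e3 : (i + 3) * ((d + 1) * B) = (i + 2) * ((d + 1) * B) + (d + 1) * B := by ring
      rcases Nat.lt_or_ge cur (i + 2) with hc | hc
      · exact (hr cur (by omega)).mono (by rw [e3]; omega) fun a ha => hlo _ (by omega)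
      · obtain rfl : cur = i + 2 := by omega
        convert hr' using 1
        funext a
        rw [step_succ_succ, hinp]
        simp only [eq_comm]
  · rintro t' s' ht' _ _ ⟨m0', m1', m2', hr⟩
    rw [r0] at ht' hr
    refine ⟨?_, B, hB, hBm, hσB, m0', m1', m2', hr⟩
    have : n * ((d + 1) * (Bmax * 22 + 48) + 30 + 8) ≤ n * ((d + 1) * (Bmax * 22 + 48) + 40) :=
      Nat.mul_le_mul_left _ (by omega)
    omega

theorem vc_trieQueryBody {s : State} {B d n σ : ℕ} (h4 : s.reg 4 = B)
    (h5 : s.reg 5 = (d + 1) * B) (h6 : s.reg 6 = d + 1) (hB : 0 < B) (h1 : s.reg 1 ≤ n + 1)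
    (h3 : s.reg 3 < σ) (hσB : σ ≤ B ^ (d + 1))
    (hS : (n + 2) * ((d + 1) * B) + 3 ≤ S) (hSw : S ≤ 2 ^ w)
    (hr : Repr s.mem B ((n + 2) * ((d + 1) * B)) (d + 1) (s.reg 1 * ((d + 1) * B))
          (step inp (s.reg 1))) (L : List ℕ) :
    vc w S L trieQueryBody s fun t s' => t ≤ (d + 1) * 20 + 20 ∧
      s'.reg 1 = step inp (s.reg 1) (s.reg 3) := by
  have hE : (d + 1) * B ≤ (n + 2) * ((d + 1) * B) := Nat.le_mul_of_pos_left _ (by omega)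
  have hd1 : d + 1 ≤ (d + 1) * B := Nat.le_mul_of_pos_right _ hB
  have hw0 : w ≠ 0 := by rintro rfl; omega
  have hle : s.reg 1 * ((d + 1) * B) ≤ (n + 2) * ((d + 1) * B) := Nat.mul_le_mul_right _ (by omega)
  simp [trieQueryBody, h5]
  refine ⟨by omega, ?_⟩
  refine vc_forUp_le 12 (fun k s' => s'.mem = s.mem ∧
    s'.reg 7 = walk s.mem B k (s.reg 1 * ((d + 1) * B)) (s.reg 3) ∧
    s'.reg 3 = s.reg 3 / B ^ k) (by decide) rfl rfl (by simp [h6]; omega) (by omega) ?_ ?_ ?_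
  · simp [walk]
  · rintro k s' hk hk8 hf ⟨hm, h7, h3'⟩
    simp [h6] at hk
    have f4 : s'.reg 4 = B := by simpa [h4] using hf 4 (by decide) rfl
    have hwk := hr.walk_add_le hB (q := s.reg 3) (j := k) (by omega)
    have := Nat.mod_lt (s.reg 3 / B ^ k) hB
    simp [f4, h7, h3', hm, walk_succ, pow_succ, Nat.div_div_eq_div_mul]
    omega
  · rintro t s' ht _ _ ⟨_, h7, _⟩
    simp [h6] at ht h7
    rw [hr.walk_eq hB (lt_of_lt_of_le h3 hσB)] at h7
    simp [h7]
    omega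

theorem trie_solves (d : ℕ) {w σ : ℕ} (T : List (Fin σ)) (Bmax : ℕ)
    (hσ : 2 ^ (d + 1) * σ < 2 ^ w) (h1 : 1 ≤ Bmax)
    (hBmax : ∀ B, B ^ (d + 1) < σ → 2 * B ≤ Bmax)
    (hSw : (T.length + 2) * ((d + 1) * Bmax) + 3 ≤ 2 ^ w) {f : ℝ} {g : ℕ → ℝ}
    (hf1 : (((T.length + 2) * ((d + 1) * Bmax) + 3 : ℕ) : ℝ) ≤ f)
    (hf2 : ((Bmax * (4 * d + 24) + T.length * ((d + 1) * (Bmax * 22 + 48) + 40) + 50 : ℕ) : ℝ) ≤ f)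
    (hg : ∀ m : ℕ, ((20 + m * ((d + 1) * 20 + 20 + 10) + 10 : ℕ) : ℝ) ≤ g m) :
    SolvesSubsequenceIndexing (triePre (d + 1)) (queryProg (trieQueryInit (d + 1)) trieQueryBody)
      w T f g := by
  have hE1 : 1 ≤ (d + 1) * Bmax := Nat.mul_pos (by omega) h1
  have hn : T.length + 2 ≤ (T.length + 2) * ((d + 1) * Bmax) := Nat.le_mul_of_pos_right _ hE1
  have hE2 : (d + 1) * Bmax ≤ (T.length + 2) * ((d + 1) * Bmax) :=
    Nat.le_mul_of_pos_left _ (by omega)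
  have hd1 : d + 1 ≤ (d + 1) * Bmax := Nat.le_mul_of_pos_right _ h1
  have hw0 : w ≠ 0 := by rintro rfl; omega
  refine solves_of_vc (σ := σ) _ _ hf1 hf2 (fun s => ∃ B, 0 < B ∧ B ≤ Bmax ∧ σ ≤ B ^ (d + 1) ∧
    s.reg 4 = B ∧ s.reg 5 = (d + 1) * B ∧ s.reg 6 = d + 1 ∧
    ∀ cur ≤ T.length + 1, Repr s.mem B ((T.length + 2) * ((d + 1) * B)) (d + 1)
      (cur * ((d + 1) * B)) (step (T.map Fin.val) cur)) 20 _ (by omega) hg rfl rfl rfl rfl ?_ ?_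
  · rintro s s' ⟨B, hB, hBm, hσB, h4, h5, h6, hr⟩ hm hf
    refine ⟨B, hB, hBm, hσB, ?_, ?_, ?_, by rwa [hm]⟩
    · rw [hf 4 (by decide) (by decide) (by decide) rfl, h4]
    · rw [hf 5 (by decide) (by decide) (by decide) rfl, h5]
    · rw [hf 6 (by decide) (by decide) (by decide) rfl, h6]
  · refine vc_conseq (vc_triePre hσ h1 hBmax (by omega) le_rfl hSw (by simp) ?_) ?_
    · intro i hi
      rw [readAt_eq (by simpa using hi)]
      simp
    · rintro t D _ _ ⟨ht, B, hB, hBm, hσB, m0, m1, m2, hr⟩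
      refine ⟨ht, fun Q hQ => ⟨?_, ?_⟩⟩
      · simp [trieQueryInit, queryStart, m0, m1, m2]
        exact ⟨by omega, by omega, by omega, by omega, by omega, hσB, hr⟩
      · rintro s ⟨B, hB, hBm, hσB, h4, h5, h6, hr⟩ hs1 hs3
        refine vc_trieQueryBody h4 h5 h6 hB hs1 hs3 hσB ?_ hSw (hr _ hs1) Q
        have := Nat.mul_le_mul_left (T.length + 2) (Nat.mul_le_mul_left (d + 1) hBm)
        omega

theorem persistent_trie (ε : ℝ) (hε : 0 < ε) :
    ∃ (pre qry : Prog) (k : ℕ) (C : ℝ), 1 ≤ k ∧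
      ∀ (σ : ℕ) (T : List (Fin σ)) (w : ℕ), 1 ≤ σ →
        (T.length + σ + 1) ^ k ≤ 2 ^ w →
        SolvesSubsequenceIndexing pre qry w T
          (C * ((T.length : ℝ) + 1) * (σ : ℝ) ^ ε)
          (fun m => C * ((m : ℝ) + 1)) := by
  -- Height `d + 1` with `1 / (d + 1) < ε` keeps the fan-out within `O(σ ^ ε)`.
  obtain ⟨d, hd⟩ := exists_nat_one_div_lt hε
  -- With `N = n + σ + 1` the trie occupies at most `N ^ (d + 5)` words, and two more factors `N ≥
  -- 2` absorb the additive constant; hence the exponent `d + 7`.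
  refine ⟨triePre (d + 1), queryProg (trieQueryInit (d + 1)) trieQueryBody, d + 7,
    1000 * (d + 1), by omega, fun σ T w hσ1 hw => ?_⟩
  set n := T.length with hn
  set δ : ℝ := 1 / ((d : ℝ) + 1) with hδ
  have hδ0 : 0 ≤ δ := by positivity
  have hσr : (1 : ℝ) ≤ σ := by exact_mod_cast hσ1
  have hx1 : (1 : ℝ) ≤ (σ : ℝ) ^ δ := Real.one_le_rpow hσr hδ0
  have hxe : (σ : ℝ) ^ δ ≤ (σ : ℝ) ^ ε := Real.rpow_le_rpow_of_exponent_le hσr hd.le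
  have hxs : (σ : ℝ) ^ δ ≤ σ := by
    have : δ ≤ 1 := by
      rw [hδ, div_le_one (by positivity)]
      have : (0 : ℝ) ≤ d := Nat.cast_nonneg d
      linarith
    simpa using Real.rpow_le_rpow_of_exponent_le hσr this
  -- The factor 2 accounts for the doubling, which overshoots `σ ^ δ` by less than this factor.
  set Bmax := ⌊2 * (σ : ℝ) ^ δ⌋₊ with hBm
  have hB1 : 1 ≤ Bmax := Nat.le_floor (by push_cast; linarith)
  have hB2 : (Bmax : ℝ) ≤ 2 * (σ : ℝ) ^ δ := Nat.floor_le (by linarith)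
  have hB3 : Bmax ≤ 2 * σ := by
    have : (Bmax : ℝ) ≤ 2 * (σ : ℝ) := hB2.trans (by linarith)
    exact_mod_cast this
  have hN2 : 2 ≤ n + σ + 1 := by omega
  set N := n + σ + 1 with hN
  have hd2 : d + 1 ≤ N ^ (d + 1) :=
    (Nat.lt_two_pow_self (n := d + 1)).le.trans (Nat.pow_le_pow_left hN2 _)
  refine trie_solves d T Bmax ?_ hB1 ?_ ?_ ?_ ?_ ?_
  · refine lt_of_lt_of_le ?_ hw
    calc 2 ^ (d + 1) * σ ≤ N ^ (d + 1) * N :=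
          Nat.mul_le_mul (Nat.pow_le_pow_left hN2 _) (by omega)
      _ = N ^ (d + 2) := by ring
      _ < N ^ (d + 7) := Nat.pow_lt_pow_right (by omega) (by omega)
  · intro B hB
    refine Nat.le_floor ?_
    push_cast
    have h3 : ((B : ℝ) ^ (d + 1)) ^ δ ≤ (σ : ℝ) ^ δ :=
      Real.rpow_le_rpow (by positivity) (by exact_mod_cast hB.le) hδ0
    have h4 : ((B : ℝ) ^ (d + 1)) ^ δ = B := by
      rw [← Real.rpow_natCast, ← Real.rpow_mul (by positivity), hδ]
      push_cast
      rw [mul_one_div_cancel (by positivity), Real.rpow_one]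
    linarith
  · rw [← hn]
    refine le_trans ?_ hw
    have h3 : (d + 1) * Bmax ≤ N ^ (d + 1) * (N * N) :=
      Nat.mul_le_mul hd2 (hB3.trans (Nat.mul_le_mul hN2 (by omega)))
    have h4 : n + 2 ≤ N * N := by nlinarith
    have h5 : (n + 2) * ((d + 1) * Bmax) ≤ N ^ (d + 5) :=
      (Nat.mul_le_mul h4 h3).trans (by apply le_of_eq; ring)
    have h6 : 3 ≤ N ^ (d + 5) := by
      have : 2 ^ 5 ≤ N ^ (d + 5) :=
        (Nat.pow_le_pow_right (by omega) (by omega)).trans (Nat.pow_le_pow_left hN2 _)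
      omega
    have h7 : 2 * 2 * N ^ (d + 5) ≤ N ^ (d + 7) := by
      calc 2 * 2 * N ^ (d + 5) ≤ N * N * N ^ (d + 5) :=
            Nat.mul_le_mul_right _ (Nat.mul_le_mul hN2 hN2)
        _ = N ^ (d + 7) := by ring
    omega
  · have hnr : (0 : ℝ) ≤ n := Nat.cast_nonneg n
    have hdr : (0 : ℝ) ≤ d := Nat.cast_nonneg d
    have hy : (Bmax : ℝ) ≤ 2 * (σ : ℝ) ^ ε := by linarith
    have hy1 : (1 : ℝ) ≤ (σ : ℝ) ^ ε := by linarith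
    push_cast
    set y := (σ : ℝ) ^ ε
    have h3 : ((n : ℝ) + 2) * (((d : ℝ) + 1) * Bmax) ≤ (2 * (n + 1)) * ((d + 1) * (2 * y)) := by
      gcongr
      linarith
    have h4 : (1 : ℝ) ≤ ((d : ℝ) + 1) * (n + 1) * y :=
      one_le_mul_of_one_le_of_one_le (one_le_mul_of_one_le_of_one_le (by linarith) (by linarith)) hy1
    nlinarith
  · have hnr : (0 : ℝ) ≤ n := Nat.cast_nonneg n
    have hdr : (0 : ℝ) ≤ d := Nat.cast_nonneg d
    have hy : (Bmax : ℝ) ≤ 2 * (σ : ℝ) ^ ε := by linarith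
    have hy1 : (1 : ℝ) ≤ (σ : ℝ) ^ ε := by linarith
    push_cast
    set y := (σ : ℝ) ^ ε
    have h3 : (Bmax : ℝ) * (4 * (d : ℝ) + 24) ≤ (2 * y) * (24 * (d + 1)) := by
      gcongr
      linarith
    have h3' : (2 * y) * (24 * ((d : ℝ) + 1)) ≤ (n + 1) * ((2 * y) * (24 * ((d : ℝ) + 1))) :=
      le_mul_of_one_le_left (by positivity) (by linarith)
    have h5 : (n : ℝ) * (((d : ℝ) + 1) * (Bmax * 22 + 48) + 40) ≤
        (n + 1) * ((d + 1) * (2 * y * 22 + 48 * y) + 40 * ((d + 1) * y)) := by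
      have h6 : (1 : ℝ) ≤ (d + 1) * y := one_le_mul_of_one_le_of_one_le (by linarith) hy1
      have h7 : (Bmax : ℝ) * 22 + 48 ≤ 2 * y * 22 + 48 * y := by linarith
      have h8 : ((d : ℝ) + 1) * (Bmax * 22 + 48) ≤ (d + 1) * (2 * y * 22 + 48 * y) := by gcongr
      exact mul_le_mul (by linarith) (by linarith) (by positivity) (by positivity)
    have h4 : (1 : ℝ) ≤ ((d : ℝ) + 1) * (n + 1) * y :=
      one_le_mul_of_one_le_of_one_le (one_le_mul_of_one_le_of_one_le (by linarith) (by linarith)) hy1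
    nlinarith
  · intro m
    have hmr : (0 : ℝ) ≤ m := Nat.cast_nonneg m
    have hdr : (0 : ℝ) ≤ d := Nat.cast_nonneg d
    have := mul_nonneg hmr hdr
    push_cast
    nlinarith

end WordRAM

/-! ### Linked lists of the members of groups -/

namespace WordRAM

/-- `p` points to a linked list with the elements `l`; pointers are indices plus one, and `nx`
gives the pointer to the successor. -/
def Chain (nx : ℕ → ℕ) : ℕ → List ℕ → Prop
  | p, [] => p = 0
  | p, i :: l => p = i + 1 ∧ Chain nx (nx i) l

theorem Chain.congr {nx nx' : ℕ → ℕ} {p : ℕ} {l : List ℕ} (h : Chain nx p l)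
    (hn : ∀ i ∈ l, nx' i = nx i) : Chain nx' p l := by
  induction l generalizing p with
  | nil => exact h
  | cons i l ih =>
    refine ⟨h.1, ?_⟩
    rw [hn i (by simp)]
    exact ih h.2 fun j hj => hn j (by simp [hj])

/-- Run through a linked list with the pointer in register `rp`, where register `rb` holds the
address of the array of successors. -/
def forChain (rp rb : ℕ) (p : Prog) : Prog :=
  .loop (.reg rp) (p ;; .load rp (.reg rb + .reg rp - 1))

variable {w S : ℕ} {inp : List ℕ}

/-- The invariant is indexed by the elements still to be visited. The body may write to memory, so
each step has to show that the link about to be followed is intact. The overhead 8 is 2 for the test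
and 6 for loading the successor. -/
theorem vc_forChain {rp rb : ℕ} {p : Prog} {s₀ : State} {Q : ℕ → State → Prop} {nx : ℕ → ℕ}
    {l : List ℕ} (I : List ℕ → ℕ → State → Prop) (hpb : rb ≠ rp) (hrp : p.writes rp = false)
    (hrb : p.writes rb = false) (hch : Chain nx (s₀.reg rp) l)
    (hl : ∀ i ∈ l, s₀.reg rb + i < S) (hSw : S < 2 ^ w) (h0 : I l 0 s₀)
    (hstep : ∀ i l' t s, (∀ r, r ≠ rp → p.writes r = false → s.reg r = s₀.reg r) →
      s.reg rp = i + 1 → (i :: l') <:+ l → I (i :: l') t s →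
      vc w S inp p s fun t' s' => s'.mem (s₀.reg rb + i) = nx i ∧
        I l' (t + t' + 8) ⟨Function.update s'.reg rp (nx i), s'.mem⟩)
    (hdone : ∀ t s, (∀ r, r ≠ rp → p.writes r = false → s.reg r = s₀.reg r) →
      I [] t s → Q (t + 2) s) :
    vc w S inp (forChain rp rb p) s₀ Q := by
  suffices H : ∀ (l' : List ℕ) (t : ℕ) (s : State), l' <:+ l →
      (∀ r, r ≠ rp → p.writes r = false → s.reg r = s₀.reg r) →
      Chain nx (s.reg rp) l' → I l' t s →
      ∃ t' s', Exec w S inp (forChain rp rb p) s t' s' ∧ Q (t + t') s' by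
    obtain ⟨t, s', h₁, h₂⟩ := H l 0 s₀ List.suffix_rfl (fun _ _ _ => rfl) hch h0
    exact ⟨t, s', h₁, by simpa using h₂⟩
  intro l'
  induction l' with
  | nil =>
    intro t s _ hf hc hI
    exact ⟨2, s, .loop_done hc, hdone t s hf hI⟩
  | cons i l' ih =>
    intro t s hsuf hf hc hI
    have hil : i ∈ l := hsuf.subset (by simp)
    have hiS := hl i hil
    have hvc : vc w S inp (p ;; .load rp (.reg rb + .reg rp - 1)) s fun t' s' =>
        I l' (t + 2 + t') s' ∧ (∀ r, r ≠ rp → p.writes r = false → s'.reg r = s₀.reg r) ∧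
          s'.reg rp = nx i := by
      refine vc_seq (hstep i l' t s hf hc.1 hsuf hI) ?_
      rintro t' s' hf' _ ⟨hm, hI'⟩
      have f1 : s'.reg rp = i + 1 := (hf' rp hrp).trans hc.1
      have f2 : s'.reg rb = s₀.reg rb := (hf' rb hrb).trans (hf rb hpb hrb)
      have e : s₀.reg rb + (i + 1) - 1 = s₀.reg rb + i := by omega
      simp only [vc, Expr.sub_def, Expr.add_def, Expr.ofNat_def, Expr.Ok, Expr.val, BinOp.Ok,
        BinOp.val, f1, f2, e, hm, Expr.cost, Function.update_self]
      refine ⟨⟨⟨trivial, trivial, by omega⟩, by omega, by omega, by omega⟩, hiS, ?_, ?_, trivial⟩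
      · convert hI' using 1
        ring
      · intro r hr hw
        rw [Function.update_of_ne hr, hf' r hw, hf r hr hw]
    obtain ⟨t₁, s₁, h₁, hI₁, hf₁, hrp₁⟩ := vc_sound hvc
    obtain ⟨t₂, s₂, h₂, hQ⟩ := ih _ s₁ ((List.suffix_cons i l').trans hsuf) hf₁
      (hrp₁ ▸ hc.2) hI₁
    refine ⟨_, _, .loop_step ?_ h₁ h₂, ?_⟩
    · have := hc.1
      simp only [Expr.eval]
      omega
    · convert hQ using 1
      simp only [Expr.cost]
      ring

/-- The indices below `M` in the group `g`. -/
def grp (G : ℕ → ℕ) (M g : ℕ) : List ℕ := (List.range M).filter fun i => G i = g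

theorem mem_grp {G : ℕ → ℕ} {M g i : ℕ} : i ∈ grp G M g ↔ i < M ∧ G i = g := by
  simp [grp]

/-- Arrange the indices `i < reg 32` in linked lists according to their groups, which are given by
the array at `reg 30`. The arrays at `reg 31`, with `reg 12` words each, receive the heads, the
successors and the lengths of the lists. -/
def buildLists : Prog :=
  forUp 33 32 (
    .assign 39 (.reg 32 - (.reg 33 + 1)) ;;
    .load 49 (.reg 30 + .reg 39) ;;
    .load 52 (.reg 31 + .reg 49) ;;
    .store (.reg 31 + .reg 12 + .reg 39) (.reg 52) ;;
    .store (.reg 31 + .reg 49) (.reg 39 + 1) ;;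
    .assign 53 (.reg 31 + .reg 12 + .reg 12 + .reg 49) ;;
    .load 52 (.reg 53) ;;
    .store (.reg 53) (.reg 52 + 1))

/-- The indices are inserted at the heads in descending order, so the lists come out ascending.
Radix sort needs this for stability, and the displacement uses the head to recognise the first
member of a group. -/
theorem vc_buildLists {s : State} {G : ℕ → ℕ} {R M a q : ℕ} (h12 : s.reg 12 = R)
    (h30 : s.reg 30 = a) (h31 : s.reg 31 = q) (h32 : s.reg 32 = M) (hMR : M ≤ R)
    (haq : a + M ≤ q) (hqS : q + 3 * R ≤ S) (hSw : S < 2 ^ w) (hw : 100 < 2 ^ w)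
    (hG : ∀ i < M, s.mem (a + i) = G i) (hGR : ∀ i < M, G i < R)
    (hz : ∀ i < 3 * R, s.mem (q + i) = 0) :
    vc w S inp buildLists s fun t s' => t ≤ M * 60 + 6 ∧
      (∀ c, (c < q ∨ q + 3 * R ≤ c) → s'.mem c = s.mem c) ∧
      ∀ g < R, Chain (fun i => s'.mem (q + R + i)) (s'.mem (q + g)) (grp G M g) ∧
        s'.mem (q + 2 * R + g) = (grp G M g).length := by
  refine vc_forUp_le 52 (fun k s' => (∀ c, (c < q ∨ q + 3 * R ≤ c) → s'.mem c = s.mem c) ∧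
    ∀ g < R, Chain (fun i => s'.mem (q + R + i)) (s'.mem (q + g))
      ((List.range' (M - k) k).filter fun i => G i = g) ∧
      s'.mem (q + 2 * R + g) = ((List.range' (M - k) k).filter fun i => G i = g).length)
    (by decide) rfl rfl (by omega) (by omega) ?_ ?_ ?_
  · refine ⟨fun _ _ => rfl, fun g hg => ?_⟩
    have h1 := hz g (by omega)
    have h2 := hz (2 * R + g) (by omega)
    rw [← add_assoc] at h2
    simp [Chain, h1, h2]
  · rintro k s' hk hk33 hf ⟨ho, hi⟩
    rw [h32] at hk
    have f12 : s'.reg 12 = R := (hf 12 (by decide) rfl).trans h12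
    have f30 : s'.reg 30 = a := (hf 30 (by decide) rfl).trans h30
    have f31 : s'.reg 31 = q := (hf 31 (by decide) rfl).trans h31
    have f32 : s'.reg 32 = M := (hf 32 (by decide) rfl).trans h32
    have hw0 : w ≠ 0 := by rintro rfl; omega
    obtain ⟨i, hik⟩ : ∃ i, M - (k + 1) = i := ⟨_, rfl⟩
    have hmi : s'.mem (a + i) = G i := by rw [ho _ (by omega), hG _ (by omega)]
    have hgi := hGR i (by omega)
    have e1 : q + R + R + G i = q + 2 * R + G i := by ring
    have hlen : s'.mem (q + 2 * R + G i) ≤ k := by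
      rw [(hi _ hgi).2]
      exact (List.length_filter_le _ _).trans (by simp)
    have e2 : (List.range' i (k + 1)) = i :: List.range' (M - k) k := by
      rw [List.range'_succ]; congr 2; omega
    simp [f12, f30, f31, f32, hk33, hik, hmi, e1]
    rw [Function.update_of_ne (by omega), Function.update_of_ne (by omega)]
    repeat' apply And.intro
    any_goals omega
    · intro c hc
      rw [Function.update_of_ne (by omega), Function.update_of_ne (by omega),
        Function.update_of_ne (by omega), ho c hc]
    · intro g hg
      rw [e2]
      obtain ⟨hc, hl⟩ := hi g hg
      have hnx : ∀ j < R, j ≠ i → Function.update (Function.update (Function.update s'.mem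
          (q + R + i) (s'.mem (q + G i))) (q + G i) (i + 1)) (q + 2 * R + G i)
          (s'.mem (q + 2 * R + G i) + 1) (q + R + j) = s'.mem (q + R + j) := by
        intro j hj hji
        rw [Function.update_of_ne (by omega), Function.update_of_ne (by omega),
          Function.update_of_ne (by omega)]
      have hmem : ∀ j ∈ (List.range' (M - k) k).filter fun i => decide (G i = g), j < R ∧ j ≠ i := by
        intro j hj
        have := (List.mem_range'_1.1 (List.mem_filter.1 hj).1)
        omega
      rcases eq_or_ne (G i) g with rfl | hne
      · rw [List.filter_cons_of_pos (by simp)]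
        refine ⟨⟨?_, ?_⟩, ?_⟩
        · rw [Function.update_of_ne (by omega), Function.update_self]
        · simp only
          rw [Function.update_of_ne (by omega), Function.update_of_ne (by omega),
            Function.update_self]
          exact hc.congr fun j hj => hnx j (hmem j hj).1 (hmem j hj).2
        · rw [Function.update_self, hl, List.length_cons]
      · rw [List.filter_cons_of_neg (by simpa using hne)]
        refine ⟨?_, ?_⟩
        · rw [Function.update_of_ne (by omega), Function.update_of_ne (by omega),
            Function.update_of_ne (by omega)]
          exact hc.congr fun j hj => hnx j (hmem j hj).1 (hmem j hj).2
        · rw [Function.update_of_ne (by omega), Function.update_of_ne (by omega),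
            Function.update_of_ne (by omega), hl]
  · rintro t s' ht _ _ ⟨ho, hi⟩
    rw [h32] at ht hi
    simp only [Nat.sub_self, ← List.range_eq_range'] at hi
    exact ⟨by omega, ho, hi⟩

end WordRAM

/-! ### Choosing a displacement by conditional expectations -/

namespace WordRAM

/-- `T` is a tree of counters in heap order with `R` leaves: every inner node is the sum of its
children. -/
def SumTree (T : ℕ → ℕ) (R : ℕ) : Prop := ∀ y, 1 ≤ y → y < R → T y = T (2 * y) + T (2 * y + 1)

/-- Bounds all counters by the number of inserted elements, which keeps the weight sums within a
word. -/
theorem SumTree.le_root {T : ℕ → ℕ} {R : ℕ} (h : SumTree T R) {z : ℕ} (h1 : 1 ≤ z)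
    (h2 : z < 2 * R) : T z ≤ T 1 := by
  induction z using Nat.strong_induction_on with
  | _ z ih =>
    rcases eq_or_ne z 1 with rfl | hz
    · exact le_rfl
    · have h3 := ih (z / 2) (by omega) (by omega) (by omega)
      have h4 := h (z / 2) (by omega) (by omega)
      rcases Nat.mod_two_eq_zero_or_one z with h5 | h5
      · have : 2 * (z / 2) = z := by omega
        rw [this] at h4; omega
      · have : 2 * (z / 2) + 1 = z := by omega
        rw [this] at h4; omega

theorem xor_one_eq (z : ℕ) : z ^^^ 1 = if z % 2 = 0 then z + 1 else z - 1 := by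
  split_ifs with h
  · exact Nat.xor_one_of_even (Nat.even_iff.2 h)
  · exact Nat.xor_one_of_odd (Nat.odd_iff.2 (by omega))

theorem SumTree.add_sibling {T : ℕ → ℕ} {R : ℕ} (h : SumTree T R) {z : ℕ} (h1 : 2 ≤ z)
    (h2 : z < 2 * R) : T z + T (z ^^^ 1) = T (z / 2) := by
  rw [h (z / 2) (by omega) (by omega), xor_one_eq]
  split_ifs with h5
  · have : 2 * (z / 2) = z := by omega
    rw [this]
  · have h6 : 2 * (z / 2) = z - 1 := by omega
    have h7 : z - 1 + 1 = z := by omega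
    rw [h6, h7, add_comm]

/-- The leaf for `y` has number `2 ^ ρ + y` in heap order. Written with xor, this number commutes
with displacing. -/
theorem two_pow_xor {ρ y : ℕ} (h : y < 2 ^ ρ) : 2 ^ ρ ^^^ y = 2 ^ ρ + y := by
  apply Nat.eq_of_testBit_eq
  intro i
  rcases lt_trichotomy i ρ with hi | rfl | hi
  · rw [Nat.testBit_xor, Nat.testBit_two_pow_add_gt hi, Nat.testBit_two_pow_of_ne (by omega)]
    simp
  · rw [Nat.testBit_xor, Nat.testBit_two_pow_add_eq, Nat.testBit_two_pow_self]
    simp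
  · have h1 : 2 ^ ρ + y < 2 ^ i := by
      calc 2 ^ ρ + y < 2 ^ ρ + 2 ^ ρ := by omega
        _ = 2 ^ (ρ + 1) := by ring
        _ ≤ 2 ^ i := Nat.pow_le_pow_right (by omega) hi
    rw [Nat.testBit_xor, Nat.testBit_lt_two_pow h1, Nat.testBit_lt_two_pow (by omega : y < 2 ^ i),
      Nat.testBit_two_pow_of_ne (by omega)]
    rfl

/-- The number of the leaf for the value `v` displaced by `d`. -/
def leafOf (R v d : ℕ) : ℕ := R ^^^ v ^^^ d

theorem leafOf_eq {ρ v d : ℕ} (hv : v < 2 ^ ρ) (hd : d < 2 ^ ρ) :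
    leafOf (2 ^ ρ) v d = 2 ^ ρ + (v ^^^ d) := by
  rw [leafOf, Nat.xor_assoc, two_pow_xor (Nat.xor_lt_two_pow hv hd)]

theorem leafOf_bounds {ρ v d : ℕ} (hv : v < 2 ^ ρ) (hd : d < 2 ^ ρ) :
    2 ^ ρ ≤ leafOf (2 ^ ρ) v d ∧ leafOf (2 ^ ρ) v d < 2 * 2 ^ ρ := by
  have := Nat.xor_lt_two_pow hv hd
  rw [leafOf_eq hv hd]
  omega

theorem leafOf_div_bounds {ρ v d h : ℕ} (hv : v < 2 ^ ρ) (hd : d < 2 ^ ρ) (hh : h < ρ) :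
    2 ≤ leafOf (2 ^ ρ) v d / 2 ^ h ∧ leafOf (2 ^ ρ) v d / 2 ^ h < 2 * 2 ^ ρ := by
  obtain ⟨h1, h2⟩ := leafOf_bounds hv hd
  refine ⟨?_, (Nat.div_le_self _ _).trans_lt h2⟩
  rw [Nat.le_div_iff_mul_le (by positivity)]
  refine le_trans ?_ h1
  rw [← pow_succ']
  exact Nat.pow_le_pow_right (by omega) hh

/-- Changing bit `h` of the displacement moves every ancestor at height `h` to its sibling. -/
theorem leafOf_flip (R v d h : ℕ) :
    leafOf R v (d ^^^ 2 ^ h) / 2 ^ h = (leafOf R v d / 2 ^ h) ^^^ 1 := by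
  rw [leafOf, ← Nat.xor_assoc, Nat.xor_div_two_pow, Nat.div_self (by positivity), leafOf]

/-- Total weight of the nodes at height `h` above the displaced values. -/
def treeWeight (T V : ℕ → ℕ) (R h d : ℕ) (l : List ℕ) : ℕ :=
  (l.map fun i => T (leafOf R (V i) d / 2 ^ h)).sum

/-- The two choices for bit `h` divide the weight at height `h + 1` between them, so the better one
gets at most half. This is the averaging step of the method of conditional expectations. -/
theorem treeWeight_add_flip {T V : ℕ → ℕ} {ρ h d : ℕ} {l : List ℕ} (hT : SumTree T (2 ^ ρ))
    (hV : ∀ i ∈ l, V i < 2 ^ ρ) (hd : d < 2 ^ ρ) (hh : h < ρ) :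
    treeWeight T V (2 ^ ρ) h d l + treeWeight T V (2 ^ ρ) h (d ^^^ 2 ^ h) l =
      treeWeight T V (2 ^ ρ) (h + 1) d l := by
  unfold treeWeight
  rw [← List.sum_map_add]
  congr 1
  refine List.map_congr_left fun i hi => ?_
  obtain ⟨h1, h2⟩ := leafOf_div_bounds (hV i hi) hd hh
  rw [leafOf_flip, hT.add_sibling h1 h2, Nat.div_div_eq_div_mul, pow_succ]

theorem treeWeight_le {T V : ℕ → ℕ} {R h d X : ℕ} {l : List ℕ}
    (hX : ∀ i ∈ l, T (leafOf R (V i) d / 2 ^ h) ≤ X) : treeWeight T V R h d l ≤ l.length * X := by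
  unfold treeWeight
  refine (List.sum_le_card_nsmul _ X ?_).trans (by simp)
  intro x hx
  obtain ⟨i, hi, rfl⟩ := List.mem_map.1 hx
  exact hX i hi

/-- At height `ρ` every ancestor is the root, whatever the displacement; the bound starts from here.
-/
theorem treeWeight_root {T V : ℕ → ℕ} {ρ d : ℕ} {l : List ℕ} (hV : ∀ i ∈ l, V i < 2 ^ ρ)
    (hd : d < 2 ^ ρ) : treeWeight T V (2 ^ ρ) ρ d l = l.length * T 1 := by
  have : ∀ i ∈ l, T (leafOf (2 ^ ρ) (V i) d / 2 ^ ρ) = T 1 := by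
    intro i hi
    obtain ⟨h1, h2⟩ := leafOf_bounds (hV i hi) hd
    congr 1
    rw [Nat.div_eq_iff (by positivity)]
    have : 0 < 2 ^ ρ := by positivity
    omega
  rw [treeWeight, List.map_congr_left this]
  simp

/-- Compute the weights for the displacement in register `40` with and without a change of the bit
in register `41`, for the group whose list starts at the index in register `43`. -/
def evalBit : Prog :=
  .assign 42 (.reg 43 + 1) ;; .assign 44 0 ;; .assign 45 0 ;;
  forChain 42 35 (
    .load 46 (.reg 34 + .reg 42 - 1) ;;
    .assign 46 (.bin .shr (.reg 12 ^^^ .reg 46 ^^^ .reg 40) (.reg 41)) ;;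
    .load 47 (.reg 37 + .reg 46) ;;
    .assign 44 (.reg 44 + .reg 47) ;;
    .load 47 (.reg 37 + (.reg 46 ^^^ 1)) ;;
    .assign 45 (.reg 45 + .reg 47))

/-- Choose the displacement of a group bit by bit. -/
def chooseDisp : Prog :=
  .assign 40 0 ;;
  forUp 48 11 (
    .assign 41 (.reg 11 - (.reg 48 + 1)) ;;
    evalBit ;;
    .ite (.bin .lt (.reg 45) (.reg 44)) (.assign 40 (.reg 40 ^^^ .two_pow (.reg 41))) .skip)

/-- Increment the counters on the path from the node in register `46` to the root. -/
def insertLeaf : Prog :=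
  .loop (.reg 46) (
    .load 47 (.reg 37 + .reg 46) ;;
    .store (.reg 37 + .reg 46) (.reg 47 + 1) ;;
    .assign 46 (.reg 46 / 2))

/-- Insert the displaced values of a group into the tree. -/
def insertGroup : Prog :=
  .assign 42 (.reg 43 + 1) ;;
  forChain 42 35 (
    .load 46 (.reg 34 + .reg 42 - 1) ;;
    .assign 46 (.reg 12 ^^^ .reg 46 ^^^ .reg 40) ;;
    insertLeaf)

/-- Displace the group in register `49`. -/
def displaceGroup : Prog :=
  chooseDisp ;; .store (.reg 38 + .reg 49) (.reg 40) ;; insertGroup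

variable {w S : ℕ} {inp : List ℕ}

/-- Layout of the arrays used in the displacement of a group: the values at `vb`, the
successors at `nb`, the tree at `tb`. -/
structure GroupLayout (w S M ρ vb nb tb : ℕ) (V : ℕ → ℕ) (mem : ℕ → ℕ) : Prop where
  hV : ∀ i < M, mem (vb + i) = V i
  hVR : ∀ i < M, V i < 2 ^ ρ
  hMR : M ≤ 2 ^ ρ
  hvb : vb + M ≤ tb
  hnb : nb + M ≤ tb
  htb : tb + 3 * 2 ^ ρ ≤ S
  hSw : S < 2 ^ w
  hw : 100 < 2 ^ w
  hRR : 2 ^ ρ * 2 ^ ρ < 2 ^ w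

theorem vc_evalBit {s : State} {M ρ vb nb tb d h it : ℕ} {V nx : ℕ → ℕ} {l : List ℕ}
    (hL : GroupLayout w S M ρ vb nb tb V s.mem)
    (h12 : s.reg 12 = 2 ^ ρ) (h34 : s.reg 34 = vb) (h35 : s.reg 35 = nb) (h37 : s.reg 37 = tb)
    (h40 : s.reg 40 = d) (h41 : s.reg 41 = h) (h43 : s.reg 43 = it)
    (hd : d < 2 ^ ρ) (hh : h < ρ) (hit : it < M)
    (hT : SumTree (fun z => s.mem (tb + z)) (2 ^ ρ)) (hT1 : s.mem (tb + 1) ≤ M)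
    (hch : Chain nx (it + 1) l) (hlM : ∀ i ∈ l, i < M) (hlen : l.length ≤ M)
    (hnx : ∀ i < M, s.mem (nb + i) = nx i) :
    vc w S inp evalBit s fun t s' => t ≤ l.length * 70 + 30 ∧
      s'.reg 44 = treeWeight (fun z => s.mem (tb + z)) V (2 ^ ρ) h d l ∧
      s'.reg 45 = treeWeight (fun z => s.mem (tb + z)) V (2 ^ ρ) h (d ^^^ 2 ^ h) l := by
  obtain ⟨hV, hVR, hMR, hvb, hnb, htb, hSw, hw, hRR⟩ := hL
  have hw0 : w ≠ 0 := by rintro rfl; omega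
  have hTM : ∀ z, 1 ≤ z → z < 2 * 2 ^ ρ → s.mem (tb + z) ≤ M := fun z h1 h2 =>
    (hT.le_root h1 h2).trans hT1
  have hMM : M * M ≤ 2 ^ ρ * 2 ^ ρ := Nat.mul_le_mul hMR hMR
  have hlM2 : l.length * M ≤ M * M := Nat.mul_le_mul_right _ hlen
  have hd' : d ^^^ 2 ^ h < 2 ^ ρ :=
    Nat.xor_lt_two_pow hd (Nat.pow_lt_pow_right (by omega) hh)
  have hb1 : treeWeight (fun z => s.mem (tb + z)) V (2 ^ ρ) h d l ≤ l.length * M :=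
    treeWeight_le fun i hi => by
      obtain ⟨h1, h2⟩ := leafOf_div_bounds (hVR i (hlM i hi)) hd hh
      exact hTM _ (by omega) h2
  have hb2 : treeWeight (fun z => s.mem (tb + z)) V (2 ^ ρ) h (d ^^^ 2 ^ h) l ≤ l.length * M :=
    treeWeight_le fun i hi => by
      obtain ⟨h1, h2⟩ := leafOf_div_bounds (hVR i (hlM i hi)) hd' hh
      exact hTM _ (by omega) h2
  simp [evalBit, h43]
  refine ⟨⟨by omega, by omega⟩, ?_⟩
  refine vc_forChain (fun l' t s' => s'.mem = s.mem ∧ t + l'.length * 70 ≤ l.length * 70 ∧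
    s'.reg 44 + treeWeight (fun z => s.mem (tb + z)) V (2 ^ ρ) h d l' =
      treeWeight (fun z => s.mem (tb + z)) V (2 ^ ρ) h d l ∧
    s'.reg 45 + treeWeight (fun z => s.mem (tb + z)) V (2 ^ ρ) h (d ^^^ 2 ^ h) l' =
      treeWeight (fun z => s.mem (tb + z)) V (2 ^ ρ) h (d ^^^ 2 ^ h) l)
    (by decide) rfl rfl (by simpa using hch) ?_ hSw ?_ ?_ ?_
  · intro i hi
    have := hlM i hi
    simp [h35]; omega
  · simp
  · rintro i l' t s' hf h42 hsuf ⟨hm, ht, h44, h45⟩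
    have hi : i < M := hlM i (hsuf.subset (by simp))
    have f12 : s'.reg 12 = 2 ^ ρ := by simpa [h12] using hf 12 (by decide) rfl
    have f34 : s'.reg 34 = vb := by simpa [h34] using hf 34 (by decide) rfl
    have f37 : s'.reg 37 = tb := by simpa [h37] using hf 37 (by decide) rfl
    have f40 : s'.reg 40 = d := by simpa [h40] using hf 40 (by decide) rfl
    have f41 : s'.reg 41 = h := by simpa [h41] using hf 41 (by decide) rfl
    have e1 : vb + (i + 1) - 1 = vb + i := by omega
    obtain ⟨h1, h2⟩ := leafOf_div_bounds (hVR i hi) hd hh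
    obtain ⟨h3, h4⟩ := leafOf_div_bounds (hVR i hi) hd' hh
    simp only [treeWeight, List.map_cons, List.sum_cons, leafOf_flip] at h44 h45 h3 h4 hb1 hb2 ⊢
    simp only [leafOf] at h1 h2 h3 h4 h44 h45 hb1 hb2 ⊢
    simp [f12, f34, f37, f40, f41, h42, e1, hm, hV i hi, h35, hnx i hi] at ht ⊢
    omega
  · rintro t s' hf ⟨hm, ht, h44, h45⟩
    simp [treeWeight] at ht h44 h45
    refine ⟨by omega, h44, h45⟩

/-- The bits are fixed from the highest to the lowest. Each choice at least halves the weight, so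
the `ρ` choices gain a factor `2 ^ ρ`: the final displacement meets at most the average number of
counted elements over all displacements. -/
theorem vc_chooseDisp {s : State} {M ρ vb nb tb it : ℕ} {V nx : ℕ → ℕ} {l : List ℕ}
    (hL : GroupLayout w S M ρ vb nb tb V s.mem) (h11 : s.reg 11 = ρ)
    (h12 : s.reg 12 = 2 ^ ρ) (h34 : s.reg 34 = vb) (h35 : s.reg 35 = nb) (h37 : s.reg 37 = tb)
    (h43 : s.reg 43 = it) (hit : it < M)
    (hT : SumTree (fun z => s.mem (tb + z)) (2 ^ ρ)) (hT1 : s.mem (tb + 1) ≤ M)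
    (hch : Chain nx (it + 1) l) (hlM : ∀ i ∈ l, i < M) (hlen : l.length ≤ M)
    (hnx : ∀ i < M, s.mem (nb + i) = nx i) :
    vc w S inp chooseDisp s fun t s' => t ≤ ρ * (l.length * 70 + 60) + 10 ∧
      s'.reg 40 < 2 ^ ρ ∧
      2 ^ ρ * treeWeight (fun z => s.mem (tb + z)) V (2 ^ ρ) 0 (s'.reg 40) l ≤
        l.length * s.mem (tb + 1) := by
  have hL' := hL
  obtain ⟨hV, hVR, hMR, hvb, hnb, htb, hSw, hw, hRR⟩ := hL'
  have hw0 : w ≠ 0 := by rintro rfl; omega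
  have hρ : ρ < 2 ^ ρ := Nat.lt_two_pow_self
  simp [chooseDisp]
  refine vc_forUp_le (l.length * 70 + 52) (fun k s' => s'.mem = s.mem ∧ s'.reg 40 < 2 ^ ρ ∧
    2 ^ k * treeWeight (fun z => s.mem (tb + z)) V (2 ^ ρ) (ρ - k) (s'.reg 40) l ≤
        l.length * s.mem (tb + 1)) (by decide) rfl rfl (by simp [h11]; omega) (by omega) ?_ ?_ ?_
  · refine ⟨rfl, by simp, ?_⟩
    simp only [pow_zero, one_mul, Nat.sub_zero]
    rw [treeWeight_root (fun i hi => hVR i (hlM i hi)) (by simp)]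
  · rintro k s' hk hk48 hf ⟨hm, hd, hw'⟩
    simp [h11] at hk
    have f11 : s'.reg 11 = ρ := by simpa [h11] using hf 11 (by decide) rfl
    have f12 : s'.reg 12 = 2 ^ ρ := by simpa [h12] using hf 12 (by decide) rfl
    have f34 : s'.reg 34 = vb := by simpa [h34] using hf 34 (by decide) rfl
    have f35 : s'.reg 35 = nb := by simpa [h35] using hf 35 (by decide) rfl
    have f37 : s'.reg 37 = tb := by simpa [h37] using hf 37 (by decide) rfl
    have f43 : s'.reg 43 = it := by simpa [h43] using hf 43 (by decide) rfl
    rw [vc]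
    simp only [vc, Expr.Ok, Expr.val, BinOp.Ok, BinOp.val, f11, hk48]
    refine ⟨⟨trivial, ⟨trivial, by omega, by omega⟩, by omega, by omega⟩, ?_⟩
    refine vc_conseq (vc_evalBit (h := ρ - (k + 1)) (d := s'.reg 40) (nx := nx) (l := l)
      (by rw [hm]; exact hL) (by simpa) (by simpa)
      (by simpa) (by simpa) (by simp) (by simp) (by simpa) hd (by omega) hit
      (by simpa [hm]) (by simpa [hm]) hch hlM hlen (by simpa [hm])) ?_
    rintro t' s'' hf' hm'' ⟨ht', h44, h45⟩
    have hm'' : s''.mem = s.mem := (hm'' rfl).trans hm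
    have g40 : s''.reg 40 = s'.reg 40 := by simpa using hf' 40 rfl
    have g41 : s''.reg 41 = ρ - (k + 1) := by simpa using hf' 41 rfl
    simp only [hm] at h44 h45
    -- Registers `44` and `45` hold the two parts of the current weight, so twice the smaller of
    -- them is at most that weight.
    have hadd := treeWeight_add_flip (h := ρ - (k + 1)) hT (fun i hi => hVR i (hlM i hi)) hd
      (by omega)
    have e1 : ρ - (k + 1) + 1 = ρ - k := by omega
    rw [e1, ← h44, ← h45] at hadd
    rw [← hadd] at hw'
    have hlt : 2 ^ (ρ - (k + 1)) < 2 ^ ρ := Nat.pow_lt_pow_right (by omega) (by omega)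
    have hp : 2 ^ (k + 1) = 2 ^ k * 2 := pow_succ _ _
    simp [g40, g41, hm'']
    refine ⟨fun hlt' => ⟨⟨by omega, by omega⟩, by omega, Nat.xor_lt_two_pow hd hlt, ?_⟩,
      fun hle => ⟨by omega, hd, ?_⟩⟩
    · rw [← h45, hp, mul_assoc]
      exact (Nat.mul_le_mul_left _ (by omega)).trans hw'
    · rw [← h44, hp, mul_assoc]
      exact (Nat.mul_le_mul_left _ (by omega)).trans hw'
  · rintro t s' ht _ _ ⟨hm, hd, hw'⟩
    simp [h11] at ht hw'
    refine ⟨?_, hd, hw'⟩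
    have e : l.length * 70 + 52 + 8 = l.length * 70 + 60 := by ring
    rw [e] at ht
    omega

/-- On the way up the sum condition is violated only at the current node: its child has been
incremented and it has not. At the leaf there is no violation yet, and when the register reaches `0`
there is none left. -/
theorem vc_insertLeaf {s : State} {ρ tb z₀ : ℕ} (h37 : s.reg 37 = tb) (h46 : s.reg 46 = z₀)
    (hz1 : 2 ^ ρ ≤ z₀) (hz2 : z₀ < 2 * 2 ^ ρ) (htb : tb + 2 * 2 ^ ρ ≤ S) (hSw : S < 2 ^ w)
    (hw : 100 < 2 ^ w) (hT : SumTree (fun z => s.mem (tb + z)) (2 ^ ρ))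
    (hT1 : s.mem (tb + 1) + 1 < 2 ^ w) :
    vc w S inp insertLeaf s fun t s' => t ≤ (ρ + 1) * 18 + 10 ∧
      SumTree (fun z => s'.mem (tb + z)) (2 ^ ρ) ∧ s'.mem (tb + 1) = s.mem (tb + 1) + 1 ∧
      (∀ y, 2 ^ ρ ≤ y → y < 2 * 2 ^ ρ → s'.mem (tb + y) = s.mem (tb + y) +
        if y = z₀ then 1 else 0) ∧
      ∀ c, (c < tb ∨ tb + 2 * 2 ^ ρ ≤ c) → s'.mem c = s.mem c := by
  have hw0 : w ≠ 0 := by rintro rfl; omega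
  have hR : 0 < 2 ^ ρ := by positivity
  have hTz : ∀ z, 1 ≤ z → z < 2 * 2 ^ ρ → s.mem (tb + z) ≤ s.mem (tb + 1) := fun z h1 h2 =>
    hT.le_root h1 h2
  refine vc_loop (fun t s' => ∃ k ≤ ρ + 1, t ≤ k * 18 ∧ s'.reg 46 < 2 ^ (ρ + 1 - k) ∧
    s'.reg 46 ≤ z₀ ∧ (s'.reg 46 < 2 ^ ρ ∨ s'.reg 46 = z₀) ∧
    (∀ y, 1 ≤ y → y < 2 ^ ρ → s'.mem (tb + y) + (if y = s'.reg 46 then 1 else 0) =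
      s'.mem (tb + 2 * y) + s'.mem (tb + 2 * y + 1)) ∧
    (∀ y, 1 ≤ y → y ≤ s'.reg 46 → s'.mem (tb + y) = s.mem (tb + y)) ∧
    (s'.reg 46 = 0 → s'.mem (tb + 1) = s.mem (tb + 1) + 1) ∧
    (∀ y, 2 ^ ρ ≤ y → y < 2 * 2 ^ ρ → s'.mem (tb + y) = s.mem (tb + y) +
        if y = z₀ ∧ s'.reg 46 ≠ z₀ then 1 else 0) ∧
    ∀ c, (c < tb ∨ tb + 2 * 2 ^ ρ ≤ c) → s'.mem c = s.mem c)
    (fun s' => s'.reg 46) ?_ ?_ ?_ ?_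
  · refine ⟨0, by omega, by omega, ?_, by omega, by omega, ?_, ?_, by omega, ?_, ?_⟩
    · rw [h46, Nat.sub_zero, pow_succ']; exact hz2
    · intro y hy1 hy2
      have := hT y hy1 hy2
      simp only at this
      rw [if_neg (by omega), this]
      ring_nf
    · simp
    · simp [h46]
    · simp
  · intros; trivial
  · rintro t s' hf ⟨k, hk, ht, hzk, hzz, hz, hsum, hlow, _, hleaf, ho⟩ h0
    simp only [Expr.val] at h0
    have f37 : s'.reg 37 = tb := by simpa [h37] using hf 37 rfl
    set z := s'.reg 46 with hzd
    have hk' : k < ρ + 1 := by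
      by_contra hc
      have : ρ + 1 - k = 0 := by omega
      rw [this] at hzk
      omega
    have hTz' := hTz z (by omega) (by omega)
    have hlz := hlow z (by omega) le_rfl
    simp [f37, ← hzd]
    repeat' apply And.intro
    any_goals omega
    refine ⟨k + 1, by omega, by omega, ?_, by omega, by omega, ?_, ?_, ?_, ?_, ?_⟩
    · have e : ρ + 1 - k = ρ + 1 - (k + 1) + 1 := by omega
      rw [e, pow_succ] at hzk
      omega
    · intro y hy1 hy2
      have h1 := hsum y hy1 hy2
      have upd : ∀ x, Function.update s'.mem (tb + z) (s'.mem (tb + z) + 1) (tb + x) =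
          s'.mem (tb + x) + if x = z then 1 else 0 := by
        intro x
        rcases eq_or_ne x z with rfl | hx
        · simp
        · rw [Function.update_of_ne (by omega), if_neg hx, add_zero]
      have h2 := upd (2 * y + 1)
      rw [← add_assoc] at h2
      rw [upd, upd, h2]
      split_ifs at h1 ⊢ <;> omega
    · intro y hy1 hy2
      rw [Function.update_of_ne (by omega)]
      exact hlow y hy1 (by omega)
    · intro hz0
      have : z = 1 := by omega
      rw [this] at hlz ⊢
      rw [Function.update_self, hlz]
    · intro y hy1 hy2
      have h1 := hleaf y hy1 hy2
      rcases eq_or_ne y z with rfl | hy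
      · rw [Function.update_self, hlz, if_pos (by omega)]
      · rw [Function.update_of_ne (by omega), h1]
        congr 1
        have : (y = z₀ ∧ z ≠ z₀) ↔ (y = z₀ ∧ ¬ z / 2 = z₀) := by omega
        simp only [this]
    · intro c hc
      rw [Function.update_of_ne (by omega), ho c hc]
  · rintro t s' hf ⟨k, hk, ht, hzk, hzz, hz, hsum, hlow, h1, hleaf, ho⟩ h0
    simp only [Expr.val] at h0
    refine ⟨?_, ?_, h1 h0, ?_, ho⟩
    · simp; omega
    · intro y hy1 hy2
      have := hsum y hy1 hy2
      rw [if_neg (by omega)] at this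
      simpa [add_assoc] using this
    · intro y hy1 hy2
      rw [hleaf y hy1 hy2, h0]
      congr 1
      have : (y = z₀ ∧ 0 ≠ z₀) ↔ y = z₀ := by omega
      simp only [this]

theorem vc_insertGroup {s : State} {M ρ vb nb tb d it : ℕ} {V nx : ℕ → ℕ} {l : List ℕ}
    (hL : GroupLayout w S M ρ vb nb tb V s.mem)
    (h12 : s.reg 12 = 2 ^ ρ) (h34 : s.reg 34 = vb) (h35 : s.reg 35 = nb) (h37 : s.reg 37 = tb)
    (h40 : s.reg 40 = d) (h43 : s.reg 43 = it) (hd : d < 2 ^ ρ) (hit : it < M)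
    (hT : SumTree (fun z => s.mem (tb + z)) (2 ^ ρ)) (hT1 : s.mem (tb + 1) + l.length ≤ M)
    (hch : Chain nx (it + 1) l) (hlM : ∀ i ∈ l, i < M)
    (hnx : ∀ i < M, s.mem (nb + i) = nx i) :
    vc w S inp insertGroup s fun t s' => t ≤ l.length * ((ρ + 1) * 18 + 40) + 10 ∧
      SumTree (fun z => s'.mem (tb + z)) (2 ^ ρ) ∧ s'.mem (tb + 1) = s.mem (tb + 1) + l.length ∧
      (∀ y < 2 ^ ρ, s'.mem (tb + 2 ^ ρ + y) = s.mem (tb + 2 ^ ρ + y) +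
        l.countP fun i => V i ^^^ d = y) ∧
      ∀ c, (c < tb ∨ tb + 2 * 2 ^ ρ ≤ c) → s'.mem c = s.mem c := by
  obtain ⟨hV, hVR, hMR, hvb, hnb, htb, hSw, hw, hRR⟩ := hL
  have hw0 : w ≠ 0 := by rintro rfl; omega
  simp [insertGroup, h43]
  refine ⟨by omega, ?_⟩
  refine vc_forChain (fun l' t s' => t + l'.length * ((ρ + 1) * 18 + 40) ≤
      l.length * ((ρ + 1) * 18 + 40) ∧
    SumTree (fun z => s'.mem (tb + z)) (2 ^ ρ) ∧
    s'.mem (tb + 1) + l'.length = s.mem (tb + 1) + l.length ∧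
    (∀ y < 2 ^ ρ, s'.mem (tb + 2 ^ ρ + y) + (l'.countP fun i => V i ^^^ d = y) =
      s.mem (tb + 2 ^ ρ + y) + l.countP fun i => V i ^^^ d = y) ∧
    ∀ c, (c < tb ∨ tb + 2 * 2 ^ ρ ≤ c) → s'.mem c = s.mem c)
    (by decide) rfl rfl (by simpa using hch) ?_ hSw ?_ ?_ ?_
  · intro i hi
    have := hlM i hi
    simp [h35]; omega
  · exact ⟨by omega, hT, rfl, fun _ _ => rfl, fun _ _ => rfl⟩
  · rintro i l' t s' hf h42 hsuf ⟨ht, hT', hT1', hcount, ho⟩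
    have hi : i < M := hlM i (hsuf.subset (by simp))
    have f12 : s'.reg 12 = 2 ^ ρ := by simpa [h12] using hf 12 (by decide) rfl
    have f34 : s'.reg 34 = vb := by simpa [h34] using hf 34 (by decide) rfl
    have f37 : s'.reg 37 = tb := by simpa [h37] using hf 37 (by decide) rfl
    have f40 : s'.reg 40 = d := by simpa [h40] using hf 40 (by decide) rfl
    have e1 : vb + (i + 1) - 1 = vb + i := by omega
    have hvm : s'.mem (vb + i) = V i := by rw [ho _ (by omega), hV i hi]
    obtain ⟨h1, h2⟩ := leafOf_bounds (hVR i hi) hd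
    have hxlt := Nat.xor_lt_two_pow (hVR i hi) hd
    have heq := leafOf_eq (hVR i hi) hd
    simp only [leafOf] at h1 h2 heq
    simp only [List.length_cons] at hT1' ht
    simp [f12, f34, f40, h42, e1, hvm, h35]
    repeat' apply And.intro
    any_goals omega
    refine vc_conseq (vc_insertLeaf (by simpa using f37) (by simp) h1 h2 (by omega) hSw hw hT'
      (by simp only; omega)) ?_
    rintro t' s'' _ _ ⟨ht', hT'', hT1'', hleaf, ho'⟩
    simp only at hT1'' ho'
    refine ⟨?_, ?_, hT'', by omega, ?_, ?_⟩
    · rw [ho' _ (by omega), ho _ (by omega), hnx i hi]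
    · rw [Nat.add_mul] at ht
      omega
    · intro y hy
      have h3 := hleaf (2 ^ ρ + y) (by omega) (by omega)
      have h4 := hcount y hy
      have h5 : (2 ^ ρ + y = 2 ^ ρ ^^^ V i ^^^ d) ↔ V i ^^^ d = y := by rw [heq]; omega
      simp only [h5, ← add_assoc] at h3
      rw [h3, ← h4, List.countP_cons]
      simp only [decide_eq_true_eq]
      ring
    · intro c hc
      rw [ho' c hc, ho c hc]
  · rintro t s' hf ⟨ht, hT', hT1', hcount, ho⟩
    simp at ht hT1' hcount
    exact ⟨by omega, hT', hT1', hcount, ho⟩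

/-- The displacement is chosen from the counters before the group itself is inserted, so only
collisions with other groups are weighed. -/
theorem vc_displaceGroup {s : State} {M ρ vb nb tb ob g it : ℕ} {V nx : ℕ → ℕ} {l : List ℕ}
    (hL : GroupLayout w S M ρ vb nb tb V s.mem) (h11 : s.reg 11 = ρ)
    (h12 : s.reg 12 = 2 ^ ρ) (h34 : s.reg 34 = vb) (h35 : s.reg 35 = nb) (h37 : s.reg 37 = tb)
    (h38 : s.reg 38 = ob) (h49 : s.reg 49 = g) (hg : g < 2 ^ ρ) (hob : ob = tb + 2 * 2 ^ ρ)
    (h43 : s.reg 43 = it) (hit : it < M)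
    (hT : SumTree (fun z => s.mem (tb + z)) (2 ^ ρ)) (hT1 : s.mem (tb + 1) + l.length ≤ M)
    (hch : Chain nx (it + 1) l) (hlM : ∀ i ∈ l, i < M)
    (hnx : ∀ i < M, s.mem (nb + i) = nx i) :
    vc w S inp displaceGroup s fun t s' => t ≤ (ρ + 1) * (l.length * 150 + 100) ∧
      s'.mem (ob + g) < 2 ^ ρ ∧
      2 ^ ρ * (l.map fun i => s.mem (tb + 2 ^ ρ + (V i ^^^ s'.mem (ob + g)))).sum ≤
        l.length * s.mem (tb + 1) ∧
      SumTree (fun z => s'.mem (tb + z)) (2 ^ ρ) ∧ s'.mem (tb + 1) = s.mem (tb + 1) + l.length ∧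
      (∀ y < 2 ^ ρ, s'.mem (tb + 2 ^ ρ + y) = s.mem (tb + 2 ^ ρ + y) +
        l.countP fun i => V i ^^^ s'.mem (ob + g) = y) ∧
      ∀ c, c ≠ ob + g → (c < tb ∨ tb + 2 * 2 ^ ρ ≤ c) → s'.mem c = s.mem c := by
  have hL' := hL
  obtain ⟨hV, hVR, hMR, hvb, hnb, htb, hSw, hw, hRR⟩ := hL'
  refine vc_seq (vc_chooseDisp hL h11 h12 h34 h35 h37 h43 hit hT (by omega) hch hlM (by omega)
    hnx) ?_
  rintro t s' hf hm ⟨ht, hd, hwt⟩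
  have hm := hm rfl
  have f12 : s'.reg 12 = 2 ^ ρ := by simpa [h12] using hf 12 rfl
  have f34 : s'.reg 34 = vb := by simpa [h34] using hf 34 rfl
  have f35 : s'.reg 35 = nb := by simpa [h35] using hf 35 rfl
  have f37 : s'.reg 37 = tb := by simpa [h37] using hf 37 rfl
  have f38 : s'.reg 38 = ob := by simpa [h38] using hf 38 rfl
  have f43 : s'.reg 43 = it := by simpa [h43] using hf 43 rfl
  have f49 : s'.reg 49 = g := by simpa [h49] using hf 49 rfl
  simp [f38, f49, hm]
  have upd : ∀ c, c ≠ ob + g → Function.update s.mem (ob + g) (s'.reg 40) c = s.mem c :=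
    fun c hc => Function.update_of_ne hc _ _
  refine ⟨by omega, by omega, ?_⟩
  have hT2 : SumTree (fun z => Function.update s.mem (ob + g) (s'.reg 40) (tb + z)) (2 ^ ρ) := by
    intro y h1 h2
    simp only
    rw [upd _ (by omega), upd _ (by omega), upd _ (by omega)]
    exact hT y h1 h2
  refine vc_conseq (vc_insertGroup (l := l) (nx := nx) ⟨?_, hVR, hMR, hvb, hnb, htb, hSw, hw, hRR⟩
    (by simpa) (by simpa) (by simpa) (by simpa) rfl (by simpa) hd hit hT2 ?_ hch hlM ?_) ?_
  · intro i hi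
    simp only
    rw [upd _ (by omega), hV i hi]
  · simp only
    rwa [upd _ (by omega)]
  · intro i hi
    simp only
    rw [upd _ (by omega), hnx i hi]
  · rintro t' s'' _ _ ⟨ht', hT', hT1', hcount, ho⟩
    simp only at hT1' hcount ho
    rw [upd _ (by omega)] at hT1'
    have hod : s''.mem (ob + g) = s'.reg 40 := by rw [ho _ (by omega), Function.update_self]
    rw [hod]
    refine ⟨?_, hd, ?_, hT', hT1', ?_, ?_⟩
    · have e1 : l.length * ((ρ + 1) * 18 + 40) ≤ (ρ + 1) * (l.length * 58) := by
        have : l.length * 40 ≤ (ρ + 1) * (l.length * 40) := Nat.le_mul_of_pos_left _ (by omega)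
        calc l.length * ((ρ + 1) * 18 + 40) = (ρ + 1) * (l.length * 18) + l.length * 40 := by ring
          _ ≤ (ρ + 1) * (l.length * 18) + (ρ + 1) * (l.length * 40) := by omega
          _ = _ := by ring
      have e2 : ρ * (l.length * 70 + 60) ≤ (ρ + 1) * (l.length * 70 + 60) :=
        Nat.mul_le_mul_right _ (by omega)
      have e3 : (ρ + 1) * (l.length * 150 + 100) = (ρ + 1) * (l.length * 58) +
        (ρ + 1) * (l.length * 70 + 60) + (ρ + 1) * (l.length * 22) + (ρ + 1) * 40 := by ring
      omega
    · convert hwt using 2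
      unfold treeWeight
      congr 1
      refine List.map_congr_left fun i hi => ?_
      rw [leafOf_eq (hVR i (hlM i hi)) hd, pow_zero, Nat.div_one, add_assoc]
    · intro y hy
      rw [hcount y hy, upd _ (by omega)]
    · intro c hc1 hc2
      rw [ho c hc2, upd c hc1]

end WordRAM

/-! ### Displacing all groups, large ones first -/

namespace WordRAM

open Finset in
/-- Number of indices whose group has been displaced. -/
def placed (G : ℕ → ℕ) (M : ℕ) (F : Finset ℕ) : ℕ := ∑ i ∈ range M, if G i ∈ F then 1 else 0

open Finset in
/-- Number of ordered pairs of indices from different displaced groups with the same displaced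
value. -/
def collisions (G V : ℕ → ℕ) (M : ℕ) (D : ℕ → ℕ) (F : Finset ℕ) : ℕ :=
  ∑ i ∈ range M, ∑ j ∈ range M,
    if G i ∈ F ∧ G j ∈ F ∧ G i ≠ G j ∧ V i ^^^ D (G i) = V j ^^^ D (G j) then 1 else 0

open Finset in
/-- Large groups are rare enough for a displacement without collisions. -/
def Decay (G : ℕ → ℕ) (M R : ℕ) : Prop := ∀ g j, 2 ^ j ≤ (grp G M g).length →
  (grp G M g).length < 2 ^ (j + 1) →
  (grp G M g).length * (∑ i ∈ range M, if 2 ^ j ≤ (grp G M (G i)).length then 1 else 0) < R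

theorem grp_succ (G : ℕ → ℕ) (M g : ℕ) :
    grp G (M + 1) g = grp G M g ++ if G M = g then [M] else [] := by
  simp only [grp, List.range_succ, List.filter_append]
  congr 1
  split_ifs with h <;> simp [h]

theorem sum_map_grp (G f : ℕ → ℕ) (M g : ℕ) :
    ((grp G M g).map f).sum = ∑ i ∈ Finset.range M, if G i = g then f i else 0 := by
  induction M with
  | zero => simp [grp]
  | succ M ih =>
    rw [grp_succ, Finset.sum_range_succ, List.map_append, List.sum_append, ih]
    split_ifs <;> simp

theorem length_grp (G : ℕ → ℕ) (M g : ℕ) :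
    (grp G M g).length = ∑ i ∈ Finset.range M, if G i = g then 1 else 0 := by
  rw [← sum_map_grp G (fun _ => 1) M g]
  simp

theorem countP_grp (G : ℕ → ℕ) (M g : ℕ) (p : ℕ → Prop) [DecidablePred p] :
    ((grp G M g).countP fun i => p i) =
      ∑ i ∈ Finset.range M, if G i = g ∧ p i then 1 else 0 := by
  induction M with
  | zero => simp [grp]
  | succ M ih =>
    rw [grp_succ, Finset.sum_range_succ, List.countP_append, ih]
    split_ifs with h1 h2 h2
    · simp [h2.2]
    · have : ¬ p M := fun h => h2 ⟨h1, h⟩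
      simp [this]
    · exact absurd h2.1 h1
    · simp

/-- The state of the displacement when the groups in `F` have been treated: `D` are the
displacements, `T` is the tree of counters. -/
structure DispInv (G V : ℕ → ℕ) (M R : ℕ) (F : Finset ℕ) (D T : ℕ → ℕ) : Prop where
  sum : SumTree T R
  root : T 1 = placed G M F
  leaf : ∀ y < R, T (R + y) =
    ∑ i ∈ Finset.range M, if G i ∈ F ∧ V i ^^^ D (G i) = y then 1 else 0
  lt : ∀ g < R, D g < R
  coll : R * collisions G V M D F ≤ placed G M F ^ 2
  zero : Decay G M R → collisions G V M D F = 0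

theorem placed_insert {G : ℕ → ℕ} {M g : ℕ} {F : Finset ℕ} (hg : g ∉ F) :
    placed G M (insert g F) = placed G M F + (grp G M g).length := by
  rw [placed, placed, length_grp, ← Finset.sum_add_distrib]
  refine Finset.sum_congr rfl fun i _ => ?_
  rcases eq_or_ne (G i) g with h | h
  · simp [h, hg]
  · simp [h]

theorem placed_le (G : ℕ → ℕ) (M : ℕ) (F : Finset ℕ) : placed G M F ≤ M := by
  refine (Finset.sum_le_card_nsmul _ _ 1 fun i _ => ?_).trans (by simp)
  split_ifs <;> omega

/-- The new ordered collisions are those of group `g` with earlier groups, each counted twice, and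
`hw` bounds them by `2 * len * placed / R`. Adding this to `placed ^ 2 / R` stays below `(placed +
len) ^ 2 / R`. Under `Decay` the product `len * placed` is less than `R`, so the integer number of
new collisions is zero. -/
theorem DispInv.insert {G V : ℕ → ℕ} {ρ M g : ℕ} {F : Finset ℕ} {D D' T T' : ℕ → ℕ}
    (h : DispInv G V M (2 ^ ρ) F D T) (hg : g ∉ F)
    (hG : ∀ i < M, G i < 2 ^ ρ) (hD : ∀ g' < 2 ^ ρ, g' ≠ g → D' g' = D g') (hd : D' g < 2 ^ ρ) (hV : ∀ i < M, V i < 2 ^ ρ)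
    (hw : 2 ^ ρ * ((grp G M g).map fun i => T (2 ^ ρ + (V i ^^^ D' g))).sum ≤
      (grp G M g).length * T 1)
    (hsum : SumTree T' (2 ^ ρ)) (hroot : T' 1 = T 1 + (grp G M g).length)
    (hleaf : ∀ y < 2 ^ ρ, T' (2 ^ ρ + y) = T (2 ^ ρ + y) +
      (grp G M g).countP fun i => V i ^^^ D' g = y)
    (hdecay : Decay G M (2 ^ ρ) → (grp G M g).length * placed G M F < 2 ^ ρ) :
    DispInv G V M (2 ^ ρ) (insert g F) D' T' := by
  have hcoll : collisions G V M D' (Insert.insert g F) = collisions G V M D F +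
      2 * ((grp G M g).map fun i => T (2 ^ ρ + (V i ^^^ D' g))).sum := by
    have h1 : ((grp G M g).map fun i => T (2 ^ ρ + (V i ^^^ D' g))).sum =
        ∑ i ∈ Finset.range M, ∑ j ∈ Finset.range M,
          if G i = g ∧ G j ∈ F ∧ V j ^^^ D (G j) = V i ^^^ D' g then 1 else 0 := by
      rw [sum_map_grp]
      refine Finset.sum_congr rfl fun i hi => ?_
      split_ifs with hgi
      · rw [h.leaf _ (Nat.xor_lt_two_pow (hV i (Finset.mem_range.1 hi)) hd)]
        simp [hgi]
      · simp [hgi]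
    have h2 : ∑ i ∈ Finset.range M, ∑ j ∈ Finset.range M,
        (if G i = g ∧ G j ∈ F ∧ V j ^^^ D (G j) = V i ^^^ D' g then 1 else 0) =
        ∑ i ∈ Finset.range M, ∑ j ∈ Finset.range M,
        (if G j = g ∧ G i ∈ F ∧ V i ^^^ D (G i) = V j ^^^ D' g then 1 else 0) :=
      -- Exchanging the roles of `i` and `j` turns the pairs with first element in `g` into those
      -- with second element in `g`.
      Finset.sum_comm
    rw [h1, two_mul]
    nth_rw 2 [h2]
    simp only [collisions, ← Finset.sum_add_distrib]
    refine Finset.sum_congr rfl fun i hiM => Finset.sum_congr rfl fun j hjM => ?_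
    have hgi : ∀ k, G k = g → G k ∉ F := fun k hk => hk ▸ hg
    have hDk : ∀ k < M, G k ∈ F → D' (G k) = D (G k) :=
      fun k hkM hk => hD _ (hG k hkM) fun h => hg (h ▸ hk)
    replace hiM := Finset.mem_range.1 hiM
    replace hjM := Finset.mem_range.1 hjM
    rcases eq_or_ne (G i) g with hi | hi <;> rcases eq_or_ne (G j) g with hj | hj
    · simp [hi, hj, hg]
    · by_cases hjF : G j ∈ F
      · simp [hi, hj, hg, hjF, hDk j hjM hjF, hj.symm, eq_comm]
      · simp [hi, hj, hg, hjF]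
    · by_cases hiF : G i ∈ F
      · simp [hi, hj, hg, hiF, hDk i hiM hiF]
      · simp [hi, hj, hg, hiF]
    · by_cases hiF : G i ∈ F <;> by_cases hjF : G j ∈ F
      · simp [hi, hj, hiF, hjF, hDk i hiM hiF, hDk j hjM hjF]
      · simp [hi, hj, hiF, hjF]
      · simp [hi, hj, hiF, hjF]
      · simp [hi, hj, hiF, hjF]
  refine ⟨hsum, ?_, ?_, ?_, ?_, ?_⟩
  · rw [hroot, h.root, placed_insert hg]
  · intro y hy
    rw [hleaf y hy, h.leaf y hy, countP_grp, ← Finset.sum_add_distrib]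
    refine Finset.sum_congr rfl fun i hiM => ?_
    rcases eq_or_ne (G i) g with hi | hi
    · simp [hi, hg]
    · by_cases hiF : G i ∈ F
      · simp [hi, hiF, hD _ (hG i (Finset.mem_range.1 hiM)) hi]
      · simp [hi, hiF]
  · intro g' hg'
    rcases eq_or_ne g' g with rfl | hne
    · exact hd
    · rw [hD g' hg' hne]; exact h.lt g' hg'
  · rw [hcoll, placed_insert hg]
    have := h.coll
    rw [h.root] at hw
    nlinarith [sq_nonneg (grp G M g).length]
  · intro hdec
    rw [hcoll, h.zero hdec]
    have h1 := hdecay hdec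
    rw [h.root] at hw
    have : 2 ^ ρ * ((grp G M g).map fun i => T (2 ^ ρ + (V i ^^^ D' g))).sum < 2 ^ ρ * 1 := by
      omega
    have := Nat.lt_of_mul_lt_mul_left this
    omega

/-- Lets a scan over the indices treat each group exactly once, namely at its smallest member,
without marking groups. -/
theorem grp_head {G : ℕ → ℕ} {M g i : ℕ} {l : List ℕ} (h : grp G M g = i :: l) :
    G i = g ∧ i < M ∧ ∀ j < i, G j ≠ g := by
  have hi : i ∈ grp G M g := by rw [h]; simp
  obtain ⟨hiM, hig⟩ := mem_grp.1 hi
  refine ⟨hig, hiM, fun j hj hjg => ?_⟩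
  have hp : (grp G M g).Pairwise (· < ·) := List.Pairwise.filter _ (List.pairwise_lt_range)
  have hjm : j ∈ grp G M g := mem_grp.2 ⟨by omega, hjg⟩
  rw [h] at hp hjm
  rcases List.mem_cons.1 hjm with rfl | hjl
  · omega
  · have := (List.pairwise_cons.1 hp).1 j hjl
    omega

/-- The groups treated before index `it` in the round for sizes between `2 ^ j` and
`2 ^ (j + 1)`. -/
def doneGroups (G : ℕ → ℕ) (M R j it : ℕ) : Finset ℕ :=
  (Finset.range R).filter fun g => 2 ^ (j + 1) ≤ (grp G M g).length ∨
    (2 ^ j ≤ (grp G M g).length ∧ ∃ i ∈ Finset.range it, G i = g)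

theorem doneGroups_all {G : ℕ → ℕ} {M R j : ℕ} :
    doneGroups G M R j M = (Finset.range R).filter fun g => 2 ^ j ≤ (grp G M g).length := by
  ext g
  simp only [doneGroups, Finset.mem_filter, Finset.mem_range, and_congr_right_iff]
  intro _
  constructor
  · rintro (h | h)
    · exact (Nat.pow_le_pow_right (by omega) (by omega)).trans h
    · exact h.1
  · intro h
    refine Or.inr ⟨h, ?_⟩
    have : 0 < (grp G M g).length := lt_of_lt_of_le (by positivity) h
    obtain ⟨i, hi⟩ := List.exists_mem_of_length_pos this
    exact ⟨i, (mem_grp.1 hi).1, (mem_grp.1 hi).2⟩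

theorem doneGroups_zero {G : ℕ → ℕ} {M R j : ℕ} :
    doneGroups G M R j 0 = (Finset.range R).filter fun g => 2 ^ (j + 1) ≤ (grp G M g).length := by
  simp [doneGroups]

theorem length_grp_le (G : ℕ → ℕ) (M g : ℕ) : (grp G M g).length ≤ M :=
  (List.length_filter_le _ _).trans (by simp)

theorem doneGroups_succ_of_not {G : ℕ → ℕ} {M R j it : ℕ}
    (h : ¬ ((∀ i < it, G i ≠ G it) ∧ 2 ^ j ≤ (grp G M (G it)).length ∧
      (grp G M (G it)).length < 2 ^ (j + 1))) :
    doneGroups G M R j (it + 1) = doneGroups G M R j it := by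
  ext g
  simp only [doneGroups, Finset.mem_filter, Finset.mem_range, and_congr_right_iff]
  intro _
  constructor
  · rintro (h1 | ⟨h1, i, hi, rfl⟩)
    · exact Or.inl h1
    · rcases Nat.lt_succ_iff_lt_or_eq.1 hi with hi | rfl
      · exact Or.inr ⟨h1, i, hi, rfl⟩
      · by_contra hc
        push Not at hc
        exact h ⟨fun i' hi' => hc.2 h1 i' hi', h1, hc.1⟩
  · rintro (h1 | ⟨h1, i, hi, rfl⟩)
    · exact Or.inl h1
    · exact Or.inr ⟨h1, i, by omega, rfl⟩

theorem doneGroups_succ_of {G : ℕ → ℕ} {M R j it : ℕ} (hR : G it < R)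
    (h1 : ∀ i < it, G i ≠ G it) (h2 : 2 ^ j ≤ (grp G M (G it)).length)
    (h3 : (grp G M (G it)).length < 2 ^ (j + 1)) :
    G it ∉ doneGroups G M R j it ∧
      doneGroups G M R j (it + 1) = insert (G it) (doneGroups G M R j it) := by
  constructor
  · simp only [doneGroups, Finset.mem_filter, Finset.mem_range, not_and, not_or]
    exact fun _ => ⟨by omega, fun _ ⟨i, hi, he⟩ => h1 i hi he⟩
  · ext g
    simp only [doneGroups, Finset.mem_filter, Finset.mem_range, Finset.mem_insert]
    constructor
    · rintro ⟨hg, h4 | ⟨h4, i, hi, rfl⟩⟩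
      · exact Or.inr ⟨hg, Or.inl h4⟩
      · rcases Nat.lt_succ_iff_lt_or_eq.1 hi with hi | rfl
        · exact Or.inr ⟨hg, Or.inr ⟨h4, i, hi, rfl⟩⟩
        · exact Or.inl rfl
    · rintro (rfl | ⟨hg, h4 | ⟨h4, i, hi, rfl⟩⟩)
      · exact ⟨hR, Or.inr ⟨h2, it, by omega, rfl⟩⟩
      · exact ⟨hg, Or.inl h4⟩
      · exact ⟨hg, Or.inr ⟨h4, i, by omega, rfl⟩⟩

/-- All groups treated up to and during round `j` have at least `2 ^ j` members. This is how the
order of treatment meets the quantity in `Decay`. -/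
theorem placed_doneGroups_le (G : ℕ → ℕ) (M R j it : ℕ) :
    placed G M (doneGroups G M R j it) ≤
      ∑ i ∈ Finset.range M, if 2 ^ j ≤ (grp G M (G i)).length then 1 else 0 := by
  refine Finset.sum_le_sum fun i _ => ?_
  split_ifs with h1 h2
  · exact le_rfl
  · refine absurd ?_ h2
    simp only [doneGroups, Finset.mem_filter] at h1
    rcases h1.2 with h | h
    · exact (Nat.pow_le_pow_right (by omega) (by omega)).trans h
    · exact h.1
  · omega
  · omega

/-- Treat the index in register `43` in the round for the sizes given by register `54`. -/
def displaceIndex : Prog :=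
  .load 49 (.reg 30 + .reg 43) ;; .load 52 (.reg 31 + .reg 49) ;; .load 53 (.reg 36 + .reg 49) ;;
  .ite (.bin .eq (.reg 52) (.reg 43 + 1))
    (.ite (.bin .eq (.bin .shr (.reg 53) (.reg 54)) 1) displaceGroup .skip) .skip

/-- Choose displacements for all groups of the `reg 32` indices with groups at `reg 30` and values
at `reg 34`, where `reg 31` is the start of a block of `6 * reg 12` zeros. The displacements
are stored at `reg 31 + 5 * reg 12`. -/
def displace : Prog :=
  buildLists ;;
  .assign 35 (.reg 31 + .reg 12) ;; .assign 36 (.reg 35 + .reg 12) ;;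
  .assign 37 (.reg 36 + .reg 12) ;; .assign 38 (.reg 37 + .reg 12 + .reg 12) ;;
  .assign 51 (.reg 11 + 1) ;;
  forUp 50 51 (.assign 54 (.reg 11 - .reg 50) ;; forUp 43 32 displaceIndex)

variable {w S : ℕ} {inp : List ℕ}

/-- Layout of the arrays used in a displacement. -/
structure DispLayout (w S M ρ ga vb q : ℕ) (G V : ℕ → ℕ) (mem : ℕ → ℕ) : Prop where
  hG : ∀ i < M, mem (ga + i) = G i
  hGR : ∀ i < M, G i < 2 ^ ρ
  hV : ∀ i < M, mem (vb + i) = V i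
  hVR : ∀ i < M, V i < 2 ^ ρ
  hMR : M ≤ 2 ^ ρ
  hga : ga + M ≤ q
  hvb : vb + M ≤ q
  hq : q + 6 * 2 ^ ρ ≤ S
  hSw : S < 2 ^ w
  hw : 100 < 2 ^ w
  hRR : 2 ^ ρ * 2 ^ ρ < 2 ^ w

/-- The time is amortised: treating a group is charged to the indices it places, at `(ρ + 1) * 250`
each, and merely looking at an index costs at most 40. The 250 is the 150 per member plus the 100
per group from `vc_displaceGroup`, as a group here has a member. -/
theorem vc_displaceIndex {s : State} {M ρ ga vb q j it : ℕ} {G V : ℕ → ℕ}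
    (hL : DispLayout w S M ρ ga vb q G V s.mem) (h11 : s.reg 11 = ρ)
    (h12 : s.reg 12 = 2 ^ ρ) (h30 : s.reg 30 = ga) (h31 : s.reg 31 = q)
    (h34 : s.reg 34 = vb) (h35 : s.reg 35 = q + 2 ^ ρ)
    (h36 : s.reg 36 = q + 2 * 2 ^ ρ) (h37 : s.reg 37 = q + 3 * 2 ^ ρ)
    (h38 : s.reg 38 = q + 5 * 2 ^ ρ) (h43 : s.reg 43 = it) (hit : it < M) (h54 : s.reg 54 = j)
    (hch : ∀ g < 2 ^ ρ, Chain (fun i => s.mem (q + 2 ^ ρ + i)) (s.mem (q + g)) (grp G M g) ∧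
        s.mem (q + 2 * 2 ^ ρ + g) = (grp G M g).length)
    (hI : DispInv G V M (2 ^ ρ) (doneGroups G M (2 ^ ρ) j it) (fun g => s.mem (q + 5 * 2 ^ ρ + g))
      (fun z => s.mem (q + 3 * 2 ^ ρ + z))) :
    vc w S inp displaceIndex s fun t s' =>
      t + (ρ + 1) * 250 * placed G M (doneGroups G M (2 ^ ρ) j it) ≤
        40 + (ρ + 1) * 250 * placed G M (doneGroups G M (2 ^ ρ) j (it + 1)) ∧
      DispInv G V M (2 ^ ρ) (doneGroups G M (2 ^ ρ) j (it + 1))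
        (fun g => s'.mem (q + 5 * 2 ^ ρ + g)) (fun z => s'.mem (q + 3 * 2 ^ ρ + z)) ∧
      ∀ c, (c < q + 3 * 2 ^ ρ ∨ q + 6 * 2 ^ ρ ≤ c) → s'.mem c = s.mem c := by
  obtain ⟨hG, hGR, hV, hVR, hMR, hga, hvb, hq, hSw, hw, hRR⟩ := hL
  have hw0 : w ≠ 0 := by rintro rfl; omega
  have hgR := hGR it hit
  obtain ⟨hc, hlen⟩ := hch (G it) hgR
  have hlM := length_grp_le G M (G it)
  have hitm : it ∈ grp G M (G it) := mem_grp.2 ⟨hit, rfl⟩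
  obtain ⟨i₀, l', hl'⟩ : ∃ i₀ l', grp G M (G it) = i₀ :: l' :=
    List.exists_cons_of_ne_nil (List.ne_nil_of_mem hitm)
  obtain ⟨hi₀, hi₀M, hfirst⟩ := grp_head hl'
  have hhead : s.mem (q + G it) = i₀ + 1 := by rw [hl'] at hc; exact hc.1
  have hdiv : (grp G M (G it)).length / 2 ^ j = 1 ↔ 2 ^ j ≤ (grp G M (G it)).length ∧
      (grp G M (G it)).length < 2 ^ (j + 1) := by
    rw [Nat.div_eq_iff (by positivity), pow_succ]
    have : 0 < 2 ^ j := by positivity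
    omega
  have hskip : ¬ ((∀ i < it, G i ≠ G it) ∧ 2 ^ j ≤ (grp G M (G it)).length ∧
      (grp G M (G it)).length < 2 ^ (j + 1)) → ∀ t ≤ 40,
      t + (ρ + 1) * 250 * placed G M (doneGroups G M (2 ^ ρ) j it) ≤
        40 + (ρ + 1) * 250 * placed G M (doneGroups G M (2 ^ ρ) j (it + 1)) ∧
      DispInv G V M (2 ^ ρ) (doneGroups G M (2 ^ ρ) j (it + 1))
        (fun g => s.mem (q + 5 * 2 ^ ρ + g)) (fun z => s.mem (q + 3 * 2 ^ ρ + z)) := by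
    intro h t ht
    rw [doneGroups_succ_of_not h]
    exact ⟨by omega, hI⟩
  unfold displaceIndex
  simp only [vc, Expr.Ok, Expr.val, BinOp.Ok, BinOp.val, Expr.cost, true_and, and_true,
    Function.update_self, ne_eq, Nat.reduceEqDiff, not_false_eq_true, Function.update_of_ne,
    h30, h31, h36, h43, h54, hG it hit, hhead, hlen, eqVal_eq_zero, not_not, hdiv]
  repeat' apply And.intro
  any_goals omega
  · rintro heq
    obtain rfl : i₀ = it := by omega
    refine ⟨by omega, ?_, ?_⟩
    · rintro ⟨h2, h3⟩
      obtain ⟨hnF, hF⟩ := doneGroups_succ_of (j := j) hgR hfirst h2 h3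
      have hpl := placed_insert (G := G) (M := M) hnF
      have hplM := placed_le G M (Insert.insert (G i₀) (doneGroups G M (2 ^ ρ) j i₀))
      have hroot := hI.root
      refine vc_conseq (vc_displaceGroup (M := M) (l := grp G M (G i₀)) (g := G i₀)
        (nx := fun i => s.mem (q + 2 ^ ρ + i)) (ρ := ρ) (vb := vb) (nb := q + 2 ^ ρ) (V := V)
        (tb := q + 3 * 2 ^ ρ) (ob := q + 5 * 2 ^ ρ) (it := i₀)
        ⟨hV, hVR, hMR, by omega, by omega, by omega, hSw, hw, hRR⟩ (by simpa) (by simpa) (by simpa)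
        (by simpa) (by simpa) (by simpa) (by simp) hgR (by omega) (by simpa) hit hI.sum
        (by simp only; omega) (by rw [← hhead]; exact hc) (fun i hi => (mem_grp.1 hi).1)
        (fun i hi => rfl)) ?_
      rintro t' s' _ _ ⟨ht', hd, hwt, hsum, hr, hleaf, ho⟩
      simp only at hwt hr hleaf ho
      refine ⟨?_, ?_, ?_⟩
      · rw [hF, hpl]
        have : 1 ≤ (grp G M (G i₀)).length := by rw [hl']; simp
        have e1 : (ρ + 1) * ((grp G M (G i₀)).length * 150 + 100) ≤
            (ρ + 1) * (250 * (grp G M (G i₀)).length) := Nat.mul_le_mul_left _ (by omega)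
        have e2 : (ρ + 1) * 250 * (placed G M (doneGroups G M (2 ^ ρ) j i₀) +
          (grp G M (G i₀)).length) = (ρ + 1) * 250 * placed G M (doneGroups G M (2 ^ ρ) j i₀) +
          (ρ + 1) * (250 * (grp G M (G i₀)).length) := by ring
        rw [e2]
        omega
      · rw [hF]
        refine hI.insert hnF hGR ?_ hd hVR ?_ hsum hr ?_ ?_
        · intro g' hlt hne
          rw [ho _ (by omega) (by omega)]
        · simpa only [add_assoc] using hwt
        · intro y hy
          simpa only [add_assoc] using hleaf y hy
        · intro hdec
          refine lt_of_le_of_lt (Nat.mul_le_mul_left _ ?_) (hdec (G i₀) j h2 h3)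
          exact placed_doneGroups_le _ _ _ _ _
      · intro c hc'
        exact ho c (by omega) (by omega)
    · intro h
      obtain ⟨h4, h5⟩ := hskip (fun h' => h h'.2) 39 (by omega)
      exact ⟨by omega, h5, fun _ _ => trivial⟩
  · intro h
    have hne : ¬ ((∀ i < it, G i ≠ G it) ∧ 2 ^ j ≤ (grp G M (G it)).length ∧
        (grp G M (G it)).length < 2 ^ (j + 1)) := by
      intro h'
      rcases lt_trichotomy i₀ it with h6 | h6 | h6
      · exact h'.1 _ h6 hi₀
      · omega
      · exact hfirst _ h6 rfl
    obtain ⟨h4, h5⟩ := hskip hne 39 (by omega)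
    exact ⟨by omega, h5, fun _ _ => trivial⟩


/-- The groups with at least `2 ^ j` indices. -/
def bigGroups (G : ℕ → ℕ) (M R j : ℕ) : Finset ℕ :=
  (Finset.range R).filter fun g => 2 ^ j ≤ (grp G M g).length

theorem vc_displaceRound {s : State} {M ρ ga vb q j : ℕ} {G V : ℕ → ℕ}
    (hL : DispLayout w S M ρ ga vb q G V s.mem) (h11 : s.reg 11 = ρ)
    (h12 : s.reg 12 = 2 ^ ρ) (h30 : s.reg 30 = ga) (h31 : s.reg 31 = q) (h32 : s.reg 32 = M)
    (h34 : s.reg 34 = vb) (h35 : s.reg 35 = q + 2 ^ ρ)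
    (h36 : s.reg 36 = q + 2 * 2 ^ ρ) (h37 : s.reg 37 = q + 3 * 2 ^ ρ)
    (h38 : s.reg 38 = q + 5 * 2 ^ ρ) (h54 : s.reg 54 = j)
    (hch : ∀ g < 2 ^ ρ, Chain (fun i => s.mem (q + 2 ^ ρ + i)) (s.mem (q + g)) (grp G M g) ∧
        s.mem (q + 2 * 2 ^ ρ + g) = (grp G M g).length)
    (hI : DispInv G V M (2 ^ ρ) (bigGroups G M (2 ^ ρ) (j + 1)) (fun g => s.mem (q + 5 * 2 ^ ρ + g))
      (fun z => s.mem (q + 3 * 2 ^ ρ + z))) :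
    vc w S inp (forUp 43 32 displaceIndex) s fun t s' =>
      t + (ρ + 1) * 250 * placed G M (bigGroups G M (2 ^ ρ) (j + 1)) ≤
        M * 48 + 6 + (ρ + 1) * 250 * placed G M (bigGroups G M (2 ^ ρ) j) ∧
      DispInv G V M (2 ^ ρ) (bigGroups G M (2 ^ ρ) j)
        (fun g => s'.mem (q + 5 * 2 ^ ρ + g)) (fun z => s'.mem (q + 3 * 2 ^ ρ + z)) ∧
      ∀ c, (c < q + 3 * 2 ^ ρ ∨ q + 6 * 2 ^ ρ ≤ c) → s'.mem c = s.mem c := by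
  have hL' := hL
  obtain ⟨hG, hGR, hV, hVR, hMR, hga, hvb, hq, hSw, hw, hRR⟩ := hL'
  refine vc_forUp (fun k t s' =>
    t + (ρ + 1) * 250 * placed G M (bigGroups G M (2 ^ ρ) (j + 1)) ≤
      k * 48 + (ρ + 1) * 250 * placed G M (doneGroups G M (2 ^ ρ) j k) ∧
    DispInv G V M (2 ^ ρ) (doneGroups G M (2 ^ ρ) j k)
      (fun g => s'.mem (q + 5 * 2 ^ ρ + g)) (fun z => s'.mem (q + 3 * 2 ^ ρ + z)) ∧
    ∀ c, (c < q + 3 * 2 ^ ρ ∨ q + 6 * 2 ^ ρ ≤ c) → s'.mem c = s.mem c) (by decide) rfl rfl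
    (by omega) (by omega) ?_ ?_ ?_
  · rw [doneGroups_zero]
    exact ⟨by simp [bigGroups], hI, fun _ _ => rfl⟩
  · rintro k t s' hk h43 hf ⟨ht, hI', ho⟩
    have fr : ∀ r v, r ≠ 43 → displaceIndex.writes r = false → s.reg r = v → s'.reg r = v :=
      fun r v hr hw hv => (hf r hr hw).trans hv
    refine vc_conseq (vc_displaceIndex (it := k) (j := j) (M := M) (ga := ga) (vb := vb) (q := q)
      (G := G) (V := V) ⟨fun i hi => ?_, hGR, fun i hi => ?_, hVR, hMR, hga, hvb, hq, hSw, hw, hRR⟩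
      (fr _ _ (by decide) rfl h11) (fr _ _ (by decide) rfl h12) (fr _ _ (by decide) rfl h30)
      (fr _ _ (by decide) rfl h31) (fr _ _ (by decide) rfl h34) (fr _ _ (by decide) rfl h35)
      (fr _ _ (by decide) rfl h36) (fr _ _ (by decide) rfl h37) (fr _ _ (by decide) rfl h38)
      h43 (by omega) (fr _ _ (by decide) rfl h54) ?_ hI') ?_
    · rw [ho _ (by omega), hG i hi]
    · rw [ho _ (by omega), hV i hi]
    · intro g hg
      obtain ⟨h1, h2⟩ := hch g hg
      rw [ho _ (by omega), ho _ (by omega)]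
      refine ⟨h1.congr fun i hi => ?_, h2⟩
      have := (mem_grp.1 hi).1
      rw [ho _ (by omega)]
    · rintro t' s'' _ _ ⟨ht', hI'', ho'⟩
      exact ⟨by omega, hI'', fun c hc => (ho' c hc).trans (ho c hc)⟩
  · rintro t s' _ _ ⟨ht, hI', ho⟩
    rw [h32, doneGroups_all] at ht hI'
    exact ⟨by rw [bigGroups]; rw [bigGroups] at ht ⊢; omega, hI', ho⟩

theorem dispInv_empty {G V : ℕ → ℕ} {M R : ℕ} {D T : ℕ → ℕ} (hR : 0 < R)
    (h : ∀ z < 2 * R, T z = 0) (hD : ∀ g < R, D g = 0) : DispInv G V M R ∅ D T := by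
  refine ⟨fun y h1 h2 => ?_, ?_, fun y hy => ?_, fun g hg => ?_, by simp [collisions], by simp [collisions]⟩
  · rw [h _ (by omega), h _ (by omega), h _ (by omega)]
  · rw [h _ (by omega)]; simp [placed]
  · rw [h _ (by omega)]; simp
  · rw [hD g hg]; exact hR

/-- The rounds for sizes `2 ^ j ≤ len < 2 ^ (j + 1)` go from `j = ρ` down to `0`, each scanning all
indices. The scans cost `O(ρ * M)` in total and so do the treatments, since every index is placed
once. -/
theorem vc_displace {s : State} {M ρ ga vb q : ℕ} {G V : ℕ → ℕ}
    (hL : DispLayout w S M ρ ga vb q G V s.mem) (h11 : s.reg 11 = ρ)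
    (h12 : s.reg 12 = 2 ^ ρ) (h30 : s.reg 30 = ga) (h31 : s.reg 31 = q) (h32 : s.reg 32 = M)
    (h34 : s.reg 34 = vb) (hz : ∀ i < 6 * 2 ^ ρ, s.mem (q + i) = 0) :
    vc w S inp displace s fun t s' => t ≤ (ρ + 1) * (M * 400 + 30) + 100 ∧
      (∀ c, (c < q ∨ q + 6 * 2 ^ ρ ≤ c) → s'.mem c = s.mem c) ∧
      (∀ g < 2 ^ ρ, s'.mem (q + 5 * 2 ^ ρ + g) < 2 ^ ρ) ∧
      2 ^ ρ * (∑ i ∈ Finset.range M, ∑ j ∈ Finset.range M,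
        if G i ≠ G j ∧ V i ^^^ s'.mem (q + 5 * 2 ^ ρ + G i) =
          V j ^^^ s'.mem (q + 5 * 2 ^ ρ + G j) then 1 else 0) ≤ M ^ 2 ∧
      (Decay G M (2 ^ ρ) → ∀ i < M, ∀ j < M, V i ^^^ s'.mem (q + 5 * 2 ^ ρ + G i) =
        V j ^^^ s'.mem (q + 5 * 2 ^ ρ + G j) → G i = G j) := by
  have hL' := hL
  obtain ⟨hG, hGR, hV, hVR, hMR, hga, hvb, hq, hSw, hw, hRR⟩ := hL'
  have hw0 : w ≠ 0 := by rintro rfl; omega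
  have hρ : ρ < 2 ^ ρ := Nat.lt_two_pow_self
  have hR0 : 0 < 2 ^ ρ := by positivity
  refine vc_seq (vc_buildLists h12 h30 h31 h32 hMR hga (by omega) hSw hw hG hGR
    (fun i hi => hz i (by omega))) ?_
  rintro t s' hf _ ⟨ht, ho, hch⟩
  have f11 : s'.reg 11 = ρ := by simpa [h11] using hf 11 rfl
  have f12 : s'.reg 12 = 2 ^ ρ := by simpa [h12] using hf 12 rfl
  have f30 : s'.reg 30 = ga := by simpa [h30] using hf 30 rfl
  have f31 : s'.reg 31 = q := by simpa [h31] using hf 31 rfl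
  have f32 : s'.reg 32 = M := by simpa [h32] using hf 32 rfl
  have f34 : s'.reg 34 = vb := by simpa [h34] using hf 34 rfl
  have e2 : q + 2 ^ ρ + 2 ^ ρ = q + 2 * 2 ^ ρ := by ring
  have e3 : q + 2 * 2 ^ ρ + 2 ^ ρ = q + 3 * 2 ^ ρ := by ring
  have e5 : q + 3 * 2 ^ ρ + 2 ^ ρ + 2 ^ ρ = q + 5 * 2 ^ ρ := by ring
  simp only [vc, Expr.Ok, Expr.val, BinOp.Ok, BinOp.val, Expr.cost, true_and,
    Function.update_self, ne_eq, Nat.reduceEqDiff, not_false_eq_true, Function.update_of_ne,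
    f11, f12, f31, e2, e3, e5]
  repeat' with_reducible apply And.intro
  any_goals omega
  refine vc_forUp (fun k t s'' =>
    t ≤ k * (M * 48 + 30) + (ρ + 1) * 250 * placed G M (bigGroups G M (2 ^ ρ) (ρ + 1 - k)) ∧
    DispInv G V M (2 ^ ρ) (bigGroups G M (2 ^ ρ) (ρ + 1 - k))
      (fun g => s''.mem (q + 5 * 2 ^ ρ + g)) (fun z => s''.mem (q + 3 * 2 ^ ρ + z)) ∧
    ∀ c, (c < q + 3 * 2 ^ ρ ∨ q + 6 * 2 ^ ρ ≤ c) → s''.mem c = s'.mem c) (by decide) rfl rfl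
    (by simp; omega) (by omega) ?_ ?_ ?_
  -- A group has at most `M ≤ 2 ^ ρ` members, so nothing is placed before the first round.
  · have hemp : bigGroups G M (2 ^ ρ) (ρ + 1) = ∅ := by
      ext g
      have := length_grp_le G M g
      simp only [bigGroups, Finset.mem_filter, Finset.notMem_empty, iff_false, pow_succ]
      omega
    simp only [Nat.sub_zero, hemp]
    refine ⟨by omega, dispInv_empty hR0 (fun z hz' => ?_) fun g hg => ?_, fun _ _ => trivial⟩
    · rw [ho _ (by omega), add_assoc, hz _ (by omega)]
    · rw [ho _ (by omega), add_assoc, hz _ (by omega)]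
  · rintro k t₁ s₁ hk h50 hf₁ ⟨ht₁, hI, ho₁⟩
    simp only [Function.update_self] at hk
    have fr : ∀ r, r ≠ 50 → r ≠ 54 → displaceIndex.writes r = false → r ≠ 43 → s₁.reg r = _ :=
      fun r h1 h2 h3 h4 => hf₁ r h1 (by simp [Prog.writes, forUp, h2, h3, h4])
    have g11 : s₁.reg 11 = ρ := by simpa [f11] using fr 11 (by decide) (by decide) rfl (by decide)
    have g12 : s₁.reg 12 = 2 ^ ρ := by
      simpa [f12] using fr 12 (by decide) (by decide) rfl (by decide)
    have g30 : s₁.reg 30 = ga := by simpa [f30] using fr 30 (by decide) (by decide) rfl (by decide)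
    have g31 : s₁.reg 31 = q := by simpa [f31] using fr 31 (by decide) (by decide) rfl (by decide)
    have g32 : s₁.reg 32 = M := by simpa [f32] using fr 32 (by decide) (by decide) rfl (by decide)
    have g34 : s₁.reg 34 = vb := by simpa [f34] using fr 34 (by decide) (by decide) rfl (by decide)
    have g35 : s₁.reg 35 = q + 2 ^ ρ := by
      simpa using fr 35 (by decide) (by decide) rfl (by decide)
    have g36 : s₁.reg 36 = q + 2 * 2 ^ ρ := by
      simpa using fr 36 (by decide) (by decide) rfl (by decide)
    have g37 : s₁.reg 37 = q + 3 * 2 ^ ρ := by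
      simpa using fr 37 (by decide) (by decide) rfl (by decide)
    have g38 : s₁.reg 38 = q + 5 * 2 ^ ρ := by
      simpa using fr 38 (by decide) (by decide) rfl (by decide)
    have ek : ρ + 1 - k = ρ - k + 1 := by omega
    have ek' : ρ + 1 - (k + 1) = ρ - k := by omega
    rw [ek] at hI ht₁
    simp only [vc, Expr.sub_def, Expr.Ok, Expr.val, BinOp.Ok, BinOp.val, Expr.cost, true_and, g11,
      h50, ek']
    refine ⟨by omega, ?_⟩
    refine vc_conseq (vc_displaceRound (j := ρ - k) (M := M) (ga := ga) (vb := vb) (q := q)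
      (G := G) (V := V) (ρ := ρ)
      ⟨fun i hi => ?_, hGR, fun i hi => ?_, hVR, hMR, hga, hvb, hq, hSw, hw, hRR⟩
      (by simpa) (by simpa) (by simpa) (by simpa) (by simpa) (by simpa) (by simpa) (by simpa)
      (by simpa) (by simpa) (by simp) ?_ hI) ?_
    · simp only
      rw [ho₁ _ (by omega), ho _ (by omega), hG i hi]
    · simp only
      rw [ho₁ _ (by omega), ho _ (by omega), hV i hi]
    · intro g hg
      obtain ⟨h1, h2⟩ := hch g hg
      simp only
      rw [ho₁ _ (by omega), ho₁ _ (by omega)]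
      refine ⟨h1.congr fun i hi => ?_, h2⟩
      have := (mem_grp.1 hi).1
      rw [ho₁ _ (by omega)]
    · rintro t' s'' _ _ ⟨ht', hI'', ho'⟩
      refine ⟨?_, hI'', fun c hc => (ho' c hc).trans (ho₁ c hc)⟩
      have : (k + 1) * (M * 48 + 30) = k * (M * 48 + 30) + (M * 48 + 30) := by ring
      omega
  · rintro t₁ s₁ _ _ ⟨ht₁, hI, ho₁⟩
    simp only [Function.update_self, Nat.sub_self] at ht₁ hI
    have hbig : ∀ i < M, G i ∈ bigGroups G M (2 ^ ρ) 0 := by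
      intro i hi
      simp only [bigGroups, Finset.mem_filter, Finset.mem_range, pow_zero]
      exact ⟨hGR i hi, List.length_pos_of_mem (mem_grp.2 ⟨hi, rfl⟩)⟩
    have hpl : placed G M (bigGroups G M (2 ^ ρ) 0) ≤ M := placed_le _ _ _
    have hcoll : collisions G V M (fun g => s₁.mem (q + 5 * 2 ^ ρ + g)) (bigGroups G M (2 ^ ρ) 0) =
        ∑ i ∈ Finset.range M, ∑ j ∈ Finset.range M,
          if G i ≠ G j ∧ V i ^^^ s₁.mem (q + 5 * 2 ^ ρ + G i) =
            V j ^^^ s₁.mem (q + 5 * 2 ^ ρ + G j) then 1 else 0 := by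
      refine Finset.sum_congr rfl fun i hi => Finset.sum_congr rfl fun j hj => ?_
      simp [hbig i (Finset.mem_range.1 hi), hbig j (Finset.mem_range.1 hj)]
    refine ⟨?_, fun c hc => ?_, hI.lt, ?_, ?_⟩
    · have e1 : (ρ + 1) * 250 * placed G M (bigGroups G M (2 ^ ρ) 0) ≤ (ρ + 1) * 250 * M :=
        Nat.mul_le_mul_left _ hpl
      have e4 : M * 60 ≤ (ρ + 1) * (M * 60) := Nat.le_mul_of_pos_left _ (by omega)
      have e6 : (ρ + 1) * (M * 400 + 30) = (ρ + 1) * (M * 48 + 30) + (ρ + 1) * 250 * M +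
        (ρ + 1) * (M * 60) + (ρ + 1) * (M * 42) := by ring
      have e7 : (OfNat.ofNat 1 : Expr).cost = 1 := rfl
      omega
    · rw [ho₁ c (by omega), ho c (by omega)]
    · rw [← hcoll]
      exact hI.coll.trans (Nat.pow_le_pow_left hpl 2)
    · intro hdec i hi j hj heq
      have h0 := hI.zero hdec
      rw [hcoll] at h0
      by_contra hne
      have := Finset.sum_eq_zero_iff.1 (Finset.sum_eq_zero_iff.1 h0 i (Finset.mem_range.2 hi)) j
        (Finset.mem_range.2 hj)
      simp [hne, heq] at this

end WordRAM

/-! ### Perfect hashing by double displacement -/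

namespace WordRAM

/-- If `N` indices lie in groups of size at least `2 ^ j`, then `N * (2 ^ j - 1)` is at most the sum
in `h`, hence at most `M ^ 2 / R`. For `j ≥ 1` a size below `2 ^ (j + 1)` is at most `3 * (2 ^ j -
1)`, so size times `N` is at most `3 * M ^ 2 / R < R`. For `j = 0` the group is a singleton and `N ≤
M < R`. -/
theorem decay_of_sum_le {G : ℕ → ℕ} {M R : ℕ} (hM : 2 * M < R)
    (h : R * (∑ i ∈ Finset.range M, ((grp G M (G i)).length - 1)) ≤ M ^ 2) : Decay G M R := by
  intro g j h1 h2
  set N := ∑ i ∈ Finset.range M, if 2 ^ j ≤ (grp G M (G i)).length then 1 else 0 with hN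
  have hNM : N ≤ M := by
    refine (Finset.sum_le_card_nsmul _ _ 1 fun i _ => ?_).trans (by simp)
    split_ifs <;> omega
  rcases Nat.eq_zero_or_pos j with rfl | hj
  · have : (grp G M g).length = 1 := by omega
    rw [this]
    omega
  · have hsum : N * (2 ^ j - 1) ≤ ∑ i ∈ Finset.range M, ((grp G M (G i)).length - 1) := by
      rw [hN, Finset.sum_mul]
      refine Finset.sum_le_sum fun i _ => ?_
      split_ifs <;> omega
    have h2j : 2 ≤ 2 ^ j := by
      calc 2 = 2 ^ 1 := rfl
        _ ≤ 2 ^ j := Nat.pow_le_pow_right (by omega) hj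
    have h3 : (grp G M g).length ≤ 3 * (2 ^ j - 1) := by
      rw [pow_succ] at h2
      omega
    have h4 : R * ((grp G M g).length * N) ≤ 3 * M ^ 2 :=
      calc R * ((grp G M g).length * N) ≤ R * (3 * (2 ^ j - 1) * N) := by gcongr
        _ = 3 * (R * (N * (2 ^ j - 1))) := by ring
        _ ≤ 3 * M ^ 2 := by
          refine Nat.mul_le_mul_left 3 ((Nat.mul_le_mul_left R hsum).trans h)
    by_contra hc
    have : R * R ≤ R * ((grp G M g).length * N) := Nat.mul_le_mul_left _ (by omega)
    nlinarith

/-- Translates the hypothesis of `decay_of_sum_le` into the number of ordered collisions, which is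
what the first displacement controls. -/
theorem sum_length_grp_sub_one {G : ℕ → ℕ} {M : ℕ} :
    ∑ i ∈ Finset.range M, ((grp G M (G i)).length - 1) =
      ∑ i ∈ Finset.range M, ∑ j ∈ Finset.range M, if i ≠ j ∧ G i = G j then 1 else 0 := by
  refine Finset.sum_congr rfl fun i hi => ?_
  have h1 : ∑ j ∈ Finset.range M, (if i = j then 1 else 0) = 1 := by
    rw [Finset.sum_ite_eq]
    simp only [hi, if_true]
  have h2 : ∑ j ∈ Finset.range M, (if G j = G i then 1 else 0) =
      (∑ j ∈ Finset.range M, if i ≠ j ∧ G i = G j then 1 else 0) +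
        ∑ j ∈ Finset.range M, if i = j then 1 else 0 := by
    rw [← Finset.sum_add_distrib]
    refine Finset.sum_congr rfl fun j _ => ?_
    by_cases h : i = j
    · simp [h]
    · by_cases h' : G i = G j
      · simp [h, h']
      · simp [h, h', Ne.symm h']
  rw [length_grp]
  omega

/-- The layout of a perfect hash table with `M` pairs `(X i, Y i)` as keys. -/
structure HashOk (M ρ B : ℕ) (X Y : ℕ → ℕ) (mem : ℕ → ℕ) : Prop where
  hX : ∀ i < M, mem (B + 1 * 2 ^ ρ + i) = X i
  hY : ∀ i < M, mem (B + 2 * 2 ^ ρ + i) = Y i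
  hMR : M ≤ 2 ^ ρ
  hb : ∀ g < 2 ^ ρ, mem (B + 10 * 2 ^ ρ + g) < 2 ^ ρ
  ha : ∀ g < 2 ^ ρ, mem (B + 17 * 2 ^ ρ + g) < 2 ^ ρ
  hslot : ∀ z < 2 ^ ρ, mem (B + 19 * 2 ^ ρ + z) ≤ M
  hit : ∀ i < M, mem (B + 19 * 2 ^ ρ + (Y i ^^^ mem (B + 17 * 2 ^ ρ +
    (X i ^^^ mem (B + 10 * 2 ^ ρ + Y i))))) = i + 1

/-- Look up the pair `(reg 60, reg 61)` in the hash table at `reg 62`. -/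
def hashLookup : Prog :=
  .load 64 (.reg 62 + .reg 12 * 10 + .reg 61) ;; .assign 64 (.reg 60 ^^^ .reg 64) ;;
  .load 65 (.reg 62 + .reg 12 * 17 + .reg 64) ;; .assign 65 (.reg 61 ^^^ .reg 65) ;;
  .load 63 (.reg 62 + .reg 12 * 19 + .reg 65) ;;
  .ite (.reg 63)
    (.load 64 (.reg 62 + .reg 12 + .reg 63 - 1) ;; .load 65 (.reg 62 + .reg 12 * 2 + .reg 63 - 1) ;;
      .ite (.bin .eq (.reg 64) (.reg 60)) (.ite (.bin .eq (.reg 65) (.reg 61)) .skip (.assign 63 0))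
        (.assign 63 0))
    .skip

variable {w S : ℕ} {inp : List ℕ}

/-- The two displacements leave a single slot where the pair can be. A stored pair occupies its
slot, and comparing the candidate's components rejects all other queries; the slot value `0` means
empty. -/
theorem vc_hashLookup {s : State} {M ρ B x y : ℕ} {X Y : ℕ → ℕ} (hH : HashOk M ρ B X Y s.mem)
    (hS : B + 20 * 2 ^ ρ ≤ S) (hSw : S < 2 ^ w) (hw : 100 < 2 ^ w) (h12 : s.reg 12 = 2 ^ ρ)
    (h60 : s.reg 60 = x) (h61 : s.reg 61 = y) (h62 : s.reg 62 = B) (hx : x < 2 ^ ρ)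
    (hy : y < 2 ^ ρ) :
    vc w S inp hashLookup s fun t s' => t ≤ 100 ∧
      ((∃ i < M, X i = x ∧ Y i = y ∧ s'.reg 63 = i + 1) ∨
        (s'.reg 63 = 0 ∧ ∀ i < M, ¬ (X i = x ∧ Y i = y))) := by
  obtain ⟨hX, hY, hMR, hb, ha, hslot, hit⟩ := hH
  have hw0 : w ≠ 0 := by rintro rfl; omega
  have hbl := hb y hy
  obtain ⟨β, hβ⟩ : ∃ β, s.mem (B + 10 * 2 ^ ρ + y) = β := ⟨_, rfl⟩
  have hx' : x ^^^ β < 2 ^ ρ := Nat.xor_lt_two_pow hx (hβ ▸ hbl)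
  obtain ⟨x', hxx⟩ : ∃ x', x ^^^ β = x' := ⟨_, rfl⟩
  rw [hxx] at hx'
  have hal := ha x' hx'
  obtain ⟨α, hα⟩ : ∃ α, s.mem (B + 17 * 2 ^ ρ + x') = α := ⟨_, rfl⟩
  have hz : y ^^^ α < 2 ^ ρ := Nat.xor_lt_two_pow hy (hα ▸ hal)
  obtain ⟨z, hzz⟩ : ∃ z, y ^^^ α = z := ⟨_, rfl⟩
  rw [hzz] at hz
  have hsl := hslot z hz
  obtain ⟨k, hk⟩ : ∃ k, s.mem (B + 19 * 2 ^ ρ + z) = k := ⟨_, rfl⟩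
  rw [hk] at hsl
  -- If the pair is stored at all, the slot that was read points to it.
  have hfound : ∀ i < M, X i = x → Y i = y → k = i + 1 := by
    rintro i hi rfl rfl
    rw [← hit i hi, hβ, hxx, hα, hzz, hk]
  have m10 : 2 ^ ρ * 10 = 10 * 2 ^ ρ := mul_comm _ _
  have m17 : 2 ^ ρ * 17 = 17 * 2 ^ ρ := mul_comm _ _
  have m19 : 2 ^ ρ * 19 = 19 * 2 ^ ρ := mul_comm _ _
  have m2 : 2 ^ ρ * 2 = 2 * 2 ^ ρ := mul_comm _ _
  simp [hashLookup, h12, h60, h61, h62, m10, m17, m19, m2, hβ, hxx, hα, hzz, hk]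
  refine ⟨by omega, by omega, by omega, by omega, by omega, by omega, ?_, ?_⟩
  · intro hk0
    obtain ⟨i, rfl⟩ : ∃ i, k = i + 1 := ⟨k - 1, by omega⟩
    have e1 : B + 2 ^ ρ + (i + 1) - 1 = B + 1 * 2 ^ ρ + i := by omega
    have e2 : B + 2 * 2 ^ ρ + (i + 1) - 1 = B + 2 * 2 ^ ρ + i := by omega
    rw [e1, e2, hX i (by omega), hY i (by omega)]
    repeat' with_reducible apply And.intro
    any_goals omega
    · intro h1
      refine ⟨fun h2 => Or.inl ⟨i, by omega, h1, h2, rfl⟩, fun h2 i' hi' h3 h4 => ?_⟩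
      have := hfound i' hi' h3 h4
      exact h2 (by rw [← h4]; congr 1; omega)
    · intro h1 i' hi' h3 h4
      have := hfound i' hi' h3 h4
      exact h1 (by rw [← h3]; congr 1; omega)
  · rintro rfl
    exact Or.inr ⟨rfl, fun i hi h1 h2 => by have := hfound i hi h1 h2; omega⟩

/-- `mem[reg 59 + i] := mem[reg 57 + i] ^^^ mem[reg 55 + mem[reg 58 + i]]` for `i < reg 32`. -/
def xorPass : Prog :=
  forUp 43 32 (.load 49 (.reg 58 + .reg 43) ;; .load 52 (.reg 55 + .reg 49) ;;
    .load 53 (.reg 57 + .reg 43) ;; .store (.reg 59 + .reg 43) (.reg 53 ^^^ .reg 52))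

theorem vc_xorPass {s : State} {M R g d v o : ℕ} {G V D : ℕ → ℕ} (h32 : s.reg 32 = M)
    (h55 : s.reg 55 = d) (h57 : s.reg 57 = v) (h58 : s.reg 58 = g) (h59 : s.reg 59 = o)
    (hG : ∀ i < M, s.mem (g + i) = G i) (hV : ∀ i < M, s.mem (v + i) = V i)
    (hD : ∀ i < R, s.mem (d + i) = D i) (hGR : ∀ i < M, G i < R)
    (hgo : g + M ≤ o) (hvo : v + M ≤ o) (hdo : d + R ≤ o) (hoS : o + M ≤ S) (hSw : S < 2 ^ w)
    (hw : 100 < 2 ^ w) :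
    vc w S inp xorPass s fun t s' => t ≤ M * 30 + 6 ∧
      (∀ i < M, s'.mem (o + i) = V i ^^^ D (G i)) ∧
      ∀ c, (c < o ∨ o + M ≤ c) → s'.mem c = s.mem c := by
  have hw0 : w ≠ 0 := by rintro rfl; omega
  refine vc_forUp_le 22 (fun k s' => (∀ i < k, s'.mem (o + i) = V i ^^^ D (G i)) ∧
      ∀ c, (c < o ∨ o + M ≤ c) → s'.mem c = s.mem c) (by decide) rfl rfl (by omega) (by omega)
    ⟨by simp, fun _ _ => rfl⟩ ?_ ?_
  · rintro k s' hk h43 hf ⟨hi, ho⟩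
    have f55 := (hf 55 (by decide) rfl).trans h55
    have f57 := (hf 57 (by decide) rfl).trans h57
    have f58 := (hf 58 (by decide) rfl).trans h58
    have f59 := (hf 59 (by decide) rfl).trans h59
    have e1 : s'.mem (g + k) = G k := by rw [ho _ (by omega), hG k (by omega)]
    have hg := hGR k (by omega)
    have e2 : s'.mem (d + G k) = D (G k) := by rw [ho _ (by omega), hD _ hg]
    have e3 : s'.mem (v + k) = V k := by rw [ho _ (by omega), hV k (by omega)]
    simp [f55, f57, f58, f59, h43, e1, e2, e3]
    repeat' with_reducible apply And.intro
    any_goals omega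
    · intro i hik
      rcases eq_or_ne i k with rfl | hne
      · rw [Function.update_self]
      · rw [Function.update_of_ne (by omega), hi i (by omega)]
    · intro c hc
      rw [Function.update_of_ne (by omega), ho c hc]
  · rintro t s' ht _ _ ⟨hi, ho⟩
    rw [h32] at ht hi
    exact ⟨by omega, hi, ho⟩

/-- `mem[reg 57 + mem[reg 59 + i]] := i + 1` for `i < reg 32`. -/
def slotPass : Prog :=
  forUp 43 32 (.load 49 (.reg 59 + .reg 43) ;; .store (.reg 57 + .reg 49) (.reg 43 + 1))

theorem vc_slotPass {s : State} {M R v o : ℕ} {Z : ℕ → ℕ} (h32 : s.reg 32 = M)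
    (h57 : s.reg 57 = v) (h59 : s.reg 59 = o)
    (hZ : ∀ i < M, s.mem (o + i) = Z i) (hZR : ∀ i < M, Z i < R)
    (hinj : ∀ i < M, ∀ j < M, Z i = Z j → i = j) (hz : ∀ i < R, s.mem (v + i) ≤ M)
    (hov : o + M ≤ v) (hoS : v + R ≤ S) (hSw : S < 2 ^ w) (hMR : M ≤ R)
    (hw : 100 < 2 ^ w) :
    vc w S inp slotPass s fun t s' => t ≤ M * 30 + 6 ∧
      (∀ i < M, s'.mem (v + Z i) = i + 1) ∧ (∀ i < R, s'.mem (v + i) ≤ M) ∧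
      ∀ c, (c < v ∨ v + R ≤ c) → s'.mem c = s.mem c := by
  have hw0 : w ≠ 0 := by rintro rfl; omega
  refine vc_forUp_le 22 (fun k s' => (∀ i < k, s'.mem (v + Z i) = i + 1) ∧
      (∀ i < R, s'.mem (v + i) ≤ M) ∧
      ∀ c, (c < v ∨ v + R ≤ c) → s'.mem c = s.mem c) (by decide) rfl rfl (by omega) (by omega)
    ⟨by simp, hz, fun _ _ => rfl⟩ ?_ ?_
  · rintro k s' hk h43 hf ⟨hi, hle, ho⟩
    have f57 := (hf 57 (by decide) rfl).trans h57
    have f59 := (hf 59 (by decide) rfl).trans h59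
    have e1 : s'.mem (o + k) = Z k := by rw [ho _ (by omega), hZ k (by omega)]
    have hg := hZR k (by omega)
    simp [f57, f59, h43, e1]
    repeat' with_reducible apply And.intro
    any_goals omega
    · intro i hik
      rcases eq_or_ne i k with rfl | hne
      · rw [Function.update_self]
      · have : Z i ≠ Z k := fun h => hne (hinj i (by omega) k (by omega) h)
        rw [Function.update_of_ne (by omega), hi i (by omega)]
    · intro i hi
      rcases eq_or_ne i (Z k) with rfl | hne
      · rw [Function.update_self]; omega
      · rw [Function.update_of_ne (by omega)]; exact hle i hi
    · intro c hc
      rw [Function.update_of_ne (by omega), ho c hc]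
  · rintro t s' ht _ _ ⟨hi, hle, ho⟩
    rw [h32] at ht hi
    exact ⟨by omega, hi, hle, ho⟩

/-- Displacement for the arrays with numbers `g`, `v`, `q`. -/
def displaceAt (g v q : ℕ) : Prog :=
  .assign 30 (.reg 23 + .reg 12 * .const g) ;; .assign 34 (.reg 23 + .reg 12 * .const v) ;;
  .assign 31 (.reg 23 + .reg 12 * .const q) ;; displace

theorem mul_word {c k ρ B S w : ℕ} (hc : c ≤ k) (hk : B + k * 2 ^ ρ ≤ S) (hS : S < 2 ^ w) :
    2 ^ ρ * c < 2 ^ w ∧ B + 2 ^ ρ * c < 2 ^ w := by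
  have := Nat.mul_le_mul_right (2 ^ ρ) hc
  rw [mul_comm c] at this
  omega

theorem vc_displaceAt {s : State} {M ρ B g v q : ℕ} {G V : ℕ → ℕ}
    (hq : q ≤ 100) (hgq : g + 1 ≤ q) (hvq : v + 1 ≤ q)
    (hG : ∀ i < M, s.mem (B + g * 2 ^ ρ + i) = G i) (hGR : ∀ i < M, G i < 2 ^ ρ)
    (hV : ∀ i < M, s.mem (B + v * 2 ^ ρ + i) = V i) (hVR : ∀ i < M, V i < 2 ^ ρ)
    (hMR : M ≤ 2 ^ ρ) (hS : B + (q + 6) * 2 ^ ρ ≤ S) (hSw : S < 2 ^ w)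
    (hw : 100 < 2 ^ w) (hRR : 2 ^ ρ * 2 ^ ρ < 2 ^ w) (h11 : s.reg 11 = ρ)
    (h12 : s.reg 12 = 2 ^ ρ) (h23 : s.reg 23 = B) (h32 : s.reg 32 = M)
    (hz : ∀ i < 6 * 2 ^ ρ, s.mem (B + q * 2 ^ ρ + i) = 0) :
    vc w S inp (displaceAt g v q) s fun t s' => t ≤ (ρ + 1) * (M * 400 + 30) + 200 ∧
      (∀ c, (c < B + q * 2 ^ ρ ∨ B + (q + 6) * 2 ^ ρ ≤ c) → s'.mem c = s.mem c) ∧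
      (∀ g < 2 ^ ρ, s'.mem (B + (q + 5) * 2 ^ ρ + g) < 2 ^ ρ) ∧
      2 ^ ρ * (∑ i ∈ Finset.range M, ∑ j ∈ Finset.range M,
        if G i ≠ G j ∧ V i ^^^ s'.mem (B + (q + 5) * 2 ^ ρ + G i) =
          V j ^^^ s'.mem (B + (q + 5) * 2 ^ ρ + G j) then 1 else 0) ≤ M ^ 2 ∧
      (Decay G M (2 ^ ρ) → ∀ i < M, ∀ j < M, V i ^^^ s'.mem (B + (q + 5) * 2 ^ ρ + G i) =
        V j ^^^ s'.mem (B + (q + 5) * 2 ^ ρ + G j) → G i = G j) := by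
  have hw0 : w ≠ 0 := by rintro rfl; omega
  obtain ⟨a1, a2⟩ := mul_word (c := g) (k := q + 6) (by omega) hS hSw
  obtain ⟨a3, a4⟩ := mul_word (c := v) (k := q + 6) (by omega) hS hSw
  obtain ⟨a5, a6⟩ := mul_word (c := q) (k := q + 6) (by omega) hS hSw
  have b1 := Nat.mul_le_mul_right (2 ^ ρ) hgq
  have b2 := Nat.mul_le_mul_right (2 ^ ρ) hvq
  rw [Nat.add_mul] at b1 b2 hS
  have e5 : B + q * 2 ^ ρ + 5 * 2 ^ ρ = B + (q + 5) * 2 ^ ρ := by ring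
  have e6 : B + q * 2 ^ ρ + 6 * 2 ^ ρ = B + (q + 6) * 2 ^ ρ := by ring
  simp only [displaceAt, vc, Expr.Ok, Expr.val, BinOp.Ok, BinOp.val, Expr.cost, true_and, ne_eq,
    Nat.reduceEqDiff, not_false_eq_true, Function.update_of_ne,
    h12, h23, Expr.add_def, Expr.mul_def]
  repeat' with_reducible apply And.intro
  any_goals omega
  refine vc_conseq (vc_displace (ρ := ρ) (M := M) (ga := B + g * 2 ^ ρ) (vb := B + v * 2 ^ ρ)
    (q := B + q * 2 ^ ρ) (G := G) (V := V) ⟨hG, hGR, hV, hVR, hMR, by omega, by omega, by omega,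
      hSw, hw, hRR⟩ (by simpa) (by simpa) (by simp [mul_comm]) (by simp [mul_comm]) (by simpa)
      (by simp [mul_comm]) hz) ?_
  rintro t s' _ _ ⟨ht, ho, h1, h2, h3⟩
  simp only [e5, e6] at ho h1 h2 h3
  exact ⟨by omega, ho, h1, h2, h3⟩

/-- `xorPass` for the arrays with numbers `d`, `v`, `g`, `o`. -/
def xorAt (d v g o : ℕ) : Prog :=
  .assign 55 (.reg 23 + .reg 12 * .const d) ;; .assign 57 (.reg 23 + .reg 12 * .const v) ;;
  .assign 58 (.reg 23 + .reg 12 * .const g) ;; .assign 59 (.reg 23 + .reg 12 * .const o) ;; xorPass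

theorem vc_xorAt {s : State} {M ρ B d v g o : ℕ} {G V D : ℕ → ℕ} (ho : o ≤ 100) (hdo : d + 1 ≤ o)
    (hvo : v + 1 ≤ o) (hgo : g + 1 ≤ o) (hMR : M ≤ 2 ^ ρ) (hS : B + (o + 1) * 2 ^ ρ ≤ S)
    (hSw : S < 2 ^ w) (hw : 100 < 2 ^ w)
    (h12 : s.reg 12 = 2 ^ ρ) (h23 : s.reg 23 = B) (h32 : s.reg 32 = M)
    (hG : ∀ i < M, s.mem (B + g * 2 ^ ρ + i) = G i) (hV : ∀ i < M, s.mem (B + v * 2 ^ ρ + i) = V i)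
    (hD : ∀ i < 2 ^ ρ, s.mem (B + d * 2 ^ ρ + i) = D i) (hGR : ∀ i < M, G i < 2 ^ ρ) :
    vc w S inp (xorAt d v g o) s fun t s' => t ≤ M * 30 + 100 ∧
      (∀ i < M, s'.mem (B + o * 2 ^ ρ + i) = V i ^^^ D (G i)) ∧
      ∀ c, (c < B + o * 2 ^ ρ ∨ B + (o + 1) * 2 ^ ρ ≤ c) → s'.mem c = s.mem c := by
  have hw0 : w ≠ 0 := by rintro rfl; omega
  obtain ⟨a1, a2⟩ := mul_word (c := g) (k := o + 1) (by omega) hS hSw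
  obtain ⟨a3, a4⟩ := mul_word (c := v) (k := o + 1) (by omega) hS hSw
  obtain ⟨a5, a6⟩ := mul_word (c := d) (k := o + 1) (by omega) hS hSw
  obtain ⟨a7, a8⟩ := mul_word (c := o) (k := o + 1) (by omega) hS hSw
  have b1 := Nat.mul_le_mul_right (2 ^ ρ) hgo
  have b2 := Nat.mul_le_mul_right (2 ^ ρ) hvo
  have b3 := Nat.mul_le_mul_right (2 ^ ρ) hdo
  have e : (o + 1) * 2 ^ ρ = o * 2 ^ ρ + 2 ^ ρ := by ring
  rw [Nat.add_mul] at b1 b2 b3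
  simp only [xorAt, vc, Expr.Ok, Expr.val, BinOp.Ok, BinOp.val, Expr.cost, true_and, ne_eq,
    Nat.reduceEqDiff, not_false_eq_true, Function.update_of_ne,
    h12, h23, Expr.add_def, Expr.mul_def]
  repeat' with_reducible apply And.intro
  any_goals omega
  refine vc_conseq (vc_xorPass (M := M) (R := 2 ^ ρ) (g := B + g * 2 ^ ρ) (v := B + v * 2 ^ ρ)
    (d := B + d * 2 ^ ρ) (o := B + o * 2 ^ ρ) (G := G) (V := V) (D := D) (by simpa)
    (by simp [mul_comm]) (by simp [mul_comm]) (by simp [mul_comm]) (by simp [mul_comm])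
    hG hV hD hGR (by omega) (by omega) (by omega) (by omega) hSw hw) ?_
  rintro t s' _ _ ⟨ht, h1, h2⟩
  exact ⟨by omega, h1, fun c hc => h2 c (by omega)⟩

/-- `slotPass` for the arrays with numbers `o` and `v`. -/
def slotAt (o v : ℕ) : Prog :=
  .assign 57 (.reg 23 + .reg 12 * .const v) ;; .assign 59 (.reg 23 + .reg 12 * .const o) ;; slotPass

theorem vc_slotAt {s : State} {M ρ B v o : ℕ} {Z : ℕ → ℕ} (hv : v ≤ 100)
    (hov : o + 1 ≤ v) (hMR : M ≤ 2 ^ ρ) (hS : B + (v + 1) * 2 ^ ρ ≤ S)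
    (hSw : S < 2 ^ w) (hw : 100 < 2 ^ w)
    (h12 : s.reg 12 = 2 ^ ρ) (h23 : s.reg 23 = B) (h32 : s.reg 32 = M)
    (hZ : ∀ i < M, s.mem (B + o * 2 ^ ρ + i) = Z i) (hZR : ∀ i < M, Z i < 2 ^ ρ)
    (hinj : ∀ i < M, ∀ j < M, Z i = Z j → i = j) (hz : ∀ i < 2 ^ ρ, s.mem (B + v * 2 ^ ρ + i) = 0) :
    vc w S inp (slotAt o v) s fun t s' => t ≤ M * 30 + 100 ∧
      (∀ i < M, s'.mem (B + v * 2 ^ ρ + Z i) = i + 1) ∧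
      (∀ i < 2 ^ ρ, s'.mem (B + v * 2 ^ ρ + i) ≤ M) ∧
      ∀ c, (c < B + v * 2 ^ ρ ∨ B + (v + 1) * 2 ^ ρ ≤ c) → s'.mem c = s.mem c := by
  have hw0 : w ≠ 0 := by rintro rfl; omega
  obtain ⟨a3, a4⟩ := mul_word (c := v) (k := v + 1) (by omega) hS hSw
  obtain ⟨a7, a8⟩ := mul_word (c := o) (k := v + 1) (by omega) hS hSw
  have b1 := Nat.mul_le_mul_right (2 ^ ρ) hov
  have e : (v + 1) * 2 ^ ρ = v * 2 ^ ρ + 2 ^ ρ := by ring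
  rw [Nat.add_mul] at b1
  simp only [slotAt, vc, Expr.Ok, Expr.val, BinOp.Ok, BinOp.val, Expr.cost, true_and, ne_eq,
    Nat.reduceEqDiff, not_false_eq_true, Function.update_of_ne,
    h12, h23, Expr.add_def, Expr.mul_def]
  repeat' with_reducible apply And.intro
  any_goals omega
  refine vc_conseq (vc_slotPass (M := M) (R := 2 ^ ρ) (v := B + v * 2 ^ ρ) (o := B + o * 2 ^ ρ)
    (Z := Z) (by simpa) (by simp [mul_comm]) (by simp [mul_comm]) hZ hZR hinj
    (fun i hi => by simp only [hz i hi]; omega) (by omega) (by omega) hSw hMR hw) ?_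
  rintro t s' _ _ ⟨ht, h1, h2, h3⟩
  exact ⟨by omega, h1, h2, fun c hc => h3 c (by omega)⟩

/-- Build the hash table at `reg 23` for `reg 32` pairs. -/
def buildHash : Prog :=
  displaceAt 2 1 5 ;; xorAt 10 1 2 11 ;; displaceAt 11 2 12 ;; xorAt 17 2 11 18 ;; slotAt 18 19

/-- The first displacement `b` groups the pairs by `Y` and acts on `X`; distinct pairs then agree in
`X' = X ^^^ b Y` only as often as the collision bound allows. The second displacement `a` groups by
`X'` and acts on `Y`, and by `Decay` it makes different groups disjoint. Within a group `Y`
determines the pair, so `Y ^^^ a X'` is injective. In units of `2 ^ ρ` words, arrays `1`, `2` hold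
`X`, `Y`; `10`, `17` the displacements `b`, `a`; `11` the values `X'`; `18` the slot numbers; `19`
the slots. -/
theorem vc_buildHash {s : State} {M ρ B : ℕ} {X Y : ℕ → ℕ}
    (hX : ∀ i < M, s.mem (B + 1 * 2 ^ ρ + i) = X i) (hXR : ∀ i < M, X i < 2 ^ ρ)
    (hY : ∀ i < M, s.mem (B + 2 * 2 ^ ρ + i) = Y i) (hYR : ∀ i < M, Y i < 2 ^ ρ)
    (hinj : ∀ i < M, ∀ j < M, X i = X j → Y i = Y j → i = j)
    (hM2 : 2 * M < 2 ^ ρ) (hS : B + 20 * 2 ^ ρ ≤ S) (hSw : S < 2 ^ w)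
    (hw : 100 < 2 ^ w) (hRR : 2 ^ ρ * 2 ^ ρ < 2 ^ w) (h11 : s.reg 11 = ρ)
    (h12 : s.reg 12 = 2 ^ ρ) (h23 : s.reg 23 = B) (h32 : s.reg 32 = M)
    (hz : ∀ c, B + 5 * 2 ^ ρ ≤ c → c < B + 20 * 2 ^ ρ → s.mem c = 0) :
    vc w S inp buildHash s fun t s' => t ≤ (ρ + 1) * (M * 1000 + 1000) ∧
      HashOk M ρ B X Y s'.mem ∧
      ∀ c, (c < B + 5 * 2 ^ ρ ∨ B + 20 * 2 ^ ρ ≤ c) → s'.mem c = s.mem c := by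
  refine vc_seq (vc_displaceAt (G := Y) (V := X) (ρ := ρ) (by omega) (by omega) (by omega) hY hYR hX
    hXR (by omega) (by omega) hSw hw hRR h11 h12 h23 h32 fun i hi => hz _ (by omega) (by omega)) ?_
  rintro t₁ s₁ f₁ _ ⟨ht₁, o₁, b₁, c₁, -⟩
  simp only [Nat.reduceAdd] at o₁ b₁ c₁
  have g11 := (f₁ 11 rfl).trans h11
  have g12 := (f₁ 12 rfl).trans h12
  have g23 := (f₁ 23 rfl).trans h23
  have g32 := (f₁ 32 rfl).trans h32
  clear f₁
  refine vc_seq (vc_xorAt (G := Y) (V := X) (ρ := ρ) (M := M)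
    (D := fun y => s₁.mem (B + 10 * 2 ^ ρ + y)) (by omega) (by omega)
    (by omega) (by omega) (by omega) (by omega) hSw hw g12 g23 g32
    (fun i hi => by rw [o₁ _ (by omega), hY i hi]) (fun i hi => by rw [o₁ _ (by omega), hX i hi])
    (fun _ _ => rfl) hYR) ?_
  rintro t₂ s₂ f₂ _ ⟨ht₂, x₂, o₂⟩
  replace g11 := (f₂ 11 rfl).trans g11
  replace g12 := (f₂ 12 rfl).trans g12
  replace g23 := (f₂ 23 rfl).trans g23
  replace g32 := (f₂ 32 rfl).trans g32
  clear f₂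
  simp only [Nat.reduceAdd] at o₂
  set b : ℕ → ℕ := fun y => s₁.mem (B + 10 * 2 ^ ρ + y) with hb
  have hX'R : ∀ i < M, X i ^^^ b (Y i) < 2 ^ ρ := fun i hi =>
    Nat.xor_lt_two_pow (hXR i hi) (b₁ _ (hYR i hi))
  -- Two different pairs with equal `X'` have different `Y`, since equal `Y` would give equal `X`.
  -- Hence the coincidences of `X'` are exactly the collisions between groups counted in `c₁`.
  have hdec : Decay (fun i => X i ^^^ b (Y i)) M (2 ^ ρ) := by
    refine decay_of_sum_le hM2 (le_trans (le_of_eq ?_) c₁)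
    rw [sum_length_grp_sub_one]
    congr 1
    refine Finset.sum_congr rfl fun i hi => Finset.sum_congr rfl fun j hj => ?_
    replace hi := Finset.mem_range.1 hi
    replace hj := Finset.mem_range.1 hj
    congr 1
    simp only [eq_iff_iff]
    constructor
    · rintro ⟨h1, h2⟩
      refine ⟨fun h3 => h1 (hinj i hi j hj ?_ h3), h2⟩
      rw [h3] at h2
      exact Nat.xor_left_inj.1 h2
    · rintro ⟨h1, h2⟩
      exact ⟨fun h3 => h1 (by rw [h3]), h2⟩
  refine vc_seq (vc_displaceAt (G := fun i => X i ^^^ b (Y i)) (V := Y) (ρ := ρ) (M := M) (by omega)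
    (by omega) (by omega) x₂ hX'R
    (fun i hi => by rw [o₂ _ (by omega), o₁ _ (by omega), hY i hi])
    hYR (by omega) (by omega) hSw hw hRR g11 g12 g23 g32
    fun i hi => by rw [o₂ _ (by omega), o₁ _ (by omega), hz _ (by omega) (by omega)]) ?_
  rintro t₃ s₃ f₃ _ ⟨ht₃, o₃, b₃, -, c₃⟩
  replace g11 := (f₃ 11 rfl).trans g11
  replace g12 := (f₃ 12 rfl).trans g12
  replace g23 := (f₃ 23 rfl).trans g23
  replace g32 := (f₃ 32 rfl).trans g32
  clear f₃
  simp only [Nat.reduceAdd] at o₃ b₃ c₃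
  replace c₃ := c₃ hdec
  refine vc_seq (vc_xorAt (G := fun i => X i ^^^ b (Y i)) (V := Y) (ρ := ρ) (M := M)
    (D := fun y => s₃.mem (B + 17 * 2 ^ ρ + y)) (by omega) (by omega)
    (by omega) (by omega) (by omega) (by omega) hSw hw g12 g23 g32
    (fun i hi => by rw [o₃ _ (by omega), x₂ i hi])
    (fun i hi => by rw [o₃ _ (by omega), o₂ _ (by omega), o₁ _ (by omega), hY i hi])
    (fun _ _ => rfl) hX'R) ?_
  rintro t₄ s₄ f₄ _ ⟨ht₄, x₄, o₄⟩
  replace g11 := (f₄ 11 rfl).trans g11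
  replace g12 := (f₄ 12 rfl).trans g12
  replace g23 := (f₄ 23 rfl).trans g23
  replace g32 := (f₄ 32 rfl).trans g32
  clear f₄
  simp only [Nat.reduceAdd] at o₄
  set a : ℕ → ℕ := fun y => s₃.mem (B + 17 * 2 ^ ρ + y) with ha
  refine vc_conseq (vc_slotAt (ρ := ρ) (M := M) (Z := fun i => Y i ^^^ a (X i ^^^ b (Y i)))
    (by omega) (by omega) (by omega) (by omega) hSw hw g12 g23 g32 x₄
    (fun i hi => Nat.xor_lt_two_pow (hYR i hi) (b₃ _ (hX'R i hi))) (fun i hi j hj h => ?_)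
    fun i hi => by
      rw [o₄ _ (by omega), o₃ _ (by omega), o₂ _ (by omega), o₁ _ (by omega),
        hz _ (by omega) (by omega)]) ?_
  -- Equal slots force equal `X'`, then equal `Y`, then equal `X`.
  · have h1 := c₃ i hi j hj h
    rw [h1] at h
    have h2 := Nat.xor_left_inj.1 h
    rw [h2] at h1
    exact hinj i hi j hj (Nat.xor_left_inj.1 h1) h2
  · rintro t₅ s₅ _ _ ⟨ht₅, x₅, l₅, o₅⟩
    simp only [Nat.reduceAdd] at o₅
    have mb : ∀ y < 2 ^ ρ, s₅.mem (B + 10 * 2 ^ ρ + y) = b y := fun y hy => by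
      rw [o₅ _ (by omega), o₄ _ (by omega), o₃ _ (by omega), o₂ _ (by omega)]
    have ma : ∀ y < 2 ^ ρ, s₅.mem (B + 17 * 2 ^ ρ + y) = a y := fun y hy => by
      rw [o₅ _ (by omega), o₄ _ (by omega)]
    refine ⟨?_, ⟨fun i hi => ?_, fun i hi => ?_, by omega, fun g hg => ?_, fun g hg => ?_, l₅,
      fun i hi => ?_⟩, fun c hc => ?_⟩
    · have e : (ρ + 1) * (M * 1000 + 1000) = (ρ + 1) * (M * 400 + 30) + (ρ + 1) * (M * 400 + 30) +
        (ρ + 1) * (M * 200 + 940) := by ring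
      have : M * 200 + 940 ≤ (ρ + 1) * (M * 200 + 940) := Nat.le_mul_of_pos_left _ (by omega)
      omega
    · rw [o₅ _ (by omega), o₄ _ (by omega), o₃ _ (by omega), o₂ _ (by omega), o₁ _ (by omega),
        hX i hi]
    · rw [o₅ _ (by omega), o₄ _ (by omega), o₃ _ (by omega), o₂ _ (by omega), o₁ _ (by omega),
        hY i hi]
    · rw [mb g hg]; exact b₁ g hg
    · rw [ma g hg]; exact b₃ g hg
    · rw [mb _ (hYR i hi), ma _ (hX'R i hi), x₅ i hi]
    · rw [o₅ _ (by omega), o₄ _ (by omega), o₃ _ (by omega), o₂ _ (by omega), o₁ _ (by omega)]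

theorem HashOk.congr {M ρ B : ℕ} {X Y mem mem' : ℕ → ℕ} (h : HashOk M ρ B X Y mem)
    (hXR : ∀ i < M, X i < 2 ^ ρ) (hYR : ∀ i < M, Y i < 2 ^ ρ)
    (hm : ∀ c, B ≤ c → c < B + 20 * 2 ^ ρ → mem' c = mem c) : HashOk M ρ B X Y mem' := by
  obtain ⟨hX, hY, hMR, hb, ha, hslot, hit⟩ := h
  refine ⟨fun i hi => ?_, fun i hi => ?_, hMR, fun g hg => ?_, fun g hg => ?_, fun z hz => ?_,
    fun i hi => ?_⟩
  · rw [hm _ (by omega) (by omega), hX i hi]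
  · rw [hm _ (by omega) (by omega), hY i hi]
  · rw [hm _ (by omega) (by omega)]; exact hb g hg
  · rw [hm _ (by omega) (by omega)]; exact ha g hg
  · rw [hm _ (by omega) (by omega)]; exact hslot z hz
  · have hY' := hYR i hi
    have hb' := hb _ hY'
    have hX' := Nat.xor_lt_two_pow (hXR i hi) hb'
    have hZ' := Nat.xor_lt_two_pow hY' (ha _ hX')
    rw [hm (B + 10 * 2 ^ ρ + Y i) (by omega) (by omega), hm (B + 17 * 2 ^ ρ + _) (by omega) (by omega),
      hm _ (by omega) (by omega), hit i hi]

end WordRAM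

/-! ### Radix sort -/

namespace WordRAM

/-- One pass of radix sort. -/
def radixStep (R j : ℕ) (L : List ℕ) : List ℕ :=
  (List.range R).flatMap fun g => L.filter fun k => k / j % R = g

/-- Each key lies in exactly one bucket, so the multiplicities agree; the partial sums over the
first `n` buckets are computed by induction. -/
theorem radixStep_perm {R j : ℕ} {L : List ℕ} (hR : 0 < R) : (radixStep R j L).Perm L := by
  rw [List.perm_iff_count]
  intro a
  rw [radixStep, List.count_flatMap]
  have h : ∀ n, ((List.range n).map (List.count a ∘ fun g => L.filter fun k => k / j % R = g)).sum =
      if a / j % R < n then L.count a else 0 := by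
    intro n
    induction n with
    | zero => simp
    | succ n ih =>
      rw [List.range_succ, List.map_append, List.sum_append, ih]
      simp only [List.map_cons, List.map_nil, Function.comp_apply, List.sum_cons, List.sum_nil]
      rcases lt_trichotomy (a / j % R) n with h | h | h
      · have : List.count a (L.filter fun k => k / j % R = n) = 0 := by
          rw [List.count_eq_zero]
          simp only [List.mem_filter, decide_eq_true_eq, not_and]
          omega
        rw [this, if_pos h, if_pos (by omega)]
        omega
      · have : List.count a (L.filter fun k => k / j % R = n) = L.count a :=
          List.count_filter (by simpa using h)
        rw [this, if_neg (by omega), if_pos (by omega)]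
        omega
      · have : List.count a (L.filter fun k => k / j % R = n) = 0 := by
          rw [List.count_eq_zero]
          simp only [List.mem_filter, decide_eq_true_eq, not_and]
          omega
        rw [this, if_neg (by omega), if_neg (by omega)]
        omega
  rw [h, if_pos (Nat.mod_lt _ hR)]

/-- Filtering is stable, so inside a bucket the order by the lower digits survives; between buckets
the new digit decides. -/
theorem radixStep_pairwise {R j : ℕ} {L : List ℕ} (h : L.Pairwise fun a b => a % j ≤ b % j) :
    (radixStep R j L).Pairwise fun a b => a % (j * R) ≤ b % (j * R) := by
  rw [radixStep, List.pairwise_flatMap]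
  constructor
  · intro g _
    refine (List.Pairwise.filter _ h).imp_of_mem ?_
    intro a b ha hb hab
    simp only [List.mem_filter, decide_eq_true_eq] at ha hb
    rw [Nat.mod_mul, Nat.mod_mul, ha.2, hb.2]
    omega
  · refine (List.pairwise_lt_range).imp ?_
    intro g g' hg a ha b hb
    simp only [List.mem_filter, decide_eq_true_eq] at ha hb
    rw [Nat.mod_mul, Nat.mod_mul, ha.2, hb.2]
    rcases Nat.eq_zero_or_pos j with rfl | hj
    · simp only [Nat.mod_zero, Nat.zero_mul, Nat.add_zero, Nat.div_zero, Nat.zero_mod] at *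
      omega
    · have := Nat.mod_lt a hj
      have : j * (g + 1) ≤ j * g' := Nat.mul_le_mul_left _ hg
      rw [Nat.mul_add] at this
      omega

/-- Radix sort. -/
def radixSort (R : ℕ) : ℕ → List ℕ → List ℕ
  | 0, L => L
  | d + 1, L => radixStep R (R ^ d) (radixSort R d L)

theorem radixSort_perm {R d : ℕ} {L : List ℕ} (hR : 0 < R) : (radixSort R d L).Perm L := by
  induction d with
  | zero => exact .refl _
  | succ d ih => exact (radixStep_perm hR).trans ih

theorem radixSort_pairwise {R d : ℕ} {L : List ℕ} :
    (radixSort R d L).Pairwise fun a b => a % R ^ d ≤ b % R ^ d := by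
  induction d with
  | zero =>
    simp only [pow_zero, Nat.mod_one, le_refl]
    exact List.pairwise_of_forall (fun _ _ => trivial)
  | succ d ih => exact pow_succ R d ▸ radixStep_pairwise ih

theorem radixSort_sorted {R d : ℕ} {L : List ℕ} (hR : 0 < R) (h : ∀ k ∈ L, k < R ^ d) :
    (radixSort R d L).Pairwise (· ≤ ·) := by
  refine (radixSort_pairwise (d := d) (L := L) (R := R)).imp_of_mem ?_
  intro a b ha hb hab
  rwa [Nat.mod_eq_of_lt (h a ((radixSort_perm hR).subset ha)),
    Nat.mod_eq_of_lt (h b ((radixSort_perm hR).subset hb))] at hab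

/-- The list is stored at `o`. -/
def Written (mem : ℕ → ℕ) (o : ℕ) (L : List ℕ) : Prop := ∀ i < L.length, mem (o + i) = readAt L i

theorem Written.append {mem : ℕ → ℕ} {o v : ℕ} {L : List ℕ} (h : Written mem o L) :
    Written (Function.update mem (o + L.length) v) o (L ++ [v]) := by
  intro i hi
  simp only [List.length_append, List.length_cons, List.length_nil] at hi
  rcases eq_or_ne i L.length with rfl | hne
  · rw [Function.update_self, readAt_eq (by simp)]
    simp
  · have hi' : i < L.length := by omega
    rw [Function.update_of_ne (by omega), h i hi', readAt_eq hi', readAt_eq (by simp; omega),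
      List.getElem_append_left hi']

theorem Written.congr {mem mem' : ℕ → ℕ} {o : ℕ} {L : List ℕ} (h : Written mem o L)
    (hm : ∀ c, o ≤ c → c < o + L.length → mem' c = mem c) : Written mem' o L := fun i hi => by
  rw [hm _ (by omega) (by omega), h i hi]

theorem map_readAt_range (L : List ℕ) : (List.range L.length).map (readAt L) = L := by
  refine List.ext_getElem (by simp) fun i h1 h2 => ?_
  simp [readAt_eq h2]

theorem map_readAt_grp (L : List ℕ) (f : ℕ → ℕ) (g : ℕ) :
    (grp (fun i => f (readAt L i)) L.length g).map (readAt L) = L.filter fun k => f k = g := by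
  conv_rhs => rw [← map_readAt_range L, List.filter_map]
  rfl

/-- Collect the elements of the array at `reg 23` in the order given by the lists at `reg 31` with
successors at `reg 35` and write them from `reg 36` on. -/
def gather : Prog :=
  forUp 43 12 (.load 44 (.reg 31 + .reg 43) ;;
    forChain 44 35 (.load 49 (.reg 23 + .reg 44 - 1) ;; .store (.reg 36) (.reg 49) ;;
      .assign 36 (.reg 36 + 1)))

variable {w S : ℕ} {inp : List ℕ}

/-- The time is charged to buckets and to elements separately. It is linear because the buckets
together contain each element once, as `hlen` says. -/
theorem vc_gather {s : State} {R p q o : ℕ} {L : List ℕ} {f : ℕ → ℕ} (h12 : s.reg 12 = R)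
    (h23 : s.reg 23 = p) (h31 : s.reg 31 = q) (h35 : s.reg 35 = q + R) (h36 : s.reg 36 = o)
    (hL : Written s.mem p L) (hNR : L.length ≤ R)
    (hch : ∀ g < R, Chain (fun i => s.mem (q + R + i)) (s.mem (q + g))
      (grp (fun i => f (readAt L i)) L.length g))
    (hlen : ((List.range R).flatMap fun g => L.filter fun k => f k = g).length = L.length)
    (hpq : p + R ≤ q) (hqo : q + 2 * R ≤ o) (hoS : o + R ≤ S) (hSw : S < 2 ^ w) (hw : 100 < 2 ^ w) :
    vc w S inp gather s fun t s' => t ≤ R * 20 + L.length * 40 + 6 ∧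
      Written s'.mem o ((List.range R).flatMap fun g => L.filter fun k => f k = g) ∧
      ∀ c, (c < o ∨ o + R ≤ c) → s'.mem c = s.mem c := by
  have hw0 : w ≠ 0 := by rintro rfl; omega
  set F : ℕ → List ℕ := fun k => (List.range k).flatMap fun g => L.filter fun k => f k = g with hF
  have hFs : ∀ k, F (k + 1) = F k ++ L.filter fun k' => f k' = k := by
    intro k
    simp [hF, List.range_succ]
  have hFle : ∀ k ≤ R, (F k).length ≤ L.length := by
    intro k hk
    have hmono : Monotone fun k => (F k).length :=
      monotone_nat_of_le_succ fun k => by simp only [hFs, List.length_append]; omega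
    rw [← hlen]
    exact hmono hk
  refine vc_forUp (fun k t s' => t ≤ k * 20 + (F k).length * 40 ∧
    s'.reg 36 = o + (F k).length ∧ Written s'.mem o (F k) ∧
      ∀ c, (c < o ∨ o + R ≤ c) → s'.mem c = s.mem c) (by decide) rfl rfl (by omega) (by omega)
    ?_ ?_ ?_
  · simp [hF, h36, Written]
  · rintro k t s₁ hk h43 hf ⟨ht, i36, hWr, ho⟩
    rw [h12] at hk
    have f12 := (hf 12 (by decide) rfl).trans h12
    have f23 := (hf 23 (by decide) rfl).trans h23
    have f31 := (hf 31 (by decide) rfl).trans h31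
    have f35 := (hf 35 (by decide) rfl).trans h35
    simp only [vc, Expr.Ok, Expr.val, BinOp.Ok, BinOp.val, Expr.cost, true_and, Expr.add_def,
      f31, h43]
    refine ⟨by omega, by omega, ?_⟩
    refine vc_forChain (nx := fun i => s.mem (q + R + i))
      (l := grp (fun i => f (readAt L i)) L.length k) (fun l' t' s' => ∃ W,
        W ++ l'.map (readAt L) = F (k + 1) ∧ (F k).length ≤ W.length ∧
        t' + (F k).length * 40 ≤ W.length * 40 ∧
        s'.reg 36 = o + W.length ∧ Written s'.mem o W ∧
        ∀ c, (c < o ∨ o + R ≤ c) → s'.mem c = s.mem c) (by decide) rfl rfl ?_ ?_ hSw ?_ ?_ ?_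
    · simp only [Function.update_self]
      rw [ho _ (by omega)]
      exact hch k hk
    · intro i hi
      have := (mem_grp.1 hi).1
      simp [f35]
      omega
    · refine ⟨F k, ?_, le_rfl, by omega, by simpa using i36, hWr, ho⟩
      rw [map_readAt_grp, hFs]
    · rintro i l' t' s₂ hf₂ h44 hsuf ⟨W, hW, hWl, ht', j36, hWr', ho'⟩
      have g23 : s₂.reg 23 = p := by simpa [f23] using hf₂ 23 (by decide) rfl
      have g35 : s₂.reg 35 = q + R := by simpa [f35] using hf₂ 35 (by decide) rfl
      have hi := (mem_grp.1 (hsuf.subset (by simp : i ∈ i :: l'))).1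
      -- The output never exceeds the number of elements, so the next store stays inside its array.
      have hWlen : W.length + 1 ≤ L.length := by
        have h1 := congrArg List.length hW
        have h2 := hFle (k + 1) (by omega)
        simp only [List.length_append, List.map_cons, List.length_cons] at h1
        omega
      have e1 : p + (i + 1) - 1 = p + i := by omega
      have e2 : s₂.mem (p + i) = readAt L i := by rw [ho' _ (by omega), hL i hi]
      simp [g23, h44, j36, e1, e2, f35]
      rw [Function.update_of_ne (by omega), ho' _ (by omega)]
      refine ⟨by omega, by omega, by omega, by omega, rfl, W ++ [readAt L i], ?_, ?_, ?_, ?_,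
        hWr'.append, ?_⟩
      · rw [← hW]; simp
      · simp; omega
      · simp; omega
      · simp; omega
      · intro c hc
        rw [Function.update_of_ne (by omega), ho' c hc]
    · rintro t' s₂ hf₂ ⟨W, hW, hWl, ht', j36, hWr', ho'⟩
      simp only [List.map_nil, List.append_nil] at hW
      subst hW
      refine ⟨?_, ?_, hWr', ho'⟩
      · have := Nat.mul_le_mul_right 40 hWl
        omega
      · simpa using j36
  · rintro t s₁ _ _ ⟨ht, i36, hWr, ho⟩
    rw [h12] at ht hWr
    refine ⟨?_, hWr, ho⟩
    have := hFle R le_rfl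
    omega

/-- One pass of radix sort for the array at `reg 23`, with the shift in register `24`. -/
def radixPass : Prog :=
  forUp 43 32 (.load 49 (.reg 23 + .reg 43) ;;
    .store (.reg 23 + .reg 12 + .reg 43) (.bin .shr (.reg 49) (.reg 24) % .reg 12)) ;;
  .assign 30 (.reg 23 + .reg 12) ;; .assign 31 (.reg 23 + .reg 12 * 2) ;; buildLists ;;
  .assign 35 (.reg 31 + .reg 12) ;; .assign 36 (.reg 23 + .reg 12 * 5) ;; gather

/-- After the keys at `p` come, in arrays of `R` words, the digits, three arrays for the lists, and
the sorted output at `p + 5 * R`. -/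
theorem vc_radixPass {s : State} {R p j : ℕ} {L : List ℕ} (h12 : s.reg 12 = R)
    (h23 : s.reg 23 = p) (h24 : s.reg 24 = j) (h32 : s.reg 32 = L.length)
    (hL : Written s.mem p L) (hNR : L.length ≤ R) (hR : 0 < R)
    (hpS : p + 6 * R ≤ S) (hSw : S < 2 ^ w) (hw : 100 < 2 ^ w)
    (hz : ∀ c, p + R ≤ c → c < p + 6 * R → s.mem c = 0) :
    vc w S inp radixPass s fun t s' => t ≤ R * 200 + 100 ∧
      Written s'.mem (p + 5 * R) (radixStep R (2 ^ j) L) ∧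
      ∀ c, (c < p + R ∨ p + 6 * R ≤ c) → s'.mem c = s.mem c := by
  have hw0 : w ≠ 0 := by rintro rfl; omega
  set G : ℕ → ℕ := fun i => readAt L i / 2 ^ j % R with hG
  have hGR : ∀ i, G i < R := fun i => Nat.mod_lt _ hR
  refine vc_seq (Q' := fun t s' => t ≤ L.length * 30 + 6 ∧
    (∀ i < L.length, s'.mem (p + R + i) = G i) ∧
    ∀ c, (c < p + R ∨ p + 2 * R ≤ c) → s'.mem c = s.mem c) ?_ ?_
  · refine vc_forUp_le 22 (fun k s' => (∀ i < k, s'.mem (p + R + i) = G i) ∧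
      ∀ c, (c < p + R ∨ p + 2 * R ≤ c) → s'.mem c = s.mem c) (by decide) rfl rfl (by omega)
      (by omega) ⟨by simp, fun _ _ => rfl⟩ ?_ ?_
    · rintro k s' hk h43 hf ⟨hi, ho⟩
      have f12 := (hf 12 (by decide) rfl).trans h12
      have f23 := (hf 23 (by decide) rfl).trans h23
      have f24 := (hf 24 (by decide) rfl).trans h24
      have e1 : s'.mem (p + k) = readAt L k := by rw [ho _ (by omega), hL k (by omega)]
      simp [f12, f23, f24, h43, e1]
      repeat' with_reducible apply And.intro
      any_goals omega
      · intro i hik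
        rcases eq_or_ne i k with rfl | hne
        · rw [Function.update_self]
        · rw [Function.update_of_ne (by omega), hi i (by omega)]
      · intro c hc
        rw [Function.update_of_ne (by omega), ho c hc]
    · rintro t s' ht _ _ ⟨hi, ho⟩
      rw [h32] at ht hi
      exact ⟨by omega, hi, ho⟩
  rintro t₁ s₁ f₁ _ ⟨ht₁, d₁, o₁⟩
  have g12 := (f₁ 12 rfl).trans h12
  have g23 := (f₁ 23 rfl).trans h23
  have g32 := (f₁ 32 rfl).trans h32
  simp only [vc, Expr.Ok, Expr.val, BinOp.Ok, BinOp.val, Expr.cost, true_and, ne_eq, Nat.reduceEqDiff, not_false_eq_true,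
    Function.update_of_ne, g12, g23]
  repeat' with_reducible apply And.intro
  any_goals omega
  refine vc_conseq (vc_buildLists (G := G) (R := R) (M := L.length) (a := p + R) (q := p + R * 2)
    (by simpa) (by simp) (by simp) (by simpa) hNR (by omega) (by omega) hSw hw d₁
    (fun i _ => hGR i) (fun i hi => ?_)) ?_
  · simp only
    rw [o₁ _ (by omega), hz _ (by omega) (by omega)]
  rintro t₂ s₂ f₂ _ ⟨ht₂, o₂, c₂⟩
  simp only at o₂
  have k12 : s₂.reg 12 = R := by simpa [g12] using f₂ 12 rfl
  have k23 : s₂.reg 23 = p := by simpa [g23] using f₂ 23 rfl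
  have k31 : s₂.reg 31 = p + R * 2 := by simpa using f₂ 31 rfl
  simp only [k12, k23, k31]
  repeat' with_reducible apply And.intro
  any_goals omega
  refine vc_conseq (vc_gather (R := R) (p := p) (q := p + R * 2) (o := p + 5 * R) (L := L)
    (f := fun k => k / 2 ^ j % R) (by simpa) (by simpa) (by simpa) (by simp) (by simp; omega)
    (fun i hi => ?_) hNR (fun g hg => (c₂ g hg).1) (radixStep_perm hR).length_eq (by omega)
    (by omega) (by omega) hSw hw) ?_
  · simp only
    rw [o₂ _ (by omega), o₁ _ (by omega), hL i hi]
  · rintro t₃ s₃ _ _ ⟨ht₃, w₃, o₃⟩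
    refine ⟨by omega, w₃, fun c hc => ?_⟩
    rw [o₃ _ (by omega)]
    simp only
    rw [o₂ _ (by omega), o₁ _ (by omega)]

/-- Radix sort for the array at `reg 23` with `d` passes; the result is at the new value of
`reg 23`. -/
def radixSortProg (d : ℕ) : Prog :=
  .assign 24 0 ;; .assign 26 (.const d) ;;
  forUp 25 26 (radixPass ;; .assign 24 (.reg 24 + .reg 11) ;; .assign 23 (.reg 23 + .reg 12 * 5))

/-- Lists have to be built in zeroed memory. Instead of clearing, each pass moves `5 * 2 ^ ρ` words
ahead into fresh memory and takes the output of the previous pass as its input. -/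
theorem vc_radixSortProg {s : State} {ρ p d : ℕ} {L : List ℕ} (h11 : s.reg 11 = ρ)
    (h12 : s.reg 12 = 2 ^ ρ) (h23 : s.reg 23 = p) (h32 : s.reg 32 = L.length)
    (hL : Written s.mem p L) (hNR : L.length ≤ 2 ^ ρ)
    (hpS : p + (5 * d + 1) * 2 ^ ρ ≤ S) (hSw : S < 2 ^ w) (hw : 100 < 2 ^ w)
    (hd : d * ρ < 2 ^ w)
    (hz : ∀ c, p + 2 ^ ρ ≤ c → c < p + (5 * d + 1) * 2 ^ ρ → s.mem c = 0) :
    vc w S inp (radixSortProg d) s fun t s' => t ≤ d * (2 ^ ρ * 200 + 200) + 20 ∧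
      s'.reg 23 = p + 5 * d * 2 ^ ρ ∧
      Written s'.mem (p + 5 * d * 2 ^ ρ) (radixSort (2 ^ ρ) d L) ∧
      ∀ c, (c < p + 2 ^ ρ ∨ p + (5 * d + 1) * 2 ^ ρ ≤ c) → s'.mem c = s.mem c := by
  have hw0 : w ≠ 0 := by rintro rfl; omega
  have hR : 0 < 2 ^ ρ := by positivity
  have e : (5 * d + 1) * 2 ^ ρ = 5 * (d * 2 ^ ρ) + 2 ^ ρ := by ring
  have hdR : d ≤ d * 2 ^ ρ := Nat.le_mul_of_pos_right _ hR
  rw [e] at hpS hz ⊢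
  simp only [radixSortProg, vc, Expr.Ok, Expr.val, Expr.cost, Expr.ofNat_def]
  refine ⟨by omega, by omega, ?_⟩
  refine vc_forUp_le (2 ^ ρ * 200 + 120) (fun k s' => s'.reg 24 = k * ρ ∧
    s'.reg 23 = p + 5 * (k * 2 ^ ρ) ∧ Written s'.mem (p + 5 * (k * 2 ^ ρ)) (radixSort (2 ^ ρ) k L) ∧
    ∀ c, (c < p + 2 ^ ρ ∨ p + (5 * (k * 2 ^ ρ) + 2 ^ ρ) ≤ c) → s'.mem c = s.mem c) (by decide)
    rfl rfl (by simp; omega) (by omega) ?_ ?_ ?_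
  · simpa [h23, radixSort] using hL
  · rintro k s₁ hk h25 hf ⟨i24, i23, hWr, ho⟩
    simp only [Function.update_self] at hk
    have f11 : s₁.reg 11 = ρ := by simpa [h11] using hf 11 (by decide) rfl
    have f12 : s₁.reg 12 = 2 ^ ρ := by simpa [h12] using hf 12 (by decide) rfl
    have f32 : s₁.reg 32 = L.length := by simpa [h32] using hf 32 (by decide) rfl
    have hperm := (radixSort_perm (d := k) (L := L) hR).length_eq
    have hkd : k * 2 ^ ρ + 2 ^ ρ ≤ d * 2 ^ ρ := by
      rw [← Nat.succ_mul]; exact Nat.mul_le_mul_right _ hk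
    have hkr : (k + 1) * ρ ≤ d * ρ := Nat.mul_le_mul_right _ hk
    have ek : (k + 1) * ρ = k * ρ + ρ := by ring
    have ek' : (k + 1) * 2 ^ ρ = k * 2 ^ ρ + 2 ^ ρ := by ring
    refine vc_seq (vc_radixPass (R := 2 ^ ρ) (p := p + 5 * (k * 2 ^ ρ)) (j := k * ρ)
      (L := radixSort (2 ^ ρ) k L) f12 i23 i24 (by omega) hWr (by omega) hR (by omega) hSw hw
      fun c h1 h2 => ?_) ?_
    · rw [ho _ (by omega), hz _ (by omega) (by omega)]
    · rintro t₂ s₂ f₂ _ ⟨ht₂, w₂, o₂⟩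
      have g11 := (f₂ 11 rfl).trans f11
      have g12 := (f₂ 12 rfl).trans f12
      have g23 := (f₂ 23 rfl).trans i23
      have g24 := (f₂ 24 rfl).trans i24
      have er : radixSort (2 ^ ρ) (k + 1) L =
          radixStep (2 ^ ρ) (2 ^ (k * ρ)) (radixSort (2 ^ ρ) k L) := by
        rw [radixSort, ← pow_mul, mul_comm ρ k]
      have ep : p + 5 * ((k + 1) * 2 ^ ρ) = p + 5 * (k * 2 ^ ρ) + 5 * 2 ^ ρ := by ring
      simp [g11, g12, g23, g24, er, ep]
      refine ⟨by omega, by omega, by omega, by omega, by omega, w₂, fun c hc => ?_⟩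
      rw [o₂ _ (by omega), ho _ (by omega)]
  · rintro t s₁ ht h25 hf ⟨i24, i23, hWr, ho⟩
    simp only [Function.update_self] at ht i23 hWr ho
    have e' : d * (2 ^ ρ * 200 + 200) = d * (2 ^ ρ * 200 + 120 + 8) + d * 72 := by ring
    rw [Nat.mul_assoc]
    exact ⟨by omega, i23, hWr, ho⟩

end WordRAM

/-! ### Naming the prefixes of the samples -/

namespace WordRAM

/-- The first index of the run of equal prefixes which contains `p`, where `e` bits are dropped. -/
def runStart (f : ℕ → ℕ) (e : ℕ) : ℕ → ℕ
  | 0 => 0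
  | p + 1 => if f (p + 1) / 2 ^ e = f p / 2 ^ e then runStart f e p else p + 1

theorem runStart_le (f : ℕ → ℕ) (e p : ℕ) : runStart f e p ≤ p := by
  induction p with
  | zero => exact le_rfl
  | succ p ih => rw [runStart]; split_ifs <;> omega

theorem runStart_prefix (f : ℕ → ℕ) (e p : ℕ) : f (runStart f e p) / 2 ^ e = f p / 2 ^ e := by
  induction p with
  | zero => rfl
  | succ p ih =>
    rw [runStart]
    split_ifs with h
    · rw [ih, h]
    · rfl

/-- In a sorted sequence the elements with a given prefix are consecutive, so the first of them is a
canonical name of the prefix. Such a name is a number below `N`, however long the prefix is. -/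
theorem runStart_eq {f : ℕ → ℕ} {N e : ℕ} (hf : ∀ p q, p ≤ q → q < N → f p ≤ f q) {p q : ℕ}
    (hp : p < N) (hq : q < N) (h : f p / 2 ^ e = f q / 2 ^ e) : runStart f e p = runStart f e q := by
  wlog hpq : p ≤ q generalizing p q
  · exact (this hq hp h.symm (by omega)).symm
  induction q, hpq using Nat.le_induction with
  | base => rfl
  | succ q hpq ih =>
    have h1 : f p / 2 ^ e ≤ f q / 2 ^ e := Nat.div_le_div_right (hf p q hpq (by omega))
    have h2 : f q / 2 ^ e ≤ f (q + 1) / 2 ^ e := Nat.div_le_div_right (hf q (q + 1) (by omega) hq)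
    rw [runStart, if_pos (by omega)]
    exact ih (by omega) (by omega)

theorem runStart_eq_iff {f : ℕ → ℕ} {N e : ℕ} (hf : ∀ p q, p ≤ q → q < N → f p ≤ f q) {p q : ℕ}
    (hp : p < N) (hq : q < N) :
    runStart f e p = runStart f e q ↔ f p / 2 ^ e = f q / 2 ^ e :=
  ⟨fun h => by rw [← runStart_prefix f e p, h, runStart_prefix], runStart_eq hf hp hq⟩

theorem runStart_runStart {f : ℕ → ℕ} {N e : ℕ} (hf : ∀ p q, p ≤ q → q < N → f p ≤ f q) {p : ℕ}
    (hp : p < N) : runStart f e (runStart f e p) = runStart f e p :=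
  runStart_eq hf (lt_of_le_of_lt (runStart_le _ _ _) hp) hp (runStart_prefix f e p)

/-- The next multiple of `ρ` above `e`. -/
def digitEnd (ρ e : ℕ) : ℕ := (e / ρ + 1) * ρ

theorem lt_digitEnd {ρ e : ℕ} (hρ : 0 < ρ) : e < digitEnd ρ e := by
  unfold digitEnd
  have := Nat.div_add_mod e ρ
  have := Nat.mod_lt e hρ
  rw [Nat.add_mul, mul_comm]
  omega

theorem digitEnd_le {ρ e : ℕ} : digitEnd ρ e ≤ e + ρ := by
  unfold digitEnd
  have := Nat.div_add_mod e ρ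
  rw [Nat.add_mul, mul_comm]
  omega

/-- The next digit boundary lies at most `ρ` bits above `e`. The low `ρ` bits of `x / 2 ^ e`
therefore contain all bits between `e` and the boundary, and bits beyond it are redundant but
harmless. -/
theorem prefix_eq_iff {ρ e x y : ℕ} (hρ : 0 < ρ) : x / 2 ^ e = y / 2 ^ e ↔
    x / 2 ^ digitEnd ρ e = y / 2 ^ digitEnd ρ e ∧ x / 2 ^ e % 2 ^ ρ = y / 2 ^ e % 2 ^ ρ := by
  have h1 := lt_digitEnd (e := e) hρ
  have h2 := digitEnd_le (e := e) (ρ := ρ)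
  obtain ⟨k, hk⟩ := Nat.exists_eq_add_of_lt h1
  have hk' : digitEnd ρ e = e + (k + 1) := by omega
  rw [hk', pow_add, ← Nat.div_div_eq_div_mul, ← Nat.div_div_eq_div_mul]
  constructor
  · intro h
    rw [h]
    exact ⟨rfl, rfl⟩
  · rintro ⟨h3, h4⟩
    have hd : 2 ^ (k + 1) ∣ 2 ^ ρ := pow_dvd_pow 2 (by omega)
    rw [← Nat.div_add_mod (x / 2 ^ e) (2 ^ (k + 1)), ← Nat.div_add_mod (y / 2 ^ e) (2 ^ (k + 1)), h3,
      ← Nat.mod_mod_of_dvd (x / 2 ^ e) hd, h4, Nat.mod_mod_of_dvd (y / 2 ^ e) hd]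

/-- The indices of the prefixes: `e * N + p` for the prefix of `f p` without the last `e` bits,
where `p` is the first index with this prefix. -/
def prefixes (f : ℕ → ℕ) (N c : ℕ) : List ℕ :=
  (List.range c).filter fun c => runStart f (c / N) (c % N) = c % N

/-- First component of the key of a prefix. -/
def keyX (f : ℕ → ℕ) (ρ N c : ℕ) : ℕ := c / N * N + runStart f (digitEnd ρ (c / N)) (c % N)

/-- Second component of the key of a prefix. -/
def keyY (f : ℕ → ℕ) (ρ N c : ℕ) : ℕ := f (c % N) / 2 ^ (c / N) % 2 ^ ρ

theorem prefixes_succ (f : ℕ → ℕ) (N c : ℕ) : prefixes f N (c + 1) = prefixes f N c ++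
    if runStart f (c / N) (c % N) = c % N then [c] else [] := by
  simp only [prefixes, List.range_succ, List.filter_append]
  congr 1
  split_ifs with h <;> simp [h]

theorem length_prefixes_le (f : ℕ → ℕ) (N c : ℕ) : (prefixes f N c).length ≤ c :=
  (List.length_filter_le _ _).trans (by simp)

theorem pair_div {a x N : ℕ} (hx : x < N) : (a * N + x) / N = a := by
  rw [add_comm, Nat.add_mul_div_right _ _ (by omega), Nat.div_eq_of_lt hx, zero_add]

theorem pair_mod {a x N : ℕ} (hx : x < N) : (a * N + x) % N = x := by
  rw [add_comm, Nat.add_mul_mod_self_right, Nat.mod_eq_of_lt hx]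

/-- The remainder modulo `N` is a run start, hence below `N`, so the first component determines both
the depth and the digit-aligned prefix. -/
theorem key_inj {f : ℕ → ℕ} {N ρ : ℕ} (hf : ∀ p q, p ≤ q → q < N → f p ≤ f q)
    (hN : 0 < N) {e p q : ℕ} (hp : p < N) (hX : keyX f ρ N q = e * N + runStart f (digitEnd ρ e) p) :
    q / N = e ∧ f (q % N) / 2 ^ digitEnd ρ e = f p / 2 ^ digitEnd ρ e := by
  have hq := Nat.mod_lt q hN
  have h1 := runStart_le f (digitEnd ρ e) p
  have h2 := runStart_le f (digitEnd ρ (q / N)) (q % N)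
  unfold keyX at hX
  have h3 : q / N = e := by
    have := congrArg (· / N) hX
    rwa [pair_div (by omega), pair_div (by omega)] at this
  rw [h3] at hX
  exact ⟨h3, (runStart_eq_iff hf hq hp).1 (by omega)⟩

/-- Enumerate the prefixes of the samples of the array at `reg 23`. -/
def makeItem : Prog :=
  .assign 44 (.reg 43 / .reg 15) ;; .assign 45 (.reg 43 % .reg 15) ;;
  .assign 46 ((.reg 44 / .reg 11 + 1) * .reg 11) ;; .load 47 (.reg 23 + .reg 45 * .reg 14) ;;
  .ite (.reg 45)
    (.load 48 (.reg 23 + (.reg 45 - 1) * .reg 14) ;;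
      .ite (.bin .eq (.bin .shr (.reg 47) (.reg 46)) (.bin .shr (.reg 48) (.reg 46))) .skip
        (.assign 40 (.reg 45)) ;;
      .ite (.bin .eq (.bin .shr (.reg 47) (.reg 44)) (.bin .shr (.reg 48) (.reg 44))) .skip
        (.assign 41 (.reg 45)))
    (.assign 40 0 ;; .assign 41 0)

/-- Array `4` is indexed by depth and run start and is overwritten by every member of the run, so it
ends up with the last one. Only the first member of a run is recorded as a prefix with its key. -/
def storeItem : Prog :=
  .store (.reg 23 + .reg 12 * 4 + .reg 44 * .reg 15 + .reg 41) (.reg 45) ;;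
  .ite (.bin .eq (.reg 41) (.reg 45))
    (.store (.reg 23 + .reg 12 + .reg 32) (.reg 44 * .reg 15 + .reg 40) ;;
      .store (.reg 23 + .reg 12 * 2 + .reg 32) (.bin .shr (.reg 47) (.reg 44) % .reg 12) ;;
      .store (.reg 23 + .reg 12 * 3 + .reg 32) (.reg 45) ;; .assign 32 (.reg 32 + 1)) .skip

def makeItems : Prog :=
  .assign 26 (.reg 13 * .reg 15) ;; .assign 32 0 ;; forUp 43 26 (makeItem ;; storeItem)

variable {w S : ℕ} {inp : List ℕ}

/-- The run starts for the digit boundary and for the exact depth are kept in registers `40` and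
`41` and updated by comparing with the preceding sample, following the recursion of `runStart`. -/
theorem vc_makeItem {s : State} {ρ N d B e p : ℕ} {f : ℕ → ℕ} (h11 : s.reg 11 = ρ)
    (h14 : s.reg 14 = d) (h15 : s.reg 15 = N) (h23 : s.reg 23 = B) (h43 : s.reg 43 = e * N + p)
    (hp : p < N) (hf : ∀ p < N, s.mem (B + p * d) = f p) (hS : B + p * d < S)
    (hpw : p < 2 ^ w) (hρ : 0 < ρ) (hSw : S < 2 ^ w) (hw : 100 < 2 ^ w) (hu : e + ρ < 2 ^ w)
    (hlo : ∀ p', p = p' + 1 → s.reg 40 = runStart f (digitEnd ρ e) p' ∧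
      s.reg 41 = runStart f e p') :
    vc w S inp makeItem s fun t s' => t ≤ 60 ∧ s'.reg 44 = e ∧ s'.reg 45 = p ∧ s'.reg 47 = f p ∧
      s'.reg 40 = runStart f (digitEnd ρ e) p ∧ s'.reg 41 = runStart f e p := by
  have hw0 : w ≠ 0 := by rintro rfl; omega
  have e1 : (e * N + p) / N = e := pair_div hp
  have e2 : (e * N + p) % N = p := pair_mod hp
  have hde := digitEnd_le (e := e) (ρ := ρ)
  have hdiv := Nat.div_le_self e ρ
  have hdd : (e / ρ + 1) * ρ = digitEnd ρ e := rfl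
  simp [makeItem, h11, h14, h15, h23, h43, e1, e2, hf p hp, hdd]
  repeat' with_reducible apply And.intro
  any_goals omega
  · intro hp0
    obtain ⟨p', rfl⟩ : ∃ p', p = p' + 1 := ⟨p - 1, by omega⟩
    obtain ⟨l1, l2⟩ := hlo p' rfl
    have hpd' : (p' + 1) * d = p' * d + d := by ring
    rw [Nat.add_sub_cancel, hf p' (by omega), l1, l2]
    repeat' with_reducible apply And.intro
    any_goals omega
    · intro h1
      repeat' with_reducible apply And.intro
      · intro h2
        simp [runStart, h1, h2]
      · intro h2
        simp [runStart, h1, h2]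
    · intro h1
      repeat' with_reducible apply And.intro
      · intro h2
        simp [runStart, h1, h2]
      · intro h2
        simp [runStart, h1, h2]
  · rintro rfl
    simp [runStart]

/-- The state of the enumeration after `c` steps. -/
structure ItemsInv (f : ℕ → ℕ) (ρ N B c : ℕ) (s : State) : Prop where
  h32 : s.reg 32 = (prefixes f N c).length
  hX : Written s.mem (B + 1 * 2 ^ ρ) ((prefixes f N c).map (keyX f ρ N))
  hY : Written s.mem (B + 2 * 2 ^ ρ) ((prefixes f N c).map (keyY f ρ N))
  hL : Written s.mem (B + 3 * 2 ^ ρ) ((prefixes f N c).map (· % N))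
  hrun : ∀ e p, p < N → e * N + p < c → ∃ h < N,
    s.mem (B + 4 * 2 ^ ρ + (e * N + runStart f e p)) = h ∧ runStart f e h = runStart f e p ∧
      ∀ p' < N, e * N + p' < c → runStart f e p' = runStart f e p → p' ≤ h

theorem vc_storeItem {s : State} {ρ N B e p : ℕ} {f : ℕ → ℕ}
    (hI : ItemsInv f ρ N B (e * N + p) s)
    (h12 : s.reg 12 = 2 ^ ρ) (h15 : s.reg 15 = N) (h23 : s.reg 23 = B) (h44 : s.reg 44 = e)
    (h45 : s.reg 45 = p) (h47 : s.reg 47 = f p)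
    (h40 : s.reg 40 = runStart f (digitEnd ρ e) p) (h41 : s.reg 41 = runStart f e p)
    (hp : p < N) (hc : e * N + p < 2 ^ ρ) (hS : B + 5 * 2 ^ ρ ≤ S)
    (hSw : S < 2 ^ w) (hw : 100 < 2 ^ w) :
    vc w S inp storeItem s fun t s' => t ≤ 60 ∧ ItemsInv f ρ N B (e * N + p + 1) s' ∧
      ∀ c, (c < B + 1 * 2 ^ ρ ∨ B + 5 * 2 ^ ρ ≤ c) → s'.mem c = s.mem c := by
  have hw0 : w ≠ 0 := by rintro rfl; omega
  obtain ⟨h32, hX, hY, hL, hrun⟩ := hI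
  have e1 : (e * N + p) / N = e := pair_div hp
  have e2 : (e * N + p) % N = p := pair_mod hp
  have hlen := length_prefixes_le f N (e * N + p)
  have r1 := runStart_le f e p
  have r2 := runStart_le f (digitEnd ρ e) p
  have hRR : 2 ^ ρ * 4 = 4 * 2 ^ ρ := mul_comm _ _
  have hR3 : 2 ^ ρ * 3 = 3 * 2 ^ ρ := mul_comm _ _
  have hR2 : 2 ^ ρ * 2 = 2 * 2 ^ ρ := mul_comm _ _
  have hR1 : 2 ^ ρ = 1 * 2 ^ ρ := (one_mul _).symm
  set a := B + 4 * 2 ^ ρ + (e * N + runStart f e p) with ha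
  set mem₁ := Function.update s.mem a p with hmem₁
  have hu : ∀ c, c ≠ a → mem₁ c = s.mem c := fun c hc => Function.update_of_ne hc _ _
  -- Since the samples are visited in increasing order, the store at `a` makes the current index the
  -- largest one seen in its run; other runs have other addresses and keep theirs.
  have hrun₁ : ∀ e' p', p' < N → e' * N + p' < e * N + p + 1 → ∃ h < N,
      mem₁ (B + 4 * 2 ^ ρ + (e' * N + runStart f e' p')) = h ∧ runStart f e' h = runStart f e' p' ∧
      ∀ p'' < N, e' * N + p'' < e * N + p + 1 → runStart f e' p'' = runStart f e' p' → p'' ≤ h := by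
    intro e' p' hp' hlt
    have r3 := runStart_le f e' p'
    by_cases heq : e' = e ∧ runStart f e' p' = runStart f e p
    · obtain ⟨rfl, heq⟩ := heq
      exact ⟨p, hp, by rw [heq, hmem₁, ha, Function.update_self], heq.symm,
        fun p'' _ h _ => by omega⟩
    · have hne : e' * N + runStart f e' p' ≠ e * N + runStart f e p := by
        intro h
        have h6 := congrArg (· / N) h
        simp only [pair_div (lt_of_le_of_lt r3 hp'), pair_div (lt_of_le_of_lt r1 hp)] at h6
        subst h6
        exact heq ⟨rfl, by omega⟩
      have hlt' : e' * N + p' < e * N + p := by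
        rcases Nat.lt_succ_iff_lt_or_eq.1 hlt with h | h
        · exact h
        · have h5 : ∀ a x, x < N → (a * N + x) / N = a := fun a x hx => by
            rw [add_comm, Nat.add_mul_div_right _ _ (by omega), Nat.div_eq_of_lt hx, zero_add]
          have h6 := congrArg (· / N) h
          simp only [pair_div hp', pair_div hp] at h6
          subst h6
          obtain rfl : p' = p := by omega
          exact absurd rfl hne
      obtain ⟨h, hN, hm, hs, hmax⟩ := hrun e' p' hp' hlt'
      refine ⟨h, hN, by rw [hu _ (by omega), hm], hs, fun p'' hp'' hlt'' hs'' => ?_⟩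
      rcases Nat.lt_succ_iff_lt_or_eq.1 hlt'' with h7 | h7
      · exact hmax p'' hp'' h7 hs''
      · have h5 : ∀ a x, x < N → (a * N + x) / N = a := fun a x hx => by
          rw [add_comm, Nat.add_mul_div_right _ _ (by omega), Nat.div_eq_of_lt hx, zero_add]
        have h6 := congrArg (· / N) h7
        simp only [pair_div hp'', pair_div hp] at h6
        subst h6
        obtain rfl : p'' = p := by omega
        exact absurd ⟨rfl, hs''.symm⟩ heq
  simp only [storeItem, vc, Expr.Ok, Expr.val, BinOp.Ok, BinOp.val, Expr.cost, true_and,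
    Expr.add_def, Expr.mul_def, Expr.mod_def, Expr.ofNat_def, h12, h15, h23, h44, h45, h47, h40, h41,
    h32, hRR, hR3, hR2, eqVal_eq_zero, not_not, ne_eq]
  have ea : B + 4 * 2 ^ ρ + e * N + runStart f e p = a := by omega
  rw [ea]
  repeat' with_reducible apply And.intro
  any_goals omega
  · intro hst
    repeat' with_reducible apply And.intro
    any_goals omega
    · have hpre : prefixes f N (e * N + p + 1) = prefixes f N (e * N + p) ++ [e * N + p] := by
        rw [prefixes_succ, e1, e2, if_pos hst]
      refine ⟨by simp [hpre], ?_, ?_, ?_, ?_⟩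
      · simp only
        rw [hpre, List.map_append]
        have h1 := (hX.congr (mem' := mem₁) fun c h3 h4 => by
          simp at h4; exact hu _ (by omega)).append
          (v := e * N + runStart f (digitEnd ρ e) p)
        rw [List.length_map] at h1
        have h2 : keyX f ρ N (e * N + p) = e * N + runStart f (digitEnd ρ e) p := by
          rw [keyX, e1, e2]
        simp only [List.map_cons, List.map_nil, h2]
        refine h1.congr fun c h3 h4 => ?_
        simp at h4
        rw [Function.update_of_ne (by omega), Function.update_of_ne (by omega), ← hR1]
      · simp only
        rw [hpre, List.map_append]
        have h1 := (hY.congr (mem' := Function.update mem₁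
          (B + 2 ^ ρ + (prefixes f N (e * N + p)).length) (e * N + runStart f (digitEnd ρ e) p))
            fun c h3 h4 => by
              simp at h4; rw [Function.update_of_ne (by omega), hu _ (by omega)]).append
          (v := f p / 2 ^ e % 2 ^ ρ)
        rw [List.length_map] at h1
        have h2 : keyY f ρ N (e * N + p) = f p / 2 ^ e % 2 ^ ρ := by
          rw [keyY, e1, e2]
        simp only [List.map_cons, List.map_nil, h2]
        refine h1.congr fun c h3 h4 => ?_
        simp at h4
        rw [Function.update_of_ne (by omega)]
      · simp only
        rw [hpre, List.map_append]
        have h1 := (hL.congr (mem' := Function.update (Function.update mem₁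
          (B + 2 ^ ρ + (prefixes f N (e * N + p)).length) (e * N + runStart f (digitEnd ρ e) p))
          (B + 2 * 2 ^ ρ + (prefixes f N (e * N + p)).length) (f p / 2 ^ e % 2 ^ ρ))
            fun c h3 h4 => by
              simp at h4
              rw [Function.update_of_ne (by omega), Function.update_of_ne (by omega),
                hu _ (by omega)]).append
          (v := p)
        rw [List.length_map] at h1
        simpa only [List.map_cons, List.map_nil, e2] using h1
      · intro e' p' hp' hlt
        obtain ⟨h, hN, hm, hs⟩ := hrun₁ e' p' hp' hlt
        refine ⟨h, hN, ?_, hs⟩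
        simp only
        rw [Function.update_of_ne (by omega), Function.update_of_ne (by omega),
          Function.update_of_ne (by omega)]
        exact hm
    · intro c hc
      rw [Function.update_of_ne (by omega), Function.update_of_ne (by omega),
        Function.update_of_ne (by omega)]
      exact hu _ (by omega)
  · intro hst
    have hpre : prefixes f N (e * N + p + 1) = prefixes f N (e * N + p) := by
      rw [prefixes_succ, e1, e2, if_neg hst, List.append_nil]
    refine ⟨by omega, ⟨by simp [hpre, h32], ?_, ?_, ?_, hrun₁⟩, fun c hc => hu _ (by omega)⟩
    · rw [hpre]
      exact hX.congr fun c h3 h4 => by simp at h4; exact hu _ (by omega)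
    · rw [hpre]
      exact hY.congr fun c h3 h4 => by simp at h4; exact hu _ (by omega)
    · rw [hpre]
      exact hL.congr fun c h3 h4 => by simp at h4; exact hu _ (by omega)

theorem vc_makeItems {s : State} {ρ N d B b : ℕ} {f : ℕ → ℕ} (h11 : s.reg 11 = ρ)
    (h12 : s.reg 12 = 2 ^ ρ) (h13 : s.reg 13 = b)
    (h14 : s.reg 14 = d) (h15 : s.reg 15 = N) (h23 : s.reg 23 = B) (hN : 0 < N) (hρ : 0 < ρ)
    (hf : ∀ p < N, s.mem (B + p * d) = f p) (hd : ∀ p < N, p * d < 2 ^ ρ) (hb : b * N ≤ 2 ^ ρ)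
    (hS : B + 5 * 2 ^ ρ ≤ S) (hSw : S < 2 ^ w) (hw : 100 < 2 ^ w) :
    vc w S inp makeItems s fun t s' => t ≤ b * N * 130 + 50 ∧ ItemsInv f ρ N B (b * N) s' ∧
      ∀ c, (c < B + 1 * 2 ^ ρ ∨ B + 5 * 2 ^ ρ ≤ c) → s'.mem c = s.mem c := by
  have hw0 : w ≠ 0 := by rintro rfl; omega
  have hρR : ρ < 2 ^ ρ := Nat.lt_two_pow_self
  simp only [makeItems, vc, Expr.Ok, Expr.val, BinOp.Ok, BinOp.val, Expr.cost, true_and,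
    Expr.ofNat_def, Expr.mul_def, h13, h15]
  refine ⟨by omega, by omega, ?_⟩
  -- The registers for the run starts are meaningful only inside a depth: nothing is claimed about
  -- them at the first sample, where the program resets them.
  refine vc_forUp_le 120 (fun c s' => (∀ e p, c = e * N + (p + 1) → p + 1 < N →
    s'.reg 40 = runStart f (digitEnd ρ e) p ∧ s'.reg 41 = runStart f e p) ∧
    ItemsInv f ρ N B c s' ∧
    ∀ c, (c < B + 1 * 2 ^ ρ ∨ B + 5 * 2 ^ ρ ≤ c) → s'.mem c = s.mem c) (by decide) rfl rfl
    (by simp; omega) (by omega) ?_ ?_ ?_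
  · refine ⟨fun e p h => by omega, ⟨by simp [prefixes], ?_, ?_, ?_, fun _ _ _ h => by omega⟩,
      fun _ _ => rfl⟩ <;> simp [prefixes, Written]
  · rintro c s₁ hc h43 hfr ⟨hlo, hI, ho⟩
    have hc' : c < b * N := by simpa using hc
    have f11 : s₁.reg 11 = ρ := by simpa [h11] using hfr 11 (by decide) rfl
    have f12 : s₁.reg 12 = 2 ^ ρ := by simpa [h12] using hfr 12 (by decide) rfl
    have f14 : s₁.reg 14 = d := by simpa [h14] using hfr 14 (by decide) rfl
    have f15 : s₁.reg 15 = N := by simpa [h15] using hfr 15 (by decide) rfl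
    have f23 : s₁.reg 23 = B := by simpa [h23] using hfr 23 (by decide) rfl
    obtain ⟨e, p, hp, rfl⟩ : ∃ e p, p < N ∧ c = e * N + p :=
      ⟨c / N, c % N, Nat.mod_lt _ hN, (Nat.div_add_mod' c N).symm⟩
    have heN : e ≤ e * N := Nat.le_mul_of_pos_right _ hN
    have hpd := hd p hp
    refine vc_seq (vc_makeItem (ρ := ρ) (N := N) (d := d) (B := B) (e := e) (p := p) (f := f)
      f11 f14 f15 f23 h43 hp (fun p hp => ?_) (by omega) (by omega) hρ hSw hw (by omega)
      (fun p' hp' => hlo e p' (by omega) (by omega))) ?_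
    · have := hd p hp
      rw [ho _ (by omega), hf p hp]
    · rintro t₂ s₂ f₂ m₂ ⟨ht₂, k44, k45, k47, k40, k41⟩
      have m₂ := m₂ rfl
      have g12 := (f₂ 12 rfl).trans f12
      have g15 := (f₂ 15 rfl).trans f15
      have g23 := (f₂ 23 rfl).trans f23
      have hI' : ItemsInv f ρ N B (e * N + p) s₂ := by
        obtain ⟨i1, i2, i3, i4, i5⟩ := hI
        exact ⟨(f₂ 32 rfl).trans i1, by rwa [m₂], by rwa [m₂], by rwa [m₂], by rwa [m₂]⟩
      refine vc_conseq (vc_storeItem hI' g12 g15 g23 k44 k45 k47 k40 k41 hp (by omega) hS hSw hw) ?_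
      rintro t₃ s₃ f₃ _ ⟨ht₃, hI₃, o₃⟩
      refine ⟨by omega, fun e' p' he' hp' => ?_, ⟨?_, hI₃.hX, hI₃.hY, hI₃.hL, hI₃.hrun⟩,
        fun c hc => ?_⟩
      · have h5 : ∀ a x, x < N → (a * N + x) / N = a := fun a x hx => by
          rw [add_comm, Nat.add_mul_div_right _ _ (by omega), Nat.div_eq_of_lt hx, zero_add]
        have h6 := congrArg (· / N) (show e * N + p = e' * N + p' by omega)
        simp only [pair_div hp, pair_div (show p' < N by omega)] at h6
        subst h6
        obtain rfl : p = p' := by omega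
        simp [(f₃ 40 rfl).trans k40, (f₃ 41 rfl).trans k41]
      · simpa using hI₃.h32
      · simp only
        rw [o₃ c hc, m₂, ho c hc]
  · rintro t s₁ ht _ _ ⟨_, hI, ho⟩
    simp only [Function.update_self, ne_eq, Nat.reduceEqDiff, not_false_eq_true,
      Function.update_of_ne] at ht hI
    exact ⟨by omega, hI, ho⟩

end WordRAM

/-! ### Probing for a prefix -/

namespace WordRAM

variable {w S : ℕ} {inp : List ℕ}

/-- The rule for bisection loops. -/
theorem vc_bisect {rl rr l₀ r₀ : ℕ} {p : Prog} {s₀ : State} {Q : ℕ → State → Prop} (B : ℕ)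
    (J : ℕ → ℕ → State → Prop) (hl : s₀.reg rl = l₀) (hr : s₀.reg rr = r₀) (hlr : l₀ < r₀)
    (hw : r₀ < 2 ^ w) (hw1 : 1 < 2 ^ w) (h0 : J l₀ r₀ s₀)
    (hstep : ∀ l r s, Frame p s₀ s → s.reg rl = l → s.reg rr = r → l₀ ≤ l → l + 1 < r → r ≤ r₀ →
      J l r s → vc w S inp p s fun t s' => t ≤ B ∧
        ((s'.reg rl = l ∧ s'.reg rr = (l + r) / 2 ∧ J l ((l + r) / 2) s') ∨
          (s'.reg rl = (l + r) / 2 ∧ s'.reg rr = r ∧ J ((l + r) / 2) r s')))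
    (hdone : ∀ t l s, Frame p s₀ s → s.reg rl = l → s.reg rr = l + 1 → l₀ ≤ l → l + 1 ≤ r₀ →
      J l (l + 1) s → t ≤ Nat.clog 2 (r₀ - l₀) * (B + 6) + 6 → Q t s) :
    vc w S inp (.loop (.bin .lt (.reg rl + 1) (.reg rr)) p) s₀ Q := by
  -- Halving with rounding up lowers the rounded-up logarithm by one, so it counts the rounds.
  have hclog : ∀ n m, 2 ≤ n → m ≤ (n + 1) / 2 → Nat.clog 2 m + 1 ≤ Nat.clog 2 n := by
    intro n m hn hm
    rw [Nat.clog_of_two_le (by omega) hn]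
    exact Nat.succ_le_succ (Nat.clog_mono_right 2 hm)
  have hle : ∀ a b T t t' : ℕ, a + 1 ≤ b → t' ≤ B → t + b * (B + 6) ≤ T →
      t + 6 + t' + a * (B + 6) ≤ T := by
    intro a b T t t' h1 h2 h3
    have := Nat.mul_le_mul_right (B + 6) h1
    rw [Nat.add_mul] at this
    omega
  refine vc_loop (fun t s => ∃ l r, s.reg rl = l ∧ s.reg rr = r ∧ l < r ∧ l₀ ≤ l ∧ r ≤ r₀ ∧
    J l r s ∧ t + Nat.clog 2 (r - l) * (B + 6) ≤ Nat.clog 2 (r₀ - l₀) * (B + 6))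
    (fun s => s.reg rr - s.reg rl) ⟨l₀, r₀, hl, hr, hlr, le_rfl, le_rfl, h0, by omega⟩ ?_ ?_ ?_
  · rintro t s _ ⟨l, r, h1, h2, h3, h4, h5, -⟩
    simp only [Expr.Ok, Expr.val, BinOp.Ok, h1]
    exact ⟨⟨trivial, hw1, by omega⟩, trivial, trivial⟩
  · rintro t s hf ⟨l, r, h1, h2, h3, h4, h5, hJ, ht⟩ hne
    have hlt : l + 1 < r := by
      by_contra hc
      simp [h1, h2] at hne
      omega
    refine vc_conseq (hstep l r s hf h1 h2 h4 hlt h5 hJ) ?_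
    rintro t' s' _ _ ⟨ht', ⟨g1, g2, hJ'⟩ | ⟨g1, g2, hJ'⟩⟩
    · refine ⟨⟨l, (l + r) / 2, g1, g2, by omega, h4, by omega, hJ', ?_⟩, ?_⟩
      · exact hle _ _ _ _ _ (hclog (r - l) _ (by omega) (by omega)) ht' ht
      · simp only [h1, h2, g1, g2]; omega
    · refine ⟨⟨(l + r) / 2, r, g1, g2, by omega, by omega, h5, hJ', ?_⟩, ?_⟩
      · exact hle _ _ _ _ _ (hclog (r - l) _ (by omega) (by omega)) ht' ht
      · simp only [h1, h2, g1, g2]; omega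
  · rintro t s hf ⟨l, r, h1, h2, h3, h4, h5, hJ, ht⟩ heq
    have hlt : r = l + 1 := by
      simp [h1, h2] at heq
      omega
    subst hlt
    refine hdone _ l s hf h1 h2 h4 h5 hJ ?_
    simp only [Expr.cost]
    omega

/-- The indices from `L` to `H` are those with the same prefix as `x`, without `e` bits. -/
structure IsRun (f : ℕ → ℕ) (N e x L H : ℕ) : Prop where
  hL : L ≤ H
  hH : H < N
  start : runStart f e L = L
  iff : ∀ p < N, f p / 2 ^ e = x / 2 ^ e ↔ L ≤ p ∧ p ≤ H

theorem IsRun.of_max {f : ℕ → ℕ} {N e x L H : ℕ} (hf : ∀ p q, p ≤ q → q < N → f p ≤ f q)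
    (hL : L < N) (hH : H < N) (hst : runStart f e L = L) (hx : f L / 2 ^ e = x / 2 ^ e)
    (hHL : runStart f e H = L) (hmax : ∀ p < N, runStart f e p = L → p ≤ H) :
    IsRun f N e x L H := by
  have hLH : L ≤ H := hHL ▸ runStart_le f e H
  refine ⟨hLH, hH, hst, fun p hp => ⟨fun h => ?_, fun ⟨h1, h2⟩ => ?_⟩⟩
  · have h3 : runStart f e p = L := by
      rw [← hst]
      exact runStart_eq hf hp hL (h.trans hx.symm)
    exact ⟨h3 ▸ runStart_le f e p, hmax p hp h3⟩
  · have h4 : f L / 2 ^ e ≤ f p / 2 ^ e := Nat.div_le_div_right (hf L p h1 hp)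
    have h5 : f p / 2 ^ e ≤ f H / 2 ^ e := Nat.div_le_div_right (hf p H h2 hH)
    have h6 : f H / 2 ^ e = f L / 2 ^ e := by
      rw [← runStart_prefix f e H, hHL]
    omega

/-- With `l + 1` bits dropped `x` matches a run, with `l` dropped it matches no sample, so all
samples in the run differ from `x` at bit `l`. If this bit of `x` is `0`, the whole run is above `x`
and the predecessor comes just before it; otherwise the whole run is below `x` and its last element
is the predecessor. -/
theorem IsRun.pred {f : ℕ → ℕ} {N l x L H : ℕ} (hf : ∀ p q, p ≤ q → q < N → f p ≤ f q)
    (h : IsRun f N (l + 1) x L H) (hno : ∀ p < N, f p / 2 ^ l ≠ x / 2 ^ l) (h0 : f 0 ≤ x) {p : ℕ}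
    (hp : p = if x / 2 ^ l % 2 = 0 then L - 1 else H) :
    (x / 2 ^ l % 2 = 0 → 1 ≤ L) ∧ p < N ∧ f p ≤ x ∧ ∀ q < N, p < q → x < f q := by
  obtain ⟨hLH, hH, hst, hiff⟩ := h
  have hd : ∀ y, y / 2 ^ (l + 1) = y / 2 ^ l / 2 := fun y => by
    rw [pow_succ, Nat.div_div_eq_div_mul]
  have hlt : ∀ a b e, a / 2 ^ e < b / 2 ^ e → a < b := fun a b e h => by
    by_contra hc
    have : b / 2 ^ e ≤ a / 2 ^ e := Nat.div_le_div_right (by omega)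
    omega
  have hgt : ∀ q < N, H < q → x < f q := by
    intro q hq hHq
    refine hlt _ _ (l + 1) ?_
    have h1 : f H / 2 ^ (l + 1) ≤ f q / 2 ^ (l + 1) := Nat.div_le_div_right (hf H q (by omega) hq)
    have h2 := (hiff H hH).2 ⟨hLH, le_rfl⟩
    have h3 := mt (hiff q hq).1 (by omega)
    omega
  have hin : ∀ q, L ≤ q → q ≤ H → f q / 2 ^ l / 2 = x / 2 ^ l / 2 ∧ f q / 2 ^ l ≠ x / 2 ^ l := by
    intro q h1 h2
    rw [← hd, ← hd]
    exact ⟨(hiff q (by omega)).2 ⟨h1, h2⟩, hno q (by omega)⟩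
  by_cases hb : x / 2 ^ l % 2 = 0
  · rw [if_pos hb] at hp
    have hgt' : ∀ q, L ≤ q → q ≤ H → x < f q := by
      intro q h1 h2
      have := hin q h1 h2
      exact hlt _ _ l (by omega)
    have hL1 : 1 ≤ L := by
      by_contra hc
      have := hgt' 0 (by omega) (by omega)
      omega
    refine ⟨fun _ => hL1, by omega, ?_, fun q hq hpq => ?_⟩
    · refine (hlt _ _ (l + 1) ?_).le
      have h1 : f p / 2 ^ (l + 1) ≤ f L / 2 ^ (l + 1) :=
        Nat.div_le_div_right (hf p L (by omega) (by omega))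
      have h2 := (hiff L (by omega)).2 ⟨le_rfl, hLH⟩
      have h3 := mt (hiff p (by omega)).1 (by omega)
      omega
    · rcases le_or_gt q H with h | h
      · exact hgt' q (by omega) h
      · exact hgt q hq h
  · rw [if_neg hb] at hp
    subst hp
    refine ⟨fun h => absurd h hb, hH, ?_, fun q hq hpq => hgt q hq hpq⟩
    have := hin p hLH le_rfl
    exact (hlt _ _ l (by omega)).le

/-- A search structure for the samples `f p`, `p < N`, which are smaller than `2 ^ b`. -/
structure TrieOk (f : ℕ → ℕ) (ρ N b B : ℕ) (mem : ℕ → ℕ) : Prop where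
  hash : HashOk (prefixes f N (b * N)).length ρ B
    (readAt ((prefixes f N (b * N)).map (keyX f ρ N)))
    (readAt ((prefixes f N (b * N)).map (keyY f ρ N))) mem
  hL : Written mem (B + 3 * 2 ^ ρ) ((prefixes f N (b * N)).map (· % N))
  hrun : ∀ e p, p < N → e * N + p < b * N → ∃ h < N,
    mem (B + 4 * 2 ^ ρ + (e * N + runStart f e p)) = h ∧ runStart f e h = runStart f e p ∧
      ∀ p' < N, e * N + p' < b * N → runStart f e p' = runStart f e p → p' ≤ h

/-- Look for the prefix of `reg 70` without `reg 77` bits; `reg 75` is the start of the run for the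
prefix without the whole last digit. -/
def probe : Prog :=
  .assign 60 (.reg 77 * .reg 15 + .reg 75) ;;
  .assign 61 (.bin .shr (.reg 70) (.reg 77) % .reg 12) ;; hashLookup ;;
  .ite (.reg 63) (.load 73 (.reg 62 + .reg 12 * 3 + .reg 63 - 1) ;;
    .load 74 (.reg 62 + .reg 12 * 4 + .reg 77 * .reg 15 + .reg 73)) .skip

/-- The start `v` of the run for the digit-aligned prefix must be known already; with it the key of
the prefix of `x` can be formed. A hit yields a sample with this prefix by `key_inj` and
`prefix_eq_iff`. Conversely, if some sample has the prefix, then the start of its run is recorded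
with exactly this key. -/
theorem vc_probe {s : State} {f : ℕ → ℕ} {ρ N b B e x v : ℕ} (hT : TrieOk f ρ N b B s.mem)
    (hf : ∀ p q, p ≤ q → q < N → f p ≤ f q) (hρ : 0 < ρ) (hb : b * N ≤ 2 ^ ρ)
    (hS : B + 20 * 2 ^ ρ ≤ S) (hSw : S < 2 ^ w) (hw : 100 < 2 ^ w)
    (h12 : s.reg 12 = 2 ^ ρ) (h15 : s.reg 15 = N) (h62 : s.reg 62 = B) (h70 : s.reg 70 = x)
    (h75 : s.reg 75 = v) (h77 : s.reg 77 = e) (he : e < b) (hv : v < N)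
    (hvs : runStart f (digitEnd ρ e) v = v)
    (hvx : f v / 2 ^ digitEnd ρ e = x / 2 ^ digitEnd ρ e) :
    vc w S inp probe s fun t s' => t ≤ 150 ∧
      ((s'.reg 63 ≠ 0 ∧ IsRun f N e x (s'.reg 73) (s'.reg 74)) ∨
        (s'.reg 63 = 0 ∧ s'.reg 73 = s.reg 73 ∧ s'.reg 74 = s.reg 74 ∧
          ∀ p < N, f p / 2 ^ e ≠ x / 2 ^ e)) := by
  have hw0 : w ≠ 0 := by rintro rfl; omega
  obtain ⟨hH, hL, hrun⟩ := hT
  have heN : e * N + N ≤ b * N := by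
    rw [← Nat.succ_mul]; exact Nat.mul_le_mul_right _ he
  have hN : 0 < N := by omega
  have hxm : x / 2 ^ e % 2 ^ ρ < 2 ^ ρ := Nat.mod_lt _ (by positivity)
  have hmem : ∀ i < (prefixes f N (b * N)).length, ∃ c, c ∈ prefixes f N (b * N) ∧
      readAt ((prefixes f N (b * N)).map (keyX f ρ N)) i = keyX f ρ N c ∧
      readAt ((prefixes f N (b * N)).map (keyY f ρ N)) i = keyY f ρ N c ∧
      readAt ((prefixes f N (b * N)).map (· % N)) i = c % N := by
    intro i hi
    refine ⟨(prefixes f N (b * N))[i], List.getElem_mem hi, ?_, ?_, ?_⟩ <;>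
      rw [readAt_eq (by simpa using hi), List.getElem_map]
  simp only [probe, vc, Expr.Ok, Expr.val, BinOp.Ok, BinOp.val, Expr.cost, true_and, and_true,
    Expr.add_def, Expr.mul_def, Expr.mod_def, h12, h15, h75, h77, Function.update_of_ne, ne_eq,
    Nat.reduceEqDiff, not_false_eq_true, h70]
  repeat' with_reducible apply And.intro
  any_goals omega
  refine vc_conseq (vc_hashLookup (M := (prefixes f N (b * N)).length) (ρ := ρ) (B := B)
    (x := e * N + v) (y := x / 2 ^ e % 2 ^ ρ) hH hS hSw hw (by simpa) (by simp) (by simp) (by simpa)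
    (by omega) hxm) ?_
  rintro t₁ s₁ f₁ m₁ ⟨ht₁, hres⟩
  have m₁ : s₁.mem = s.mem := m₁ rfl
  have g12 : s₁.reg 12 = 2 ^ ρ := by simpa [h12] using f₁ 12 rfl
  have g15 : s₁.reg 15 = N := by simpa [h15] using f₁ 15 rfl
  have g62 : s₁.reg 62 = B := by simpa [h62] using f₁ 62 rfl
  have g73 : s₁.reg 73 = s.reg 73 := by simpa using f₁ 73 rfl
  have g74 : s₁.reg 74 = s.reg 74 := by simpa using f₁ 74 rfl
  have g77 : s₁.reg 77 = e := by simpa [h77] using f₁ 77 rfl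
  rcases hres with ⟨i, hi, hXi, hYi, h63⟩ | ⟨h63, hno⟩
  · obtain ⟨c, hc, hX, hY, hcN⟩ := hmem i hi
    have hbi : (prefixes f N (b * N)).length ≤ b * N := length_prefixes_le _ _ _
    have hcm := Nat.mod_lt c hN
    have hld := hL i (by simpa using hi)
    rw [hcN] at hld
    rw [hX] at hXi
    rw [hY] at hYi
    rw [← hvs] at hXi
    obtain ⟨hce, hcu⟩ := key_inj hf hN hv hXi
    rw [keyY, hce] at hYi
    have hpre : f (c % N) / 2 ^ e = x / 2 ^ e := (prefix_eq_iff hρ).2 ⟨hcu.trans hvx, hYi⟩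
    have hst : runStart f e (c % N) = c % N := by
      have := (List.mem_filter.1 hc).2
      rw [hce] at this
      simpa using this
    obtain ⟨h, hhN, hhm, hhs, hhmax⟩ := hrun e (c % N) hcm (by omega)
    rw [hst] at hhm hhs hhmax
    have e1 : B + 2 ^ ρ * 3 + (i + 1) - 1 = B + 3 * 2 ^ ρ + i := by omega
    have e2 : B + 2 ^ ρ * 4 + e * N + c % N = B + 4 * 2 ^ ρ + (e * N + c % N) := by omega
    have hres : IsRun f N e x (c % N) h :=
      IsRun.of_max hf hcm hhN hst hpre hhs fun p' hp' => hhmax p' hp' (by omega)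
    simp [g12, g15, g62, g77, h63, m₁, e1, hld, e2, hhm, hres]
    repeat' with_reducible apply And.intro
    all_goals omega
  · have hno' : ∀ p < N, f p / 2 ^ e ≠ x / 2 ^ e := by
      intro p hp hpx
      have hst := runStart_runStart (e := e) hf hp
      have hple := runStart_le f e p
      have hpre := (runStart_prefix f e p).trans hpx
      have hc : e * N + runStart f e p ∈ prefixes f N (b * N) := by
        refine List.mem_filter.2 ⟨List.mem_range.2 (by omega), ?_⟩
        rw [pair_div (by omega), pair_mod (by omega)]
        simpa using hst
      obtain ⟨i, hi, hic⟩ := List.mem_iff_getElem.1 hc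
      refine hno i hi ⟨?_, ?_⟩
      · rw [readAt_eq (by simpa using hi), List.getElem_map, hic, keyX, pair_div (by omega),
          pair_mod (by omega), ← hvs]
        congr 1
        refine runStart_eq hf (by omega) hv ?_
        rw [hvx]
        exact ((prefix_eq_iff hρ).1 hpre).1
      · rw [readAt_eq (by simpa using hi), List.getElem_map, hic, keyY, pair_div (by omega),
          pair_mod (by omega), hpre]
    have hno'' : ∀ p < N, ¬ f p / 2 ^ e = x / 2 ^ e := hno'
    simp [h63, g73, g74]
    exact ⟨by omega, hno''⟩

end WordRAM

/-! ### Predecessor search -/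

namespace WordRAM

variable {w S : ℕ} {inp : List ℕ}

/-- The assumptions for a search for `x` in a trie with `D` digits. -/
structure SearchOk (w S : ℕ) (f : ℕ → ℕ) (ρ N D B x : ℕ) (s : State) : Prop where
  trie : TrieOk f ρ N (D * ρ) B s.mem
  hf : ∀ p q, p ≤ q → q < N → f p ≤ f q
  hfb : ∀ p < N, f p < 2 ^ (D * ρ)
  hfx : ∀ p < N, f p ≠ x
  f0 : f 0 ≤ x
  hx : x < 2 ^ (D * ρ)
  hN : 0 < N
  hD : 0 < D
  hρ : 0 < ρ
  hb : D * ρ * N ≤ 2 ^ ρ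
  hS : B + 20 * 2 ^ ρ ≤ S
  hSw : S < 2 ^ w
  hw : 100 < 2 ^ w
  h11 : s.reg 11 = ρ
  h12 : s.reg 12 = 2 ^ ρ
  h13 : s.reg 13 = D * ρ
  h15 : s.reg 15 = N
  h62 : s.reg 62 = B
  h70 : s.reg 70 = x

theorem SearchOk.of_eq {f : ℕ → ℕ} {ρ N D B x : ℕ} {s s' : State}
    (h : SearchOk w S f ρ N D B x s) (hm : s'.mem = s.mem) (h11 : s'.reg 11 = s.reg 11)
    (h12 : s'.reg 12 = s.reg 12) (h13 : s'.reg 13 = s.reg 13) (h15 : s'.reg 15 = s.reg 15)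
    (h62 : s'.reg 62 = s.reg 62) (h70 : s'.reg 70 = s.reg 70) : SearchOk w S f ρ N D B x s' :=
  { h with
    trie := hm ▸ h.trie
    h11 := h11.trans h.h11
    h12 := h12.trans h.h12
    h13 := h13.trans h.h13
    h15 := h15.trans h.h15
    h62 := h62.trans h.h62
    h70 := h70.trans h.h70 }

/-- Descend in the trie by whole digits. -/
def descend : Prog :=
  .assign 71 (.reg 13) ;; .assign 72 (.reg 13 - .reg 11) ;; .assign 73 0 ;;
  .assign 74 (.reg 15 - 1) ;; .assign 75 0 ;; .assign 76 1 ;;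
  .loop (.reg 76) (.assign 77 (.reg 72) ;; probe ;;
    .ite (.reg 63) (.assign 71 (.reg 72) ;; .assign 72 (.reg 72 - .reg 11) ;; .assign 75 (.reg 73))
      (.assign 76 0))

theorem digitEnd_mul {ρ i e : ℕ} (h1 : i * ρ ≤ e) (h2 : e < (i + 1) * ρ) :
    digitEnd ρ e = (i + 1) * ρ := by
  have : e / ρ = i := by
    rw [Nat.div_eq_of_lt_le h1 h2]
  rw [digitEnd, this]

/-- At the top all bits are dropped and every sample matches. Each hit at a digit boundary supplies
the run start that the next probe needs. -/
theorem vc_descend {f : ℕ → ℕ} {ρ N D B x : ℕ} {s : State} (h : SearchOk w S f ρ N D B x s) :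
    vc w S inp descend s fun t s' => t ≤ D * 200 + 40 ∧ ∃ i < D, s'.reg 71 = (i + 1) * ρ ∧
      s'.reg 72 = i * ρ ∧ IsRun f N ((i + 1) * ρ) x (s'.reg 73) (s'.reg 74) ∧
      s'.reg 75 = s'.reg 73 ∧ ∀ p < N, f p / 2 ^ (i * ρ) ≠ x / 2 ^ (i * ρ) := by
  have hh := h
  obtain ⟨hT, hf, hfb, hfx, f0, hx, hN, hD, hρ, hb, hS, hSw, hw, h11, h12, h13, h15, h62, h70⟩ := hh
  have hw0 : w ≠ 0 := by rintro rfl; omega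
  have hDN : D * ρ ≤ D * ρ * N := Nat.le_mul_of_pos_right _ hN
  have hDN' : N ≤ D * ρ * N := Nat.le_mul_of_pos_left _ (by positivity)
  have hDρ : D * ρ - ρ = (D - 1) * ρ := by rw [Nat.sub_mul, one_mul]
  have hρD : ρ ≤ D * ρ := Nat.le_mul_of_pos_left _ hD
  simp only [descend, vc, Expr.Ok, Expr.val, BinOp.Ok, BinOp.val, Expr.cost, true_and, ne_eq,
    Nat.reduceEqDiff, not_false_eq_true, Function.update_of_ne, h11, h13, h15,
    Expr.sub_def, Expr.ofNat_def]
  repeat' with_reducible apply And.intro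
  any_goals omega
  refine vc_loop (fun t s' => ∃ i < D, s'.reg 71 = (i + 1) * ρ ∧
      s'.reg 72 = i * ρ ∧ IsRun f N ((i + 1) * ρ) x (s'.reg 73) (s'.reg 74) ∧
      s'.reg 75 = s'.reg 73 ∧ s'.mem = s.mem ∧
      ((s'.reg 76 = 1 ∧ t + 200 * (i + 1) ≤ 200 * D) ∨
      (s'.reg 76 = 0 ∧ t ≤ 200 * D ∧ ∀ p < N, f p / 2 ^ (i * ρ) ≠ x / 2 ^ (i * ρ))))
    (fun s' => s'.reg 71 + s'.reg 76) ?_ ?_ ?_ ?_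
  · refine ⟨D - 1, by omega, ?_⟩
    have hD1 : D - 1 + 1 = D := by omega
    rw [hD1]
    simp [hDρ]
    refine ⟨by omega, by omega, rfl, fun p hp => ?_⟩
    rw [Nat.div_eq_of_lt (hfb p hp), Nat.div_eq_of_lt hx]
    omega
  · intro t s' _ _
    trivial
  · rintro t s₁ hfr ⟨i, hi, h71, h72, hrun, h75, hm, hor⟩ hne
    simp only [Expr.val] at hne
    obtain ⟨h76, ht⟩ : s₁.reg 76 = 1 ∧ t + 200 * (i + 1) ≤ 200 * D := by
      rcases hor with h | h
      · exact h
      · exact absurd h.1 hne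
    have k11 : s₁.reg 11 = ρ := by simpa [h11] using hfr 11 rfl
    have k12 : s₁.reg 12 = 2 ^ ρ := by simpa [h12] using hfr 12 rfl
    have k15 : s₁.reg 15 = N := by simpa [h15] using hfr 15 rfl
    have k62 : s₁.reg 62 = B := by simpa [h62] using hfr 62 rfl
    have k70 : s₁.reg 70 = x := by simpa [h70] using hfr 70 rfl
    have hiD : i * ρ + ρ ≤ D * ρ := by
      rw [← Nat.succ_mul]; exact Nat.mul_le_mul_right _ hi
    have hi1 : (i + 1) * ρ = i * ρ + ρ := by ring
    have hde : digitEnd ρ (i * ρ) = (i + 1) * ρ := digitEnd_mul le_rfl (by omega)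
    have hvN : s₁.reg 73 < N := lt_of_le_of_lt hrun.hL hrun.hH
    simp only [vc, Expr.Ok, Expr.val, true_and, Expr.cost, BinOp.Ok, BinOp.val]
    refine vc_conseq (vc_probe (e := i * ρ) (b := D * ρ) (v := s₁.reg 73) (hm ▸ hT) hf hρ hb hS hSw
      hw (by simpa) (by simpa) (by simpa) (by simpa) (by simpa) (by simpa) (by omega) hvN
      (by rw [hde]; exact hrun.start)
      (by rw [hde]; exact (hrun.iff _ hvN).2 ⟨le_rfl, hrun.hL⟩)) ?_
    rintro t₂ s₂ f₂ m₂ ⟨ht₂, hres⟩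
    have m₂ : s₂.mem = s₁.mem := m₂ rfl
    have g11 : s₂.reg 11 = ρ := by simpa [k11] using f₂ 11 rfl
    have g71 : s₂.reg 71 = (i + 1) * ρ := by simpa [h71] using f₂ 71 rfl
    have g72 : s₂.reg 72 = i * ρ := by simpa [h72] using f₂ 72 rfl
    have g75 : s₂.reg 75 = s₁.reg 73 := by simpa [h75] using f₂ 75 rfl
    have g76 : s₂.reg 76 = 1 := by simpa [h76] using f₂ 76 rfl
    rcases hres with ⟨h63, hrun'⟩ | ⟨h63, h73, h74, hno⟩
    -- A hit with no bits dropped would make `x` a sample, which `hfx` excludes; so the descent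
    -- stops with a miss.
    · have hi0 : i ≠ 0 := by
        rintro rfl
        rw [Nat.zero_mul] at hrun'
        have := (hrun'.iff (s₂.reg 73) (lt_of_le_of_lt hrun'.hL hrun'.hH)).2 ⟨le_rfl, hrun'.hL⟩
        simp only [pow_zero, Nat.div_one] at this
        exact hfx _ (lt_of_le_of_lt hrun'.hL hrun'.hH) this
      obtain ⟨j, rfl⟩ := Nat.exists_eq_succ_of_ne_zero hi0
      have hj : (j + 1) * ρ - ρ = j * ρ := by rw [Nat.add_mul, one_mul, Nat.add_sub_cancel]
      have hj' : (j + 1) * ρ = j * ρ + ρ := by ring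
      simp only [Nat.succ_eq_add_one] at *
      refine ⟨fun _ => ?_, fun h => absurd h h63⟩
      simp only [Function.update_self, Function.update_of_ne, ne_eq, Nat.reduceEqDiff,
        not_false_eq_true, g11, g72, g76, hj]
      exact ⟨by omega, ⟨j, by omega, rfl, rfl, hrun', trivial, by rw [m₂, hm],
        Or.inl ⟨trivial, by omega⟩⟩, by omega⟩
    · refine ⟨fun h => absurd h63 h, fun _ => ?_⟩
      simp only [Function.update_of_ne, ne_eq, Nat.reduceEqDiff, not_false_eq_true] at h73 h74
      simp only [Function.update_self, Function.update_of_ne, ne_eq, Nat.reduceEqDiff,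
        not_false_eq_true, g71, g72, g75, h71, h76]
      exact ⟨by omega, ⟨i, hi, rfl, rfl, by rw [h73, h74]; exact hrun, h73.symm, by rw [m₂, hm],
        Or.inr ⟨trivial, by omega, hno⟩⟩, by omega⟩
  · rintro t s₁ _ ⟨i, hi, h71, h72, hrun, h75, hm, hor⟩ h0
    simp only [Expr.val] at h0
    rcases hor with h | ⟨_, ht, hno⟩
    · omega
    · exact ⟨by simp only [Expr.cost]; omega, i, hi, h71, h72, hrun, h75, hno⟩

/-- Find the last sample which is smaller than `reg 70`. -/
def predSample : Prog :=
  descend ;;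
  .loop (.bin .lt (.reg 72 + 1) (.reg 71)) (.assign 77 ((.reg 72 + .reg 71) / 2) ;; probe ;;
    .ite (.reg 63) (.assign 71 (.reg 77)) (.assign 72 (.reg 77))) ;;
  .ite (.bin .shr (.reg 70) (.reg 72) % 2) (.assign 78 (.reg 74)) (.assign 78 (.reg 73 - 1))

/-- Between the last hit and the first miss lies one digit, and the longest matching prefix is found
by bisection over its `ρ` bits. All these probes have the same digit boundary above them, so they
share the run start in register `75`. -/
theorem vc_predSample {f : ℕ → ℕ} {ρ N D B x : ℕ} {s : State} (h : SearchOk w S f ρ N D B x s) :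
    vc w S inp predSample s fun t s' => t ≤ D * 200 + Nat.clog 2 ρ * 200 + 100 ∧
      s'.reg 78 < N ∧ f (s'.reg 78) ≤ x ∧ ∀ q < N, s'.reg 78 < q → x < f q := by
  refine vc_seq (vc_descend h) ?_
  rintro t₁ s₁ f₁ m₁ ⟨ht₁, i, hi, h71, h72, hrun, h75, hno⟩
  have h₁ := h.of_eq (m₁ rfl) (f₁ 11 rfl) (f₁ 12 rfl) (f₁ 13 rfl) (f₁ 15 rfl) (f₁ 62 rfl)
    (f₁ 70 rfl)
  clear f₁ m₁
  have hh := h₁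
  obtain ⟨hT, hf, hfb, hfx, f0, hx, hN, hD, hρ, hb, hS, hSw, hw, h11, h12, h13, h15, h62, h70⟩ := hh
  have hw0 : w ≠ 0 := by rintro rfl; omega
  have hDN : D * ρ ≤ D * ρ * N := Nat.le_mul_of_pos_right _ hN
  have hDN' : N ≤ D * ρ * N := Nat.le_mul_of_pos_left _ (by positivity)
  have hiD : i * ρ + ρ ≤ D * ρ := by
    rw [← Nat.succ_mul]; exact Nat.mul_le_mul_right _ hi
  have hi1 : (i + 1) * ρ = i * ρ + ρ := by ring
  have hvN : s₁.reg 73 < N := lt_of_le_of_lt hrun.hL hrun.hH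
  -- The right end always matches, with its run in registers `73` and `74`; the left end never does.
  refine vc_seq (vc_bisect 180 (fun l r s' => IsRun f N r x (s'.reg 73) (s'.reg 74) ∧
    s'.mem = s₁.mem ∧ ∀ p < N, f p / 2 ^ l ≠ x / 2 ^ l) h72 h71 (by omega) (by omega) (by omega)
    ⟨hrun, rfl, hno⟩ ?_ (Q := fun t s' => t ≤ Nat.clog 2 ρ * 186 + 6 ∧
      ∃ l < (i + 1) * ρ, s'.reg 72 = l ∧ IsRun f N (l + 1) x (s'.reg 73) (s'.reg 74) ∧
      ∀ p < N, f p / 2 ^ l ≠ x / 2 ^ l) ?_) ?_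
  · rintro l r s₂ f₂ k72 k71 hl hlr hr ⟨hrun₂, hm, hno₂⟩
    have k12 := (f₂ 12 rfl).trans h12
    have k15 := (f₂ 15 rfl).trans h15
    have k62 := (f₂ 62 rfl).trans h62
    have k70 := (f₂ 70 rfl).trans h70
    have k75 := (f₂ 75 rfl).trans h75
    have hde : digitEnd ρ ((l + r) / 2) = (i + 1) * ρ := digitEnd_mul (by omega) (by omega)
    simp only [vc, Expr.div_def, Expr.add_def, Expr.ofNat_def, Expr.Ok, Expr.val, BinOp.val, BinOp.Ok,
      Expr.cost, true_and, k71, k72]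
    refine ⟨⟨by omega, by omega, trivial⟩, ?_⟩
    refine vc_conseq (vc_probe (e := (l + r) / 2) (b := D * ρ) (v := s₁.reg 73)
      (by simpa [hm] using hT) hf hρ hb hS hSw
      hw (by simpa) (by simpa) (by simpa) (by simpa) (by simpa) (by simp) (by omega) hvN
      (by rw [hde]; exact hrun.start)
      (by rw [hde]; exact (hrun.iff _ hvN).2 ⟨le_rfl, hrun.hL⟩)) ?_
    rintro t₃ s₃ f₃ m₃ ⟨ht₃, hres⟩
    have m₃ : s₃.mem = s₂.mem := m₃ rfl
    have g71 : s₃.reg 71 = r := by simpa [k71] using f₃ 71 rfl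
    have g72 : s₃.reg 72 = l := by simpa [k72] using f₃ 72 rfl
    have g77 : s₃.reg 77 = (l + r) / 2 := by simpa using f₃ 77 rfl
    rcases hres with ⟨h63, hrun'⟩ | ⟨h63, h73, h74, hno'⟩
    · refine ⟨fun _ => ⟨by omega, Or.inl ?_⟩, fun h => absurd h h63⟩
      simp [g72, g77]
      exact ⟨hrun', m₃.trans hm, hno₂⟩
    · refine ⟨fun h => absurd h63 h, fun _ => ⟨by omega, Or.inr ?_⟩⟩
      simp only [Function.update_of_ne, ne_eq, Nat.reduceEqDiff, not_false_eq_true] at h73 h74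
      simp [g71, g77]
      exact ⟨by rw [h73, h74]; exact hrun₂, m₃.trans hm, hno'⟩
  · rintro t l s₂ f₂ k72 k71 hl hr ⟨hrun₂, hm, hno₂⟩ ht
    have : (i + 1) * ρ - i * ρ = ρ := by omega
    rw [this] at ht
    exact ⟨ht, l, by omega, k72, hrun₂, hno₂⟩
  · rintro t₂ s₂ f₂ m₂ ⟨ht₂, l, hl, k72, hrun₂, hno₂⟩
    have k70 := (f₂ 70 rfl).trans h70
    obtain ⟨p1, p2, p3, p4⟩ := hrun₂.pred hf hno₂ f0 rfl
    simp only [vc, Expr.sub_def, Expr.ofNat_def, Expr.Ok, Expr.val, BinOp.val, BinOp.Ok,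
      Expr.cost, true_and, k70, k72, Function.update_self]
    have hLN : s₂.reg 73 < N := lt_of_le_of_lt hrun₂.hL hrun₂.hH
    refine ⟨⟨by omega, trivial⟩, fun hb => ?_, fun hb => ?_⟩
    · rw [if_neg hb] at p2 p3 p4
      exact ⟨by omega, p2, p3, p4⟩
    · rw [if_pos hb] at p2 p3 p4
      exact ⟨⟨by omega, p1 hb, by omega⟩, by omega, p2, p3, p4⟩

/-- Bisection between the indices `reg 81` and `reg 82` of the array at `reg 62`. -/
def keySearch : Prog :=
  .loop (.bin .lt (.reg 81 + 1) (.reg 82)) (.assign 83 ((.reg 81 + .reg 82) / 2) ;;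
    .load 84 (.reg 62 + .reg 83) ;;
    .ite (.bin .lt (.reg 70) (.reg 84)) (.assign 82 (.reg 83)) (.assign 81 (.reg 83)))

theorem readAt_mono {A : List ℕ} (hs : A.Pairwise (· ≤ ·)) {i j : ℕ} (hij : i ≤ j)
    (hj : j < A.length) : readAt A i ≤ readAt A j := by
  rw [readAt_eq hj, readAt_eq (by omega)]
  rcases eq_or_lt_of_le hij with rfl | h
  · exact le_rfl
  · exact List.pairwise_iff_getElem.1 hs i j (by omega) hj h

theorem vc_keySearch {s : State} {A : List ℕ} {B x l₀ r₀ : ℕ} (h62 : s.reg 62 = B)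
    (h70 : s.reg 70 = x) (h81 : s.reg 81 = l₀) (h82 : s.reg 82 = r₀)
    (hA : Written s.mem B A) (hs : A.Pairwise (· ≤ ·)) (hlr : l₀ < r₀) (hr : r₀ ≤ A.length)
    (hlx : readAt A l₀ ≤ x) (hrx : r₀ < A.length → x < readAt A r₀) (hS : B + A.length ≤ S)
    (hSw : S < 2 ^ w) (hw : 100 < 2 ^ w) (hAw : A.length + A.length < 2 ^ w) :
    vc w S inp keySearch s fun t s' => t ≤ Nat.clog 2 (r₀ - l₀) * 40 + 6 ∧ s'.reg 81 < A.length ∧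
      readAt A (s'.reg 81) ≤ x ∧ ∀ i, s'.reg 81 < i → i < A.length → x < readAt A i := by
  refine vc_bisect 34 (fun l r s' => s'.mem = s.mem ∧ readAt A l ≤ x ∧
    (r < A.length → x < readAt A r)) h81 h82 (by omega) (by omega) (by omega) ⟨rfl, hlx, hrx⟩ ?_ ?_
  · rintro l r s₂ f₂ g81 g82 hl hlr' hr' ⟨m₂, i1, i2⟩
    have g62 := (f₂ 62 rfl).trans h62
    have g70 := (f₂ 70 rfl).trans h70
    have hld : s.mem (B + (l + r) / 2) = readAt A ((l + r) / 2) := hA _ (by omega)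
    simp only [vc, Expr.div_def, Expr.add_def, Expr.ofNat_def, Expr.Ok, Expr.val, BinOp.val, BinOp.Ok,
      Expr.cost, true_and, g81, g82, g62, g70, m₂, hld, Function.update_self, Function.update_of_ne,
      ne_eq, Nat.reduceEqDiff, not_false_eq_true, ltVal_eq_zero]
    refine ⟨⟨by omega, by omega, trivial⟩, by omega, by omega, fun hx => ?_, fun hx => ?_⟩
    · exact ⟨by omega, Or.inl ⟨i1, fun _ => by omega⟩⟩
    · exact ⟨by omega, Or.inr ⟨hx, i2⟩⟩
  · rintro t l s₂ f₂ g81 g82 hl hr' ⟨m₂, i1, i2⟩ ht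
    rw [g81]
    refine ⟨by omega, by omega, i1, fun i hi hi' => ?_⟩
    exact lt_of_lt_of_le (i2 (by omega)) (readAt_mono hs hi hi')

/-- Find the last element of the array at `reg 62` which is not larger than `reg 70`. -/
def predKey : Prog :=
  .assign 81 (.reg 78 * .reg 14) ;; .assign 82 (.reg 81 + .reg 14) ;;
  .ite (.bin .lt (.reg 22) (.reg 82)) (.assign 82 (.reg 22)) .skip ;; keySearch

/-- Once the last sample not above `x` is known, only the `d` keys up to the next sample are left,
cut off at the end of the array. -/
theorem vc_predKey {s : State} {A : List ℕ} {B d x p : ℕ} (h14 : s.reg 14 = d)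
    (h22 : s.reg 22 = A.length) (h62 : s.reg 62 = B) (h70 : s.reg 70 = x) (h78 : s.reg 78 = p)
    (hA : Written s.mem B A) (hs : A.Pairwise (· ≤ ·)) (hd : 0 < d) (hp : p * d < A.length)
    (hpx : readAt A (p * d) ≤ x)
    (hnext : (p + 1) * d < A.length → x < readAt A ((p + 1) * d)) (hS : B + A.length ≤ S)
    (hSw : S < 2 ^ w) (hw : 100 < 2 ^ w) (hAw : A.length + A.length < 2 ^ w)
    (hdw : A.length + d < 2 ^ w) :
    vc w S inp predKey s fun t s' => t ≤ Nat.clog 2 d * 40 + 50 ∧ s'.reg 81 < A.length ∧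
      readAt A (s'.reg 81) ≤ x ∧ ∀ i, s'.reg 81 < i → i < A.length → x < readAt A i := by
  have hp1 : (p + 1) * d = p * d + d := by ring
  rw [hp1] at hnext
  simp only [predKey, vc, Expr.mul_def, Expr.add_def, Expr.Ok, Expr.val, BinOp.val,
    BinOp.Ok, Expr.cost, true_and, ne_eq, Nat.reduceEqDiff, not_false_eq_true,
    Function.update_of_ne, Function.update_self, h14, h22, h78, ltVal_eq_zero]
  refine ⟨by omega, by omega, fun hlt => ?_, fun hle => ?_⟩
  · refine vc_conseq (vc_keySearch (A := A) (B := B) (x := x) (l₀ := p * d) (r₀ := A.length)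
      (by simpa) (by simpa) (by simp) (by simp) hA hs hp le_rfl hpx (by omega) hS hSw hw hAw) ?_
    rintro t s' _ _ ⟨ht, hres⟩
    have := Nat.mul_le_mul_right 40 (Nat.clog_mono_right 2 (show A.length - p * d ≤ d by omega))
    exact ⟨by omega, hres⟩
  · refine vc_conseq (vc_keySearch (A := A) (B := B) (x := x) (l₀ := p * d) (r₀ := p * d + d)
      (by simpa) (by simpa) (by simp) (by simp) hA hs (by omega) hle hpx hnext hS hSw hw hAw) ?_
    rintro t s' _ _ ⟨ht, hres⟩
    rw [Nat.add_sub_cancel_left] at ht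
    exact ⟨by omega, hres⟩

end WordRAM

/-! ### The search structure of a block -/

namespace WordRAM

/-- The key of the position with number `j ≥ 1` in block `k`: the letter at this position followed
by `2 * j`, with `h` bits. -/
def blockKey (L : List ℕ) (ℓ h k j : ℕ) : ℕ :=
  if j = 0 ∨ k * ℓ + (j - 1) = 0 ∨ L.length < k * ℓ + (j - 1) then 0
  else readAt L (L.length - (k * ℓ + (j - 1))) * 2 ^ h + 2 * j

def blockKeys (L : List ℕ) (ℓ h k : ℕ) : List ℕ := (List.range (ℓ + 1)).map (blockKey L ℓ h k)

theorem readAt_blockKeys {L : List ℕ} {ℓ h k j : ℕ} (hj : j ≤ ℓ) :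
    readAt (blockKeys L ℓ h k) j = blockKey L ℓ h k j := by
  rw [readAt_eq (by simp [blockKeys]; omega)]
  simp [blockKeys]

theorem readAt_lt {L : List ℕ} {σ i : ℕ} (hσ : 0 < σ) (hL : ∀ a ∈ L, a < σ) : readAt L i < σ := by
  rcases lt_or_ge i L.length with h | h
  · rw [readAt_eq h]
    exact hL _ (List.getElem_mem h)
  · rw [readAt, List.getD_eq_default _ _ h]
    exact hσ

theorem blockKey_lt {L : List ℕ} {ℓ h k j σ : ℕ} (hσ : 0 < σ) (hL : ∀ a ∈ L, a < σ) (hj : j ≤ ℓ)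
    (hℓ : 2 * ℓ + 1 < 2 ^ h) : blockKey L ℓ h k j < σ * 2 ^ h := by
  have hpos : 0 < σ * 2 ^ h := by positivity
  unfold blockKey
  split_ifs
  · exact hpos
  · have h1 := readAt_lt (i := L.length - (k * ℓ + (j - 1))) hσ hL
    have h2 : (readAt L (L.length - (k * ℓ + (j - 1))) + 1) * 2 ^ h ≤ σ * 2 ^ h :=
      Nat.mul_le_mul_right _ h1
    rw [Nat.add_mul] at h2
    omega

/-- Queries use odd keys, so a query key never equals a sample; the descent relies on this. -/
theorem blockKey_even {L : List ℕ} {ℓ h k j : ℕ} : blockKey L ℓ (h + 1) k j % 2 = 0 := by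
  unfold blockKey
  split_ifs
  · rfl
  · rw [pow_succ, ← mul_assoc]
    omega

theorem blockKey_succ_of_pos {L : List ℕ} {ℓ h k i : ℕ} (h1 : k * ℓ + i ≠ 0)
    (h2 : k * ℓ + i ≤ L.length) :
    blockKey L ℓ h k (i + 1) = readAt L (L.length - (k * ℓ + i)) * 2 ^ h + (i + 1) * 2 := by
  simp only [blockKey, Nat.add_sub_cancel]
  rw [if_neg (by omega), mul_comm 2]

theorem blockKey_succ_of_not {L : List ℕ} {ℓ h k i : ℕ}
    (h1 : k * ℓ + i = 0 ∨ L.length < k * ℓ + i) : blockKey L ℓ h k (i + 1) = 0 := by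
  simp only [blockKey, Nat.add_sub_cancel]
  rw [if_pos (by omega)]

/-- Write the keys of the block which starts at position `reg 27` to the array at `reg 23`. -/
def fillBlock : Prog :=
  forUp 43 10 (.assign 44 (.reg 27 + .reg 43) ;;
    .ite (.reg 44) (.ite (.bin .lt (.reg 0) (.reg 44)) .skip
      (.read 45 (.reg 0 - .reg 44) ;;
        .store (.reg 23 + .reg 43 + 1) (.reg 45 * .reg 17 + (.reg 43 + 1) * 2))) .skip)

variable {w S : ℕ} {L : List ℕ}

theorem vc_fillBlock {s : State} {ℓ h k P σ : ℕ} (hσ : 0 < σ) (hL : ∀ a ∈ L, a < σ)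
    (hℓ : 2 * ℓ + 1 < 2 ^ h) (hw : 100 < 2 ^ w) (hkey : σ * 2 ^ h < 2 ^ w)
    (hr : k * ℓ + ℓ < 2 ^ w) (hn : L.length < 2 ^ w)
    (h0 : s.reg 0 = L.length) (h10 : s.reg 10 = ℓ) (h17 : s.reg 17 = 2 ^ h) (h23 : s.reg 23 = P)
    (h27 : s.reg 27 = k * ℓ) (hS : P + ℓ + 1 ≤ S) (hSw : S < 2 ^ w)
    (hz : ∀ i ≤ ℓ, s.mem (P + i) = 0) :
    vc w S L fillBlock s fun t s' => t ≤ ℓ * 60 + 6 ∧ Written s'.mem P (blockKeys L ℓ h k) ∧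
      ∀ c, (c < P ∨ P + ℓ + 1 ≤ c) → s'.mem c = s.mem c := by
  have hw0 : w ≠ 0 := by rintro rfl; omega
  have h2h : 2 ^ h ≤ σ * 2 ^ h := Nat.le_mul_of_pos_left _ hσ
  refine vc_forUp_le 52 (fun i s' => (∀ j ≤ i, s'.mem (P + j) = blockKey L ℓ h k j) ∧
    (∀ j, i < j → j ≤ ℓ → s'.mem (P + j) = 0) ∧
    ∀ c, (c < P ∨ P + ℓ + 1 ≤ c) → s'.mem c = s.mem c) (by decide) rfl rfl (by omega) (by omega)
    ⟨?_, fun j _ hj => hz j hj, fun _ _ => rfl⟩ ?_ ?_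
  · intro j hj
    obtain rfl : j = 0 := by omega
    rw [hz 0 (by omega)]
    simp [blockKey]
  · rintro i s' hi h43 hf ⟨hk1, hk2, ho⟩
    rw [h10] at hi
    have f0 := (hf 0 (by decide) rfl).trans h0
    have f17 := (hf 17 (by decide) rfl).trans h17
    have f23 := (hf 23 (by decide) rfl).trans h23
    have f27 := (hf 27 (by decide) rfl).trans h27
    have hkeylt := blockKey_lt (k := k) (j := i + 1) hσ hL (by omega) hℓ
    simp only [vc, Expr.add_def, Expr.sub_def, Expr.ofNat_def, Expr.Ok,
      Expr.val, BinOp.Ok, BinOp.val, Expr.cost, true_and, Function.update_self, Function.update_of_ne,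
      ne_eq, Nat.reduceEqDiff, not_false_eq_true, f0, f17, f23, f27, h43, ltVal_eq_zero, not_le]
    refine ⟨by omega, fun hne => ⟨fun hlt => ?_, fun hle => ?_⟩, fun heq => ?_⟩
    · refine ⟨by omega, fun j hj => ?_, fun j h1 h2 => hk2 j (by omega) h2, ho⟩
      rcases eq_or_lt_of_le hj with rfl | hj
      · rw [hk2 _ (by omega) (by omega), blockKey_succ_of_not (by omega)]
      · exact hk1 j (by omega)
    · have hlt : readAt L (L.length - (k * ℓ + i)) * 2 ^ h + (i + 1) * 2 < σ * 2 ^ h := by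
        rwa [blockKey_succ_of_pos hne hle] at hkeylt
      repeat' with_reducible apply And.intro
      any_goals omega
      · intro j hj
        rcases eq_or_lt_of_le hj with rfl | hj
        · rw [← add_assoc, Function.update_self, blockKey_succ_of_pos hne hle]
        · rw [Function.update_of_ne (by omega)]
          exact hk1 j (by omega)
      · intro j h1 h2
        rw [Function.update_of_ne (by omega)]
        exact hk2 j (by omega) h2
      · intro c hc
        rw [Function.update_of_ne (by omega), ho c hc]
    · refine ⟨by omega, fun j hj => ?_, fun j h1 h2 => hk2 j (by omega) h2, ho⟩
      rcases eq_or_lt_of_le hj with rfl | hj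
      · rw [hk2 _ (by omega) (by omega), blockKey_succ_of_not (by omega)]
      · exact hk1 j (by omega)
  · rintro t s' ht _ _ ⟨hk1, _, ho⟩
    rw [h10] at ht hk1
    refine ⟨by omega, fun j hj => ?_, ho⟩
    have hj' : j ≤ ℓ := by simp [blockKeys] at hj; omega
    rw [readAt_blockKeys hj', hk1 j hj']

/-- The numbers which describe the data structure. -/
structure SizeOk (w S ρ D ℓ h N d σ : ℕ) : Prop where
  hD : 0 < D
  hρ : 0 < ρ
  hσ : 0 < σ
  hd : d = D * ρ * ρ
  hℓ : 0 < ℓ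
  hh : 2 * ℓ + 1 < 2 ^ (h + 1)
  hkey : σ * 2 ^ (h + 1) ≤ 2 ^ (D * ρ)
  hkw : 2 ^ (D * ρ) < 2 ^ w
  hℓR : ℓ < 2 ^ ρ
  hN : N = ℓ / d + 1
  hM : 2 * (D * ρ * N) < 2 ^ ρ
  hMt : (ρ + 1) * (D * ρ * N + 1) ≤ 4 * 2 ^ ρ
  hSw : S < 2 ^ w
  hw : 100 < 2 ^ w
  hRR : 2 ^ ρ * 2 ^ ρ < 2 ^ w

/-- The samples of a sorted list. -/
def sample (A : List ℕ) (d p : ℕ) : ℕ := readAt A (p * d)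

/-- The search structure for a block. -/
structure BlockOk (ρ D ℓ N d B : ℕ) (keys : List ℕ) (mem : ℕ → ℕ) : Prop where
  ex : ∃ A : List ℕ, A.Perm keys ∧ A.Pairwise (· ≤ ·) ∧ Written mem B A ∧
    TrieOk (sample A d) ρ N (D * ρ) B mem

theorem sample_mono {A : List ℕ} {d N ℓ : ℕ} (hA : A.Pairwise (· ≤ ·)) (hl : A.length = ℓ + 1)
    (hN : N = ℓ / d + 1) : (∀ p < N, p * d < A.length) ∧
      ∀ p q, p ≤ q → q < N → sample A d p ≤ sample A d q := by
  have h : ∀ p < N, p * d < A.length := by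
    intro p hp
    have h1 : p * d ≤ ℓ / d * d := Nat.mul_le_mul_right _ (by omega)
    have h2 := Nat.div_mul_le_self ℓ d
    omega
  exact ⟨h, fun p q hpq hq => readAt_mono hA (Nat.mul_le_mul_right _ hpq) (h q hq)⟩

/-- Build the search structure for the block which starts at position `reg 27` in the memory from
`reg 23` on. -/
def buildBlock (D : ℕ) : Prog :=
  fillBlock ;; .assign 32 (.reg 10 + 1) ;; radixSortProg D ;; makeItems ;; buildHash

/-- The first `5 * D * 2 ^ ρ` words are used up by radix sort, and the sorted keys end up as array
`0` of the search structure behind them. Everything there beyond the keys is still zero, as the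
later phases require. -/
theorem vc_buildBlock {s : State} {ρ D ℓ h N d k P σ : ℕ} (hZ : SizeOk w S ρ D ℓ h N d σ)
    (hL : ∀ a ∈ L, a < σ) (hr : k * ℓ + ℓ < 2 ^ w) (hn : L.length < 2 ^ w)
    (h0 : s.reg 0 = L.length) (h10 : s.reg 10 = ℓ) (h11 : s.reg 11 = ρ) (h12 : s.reg 12 = 2 ^ ρ)
    (h13 : s.reg 13 = D * ρ) (h14 : s.reg 14 = d) (h15 : s.reg 15 = N)
    (h17 : s.reg 17 = 2 ^ (h + 1)) (h23 : s.reg 23 = P) (h27 : s.reg 27 = k * ℓ)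
    (hS : P + (5 * D + 20) * 2 ^ ρ ≤ S)
    (hz : ∀ c, P ≤ c → c < P + (5 * D + 20) * 2 ^ ρ → s.mem c = 0) :
    vc w S L (buildBlock D) s fun t s' => t ≤ (D + 20) * 1000 * 2 ^ ρ ∧
      BlockOk ρ D ℓ N d (P + 5 * D * 2 ^ ρ) (blockKeys L ℓ (h + 1) k) s'.mem ∧
      ∀ c, (c < P ∨ P + (5 * D + 20) * 2 ^ ρ ≤ c) → s'.mem c = s.mem c := by
  obtain ⟨hD, hρ, hσ, hd, hℓ, hh, hkey, hkw, hℓR, hN, hM, hMt, hSw, hw, hRR⟩ := hZ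
  have hw0 : w ≠ 0 := by rintro rfl; omega
  have hR : 0 < 2 ^ ρ := by positivity
  have eZ : (5 * D + 20) * 2 ^ ρ = 5 * D * 2 ^ ρ + 20 * 2 ^ ρ := by ring
  have eZ' : (5 * D + 1) * 2 ^ ρ = 5 * D * 2 ^ ρ + 1 * 2 ^ ρ := by ring
  rw [eZ] at hS hz ⊢
  refine vc_seq (vc_fillBlock (h := h + 1) (k := k) (P := P) (ℓ := ℓ) hσ hL hh hw (by omega) hr hn h0
    h10 h17 h23 h27 (by omega) hSw fun i hi => hz _ (by omega) (by omega)) ?_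
  rintro t₁ s₁ f₁ - ⟨ht₁, w₁, o₁⟩
  have hlen : (blockKeys L ℓ (h + 1) k).length = ℓ + 1 := by simp [blockKeys]
  have g10 := (f₁ 10 rfl).trans h10
  have g11 := (f₁ 11 rfl).trans h11
  have g12 := (f₁ 12 rfl).trans h12
  have g13 := (f₁ 13 rfl).trans h13
  have g14 := (f₁ 14 rfl).trans h14
  have g15 := (f₁ 15 rfl).trans h15
  have g23 := (f₁ 23 rfl).trans h23
  clear f₁
  refine vc_seq (Q' := fun t s' => t = 4 ∧ s' = ⟨Function.update s₁.reg 32 (ℓ + 1), s₁.mem⟩) ?_ ?_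
  · simp only [vc, Expr.Ok, Expr.val, BinOp.Ok, BinOp.val, Expr.cost, true_and, g10]
    exact ⟨by omega, trivial⟩
  rintro _ _ - - ⟨rfl, rfl⟩
  have hkeys : ∀ a ∈ blockKeys L ℓ (h + 1) k, a < (2 ^ ρ) ^ D := by
    intro a ha
    simp only [blockKeys, List.mem_map, List.mem_range] at ha
    obtain ⟨j, hj, rfl⟩ := ha
    rw [← pow_mul, mul_comm ρ D]
    exact lt_of_lt_of_le (blockKey_lt hσ hL (by omega) hh) hkey
  have hDρ : D * ρ < 2 ^ w := lt_of_lt_of_le Nat.lt_two_pow_self hkw.le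
  refine vc_seq (vc_radixSortProg (d := D) (p := P) (ρ := ρ) (L := blockKeys L ℓ (h + 1) k) (by simpa)
    (by simpa) (by simpa) (by simp [hlen]) w₁ (by omega) (by omega) hSw hw hDρ
    fun c h1 h2 => ?_) ?_
  · simp only
    rw [o₁ _ (by omega), hz _ (by omega) (by omega)]
  rintro t₂ s₂ f₂ - ⟨ht₂, k23, w₂, o₂⟩
  simp only at o₂
  have k11 : s₂.reg 11 = ρ := by simpa [g11] using f₂ 11 rfl
  have k12 : s₂.reg 12 = 2 ^ ρ := by simpa [g12] using f₂ 12 rfl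
  have k13 : s₂.reg 13 = D * ρ := by simpa [g13] using f₂ 13 rfl
  have k14 : s₂.reg 14 = d := by simpa [g14] using f₂ 14 rfl
  have k15 : s₂.reg 15 = N := by simpa [g15] using f₂ 15 rfl
  clear f₂
  set A := radixSort (2 ^ ρ) D (blockKeys L ℓ (h + 1) k) with hA
  have hperm : A.Perm (blockKeys L ℓ (h + 1) k) := radixSort_perm hR
  have hsort : A.Pairwise (· ≤ ·) := radixSort_sorted hR hkeys
  have hAl : A.length = ℓ + 1 := hperm.length_eq.trans hlen
  obtain ⟨hpd, hmono⟩ := sample_mono hsort hAl hN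
  have hN0 : 0 < N := by rw [hN]; exact Nat.succ_pos _
  refine vc_seq (vc_makeItems (ρ := ρ) (N := N) (d := d) (b := D * ρ) (f := sample A d) k11 k12 k13 k14
    k15 k23 hN0 hρ (fun p hp => w₂ _ (hpd p hp)) (fun p hp => by have := hpd p hp; omega) (by omega)
    (by omega) hSw hw) ?_
  rintro t₃ s₃ f₃ - ⟨ht₃, ⟨i32, iX, iY, iL, irun⟩, o₃⟩
  replace k11 := (f₃ 11 rfl).trans k11
  replace k12 := (f₃ 12 rfl).trans k12
  replace k23 := (f₃ 23 rfl).trans k23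
  clear f₃
  set I := prefixes (sample A d) N (D * ρ * N) with hI
  have hIl : I.length ≤ D * ρ * N := length_prefixes_le _ _ _
  have hmem : ∀ i < I.length, ∃ c, I[i]? = some c ∧ c < D * ρ * N ∧
      runStart (sample A d) (c / N) (c % N) = c % N ∧
      readAt (I.map (keyX (sample A d) ρ N)) i = keyX (sample A d) ρ N c ∧
      readAt (I.map (keyY (sample A d) ρ N)) i = keyY (sample A d) ρ N c := by
    intro i hi
    have hm := List.getElem_mem hi
    have hm' := List.mem_filter.1 hm
    refine ⟨I[i], List.getElem?_eq_getElem hi, List.mem_range.1 hm'.1, by simpa using hm'.2, ?_, ?_⟩ <;>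
      rw [readAt_eq (by simpa using hi), List.getElem_map]
  have hXR : ∀ i < I.length, readAt (I.map (keyX (sample A d) ρ N)) i < 2 ^ ρ := by
    intro i hi
    obtain ⟨c, -, hc, -, hX, -⟩ := hmem i hi
    have h1 := runStart_le (sample A d) (digitEnd ρ (c / N)) (c % N)
    have h2 := Nat.div_add_mod' c N
    rw [hX, keyX]
    omega
  have hYR : ∀ i < I.length, readAt (I.map (keyY (sample A d) ρ N)) i < 2 ^ ρ := by
    intro i hi
    obtain ⟨c, -, hc, -, -, hY⟩ := hmem i hi
    rw [hY, keyY]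
    exact Nat.mod_lt _ hR
  have hnodup : I.Nodup := List.Nodup.filter _ List.nodup_range
  -- Equal keys mean equal depth and equal prefix, hence the same run. Both indices are starts of
  -- their runs, so they coincide.
  have hinj : ∀ i < I.length, ∀ j < I.length,
      readAt (I.map (keyX (sample A d) ρ N)) i = readAt (I.map (keyX (sample A d) ρ N)) j →
      readAt (I.map (keyY (sample A d) ρ N)) i = readAt (I.map (keyY (sample A d) ρ N)) j →
      i = j := by
    intro i hi j hj hX hY
    obtain ⟨c, hci, hc, hcs, hcX, hcY⟩ := hmem i hi
    obtain ⟨c', hcj, hc', hcs', hcX', hcY'⟩ := hmem j hj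
    rw [hcX, hcX'] at hX
    rw [hcY, hcY'] at hY
    have hmc := Nat.mod_lt c hN0
    have hmc' := Nat.mod_lt c' hN0
    obtain ⟨h1, h2⟩ := key_inj hmono hN0 hmc' hX
    rw [keyY, keyY, h1] at hY
    have h3 := runStart_eq hmono hmc hmc' ((prefix_eq_iff hρ).2 ⟨h2, hY⟩)
    rw [h1] at hcs
    have h4 : c = c' := by
      rw [← Nat.div_add_mod' c N, ← Nat.div_add_mod' c' N, h1, ← hcs, h3, hcs']
    refine (List.getElem_inj hnodup (h₀ := hi) (h₁ := hj)).1 ?_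
    rw [List.getElem?_eq_getElem hi] at hci
    rw [List.getElem?_eq_getElem hj] at hcj
    injection hci with e1
    injection hcj with e2
    rw [e1, e2, h4]
  refine vc_conseq (vc_buildHash (ρ := ρ) (M := I.length) (B := P + 5 * D * 2 ^ ρ)
    (fun i hi => iX i (by simpa using hi)) hXR (fun i hi => iY i (by simpa using hi)) hYR hinj
    (by omega) (by omega) hSw hw hRR k11 k12 k23 i32 fun c h1 h2 => ?_) ?_
  · rw [o₃ _ (by omega), o₂ _ (by omega), o₁ _ (by omega), hz _ (by omega) (by omega)]
  rintro t₄ s₄ - - ⟨ht₄, hH, o₄⟩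
  refine ⟨?_, ⟨A, hperm, hsort, w₂.congr fun c h1 h2 => ?_, ⟨hH, ?_, ?_⟩⟩, fun c hc => ?_⟩
  -- Hashing costs `O(ρ)` per prefix; by `hMt` there are few enough prefixes to make this linear in
  -- `2 ^ ρ`.
  · have e1 : (ρ + 1) * (I.length * 1000 + 1000) ≤ 1000 * ((ρ + 1) * (D * ρ * N + 1)) := by
      calc (ρ + 1) * (I.length * 1000 + 1000) ≤ (ρ + 1) * (D * ρ * N * 1000 + 1000) := by gcongr
        _ = _ := by ring
    have e2 : (D + 20) * 1000 * 2 ^ ρ = D * (2 ^ ρ * 200 + 200 * 2 ^ ρ) + D * (2 ^ ρ * 600) +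
      20000 * 2 ^ ρ := by ring
    have e3 : D * (2 ^ ρ * 200 + 200) ≤ D * (2 ^ ρ * 200 + 200 * 2 ^ ρ) := by gcongr; omega
    omega
  · rw [o₄ _ (by omega), o₃ _ (by omega)]
  · intro i hi
    have hi' : i < I.length := by simpa using hi
    rw [o₄ _ (by omega), iL i hi]
  · intro e p hp hlt
    have := runStart_le (sample A d) e p
    rw [o₄ _ (by omega)]
    exact irun e p hp hlt
  · rw [o₄ _ (by omega), o₃ _ (by omega), o₂ _ (by omega), o₁ _ (by omega)]

end WordRAM

/-! ### A step as a search in a block -/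

namespace WordRAM

theorem step_maximal {L : List ℕ} {cur a r : ℕ} (h : step L cur a < r) (hr : r < cur) :
    readAt L (L.length - r) ≠ a := fun ha =>
  Nat.findGreatest_is_greatest h (by omega) ⟨by omega, ha⟩

/-- Key number `j` belongs to position `k * ℓ + (j - 1)`, so the positions of the block below the
cursor are those with `j ≤ q`, and their keys with letter `a` lie strictly between `a * 2 ^ h` and
the odd bound. Among them the largest key is the largest position. If the predecessor `K` is not
above `a * 2 ^ h`, the letter does not occur in the block before the cursor, and the answer is the
one at the start of the block. -/
theorem block_step {L : List ℕ} {ℓ h k q a K : ℕ} (hq : q < ℓ) (hn : k * ℓ + q ≤ L.length + 1)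
    (hh : 2 * ℓ + 1 < 2 ^ h) (hK : ∃ j ≤ ℓ, blockKey L ℓ h k j = K)
    (hKx : K ≤ a * 2 ^ h + q * 2 + 1)
    (hmax : ∀ j ≤ ℓ, blockKey L ℓ h k j ≤ a * 2 ^ h + q * 2 + 1 → blockKey L ℓ h k j ≤ K) :
    step L (k * ℓ + q) a =
      if a * 2 ^ h < K then k * ℓ + (K - a * 2 ^ h) / 2 - 1 else step L (k * ℓ) a := by
  have key : ∀ i < q, k * ℓ + i ≠ 0 → readAt L (L.length - (k * ℓ + i)) = a →
      a * 2 ^ h + (i + 1) * 2 ≤ K := by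
    intro i hi h0 hra
    have h1 := blockKey_succ_of_pos (h := h) h0 (by omega : k * ℓ + i ≤ L.length)
    rw [hra] at h1
    have := hmax (i + 1) (by omega) (by omega)
    omega
  split_ifs with hc
  · obtain ⟨j, hj, hjK⟩ := hK
    unfold blockKey at hjK
    split_ifs at hjK with hz
    · omega
    obtain ⟨i, rfl⟩ : ∃ i, j = i + 1 := ⟨j - 1, by omega⟩
    simp only [Nat.add_sub_cancel] at hjK hz
    have hra : readAt L (L.length - (k * ℓ + i)) = a := by
      rcases lt_trichotomy (readAt L (L.length - (k * ℓ + i))) a with hlt | heq | hgt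
      · have := Nat.mul_le_mul_right (2 ^ h) (Nat.succ_le_of_lt hlt)
        rw [Nat.succ_mul] at this
        omega
      · exact heq
      · have := Nat.mul_le_mul_right (2 ^ h) (Nat.succ_le_of_lt hgt)
        rw [Nat.succ_mul] at this
        omega
    rw [hra] at hjK
    have e : k * ℓ + (K - a * 2 ^ h) / 2 - 1 = k * ℓ + i := by omega
    rw [e]
    refine step_eq_of (fun _ => by omega) (fun _ => hra) fun r' h1 h2 hr' => ?_
    have := key (r' - k * ℓ) (by omega) (by omega) (by rwa [Nat.add_sub_cancel' (by omega)])
    omega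
  · refine step_eq_of (fun h0 => ?_) (fun h0 => (step_ne_zero_spec h0).2) fun r' h1 h2 hr' => ?_
    · have := (step_ne_zero_spec h0).1
      omega
    · rcases lt_or_ge r' (k * ℓ) with hlt | hge
      · exact step_maximal h1 hlt hr'
      · have := key (r' - k * ℓ) (by omega) (by omega) (by rwa [Nat.add_sub_cancel' hge])
        omega

/-- The parts of the data structure which a query uses, with the parameters in registers. -/
structure QueryOk (w S : ℕ) (L : List ℕ) (ρ D ℓ h N d σ P Z : ℕ) (s : State) : Prop where
  size : SizeOk w S ρ D ℓ h N d σ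
  hL : ∀ a ∈ L, a < σ
  block : ∀ k, k * ℓ ≤ L.length + 1 → P + k * Z + 20 * 2 ^ ρ ≤ S ∧
    BlockOk ρ D ℓ N d (P + k * Z) (blockKeys L ℓ (h + 1) k) s.mem
  table : ∀ k, k * ℓ ≤ L.length + 1 → 16 + k * ℓ + ℓ ≤ S ∧
    ∀ a < σ, s.mem (16 + k * ℓ + a % ℓ) = step L (k * ℓ) a
  h10 : s.reg 10 = ℓ
  h11 : s.reg 11 = ρ
  h12 : s.reg 12 = 2 ^ ρ
  h13 : s.reg 13 = D * ρ
  h14 : s.reg 14 = d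
  h15 : s.reg 15 = N
  h17 : s.reg 17 = 2 ^ (h + 1)
  h19 : s.reg 19 = Z
  h21 : s.reg 21 = P
  h22 : s.reg 22 = ℓ + 1

/-- Find the last key of the block of `reg 1` which is not above the key of `reg 1` itself with the
letter `reg 3`. -/
def blockSearch : Prog :=
  .assign 86 (.reg 1 / .reg 10) ;; .assign 87 (.reg 1 % .reg 10) ;;
  .assign 62 (.reg 21 + .reg 86 * .reg 19) ;;
  .assign 70 (.reg 3 * .reg 17 + .reg 87 * 2 + 1) ;; predSample ;; predKey

def blockQuery : Prog :=
  blockSearch ;; .load 84 (.reg 62 + .reg 81) ;; .assign 85 (.reg 3 * .reg 17) ;;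
  .ite (.bin .lt (.reg 85) (.reg 84)) (.assign 1 (.reg 86 * .reg 10 + (.reg 84 - .reg 85) / 2 - 1))
    (.load 1 (16 + .reg 86 * .reg 10 + .reg 3 % .reg 10))

theorem SizeOk.d_le {w S ρ D ℓ h N d σ : ℕ} (hZ : SizeOk w S ρ D ℓ h N d σ) : d ≤ 4 * 2 ^ ρ := by
  refine le_trans ?_ hZ.hMt
  have hN1 : 1 ≤ N := by rw [hZ.hN]; exact Nat.succ_pos _
  have : D * ρ * 1 ≤ D * ρ * N := Nat.mul_le_mul_left _ hN1
  calc d = ρ * (D * ρ * 1) := by rw [hZ.hd]; ring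
    _ ≤ (ρ + 1) * (D * ρ * N + 1) := Nat.mul_le_mul (by omega) (by omega)

variable {w S : ℕ} {L inp : List ℕ}

theorem BlockOk.search {ρ D ℓ h N d σ B k x : ℕ} {A : List ℕ} {s : State}
    (hZ : SizeOk w S ρ D ℓ h N d σ) (hL : ∀ a ∈ L, a < σ)
    (hperm : A.Perm (blockKeys L ℓ (h + 1) k)) (hsort : A.Pairwise (· ≤ ·))
    (hT : TrieOk (sample A d) ρ N (D * ρ) B s.mem) (hx : x < 2 ^ (D * ρ)) (hodd : x % 2 = 1)
    (hS : B + 20 * 2 ^ ρ ≤ S)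
    (h11 : s.reg 11 = ρ) (h12 : s.reg 12 = 2 ^ ρ) (h13 : s.reg 13 = D * ρ) (h15 : s.reg 15 = N)
    (h62 : s.reg 62 = B) (h70 : s.reg 70 = x) : SearchOk w S (sample A d) ρ N D B x s := by
  have hlen : A.length = ℓ + 1 := by rw [hperm.length_eq]; simp [blockKeys]
  obtain ⟨hpd, hmono⟩ := sample_mono hsort hlen hZ.hN
  have hmem : ∀ i < A.length, ∃ j ≤ ℓ, blockKey L ℓ (h + 1) k j = readAt A i := by
    intro i hi
    have : A[i] ∈ blockKeys L ℓ (h + 1) k := hperm.subset (List.getElem_mem hi)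
    simp only [blockKeys, List.mem_map, List.mem_range] at this
    obtain ⟨j, hj, he⟩ := this
    exact ⟨j, by omega, by rw [readAt_eq hi, he]⟩
  have hM := hZ.hM
  refine ⟨hT, hmono, fun p hp => ?_, fun p hp => ?_, ?_, hx, by rw [hZ.hN]; exact Nat.succ_pos _,
    hZ.hD, hZ.hρ, by omega, hS, hZ.hSw, hZ.hw, h11, h12, h13, h15, h62, h70⟩
  · obtain ⟨j, hj, he⟩ := hmem _ (hpd p hp)
    rw [sample, ← he]
    exact lt_of_lt_of_le (blockKey_lt hZ.hσ hL hj hZ.hh) hZ.hkey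
  · obtain ⟨j, hj, he⟩ := hmem _ (hpd p hp)
    rw [sample, ← he]
    have := blockKey_even (L := L) (ℓ := ℓ) (h := h) (k := k) (j := j)
    omega
  -- Key number `0` is a sentinel with value `0`, so a predecessor always exists.
  · have h0 : (0 : ℕ) ∈ A := by
      refine hperm.symm.subset ?_
      simp only [blockKeys, List.mem_map, List.mem_range]
      exact ⟨0, by omega, by simp [blockKey]⟩
    obtain ⟨i, hi, he⟩ := List.getElem_of_mem h0
    have := readAt_mono hsort (Nat.zero_le i) hi
    rw [readAt_eq hi, he] at this
    rw [sample, zero_mul]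
    omega

theorem vc_blockSearch {ρ D ℓ h N d σ P Z k q a : ℕ} {s : State}
    (hQ : QueryOk w S L ρ D ℓ h N d σ P Z s) (h1 : s.reg 1 = k * ℓ + q) (hq : q < ℓ)
    (hcur : k * ℓ + q ≤ L.length + 1) (h3 : s.reg 3 = a) (ha : a < σ) :
    vc w S inp blockSearch s fun t s' =>
      t ≤ D * 200 + Nat.clog 2 ρ * 200 + Nat.clog 2 d * 40 + 200 ∧ s'.reg 86 = k ∧
      s'.reg 62 = P + k * Z ∧ s'.reg 81 ≤ ℓ ∧ ∃ K, s.mem (P + k * Z + s'.reg 81) = K ∧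
      (∃ j ≤ ℓ, blockKey L ℓ (h + 1) k j = K) ∧ K ≤ a * 2 ^ (h + 1) + q * 2 + 1 ∧
      ∀ j ≤ ℓ, blockKey L ℓ (h + 1) k j ≤ a * 2 ^ (h + 1) + q * 2 + 1 →
        blockKey L ℓ (h + 1) k j ≤ K := by
  obtain ⟨hZ, hL, hblock, htable, h10, h11, h12, h13, h14, h15, h17, h19, h21, h22⟩ := hQ
  have hZZ := hZ
  obtain ⟨hD, hρ, hσ, hd, hℓ, hh, hkey, hkw, hℓR, hN, hM, hMt, hSw, hw, hRR⟩ := hZZ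
  have hw0 : w ≠ 0 := by rintro rfl; omega
  obtain ⟨hPS, ⟨A, hperm, hsort, hA, hT⟩⟩ := hblock k (by omega)
  have hdiv : (k * ℓ + q) / ℓ = k := by
    rw [mul_comm, Nat.mul_add_div hℓ, Nat.div_eq_of_lt hq, add_zero]
  have hmod : (k * ℓ + q) % ℓ = q := by
    rw [mul_comm, Nat.mul_add_mod, Nat.mod_eq_of_lt hq]
  have hx : (a + 1) * 2 ^ (h + 1) ≤ σ * 2 ^ (h + 1) := Nat.mul_le_mul_right _ ha
  rw [Nat.add_mul, one_mul] at hx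
  have hodd : (a * 2 ^ (h + 1) + q * 2 + 1) % 2 = 1 := by
    rw [pow_succ, ← mul_assoc]; omega
  set x := a * 2 ^ (h + 1) + q * 2 + 1 with hxd
  have hlen : A.length = ℓ + 1 := by rw [hperm.length_eq]; simp [blockKeys]
  have hd0 : 0 < d := by rw [hd]; positivity
  have hdR := hZ.d_le
  simp only [blockSearch, vc, Expr.add_def, Expr.mul_def, Expr.div_def, Expr.mod_def,
    Expr.ofNat_def, Expr.Ok, Expr.val, BinOp.val, BinOp.Ok, Expr.cost, true_and,
    Function.update_self, Function.update_of_ne, ne_eq, Nat.reduceEqDiff, not_false_eq_true,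
    h1, h3, h10, h17, h19, h21, hdiv, hmod, ← hxd]
  repeat' with_reducible apply And.intro
  any_goals omega
  refine vc_conseq (vc_predSample (BlockOk.search (x := x) hZ hL hperm hsort hT (by omega) hodd
    hPS (by simpa) (by simpa) (by simpa) (by simpa) (by simp) (by simp))) ?_
  rintro t₁ s₁ f₁ m₁ ⟨ht₁, p1, p2, p3⟩
  have m₁ : s₁.mem = s.mem := m₁ rfl
  obtain ⟨hpd, -⟩ := sample_mono hsort hlen hN
  refine vc_conseq (vc_predKey (A := A) (B := P + k * Z) (d := d) (x := x) (p := s₁.reg 78)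
    (by simpa [h14] using f₁ 14 rfl) (by simpa [h22, hlen] using f₁ 22 rfl)
    (by simpa using f₁ 62 rfl) (by simpa using f₁ 70 rfl) rfl (by rwa [m₁]) hsort hd0
    (hpd _ p1) p2 (fun hlt => p3 _ ?_ (by omega)) (by omega) hSw hw (by omega) (by omega)) ?_
  · rw [hN]
    have : s₁.reg 78 + 1 ≤ ℓ / d := (Nat.le_div_iff_mul_le hd0).2 (by omega)
    omega
  · rintro t₂ s₂ f₂ m₂ ⟨ht₂, q1, q2, q3⟩
    have g86 : s₁.reg 86 = k := by simpa using f₁ 86 rfl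
    have g62 : s₁.reg 62 = P + k * Z := by simpa using f₁ 62 rfl
    refine ⟨by omega, (f₂ 86 rfl).trans g86, (f₂ 62 rfl).trans g62, by omega,
      readAt A (s₂.reg 81), hA _ q1, ?_, q2, fun j hj hjx => ?_⟩
    · have : A[s₂.reg 81] ∈ blockKeys L ℓ (h + 1) k := hperm.subset (List.getElem_mem q1)
      simp only [blockKeys, List.mem_map, List.mem_range] at this
      obtain ⟨j, hj, he⟩ := this
      exact ⟨j, by omega, by rw [readAt_eq q1, he]⟩
    · have hjA : blockKey L ℓ (h + 1) k j ∈ A := by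
        refine hperm.symm.subset ?_
        simp only [blockKeys, List.mem_map, List.mem_range]
        exact ⟨j, by omega, rfl⟩
      obtain ⟨i, hi, he⟩ := List.getElem_of_mem hjA
      rw [← readAt_eq hi] at he
      rw [← he] at hjx ⊢
      rcases lt_or_ge (s₂.reg 81) i with hlt | hge
      · have := q3 i hlt hi
        omega
      · exact readAt_mono hsort hge q1

/-- Comparing the key found with `a * 2 ^ (h + 1)` decides whether it decodes to a position or the
table row of the block is consulted. -/
theorem vc_blockQuery {ρ D ℓ h N d σ P Z : ℕ} {s : State}
    (hQ : QueryOk w S L ρ D ℓ h N d σ P Z s) (hcur : s.reg 1 ≤ L.length + 1) (ha : s.reg 3 < σ) :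
    vc w S inp blockQuery s fun t s' =>
      t ≤ D * 200 + Nat.clog 2 ρ * 200 + Nat.clog 2 d * 40 + 300 ∧
      s'.reg 1 = step L (s.reg 1) (s.reg 3) := by
  have hℓ := hQ.size.hℓ
  have hq := Nat.mod_lt (s.reg 1) hℓ
  have he := Nat.div_add_mod' (s.reg 1) ℓ
  have hw := hQ.size.hw
  have hSw := hQ.size.hSw
  generalize hk : s.reg 1 / ℓ = k at he
  generalize hqd : s.reg 1 % ℓ = q at he hq
  generalize h3 : s.reg 3 = a at ha
  rw [← he] at hcur ⊢
  refine vc_seq (vc_blockSearch hQ he.symm hq hcur h3 ha) ?_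
  rintro t₁ s₁ f₁ m₁ ⟨ht₁, h86, h62, h81, K, hKm, hK, hKx, hmax⟩
  have m₁ : s₁.mem = s.mem := m₁ rfl
  have hst := block_step hq hcur hQ.size.hh hK hKx hmax
  have g3 := (f₁ 3 rfl).trans h3
  have g10 := (f₁ 10 rfl).trans hQ.h10
  have g17 := (f₁ 17 rfl).trans hQ.h17
  obtain ⟨hbS, -⟩ := hQ.block k (by omega)
  obtain ⟨htS, htab⟩ := hQ.table k (by omega)
  have hℓR := hQ.size.hℓR
  have hkey := hQ.size.hkey
  have hkw := hQ.size.hkw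
  have hx : (a + 1) * 2 ^ (h + 1) ≤ σ * 2 ^ (h + 1) := Nat.mul_le_mul_right _ ha
  rw [Nat.add_mul, one_mul] at hx
  have hR : 0 < 2 ^ (h + 1) := by positivity
  have hamod := Nat.mod_lt a hℓ
  have hh := hQ.size.hh
  have hw0 : w ≠ 0 := by rintro rfl; omega
  have hK2 : K % 2 = 0 := by
    obtain ⟨j, -, rfl⟩ := hK
    exact blockKey_even
  have ha2 : a * 2 ^ (h + 1) % 2 = 0 := by rw [pow_succ, ← mul_assoc]; omega
  simp only [vc, Expr.add_def, Expr.sub_def, Expr.mul_def, Expr.div_def,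
    Expr.ofNat_def, Expr.Ok, Expr.val, BinOp.val, BinOp.Ok, Expr.cost, true_and,
    Function.update_self, Function.update_of_ne, ne_eq, Nat.reduceEqDiff, not_false_eq_true,
    h86, h62, g3, g10, g17, m₁, hKm, ltVal_eq_zero, not_le]
  refine ⟨by omega, by omega, by omega, fun hlt => ?_, fun hle => ?_⟩
  · rw [if_pos hlt] at hst
    refine ⟨?_, by omega, hst.symm⟩
    repeat' with_reducible apply And.intro
    all_goals first | trivial | omega
  · rw [if_neg (by omega)] at hst
    refine ⟨?_, by omega, by omega, (htab a ha).trans hst.symm⟩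
    repeat' with_reducible apply And.intro
    all_goals first | trivial | omega

end WordRAM

/-! ### The table of answers at block starts -/

namespace WordRAM

/-- The text with the letters reduced modulo `ℓ`. -/
def modText (L : List ℕ) (ℓ : ℕ) : List ℕ := L.map (· % ℓ)

theorem readAt_modText (L : List ℕ) (ℓ i : ℕ) : readAt (modText L ℓ) i = readAt L i % ℓ := by
  rcases lt_or_ge i L.length with h | h
  · rw [readAt_eq (by simpa [modText]), readAt_eq h]
    simp [modText]
  · rw [readAt, readAt, List.getD_eq_default _ _ h, List.getD_eq_default _ _ (by simpa [modText]),
      Nat.zero_mod]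

theorem step_succ (L : List ℕ) (r a : ℕ) : step L (r + 1) a =
    if r ≠ 0 ∧ readAt L (L.length - r) = a then r else step L r a := by
  cases r with
  | zero => simp [step_one, step_zero]
  | succ r => rw [step_succ_succ]; simp

/-- Indexing rows by letters modulo `ℓ` is harmless. Either `ℓ = σ` and nothing is reduced, or `ℓ`
exceeds `n + 1`, and then the only row is that of block `0`, which is zero. -/
theorem step_modText {L : List ℕ} {ℓ σ k a : ℕ} (hL : ∀ a ∈ L, a < σ) (ha : a < σ)
    (hℓ : ℓ = σ ∨ L.length + 1 < ℓ) (hk : k * ℓ ≤ L.length + 1) :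
    step (modText L ℓ) (k * ℓ) (a % ℓ) = step L (k * ℓ) a := by
  rcases hℓ with rfl | hℓ
  · have : modText L ℓ = L := by
      conv_rhs => rw [← List.map_id L]
      exact List.map_congr_left fun a ha => Nat.mod_eq_of_lt (hL a ha)
    rw [this, Nat.mod_eq_of_lt ha]
  · obtain rfl : k = 0 := by
      by_contra h0
      have : 1 * ℓ ≤ k * ℓ := Nat.mul_le_mul_right _ (Nat.pos_of_ne_zero h0)
      omega
    rw [zero_mul, step_zero, step_zero]

/-- Compute row `reg 25 + 1` of the table from row `reg 25`. -/
def tableRow : Prog :=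
  .assign 27 (16 + .reg 25 * .reg 10) ;; .assign 28 (.reg 27 + .reg 10) ;;
  forUp 29 10 (.load 30 (.reg 27 + .reg 29) ;; .store (.reg 28 + .reg 29) (.reg 30)) ;;
  forUp 29 10 (.assign 30 (.reg 25 * .reg 10 + .reg 29) ;;
    .ite (.reg 30) (.read 31 (.reg 0 - .reg 30) ;;
      .store (.reg 28 + .reg 31 % .reg 10) (.reg 30)) .skip)

/-- Compute the table of the last occurrences of the letters before the blocks. -/
def makeTable : Prog := forUp 25 24 tableRow

variable {w S : ℕ} {L : List ℕ}

/-- A row starts as a copy of the previous one. The positions of the block are then entered in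
increasing order, so the largest wins, as `step` demands. Position `0` does not exist and is
skipped. -/
theorem vc_tableRow {s : State} {ℓ k : ℕ} (h0 : s.reg 0 = L.length) (h10 : s.reg 10 = ℓ)
    (h25 : s.reg 25 = k) (hℓ : 0 < ℓ) (hn : L.length < 2 ^ w) (hk : (k + 1) * ℓ ≤ L.length + 1)
    (hS : 16 + (k + 1) * ℓ + ℓ ≤ S) (hSw : S < 2 ^ w) (hw : 100 < 2 ^ w)
    (hrow : ∀ c < ℓ, s.mem (16 + k * ℓ + c) = step (modText L ℓ) (k * ℓ) c) :
    vc w S L tableRow s fun t s' => t ≤ ℓ * 60 + 40 ∧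
      (∀ c < ℓ, s'.mem (16 + (k + 1) * ℓ + c) = step (modText L ℓ) ((k + 1) * ℓ) c) ∧
      ∀ c, (c < 16 + (k + 1) * ℓ ∨ 16 + (k + 1) * ℓ + ℓ ≤ c) → s'.mem c = s.mem c := by
  have hw0 : w ≠ 0 := by rintro rfl; omega
  have e : (k + 1) * ℓ = k * ℓ + ℓ := by ring
  rw [e] at hk hS ⊢
  have hlen : (modText L ℓ).length = L.length := by simp [modText]
  simp only [tableRow, vc, Expr.add_def, Expr.mul_def, Expr.ofNat_def, Expr.Ok, Expr.val, BinOp.val,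
    BinOp.Ok, Expr.cost, true_and, Function.update_self, Function.update_of_ne, ne_eq,
    Nat.reduceEqDiff, not_false_eq_true, h10, h25]
  repeat' with_reducible apply And.intro
  any_goals omega
  refine vc_conseq (Q := fun t s' => t ≤ ℓ * 17 + 6 ∧
      (∀ c < ℓ, s'.mem (16 + k * ℓ + ℓ + c) = step (modText L ℓ) (k * ℓ) c) ∧
      ∀ c, (c < 16 + (k * ℓ + ℓ) ∨ 16 + (k * ℓ + ℓ) + ℓ ≤ c) → s'.mem c = s.mem c)
    (vc_forUp_le 9 (fun i s' =>
    (∀ c < i, s'.mem (16 + k * ℓ + ℓ + c) = step (modText L ℓ) (k * ℓ) c) ∧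
    ∀ c, (c < 16 + (k * ℓ + ℓ) ∨ 16 + (k * ℓ + ℓ) + ℓ ≤ c) → s'.mem c = s.mem c)
    (by decide) rfl rfl (by simp [h10]; omega) (by omega) ?_ ?_ ?_) ?_
  · exact ⟨fun c hc => absurd hc (Nat.not_lt_zero _), fun _ _ => rfl⟩
  · rintro i s₁ hi h29 hf ⟨hr, ho⟩
    have g27 : s₁.reg 27 = 16 + k * ℓ := by simpa using hf 27 (by decide) rfl
    have g28 : s₁.reg 28 = 16 + k * ℓ + ℓ := by simpa using hf 28 (by decide) rfl
    simp only [Function.update_of_ne, ne_eq, Nat.reduceEqDiff, not_false_eq_true, h10] at hi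
    have hv : s₁.mem (16 + k * ℓ + i) = step (modText L ℓ) (k * ℓ) i := by
      rw [ho _ (by omega), hrow _ hi]
    simp only [vc, Expr.Ok, Expr.val, BinOp.val, BinOp.Ok, Expr.cost, true_and, Function.update_self, Function.update_of_ne, ne_eq,
      Nat.reduceEqDiff, not_false_eq_true, g27, g28, h29, hv]
    refine ⟨by omega, by omega, by omega, by omega, by omega, fun c hc => ?_, fun c hc => ?_⟩
    · rcases eq_or_ne c i with rfl | hne
      · rw [Function.update_self]
      · rw [Function.update_of_ne (by omega), hr c (by omega)]
    · rw [Function.update_of_ne (by omega), ho c hc]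
  · rintro t s₁ ht - - ⟨hr, ho⟩
    simp only [Function.update_of_ne, ne_eq, Nat.reduceEqDiff, not_false_eq_true, h10] at ht hr
    exact ⟨ht, hr, ho⟩
  rintro t₁ s₁ f₁ - ⟨ht₁, hr₁, ho₁⟩
  have g0 : s₁.reg 0 = L.length := by simpa [h0] using f₁ 0 rfl
  have g10 : s₁.reg 10 = ℓ := by simpa [h10] using f₁ 10 rfl
  have g25 : s₁.reg 25 = k := by simpa [h25] using f₁ 25 rfl
  have g28 : s₁.reg 28 = 16 + k * ℓ + ℓ := by simpa using f₁ 28 rfl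
  refine vc_forUp_le 25 (fun i s' =>
    (∀ c < ℓ, s'.mem (16 + k * ℓ + ℓ + c) = step (modText L ℓ) (k * ℓ + i) c) ∧
    ∀ c, (c < 16 + (k * ℓ + ℓ) ∨ 16 + (k * ℓ + ℓ) + ℓ ≤ c) → s'.mem c = s.mem c)
    (by decide) rfl rfl (by omega) (by omega) ⟨hr₁, ho₁⟩ ?_ ?_
  · rintro i s₂ hi h29 hf ⟨hr, ho⟩
    rw [g10] at hi
    replace g0 := (hf 0 (by decide) rfl).trans g0
    replace g10 := (hf 10 (by decide) rfl).trans g10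
    replace g25 := (hf 25 (by decide) rfl).trans g25
    replace g28 := (hf 28 (by decide) rfl).trans g28
    have hm := Nat.mod_lt (readAt L (L.length - (k * ℓ + i))) hℓ
    simp only [vc, Expr.sub_def, Expr.mod_def, Expr.Ok, Expr.val,
      BinOp.val, BinOp.Ok, Expr.cost, true_and, Function.update_self, Function.update_of_ne, ne_eq,
      Nat.reduceEqDiff, not_false_eq_true, g0, g10, g25, g28, h29, ← add_assoc (k * ℓ) i 1,
      step_succ, hlen, readAt_modText]
    refine ⟨by omega, fun hne => ?_, fun heq => ?_⟩
    · refine ⟨by omega, by omega, by omega, by omega, by omega, fun c hc => ?_, fun c hc => ?_⟩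
      · rcases eq_or_ne (readAt L (L.length - (k * ℓ + i)) % ℓ) c with rfl | hne'
        · rw [Function.update_self, if_pos ⟨hne, rfl⟩]
        · rw [Function.update_of_ne (by omega), hr c hc, if_neg (fun h => hne' h.2)]
      · rw [Function.update_of_ne (by omega), ho c hc]
    · refine ⟨by omega, fun c hc => ?_, ho⟩
      rw [if_neg (fun h => h.1 heq)]
      exact hr c hc
  · rintro t₂ s₂ ht - - ⟨hr, ho⟩
    rw [g10] at ht hr
    refine ⟨by omega, fun c hc => ?_, ho⟩
    rw [← add_assoc, hr c hc]

theorem vc_makeTable {s : State} {ℓ : ℕ} (h0 : s.reg 0 = L.length) (h10 : s.reg 10 = ℓ)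
    (h24 : s.reg 24 = (L.length + 1) / ℓ) (hℓ : 0 < ℓ)
    (hS : 16 + (L.length + 1) / ℓ * ℓ + ℓ ≤ S) (hSw : S < 2 ^ w) (hw : 100 < 2 ^ w)
    (hz : ∀ c < ℓ, s.mem (16 + c) = 0) :
    vc w S L makeTable s fun t s' => t ≤ (L.length + 1) / ℓ * (ℓ * 60 + 48) + 6 ∧
      (∀ k, k * ℓ ≤ L.length + 1 → ∀ c < ℓ,
        s'.mem (16 + k * ℓ + c) = step (modText L ℓ) (k * ℓ) c) ∧
      ∀ c, (c < 16 ∨ 16 + (L.length + 1) / ℓ * ℓ + ℓ ≤ c) → s'.mem c = s.mem c := by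
  set K := (L.length + 1) / ℓ with hK
  have hKn : K * ℓ ≤ L.length + 1 := Nat.div_mul_le_self _ _
  have hKl : L.length + 1 < K * ℓ + ℓ := by
    have := Nat.lt_div_mul_add (a := L.length + 1) hℓ
    rwa [← hK] at this
  have hKS : K ≤ K * ℓ := Nat.le_mul_of_pos_right _ hℓ
  refine vc_forUp_le (ℓ * 60 + 40) (fun k s' => (∀ j ≤ k, ∀ c < ℓ,
    s'.mem (16 + j * ℓ + c) = step (modText L ℓ) (j * ℓ) c) ∧
    ∀ c, (c < 16 ∨ 16 + k * ℓ + ℓ ≤ c) → s'.mem c = s.mem c) (by decide) rfl rfl (by omega) (by omega)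
    ⟨?_, fun _ _ => rfl⟩ ?_ ?_
  · intro j hj c hc
    obtain rfl : j = 0 := by omega
    rw [zero_mul, step_zero]
    exact hz c hc
  · rintro k s₁ hk h25 hf ⟨hr, ho⟩
    rw [h24] at hk
    have hk' : (k + 1) * ℓ ≤ K * ℓ := Nat.mul_le_mul_right _ hk
    have e : (k + 1) * ℓ = k * ℓ + ℓ := by ring
    refine vc_conseq (vc_tableRow ((hf 0 (by decide) rfl).trans h0) ((hf 10 (by decide) rfl).trans h10)
      h25 hℓ (by omega) (by omega) (by omega) hSw hw (hr k le_rfl)) ?_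
    rintro t s₂ - - ⟨ht, hr₂, ho₂⟩
    refine ⟨ht, fun j hj c hc => ?_, fun c hc => ?_⟩
    · rcases eq_or_lt_of_le hj with rfl | hj
      · exact hr₂ c hc
      · have : j * ℓ ≤ k * ℓ := Nat.mul_le_mul_right _ (by omega)
        simp only
        rw [ho₂ _ (by omega), hr j (by omega) c hc]
    · simp only
      rw [ho₂ _ (by omega), ho c (by omega)]
  · rintro t s₁ ht - - ⟨hr, ho⟩
    rw [h24] at ht hr ho
    refine ⟨ht, fun k hk => hr k ((Nat.le_div_iff_mul_le hℓ).2 hk), ho⟩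

end WordRAM

/-! ### Choice of the parameters -/

namespace WordRAM

theorem cube_lt_two_pow {n : ℕ} (hn : 10 ≤ n) : n ^ 3 < 2 ^ n := by
  induction n, hn using Nat.le_induction with
  | base => norm_num
  | succ n hn ih =>
    have h1 : n * (n * n) ≥ 10 * (n * n) := Nat.mul_le_mul_right _ hn
    have h2 : n * n ≥ 10 * n := Nat.mul_le_mul_right _ hn
    have e1 : (n + 1) ^ 3 = n * (n * n) + 3 * (n * n) + 3 * n + 1 := by ring
    have e2 : n ^ 3 = n * (n * n) := by ring
    rw [pow_succ 2]
    omega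

/-- The choice of the parameters for alphabets of size at most `(n + 1) ^ c`. -/
theorem sizeOk_of {w S c n σ h ℓ ρ d N : ℕ} (hσ : 0 < σ) (hσn : σ ≤ (n + 1) ^ c)
    (hℓ : ℓ = min σ (n + 2)) (hh : ℓ < 2 ^ h) (hρ : ρ = h + (c + 11)) (hd : d = (c + 2) * ρ * ρ)
    (hN : N = ℓ / d + 1) (hkw : 2 ^ ((c + 2) * ρ) < 2 ^ w) (hSw : S < 2 ^ w) (hw : 100 < 2 ^ w)
    (hRR : 2 ^ ρ * 2 ^ ρ < 2 ^ w) : SizeOk w S ρ (c + 2) ℓ h N d σ := by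
  have hℓ0 : 0 < ℓ := by omega
  have hh1 : 2 ^ (h + 1) = 2 * 2 ^ h := by ring
  have hρ10 : 10 ≤ ρ := by omega
  have hcube := cube_lt_two_pow hρ10
  have hR : 2 ^ 11 * 2 ^ h ≤ 2 ^ ρ := by
    rw [← pow_add]; exact Nat.pow_le_pow_right (by omega) (by omega)
  have hDρ : (c + 2) + 1 ≤ ρ := by omega
  -- Here polynomial boundedness enters: a letter fits into `c + 1` pieces of `h` bits, so `c + 2`
  -- digits of `ρ` bits hold a whole key.
  have hσh : σ ≤ 2 ^ (h * (c + 1)) := by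
    rcases le_total σ (n + 2) with h1 | h1
    · rw [min_eq_left h1] at hℓ
      calc σ ≤ 2 ^ h := by omega
        _ ≤ _ := Nat.pow_le_pow_right (by omega) (Nat.le_mul_of_pos_right _ (by omega))
    · rw [min_eq_right h1] at hℓ
      calc σ ≤ (2 ^ h) ^ c := hσn.trans (Nat.pow_le_pow_left (by omega) _)
        _ = 2 ^ (h * c) := by rw [← pow_mul]
        _ ≤ _ := Nat.pow_le_pow_right (by omega) (Nat.mul_le_mul_left _ (by omega))
  -- Sampling every `d = D * ρ * ρ` keys makes `ρ` times the number of prefixes at most `ℓ` plus a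
  -- term that `ρ ^ 3 < 2 ^ ρ` absorbs. The summand `c + 11` in `ρ` provides `D + 1 ≤ ρ` and `10 ≤
  -- ρ`.
  have hdN : ρ * ((c + 2) * ρ * N) ≤ ℓ + ρ * ((c + 2) * ρ) := by
    have := Nat.div_mul_le_self ℓ d
    calc ρ * ((c + 2) * ρ * N) = ℓ / d * d + ρ * ((c + 2) * ρ) := by rw [hN, hd]; ring
      _ ≤ _ := by omega
  have hb : ρ * ((c + 2) * ρ) + ρ * ρ ≤ ρ ^ 3 := by
    calc ρ * ((c + 2) * ρ) + ρ * ρ = ρ * ρ * ((c + 2) + 1) := by ring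
      _ ≤ ρ * ρ * ρ := Nat.mul_le_mul_left _ hDρ
      _ = ρ ^ 3 := by ring
  have h10 : 10 * ((c + 2) * ρ * N) ≤ ρ * ((c + 2) * ρ * N) := Nat.mul_le_mul_right _ hρ10
  have h10' : 10 * ρ ≤ ρ * ρ := Nat.mul_le_mul_right _ hρ10
  refine ⟨by omega, by omega, hσ, hd, hℓ0, by omega, ?_, hkw, by omega, hN, by omega, ?_, hSw, hw,
    hRR⟩
  · calc σ * 2 ^ (h + 1) ≤ 2 ^ (h * (c + 1)) * 2 ^ (h + 1) := Nat.mul_le_mul_right _ hσh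
      _ = 2 ^ (h * (c + 1) + (h + 1)) := by rw [← pow_add]
      _ ≤ 2 ^ ((c + 2) * ρ) := Nat.pow_le_pow_right (by omega) (by rw [hρ]; nlinarith)
  · have e : (ρ + 1) * ((c + 2) * ρ * N + 1) =
      ρ * ((c + 2) * ρ * N) + (c + 2) * ρ * N + ρ + 1 := by ring
    omega

theorem readAt_map_lt {α : Type*} {l : List α} {f : α → ℕ} {R : ℕ} (h : ∀ a ∈ l, f a < R) :
    ∀ i < l.length, readAt (l.map f) i < R := by
  intro i hi
  rw [readAt_eq (by simpa using hi), List.getElem_map]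
  exact h _ (List.getElem_mem hi)

theorem TrieOk.congr {f : ℕ → ℕ} {ρ N b B : ℕ} {mem mem' : ℕ → ℕ} (h : TrieOk f ρ N b B mem)
    (hbN : b * N ≤ 2 ^ ρ) (hm : ∀ c, B ≤ c → c < B + 20 * 2 ^ ρ → mem' c = mem c) :
    TrieOk f ρ N b B mem' := by
  obtain ⟨hH, hL, hrun⟩ := h
  have hlen := length_prefixes_le f N (b * N)
  refine ⟨hH.congr (readAt_map_lt fun c hc => ?_) (readAt_map_lt fun c hc => ?_) hm,
    hL.congr fun c h1 h2 => hm c (by omega) ?_, fun e p hp hlt => ?_⟩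
  · have hc' := List.mem_range.1 (List.mem_filter.1 hc).1
    have h1 := runStart_le f (digitEnd ρ (c / N)) (c % N)
    have h2 := Nat.div_add_mod' c N
    rw [keyX]
    omega
  · rw [keyY]
    exact Nat.mod_lt _ (by positivity)
  · rw [List.length_map] at h2
    omega
  · have := runStart_le f e p
    rw [hm _ (by omega) (by omega)]
    exact hrun e p hp hlt

theorem BlockOk.congr {ρ D ℓ N d B : ℕ} {keys : List ℕ} {mem mem' : ℕ → ℕ}
    (h : BlockOk ρ D ℓ N d B keys mem) (hk : keys.length ≤ 2 ^ ρ) (hbN : D * ρ * N ≤ 2 ^ ρ)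
    (hm : ∀ c, B ≤ c → c < B + 20 * 2 ^ ρ → mem' c = mem c) :
    BlockOk ρ D ℓ N d B keys mem' := by
  obtain ⟨A, hA, hs, hW, hT⟩ := h
  have := hA.length_eq
  exact ⟨A, hA, hs, hW.congr fun c h1 h2 => hm c h1 (by omega), hT.congr hbN hm⟩

theorem QueryOk.of_eq {w S : ℕ} {L : List ℕ} {ρ D ℓ h N d σ P Z : ℕ} {s s' : State}
    (hQ : QueryOk w S L ρ D ℓ h N d σ P Z s) (hm : s'.mem = s.mem)
    (hr : ∀ r, 10 ≤ r → r ≤ 22 → s'.reg r = s.reg r) : QueryOk w S L ρ D ℓ h N d σ P Z s' := by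
  obtain ⟨hZ, hL, hblock, htable, h10, h11, h12, h13, h14, h15, h17, h19, h21, h22⟩ := hQ
  refine ⟨hZ, hL, hm ▸ hblock, hm ▸ htable, ?_, ?_, ?_, ?_, ?_, ?_, ?_, ?_, ?_, ?_⟩ <;>
    rwa [hr _ (by decide) (by decide)]

theorem clog_mul_le (a b : ℕ) : Nat.clog 2 (a * b) ≤ Nat.clog 2 a + Nat.clog 2 b := by
  rw [Nat.clog_le_iff_le_pow (by omega), pow_add]
  exact Nat.mul_le_mul (Nat.le_pow_clog (by omega) a) (Nat.le_pow_clog (by omega) b)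

/-- Since `h ≤ 1 + logb 2 σ`, a bisection over `h + κ` bits takes `O(1 + log log σ)` rounds, with a
constant that depends on `κ` alone. -/
theorem clog_le_of_two_pow_le {σ h κ : ℕ} (hσ : 1 ≤ σ) (hh : 2 ^ h ≤ 2 * σ) :
    0 ≤ Real.logb 2 (Real.logb 2 σ) ∧
    (Nat.clog 2 (h + κ) : ℝ) ≤ (κ + 3) * (1 + Real.logb 2 (Real.logb 2 σ)) := by
  have hκ : (0 : ℝ) ≤ κ := Nat.cast_nonneg κ
  have hclog : ∀ y : ℝ, 1 ≤ y → ((h + κ : ℕ) : ℝ) ≤ (κ + 2) * y →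
      (Nat.clog 2 (h + κ) : ℝ) ≤ κ + 3 + Real.logb 2 y := by
    intro y hy hle
    rcases Nat.eq_zero_or_pos (h + κ) with h0 | h0
    · have := Real.logb_nonneg (one_lt_two) hy
      rw [h0, Nat.clog_zero_right]
      push_cast
      linarith
    · have h1 : (1 : ℝ) ≤ ((h + κ : ℕ) : ℝ) := by exact_mod_cast h0
      have h2 := Nat.ceil_lt_add_one (Real.logb_nonneg one_lt_two h1)
      have h3 := Real.natCeil_logb_natCast 2 (h + κ)
      rw [Nat.cast_ofNat] at h3
      rw [h3] at h2
      have h4 : Real.logb 2 ((h + κ : ℕ) : ℝ) ≤ Real.logb 2 ((κ + 2) * y) :=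
        Real.logb_le_logb_of_le one_lt_two (by linarith) hle
      rw [Real.logb_mul (by positivity) (by positivity)] at h4
      have h5 : Real.logb 2 ((κ : ℝ) + 2) ≤ κ + 2 := by
        rw [Real.logb_le_iff_le_rpow one_lt_two (by positivity)]
        have : ((κ + 2 : ℕ) : ℝ) ≤ ((2 ^ (κ + 2) : ℕ) : ℝ) := by
          exact_mod_cast Nat.lt_two_pow_self.le
        push_cast at this
        rw [show ((κ : ℝ) + 2) = ((κ + 2 : ℕ) : ℝ) by push_cast; ring, Real.rpow_natCast]
        push_cast
        linarith
      linarith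
  rcases Nat.lt_or_ge σ 2 with h2 | h2
  -- Here `logb 2 1 = 0` and `logb 2 0 = 0` by convention, so the factor is `1`, in agreement with
  -- the reading of the bound for `σ = 1`.
  · obtain rfl : σ = 1 := by omega
    have hh1 : h ≤ 1 := (Nat.pow_le_pow_iff_right (a := 2) (by omega)).1 (by simpa using hh)
    have := hclog 1 le_rfl (by
      have : (h : ℝ) ≤ 1 := by exact_mod_cast hh1
      push_cast; linarith)
    simp only [Nat.cast_one, Real.logb_one, Real.logb_zero, add_zero, mul_one] at this ⊢
    exact ⟨le_rfl, this⟩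
  · have hσ2 : (2 : ℝ) ≤ σ := by exact_mod_cast h2
    have hy : 1 ≤ Real.logb 2 (σ : ℝ) := by
      rw [Real.le_logb_iff_rpow_le one_lt_two (by linarith), Real.rpow_one]
      exact hσ2
    have hhy : (h : ℝ) ≤ 1 + Real.logb 2 σ := by
      have h3 : ((2 : ℝ) ^ h) ≤ 2 * σ := by exact_mod_cast hh
      have h4 : (h : ℝ) ≤ Real.logb 2 (2 * σ) := by
        rw [Real.le_logb_iff_rpow_le one_lt_two (by linarith), Real.rpow_natCast]
        exact h3
      rwa [Real.logb_mul (by norm_num) (by linarith), Real.logb_self_eq_one one_lt_two] at h4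
    have hyy := Real.logb_nonneg one_lt_two hy
    have := hclog _ hy (by push_cast; nlinarith)
    exact ⟨hyy, by nlinarith⟩

end WordRAM

/-! ### Layout of the whole data structure -/

namespace WordRAM

/-- Build the search structures of all blocks. -/
def buildBlocks (D : ℕ) : Prog :=
  forUp 90 18 (.assign 27 (.reg 90 * .reg 10) ;; .assign 23 (.reg 91 + .reg 90 * .reg 19) ;;
    buildBlock D)

variable {w S : ℕ} {L : List ℕ}

/-- Every block gets its own area of zeroed memory, so finished blocks are untouched afterwards and
nothing has to be cleared. -/
theorem vc_buildBlocks {s : State} {ρ D ℓ h N d σ P K : ℕ} (hZ : SizeOk w S ρ D ℓ h N d σ)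
    (hL : ∀ a ∈ L, a < σ) (hn : L.length + 1 + ℓ < 2 ^ w) (hK : K = (L.length + 1) / ℓ + 1)
    (h0 : s.reg 0 = L.length) (h10 : s.reg 10 = ℓ) (h11 : s.reg 11 = ρ) (h12 : s.reg 12 = 2 ^ ρ)
    (h13 : s.reg 13 = D * ρ) (h14 : s.reg 14 = d) (h15 : s.reg 15 = N)
    (h17 : s.reg 17 = 2 ^ (h + 1)) (h18 : s.reg 18 = K) (h19 : s.reg 19 = (5 * D + 20) * 2 ^ ρ)
    (h91 : s.reg 91 = P) (hS : P + K * ((5 * D + 20) * 2 ^ ρ) ≤ S)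
    (hz : ∀ c, P ≤ c → s.mem c = 0) :
    vc w S L (buildBlocks D) s fun t s' => t ≤ K * ((D + 20) * 1000 * 2 ^ ρ + 28) + 6 ∧
      (∀ k < K, BlockOk ρ D ℓ N d (P + 5 * D * 2 ^ ρ + k * ((5 * D + 20) * 2 ^ ρ))
        (blockKeys L ℓ (h + 1) k) s'.mem) ∧ ∀ c < P, s'.mem c = s.mem c := by
  have hR : 0 < 2 ^ ρ := by positivity
  set Z := (5 * D + 20) * 2 ^ ρ with hZd
  have eZ : Z = 5 * D * 2 ^ ρ + 20 * 2 ^ ρ := by rw [hZd]; ring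
  have hKZ : K ≤ K * Z := Nat.le_mul_of_pos_right _ (by positivity)
  have hSw := hZ.hSw
  have hw := hZ.hw
  have hM := hZ.hM
  have hℓR := hZ.hℓR
  have hlen : ∀ k, (blockKeys L ℓ (h + 1) k).length = ℓ + 1 := fun k => by simp [blockKeys]
  refine vc_forUp_le ((D + 20) * 1000 * 2 ^ ρ + 20) (fun k s' =>
    (∀ j < k, BlockOk ρ D ℓ N d (P + 5 * D * 2 ^ ρ + j * Z) (blockKeys L ℓ (h + 1) j) s'.mem) ∧
    ∀ c, (c < P ∨ P + k * Z ≤ c) → s'.mem c = s.mem c) (by decide) rfl rfl (by omega) (by omega)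
    ⟨fun j hj => absurd hj (Nat.not_lt_zero _), fun _ _ => rfl⟩ ?_ ?_
  · rintro k s₁ hk h90 hf ⟨hb, ho⟩
    rw [h18] at hk
    have g0 := (hf 0 (by decide) rfl).trans h0
    have g10 := (hf 10 (by decide) rfl).trans h10
    have g11 := (hf 11 (by decide) rfl).trans h11
    have g12 := (hf 12 (by decide) rfl).trans h12
    have g13 := (hf 13 (by decide) rfl).trans h13
    have g14 := (hf 14 (by decide) rfl).trans h14
    have g15 := (hf 15 (by decide) rfl).trans h15
    have g17 := (hf 17 (by decide) rfl).trans h17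
    have g19 := (hf 19 (by decide) rfl).trans h19
    have g91 := (hf 91 (by decide) rfl).trans h91
    have hkℓ : k * ℓ ≤ L.length + 1 :=
      (Nat.le_div_iff_mul_le hZ.hℓ).1 (by omega)
    have hk1 : (k + 1) * Z ≤ K * Z := Nat.mul_le_mul_right _ hk
    have e1 : (k + 1) * Z = k * Z + Z := by ring
    simp only [vc, Expr.Ok, Expr.val, BinOp.val, BinOp.Ok, Expr.cost, true_and,
      Function.update_of_ne, ne_eq, Nat.reduceEqDiff, not_false_eq_true, g10, g19, g91, h90]
    refine ⟨by omega, by omega, ?_⟩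
    refine vc_conseq (vc_buildBlock (k := k) (P := P + k * Z) hZ hL (by omega) (by omega) (by simpa)
      (by simpa) (by simpa) (by simpa) (by simpa) (by simpa) (by simpa) (by simpa) (by simp)
      (by simp) (by rw [← hZd]; omega) fun c h1 h2 => ?_) ?_
    · simp only
      rw [ho c (by omega), hz c (by omega)]
    · rintro t s₂ - - ⟨ht, hB, ho₂⟩
      rw [← hZd] at ho₂
      refine ⟨by omega, fun j hj => ?_, fun c hc => ?_⟩
      · rcases eq_or_lt_of_le (Nat.le_of_lt_succ hj) with rfl | hj
        · convert hB using 1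
          ring
        · have hj1 : (j + 1) * Z ≤ k * Z := Nat.mul_le_mul_right _ hj
          have e2 : (j + 1) * Z = j * Z + Z := by ring
          refine (hb j hj).congr (by rw [hlen]; omega) (by omega) fun c h1 h2 => ?_
          exact ho₂ c (by omega)
      · exact (ho₂ c (by omega)).trans (ho c (by omega))
  · rintro t s₁ ht - - ⟨hb, ho⟩
    rw [h18] at ht hb
    exact ⟨ht, hb, fun c hc => ho c (Or.inl hc)⟩

/-- Choose the size of the blocks and the number of bits of the digits. -/
def chooseSize (c : ℕ) : Prog :=
  .assign 10 (.reg 0 + 2) ;; .ite (.bin .lt (.reg 1) (.reg 10)) (.assign 10 (.reg 1)) .skip ;;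
  .assign 22 (.reg 10 + 1) ;; .assign 11 (.const (c + 11)) ;; .assign 12 (.const (2 ^ (c + 11))) ;;
  .assign 16 1 ;; .assign 17 2 ;;
  .loop (.bin .lt (.reg 16) (.reg 22)) (.assign 16 (.reg 16 + .reg 16) ;;
    .assign 17 (.reg 17 + .reg 17) ;; .assign 12 (.reg 12 + .reg 12) ;; .assign 11 (.reg 11 + 1))

/-- Doubling finds `h` with `ℓ < 2 ^ h ≤ 2 * ℓ`. The lower bound makes room for position numbers in
the keys; the upper bound makes `2 ^ ρ` linear in `ℓ` for fixed `c`. -/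
theorem vc_chooseSize {c n σ ℓ : ℕ} {s : State} (hσ : 0 < σ) (hℓ : ℓ = min σ (n + 2))
    (hb : 2 ^ (c + 12) * ℓ < 2 ^ w) (hn : n + 2 < 2 ^ w) (h0 : s.reg 0 = n) (h1 : s.reg 1 = σ) :
    vc w S L (chooseSize c) s fun t s' => t ≤ ℓ * 60 + 60 ∧ ∃ h, ℓ < 2 ^ h ∧ 2 ^ h ≤ 2 * ℓ ∧
      s'.reg 10 = ℓ ∧ s'.reg 11 = h + (c + 11) ∧ s'.reg 12 = 2 ^ (h + (c + 11)) ∧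
      s'.reg 17 = 2 ^ (h + 1) ∧ s'.reg 22 = ℓ + 1 := by
  have hw0 : w ≠ 0 := by rintro rfl; omega
  have hℓ0 : 0 < ℓ := by omega
  have e12 : 2 ^ (c + 12) * ℓ = 2 ^ (c + 11) * (2 * ℓ) := by ring
  have h2c : 2 ^ 11 ≤ 2 ^ (c + 11) := Nat.pow_le_pow_right (by omega) (by omega)
  have hc2 : c + 11 < 2 ^ (c + 11) := Nat.lt_two_pow_self
  have hmul : ∀ x, x ≤ 2 * ℓ → x * 2 ^ (c + 11) < 2 ^ w := fun x hx =>
    lt_of_le_of_lt (by rw [e12, mul_comm]; exact Nat.mul_le_mul_left _ hx) hb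
  have hmul2 := hmul 2 (by omega)
  have hmulℓ := hmul (2 * ℓ) le_rfl
  have hℓc : 2 * ℓ * 2 ^ 11 ≤ 2 * ℓ * 2 ^ (c + 11) := Nat.mul_le_mul_left _ h2c
  refine vc_seq (Q' := fun t s' => t = 4 ∧ s' = ⟨Function.update s.reg 10 (n + 2), s.mem⟩) ?_ ?_
  · simp only [vc, Expr.Ok, Expr.val, BinOp.Ok, BinOp.val, Expr.cost, true_and, h0, and_true]
    exact ⟨by omega, hn⟩
  rintro _ _ - - ⟨rfl, rfl⟩
  refine vc_seq (Q' := fun t s' => t ≤ 10 ∧ s'.reg 10 = ℓ) ?_ ?_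
  · simp only [vc, Expr.Ok, Expr.val, BinOp.Ok, BinOp.val, Expr.cost,
      true_and, and_true, Function.update_self, Function.update_of_ne, ne_eq, Nat.reduceEqDiff,
      not_false_eq_true, h1, ltVal_eq_zero]
    refine ⟨fun _ => ⟨by omega, by omega⟩, fun _ => ⟨by omega, by omega⟩⟩
  rintro t₁ s₁ - - ⟨ht₁, g10⟩
  simp only [vc, Expr.add_def, Expr.ofNat_def, Expr.Ok, Expr.val, BinOp.Ok, BinOp.val, Expr.cost,
      true_and, g10]
  repeat' with_reducible apply And.intro
  any_goals omega
  refine vc_loop (fun t s' => t ≤ 30 * s'.reg 16 ∧ ∃ h, s'.reg 16 = 2 ^ h ∧ 2 ^ h ≤ 2 * ℓ ∧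
      s'.reg 11 = h + (c + 11) ∧ s'.reg 12 = 2 ^ (h + (c + 11)) ∧
      s'.reg 17 = 2 ^ (h + 1)) (fun s' => 2 * ℓ - s'.reg 16) ?_ ?_ ?_ ?_
  · exact ⟨by simp, 0, by simp; omega⟩
  · intro t s' _ _
    exact ⟨trivial, trivial, trivial⟩
  · rintro t s₂ hf ⟨ht, h, h16, hle, h11, h12, h17⟩ hne
    have g22 : s₂.reg 22 = ℓ + 1 := by simpa using hf 22 rfl
    simp only [Expr.val, BinOp.val, ne_eq, ltVal_eq_zero, not_le, g22, h16] at hne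
    have hp : 0 < 2 ^ h := by positivity
    have hle' : 2 ^ (h + 1) ≤ 2 * ℓ := by rw [pow_succ]; omega
    have hh : h < 2 ^ h := Nat.lt_two_pow_self
    have hm := hmul _ hle'
    have e1 : 2 ^ (h + 1) * 2 ^ (c + 11) = 2 ^ (h + (c + 11)) + 2 ^ (h + (c + 11)) := by
      rw [← pow_add]; ring
    have e2 : 2 ^ (h + 1) = 2 ^ h + 2 ^ h := by ring
    have e3 : 2 ^ (h + 1 + 1) = 2 ^ (h + 1) + 2 ^ (h + 1) := by ring
    have e4 : 2 ^ (h + 1 + (c + 11)) = 2 ^ (h + (c + 11)) + 2 ^ (h + (c + 11)) := by ring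
    simp only [vc, Expr.Ok, Expr.val, BinOp.Ok, BinOp.val, Expr.cost,
      true_and, Function.update_self, Function.update_of_ne, ne_eq, Nat.reduceEqDiff,
      not_false_eq_true, h16, h11, h12, h17]
    refine ⟨by omega, by omega, by omega, by omega, ⟨by omega, h + 1, ?_⟩, by omega⟩
    exact ⟨by omega, by omega, by omega, by omega, by omega⟩
  · rintro t s₂ hf ⟨ht, h, h16, hle, h11, h12, h17⟩ heq
    have g22 : s₂.reg 22 = ℓ + 1 := by simpa using hf 22 rfl
    have g10 : s₂.reg 10 = ℓ := by simpa [g10] using hf 10 rfl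
    simp only [Expr.val, BinOp.val, ltVal_eq_zero, g22, h16] at heq
    exact ⟨by simp only [Expr.cost]; omega, h, by omega, hle, g10, h11, h12, h17, g22⟩

/-- Compute the remaining parameters and save them. -/
def layout (D : ℕ) : Prog :=
  .assign 13 (.const D * .reg 11) ;; .assign 14 (.reg 13 * .reg 11) ;;
  .assign 15 (.reg 10 / .reg 14 + 1) ;; .assign 19 (.const (5 * D + 20) * .reg 12) ;;
  .assign 24 ((.reg 0 + 1) / .reg 10) ;; .assign 18 (.reg 24 + 1) ;;
  .assign 91 (16 + .reg 18 * .reg 10) ;; .assign 21 (.reg 91 + .const (5 * D) * .reg 12)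

/-- A query knows only the memory, so the parameters go into the first words. Word `0` is the
initial cursor `n + 1`. -/
def saveSizes : Prog :=
  .store 0 (.reg 0 + 1) ;; .store 1 (.reg 10) ;; .store 2 (.reg 11) ;; .store 3 (.reg 12) ;;
  .store 4 (.reg 13) ;; .store 5 (.reg 14) ;; .store 6 (.reg 15) ;; .store 7 (.reg 17) ;;
  .store 8 (.reg 19) ;; .store 9 (.reg 21) ;; .store 10 (.reg 22)

def loadSizes : Prog :=
  .load 1 0 ;; .load 10 1 ;; .load 11 2 ;; .load 12 3 ;; .load 13 4 ;; .load 14 5 ;; .load 15 6 ;;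
  .load 17 7 ;; .load 19 8 ;; .load 21 9 ;; .load 22 10

def blockPre (c : ℕ) : Prog :=
  chooseSize c ;; layout (c + 2) ;; saveSizes ;; makeTable ;; buildBlocks (c + 2)

theorem vc_layout {s : State} {n ℓ ρ D K : ℕ} (h0 : s.reg 0 = n) (h10 : s.reg 10 = ℓ)
    (h11 : s.reg 11 = ρ) (h12 : s.reg 12 = 2 ^ ρ) (hK : K = (n + 1) / ℓ + 1)
    (hS : 16 + K * ℓ + K * ((5 * D + 20) * 2 ^ ρ) ≤ S) (hSw : S < 2 ^ w) (hw : 100 < 2 ^ w)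
    (hd : D * ρ * ρ + ℓ < 2 ^ w) (hD : 0 < D) (hρ : 0 < ρ) (hℓ : 0 < ℓ) (hn : n + 1 < 2 ^ w) :
    vc w S L (layout D) s fun t s' => t ≤ 60 ∧ s'.reg 13 = D * ρ ∧ s'.reg 14 = D * ρ * ρ ∧
      s'.reg 15 = ℓ / (D * ρ * ρ) + 1 ∧ s'.reg 19 = (5 * D + 20) * 2 ^ ρ ∧
      s'.reg 24 = (n + 1) / ℓ ∧ s'.reg 18 = K ∧ s'.reg 91 = 16 + K * ℓ ∧
      s'.reg 21 = 16 + K * ℓ + 5 * D * 2 ^ ρ := by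
  have hw0 : w ≠ 0 := by rintro rfl; omega
  have hd' : D * ρ ≤ D * ρ * ρ := Nat.le_mul_of_pos_right _ hρ
  have hd2 : D ≤ D * ρ := Nat.le_mul_of_pos_right _ hρ
  have hR : 0 < 2 ^ ρ := by positivity
  have h1 : 1 * ((5 * D + 20) * 2 ^ ρ) ≤ K * ((5 * D + 20) * 2 ^ ρ) :=
    Nat.mul_le_mul_right _ (by rw [hK]; exact Nat.succ_pos _)
  have h2 : 5 * D + 20 ≤ (5 * D + 20) * 2 ^ ρ := Nat.le_mul_of_pos_right _ hR
  have h3 : (5 * D + 20) * 2 ^ ρ = 5 * D * 2 ^ ρ + 20 * 2 ^ ρ := by ring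
  have h4 : K ≤ K * ℓ := Nat.le_mul_of_pos_right _ hℓ
  have h5 := Nat.div_le_self ℓ (D * ρ * ρ)
  have h6 : 0 < D * ρ * ρ := by positivity
  simp only [layout, vc, Expr.add_def, Expr.mul_def, Expr.div_def, Expr.ofNat_def, Expr.Ok, Expr.val,
    BinOp.val, BinOp.Ok, Expr.cost, true_and, and_true, Function.update_self, Function.update_of_ne,
    ne_eq, Nat.reduceEqDiff, not_false_eq_true, h0, h10, h11, h12, ← hK]
  repeat' with_reducible apply And.intro
  all_goals omega

theorem vc_saveSizes {s : State} (hS : 16 ≤ S) (hSw : S < 2 ^ w) (h0 : s.reg 0 + 1 < 2 ^ w) :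
    vc w S L saveSizes s fun t s' => t ≤ 40 ∧ s'.mem 0 = s.reg 0 + 1 ∧ s'.mem 1 = s.reg 10 ∧
      s'.mem 2 = s.reg 11 ∧ s'.mem 3 = s.reg 12 ∧ s'.mem 4 = s.reg 13 ∧ s'.mem 5 = s.reg 14 ∧
      s'.mem 6 = s.reg 15 ∧ s'.mem 7 = s.reg 17 ∧ s'.mem 8 = s.reg 19 ∧ s'.mem 9 = s.reg 21 ∧
      s'.mem 10 = s.reg 22 ∧ ∀ c, 16 ≤ c → s'.mem c = s.mem c := by
  have hw0 : w ≠ 0 := by rintro rfl; omega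
  simp only [saveSizes, vc, Expr.add_def, Expr.ofNat_def, Expr.Ok, Expr.val,
    BinOp.val, BinOp.Ok, Expr.cost, true_and, Function.update_self, Function.update_of_ne,
    ne_eq, Nat.reduceEqDiff, not_false_eq_true, Nat.reduceEqDiff, OfNat.zero_ne_ofNat,
    OfNat.one_ne_ofNat, zero_ne_one]
  repeat' with_reducible apply And.intro
  any_goals omega
  intro c hc
  rw [Function.update_of_ne (by omega), Function.update_of_ne (by omega),
    Function.update_of_ne (by omega), Function.update_of_ne (by omega),
    Function.update_of_ne (by omega), Function.update_of_ne (by omega),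
    Function.update_of_ne (by omega), Function.update_of_ne (by omega),
    Function.update_of_ne (by omega), Function.update_of_ne (by omega),
    Function.update_of_ne (by omega)]

theorem vc_loadSizes {s : State} (hS : 16 ≤ S) (hSw : S < 2 ^ w) :
    vc w S L loadSizes s fun t s' => t ≤ 30 ∧ s'.reg 1 = s.mem 0 ∧ s'.reg 10 = s.mem 1 ∧
      s'.reg 11 = s.mem 2 ∧ s'.reg 12 = s.mem 3 ∧ s'.reg 13 = s.mem 4 ∧ s'.reg 14 = s.mem 5 ∧
      s'.reg 15 = s.mem 6 ∧ s'.reg 17 = s.mem 7 ∧ s'.reg 19 = s.mem 8 ∧ s'.reg 21 = s.mem 9 ∧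
      s'.reg 22 = s.mem 10 := by
  have hw0 : w ≠ 0 := by rintro rfl; omega
  simp only [loadSizes, vc, Expr.ofNat_def, Expr.Ok, Expr.val,
    Expr.cost, and_true, Function.update_self, Function.update_of_ne,
    ne_eq, Nat.reduceEqDiff, not_false_eq_true]
  repeat' with_reducible apply And.intro
  all_goals omega

end WordRAM

/-! ### Assembling the second claim -/

namespace WordRAM

variable {w S : ℕ} {L : List ℕ}

/-- The data structure with `h + (c + 11)` bits per digit, in the state at the start of a query. -/
def BlocksOk (w S : ℕ) (L : List ℕ) (c ℓ h σ : ℕ) (s : State) : Prop :=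
  QueryOk w S L (h + (c + 11)) (c + 2) ℓ h
    (ℓ / ((c + 2) * (h + (c + 11)) * (h + (c + 11))) + 1)
    ((c + 2) * (h + (c + 11)) * (h + (c + 11))) σ
    (16 + ((L.length + 1) / ℓ + 1) * ℓ + 5 * (c + 2) * 2 ^ (h + (c + 11)))
    ((5 * (c + 2) + 20) * 2 ^ (h + (c + 11))) s

theorem vc_blockPre {c σ ℓ tp : ℕ} (hσ : 0 < σ) (hL : ∀ a ∈ L, a < σ)
    (hσn : σ ≤ (L.length + 1) ^ c) (hℓ : ℓ = min σ (L.length + 2))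
    (hb : 2 ^ (c + 12) * ℓ < 2 ^ w) (hSw : S < 2 ^ w) (hw : 100 < 2 ^ w)
    (hsize : ∀ h, 2 ^ h ≤ 2 * ℓ → 2 ^ ((c + 2) * (h + (c + 11))) < 2 ^ w ∧
      2 ^ (h + (c + 11)) * 2 ^ (h + (c + 11)) < 2 ^ w ∧
      16 + ((L.length + 1) / ℓ + 1) * ℓ +
        ((L.length + 1) / ℓ + 1) * ((5 * (c + 2) + 20) * 2 ^ (h + (c + 11))) ≤ S ∧
      ℓ * 60 + 200 + ((L.length + 1) / ℓ + 1) * (ℓ * 60 + 48) +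
        ((L.length + 1) / ℓ + 1) * ((c + 2 + 20) * 1000 * 2 ^ (h + (c + 11)) + 28) ≤ tp) :
    vc w S L (blockPre c) (preStart L.length σ) fun t s => t ≤ tp ∧ ∀ Q : List ℕ,
      vc w S Q loadSizes (queryStart Q.length s.mem) fun t s' => t ≤ 30 ∧ s'.reg 0 = Q.length ∧
        s'.reg 1 = L.length + 1 ∧ ∃ h, 2 ^ h ≤ 2 * ℓ ∧ BlocksOk w S L c ℓ h σ s' := by
  have hℓ0 : 0 < ℓ := by omega
  have hKl : L.length + 1 < (L.length + 1) / ℓ * ℓ + ℓ := Nat.lt_div_mul_add hℓ0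
  set K := (L.length + 1) / ℓ + 1 with hK
  have hKe : (L.length + 1) / ℓ * ℓ + ℓ = K * ℓ := by rw [hK]; ring
  have hS0 := (hsize 0 (by simp; omega)).2.2.1
  refine vc_seq (vc_chooseSize (n := L.length) (σ := σ) hσ hℓ hb (by omega) rfl rfl) ?_
  rintro t₁ s₁ f₁ m₁ ⟨ht₁, h, hh, hh', h10, h11, h12, h17, h22⟩
  have m₁ : s₁.mem = fun _ => 0 := m₁ rfl
  have h0 : s₁.reg 0 = L.length := f₁ 0 rfl
  clear f₁
  obtain ⟨hkw, hRR, hS, htp⟩ := hsize h hh'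
  clear hsize hS0
  have hZ := sizeOk_of (S := S) hσ hσn hℓ hh rfl rfl rfl hkw hSw hw hRR
  have hZN := hZ.hN
  have hℓR := hZ.hℓR
  have hdle := hZ.d_le
  simp only [BlocksOk, ← hK]
  set ρ := h + (c + 11) with hρ
  have hR : 0 < 2 ^ ρ := by positivity
  have hK1 : 1 * ((5 * (c + 2) + 20) * 2 ^ ρ) ≤ K * ((5 * (c + 2) + 20) * 2 ^ ρ) :=
    Nat.mul_le_mul_right _ (Nat.succ_pos _)
  have eZ : (5 * (c + 2) + 20) * 2 ^ ρ = 5 * (c + 2) * 2 ^ ρ + 20 * 2 ^ ρ := by ring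
  refine vc_seq (vc_layout (n := L.length) (ℓ := ℓ) h0 h10 h11 h12 hK hS hSw hw (by omega) hZ.hD hZ.hρ
    hℓ0 (by omega)) ?_
  rintro t₂ s₂ f₂ m₂ ⟨ht₂, h13, h14, h15, h19, h24, h18, h91, h21⟩
  replace m₂ := (m₂ rfl).trans m₁
  replace h0 := (f₂ 0 rfl).trans h0
  replace h10 := (f₂ 10 rfl).trans h10
  replace h11 := (f₂ 11 rfl).trans h11
  replace h12 := (f₂ 12 rfl).trans h12
  replace h17 := (f₂ 17 rfl).trans h17
  replace h22 := (f₂ 22 rfl).trans h22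
  clear f₂ m₁
  refine vc_seq (vc_saveSizes (by omega) hSw (by omega)) ?_
  rintro t₃ s₃ f₃ - ⟨ht₃, p0, p1, p2, p3, p4, p5, p6, p7, p8, p9, p10, o₃⟩
  rw [h0] at p0
  rw [h10] at p1
  rw [h11] at p2
  rw [h12] at p3
  rw [h13] at p4
  rw [h14] at p5
  rw [h15] at p6
  rw [h17] at p7
  rw [h19] at p8
  rw [h21] at p9
  rw [h22] at p10
  refine vc_seq (vc_makeTable ((f₃ 0 rfl).trans h0) ((f₃ 10 rfl).trans h10) ((f₃ 24 rfl).trans h24) hℓ0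
    (by omega) hSw hw fun i _ => ?_) ?_
  · rw [o₃ _ (by omega), m₂]
  rintro t₄ s₄ f₄ - ⟨ht₄, htab, o₄⟩
  have hf : ∀ r, saveSizes.writes r = false → makeTable.writes r = false → s₄.reg r = s₂.reg r :=
    fun r h1 h2 => (f₄ r h2).trans (f₃ r h1)
  refine vc_conseq (vc_buildBlocks (P := 16 + K * ℓ) hZ hL (by omega) hK ((hf 0 rfl rfl).trans h0)
    ((hf 10 rfl rfl).trans h10) ((hf 11 rfl rfl).trans h11) ((hf 12 rfl rfl).trans h12)
    ((hf 13 rfl rfl).trans h13) ((hf 14 rfl rfl).trans h14) ((hf 15 rfl rfl).trans h15)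
    ((hf 17 rfl rfl).trans h17) ((hf 18 rfl rfl).trans h18) ((hf 19 rfl rfl).trans h19)
    ((hf 91 rfl rfl).trans h91) hS fun i hi => ?_) ?_
  · rw [o₄ _ (by omega), o₃ _ (by omega), m₂]
  rintro t₅ s₅ - - ⟨ht₅, hblk, o₅⟩
  have hlo : ∀ i < 16, s₅.mem i = s₃.mem i := fun i hi => by
    rw [o₅ _ (by omega), o₄ _ (by omega)]
  refine ⟨?_, fun Q => vc_conseq (vc_loadSizes (by omega) hSw) ?_⟩
  · have : (L.length + 1) / ℓ * (ℓ * 60 + 48) ≤ K * (ℓ * 60 + 48) :=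
      Nat.mul_le_mul_right _ (by omega)
    omega
  rintro t₆ s₆ f₆ m₆ ⟨ht₆, q0, q1, q2, q3, q4, q5, q6, q7, q8, q9, q10⟩
  have m₆ : s₆.mem = s₅.mem := m₆ rfl
  simp only [queryStart] at q0 q1 q2 q3 q4 q5 q6 q7 q8 q9 q10
  rw [hlo _ (by decide)] at q0 q1 q2 q3 q4 q5 q6 q7 q8 q9 q10
  refine ⟨ht₆, f₆ 0 rfl, q0.trans p0, h, hh', hZ, hL, fun k hk => ⟨?_, ?_⟩, fun k hk => ⟨?_, ?_⟩,
    q1.trans p1, q2.trans p2, q3.trans p3, q4.trans p4, q5.trans p5, q6.trans p6, q7.trans p7,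
    q8.trans p8, q9.trans p9, q10.trans p10⟩
  · have hkK : k + 1 ≤ K := Nat.succ_le_succ ((Nat.le_div_iff_mul_le hℓ0).2 hk)
    have h1 : (k + 1) * ((5 * (c + 2) + 20) * 2 ^ ρ) ≤ K * ((5 * (c + 2) + 20) * 2 ^ ρ) :=
      Nat.mul_le_mul_right _ hkK
    rw [Nat.add_mul k, one_mul] at h1
    change 16 + K * ℓ + 5 * (c + 2) * 2 ^ ρ + k * ((5 * (c + 2) + 20) * 2 ^ ρ) + 20 * 2 ^ ρ ≤ S
    omega
  · rw [m₆]
    exact hblk k (Nat.lt_succ_of_le ((Nat.le_div_iff_mul_le hℓ0).2 hk))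
  · have hkK : k + 1 ≤ K := Nat.succ_le_succ ((Nat.le_div_iff_mul_le hℓ0).2 hk)
    have h1 : (k + 1) * ℓ ≤ K * ℓ := Nat.mul_le_mul_right _ hkK
    rw [Nat.add_mul, one_mul] at h1
    omega
  · intro a ha
    have hkK : k + 1 ≤ K := Nat.succ_le_succ ((Nat.le_div_iff_mul_le hℓ0).2 hk)
    have h1 : (k + 1) * ℓ ≤ K * ℓ := Nat.mul_le_mul_right _ hkK
    rw [Nat.add_mul, one_mul] at h1
    have h2 := Nat.mod_lt a hℓ0
    -- The alternative `ℓ = σ` or `n + 1 < ℓ` required by `step_modText` comes from `ℓ = min σ (n +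
    -- 2)`.
    rw [m₆, o₅ _ (by omega), htab k hk _ h2, step_modText hL ha (by omega) hk]

theorem clog_le_self (n : ℕ) : Nat.clog 2 n ≤ n :=
  (Nat.clog_le_iff_le_pow (by omega)).2 Nat.lt_two_pow_self.le

/-- The structure consisting of the table and of the search structures of the blocks. -/
theorem blocks_solve (c : ℕ) {w σ ℓ S H : ℕ} (T : List (Fin σ)) (hσ : 0 < σ)
    (hσn : σ ≤ (T.length + 1) ^ c) (hℓ : ℓ = min σ (T.length + 2))
    (hb : 2 ^ (c + 12) * ℓ < 2 ^ w) (hSw : S < 2 ^ w) (hw : 100 < 2 ^ w)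
    (hH : ∀ h, 2 ^ h ≤ 2 * ℓ → h ≤ H)
    (hsize : ∀ h, 2 ^ h ≤ 2 * ℓ → 2 ^ ((c + 2) * (h + (c + 11))) < 2 ^ w ∧
      2 ^ (h + (c + 11)) * 2 ^ (h + (c + 11)) < 2 ^ w ∧
      16 + ((T.length + 1) / ℓ + 1) * ℓ +
        ((T.length + 1) / ℓ + 1) * ((5 * (c + 2) + 20) * 2 ^ (h + (c + 11))) ≤ S ∧
      ℓ * 60 + 200 + ((T.length + 1) / ℓ + 1) * (ℓ * 60 + 48) +
        ((T.length + 1) / ℓ + 1) * ((c + 2 + 20) * 1000 * 2 ^ (h + (c + 11)) + 28) ≤ S)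
    {f : ℝ} {g : ℕ → ℝ} (hf : (S : ℝ) ≤ f)
    (hg : ∀ m : ℕ, ((30 + m * (((c + 2) * 240 + Nat.clog 2 (H + (c + 11)) * 280 + 300) + 10) + 10 :
      ℕ) : ℝ) ≤ g m) :
    SolvesSubsequenceIndexing (blockPre c) (queryProg loadSizes blockQuery) w T f g := by
  have hlen : (T.map Fin.val).length = T.length := List.length_map _
  refine solves_of_vc (σ := σ) S S hf hf
    (fun s => ∃ h, 2 ^ h ≤ 2 * ℓ ∧ BlocksOk w S (T.map Fin.val) c ℓ h σ s) 30 _ (by omega) hg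
    rfl rfl rfl rfl ?_ ?_
  · rintro s s' ⟨h, hh, hQ⟩ hm hfr
    refine ⟨h, hh, hQ.of_eq hm fun r h1 h2 => hfr r (by omega) (by omega) (by omega) ?_⟩
    interval_cases r <;> rfl
  · have hpre := vc_blockPre (L := T.map Fin.val) (S := S) (w := w) (tp := S) (c := c) (ℓ := ℓ) hσ
      (by simp) (by rwa [hlen]) (by rwa [hlen]) hb hSw hw (by rwa [hlen])
    rw [hlen] at hpre
    refine vc_conseq hpre ?_
    rintro t D - - ⟨ht, hq⟩
    refine ⟨ht, fun Q _ => ⟨hq Q, ?_⟩⟩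
    rintro s ⟨h, hh, hQ⟩ hs1 hs3
    refine vc_conseq (vc_blockQuery hQ (by rwa [hlen]) hs3) ?_
    rintro t s' - - ⟨ht', hs'⟩
    refine ⟨?_, hs'⟩
    -- As `d = D * ρ * ρ`, the logarithm of `d` is at most that of `D` plus twice that of `ρ`. This
    -- is where 280 = 200 + 2 * 40 and 240 = 200 + 40 come from.
    have h1 := clog_mul_le ((c + 2) * (h + (c + 11))) (h + (c + 11))
    have h2 := clog_mul_le (c + 2) (h + (c + 11))
    have h3 := clog_le_self (c + 2)
    have h4 : Nat.clog 2 (h + (c + 11)) ≤ Nat.clog 2 (H + (c + 11)) :=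
      Nat.clog_mono_right 2 (by have := hH h hh; omega)
    omega

theorem block_structure (c : ℕ) :
    ∃ (pre qry : Prog) (k : ℕ) (C : ℝ), 1 ≤ k ∧
      ∀ (σ : ℕ) (T : List (Fin σ)) (w : ℕ), 1 ≤ σ →
        σ ≤ (T.length + 1) ^ c →
        (T.length + σ + 1) ^ k ≤ 2 ^ w →
        SolvesSubsequenceIndexing pre qry w T
          (C * ((T.length : ℝ) + 1))
          (fun m => C * ((m : ℝ) + 1) * (1 + Real.logb 2 (Real.logb 2 (σ : ℝ)))) := by
  -- The cost of a block is at most `(c + 22) * 1000 * 2 ^ ρ` up to lower order, and the number of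
  -- blocks times `2 ^ ρ` is at most `6 * 2 ^ (c + 11) * (n + 1)`; the last 1000 pays for the
  -- remaining phases.
  obtain ⟨C₀, hC₀⟩ : ∃ C₀, C₀ = (c + 22) * 6000 * 2 ^ (c + 11) + 1000 := ⟨_, rfl⟩
  -- The exponent adds up what the quantities that must fit into a word require: the size `C₀ * (n +
  -- 1)` of the memory, the keys below `2 ^ (D * ρ)` and the products `2 ^ ρ * 2 ^ ρ`, using `2 ^ ρ
  -- ≤ m ^ (c + 13)`.
  refine ⟨blockPre c, queryProg loadSizes blockQuery, C₀ + (c + 2) * (c + 13) + 2 * (c + 13) + 1,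
    C₀ + 1000 * (c + 20), by omega, fun σ T w hσ hσn hw => ?_⟩
  set n := T.length with hn
  obtain ⟨m, hm⟩ : ∃ m, m = n + σ + 1 := ⟨_, rfl⟩
  rw [← hm] at hw
  have hm2 : 2 ≤ m := by omega
  have hlt : ∀ e x, e < C₀ + (c + 2) * (c + 13) + 2 * (c + 13) + 1 → x ≤ m ^ e → x < 2 ^ w :=
    fun e x he hx => lt_of_le_of_lt hx ((Nat.pow_lt_pow_right hm2 he).trans_le hw)
  obtain ⟨ℓ, hℓ⟩ : ∃ ℓ, ℓ = min σ (n + 2) := ⟨_, rfl⟩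
  have hℓ0 : 0 < ℓ := by omega
  -- Since `ℓ ≤ n + 2`, rounding up the number of blocks keeps their total length linear in `n + 1`,
  -- even when `σ` is much larger.
  have hKℓ : ((n + 1) / ℓ + 1) * ℓ ≤ 3 * (n + 1) := by
    have := Nat.div_mul_le_self (n + 1) ℓ
    rw [Nat.add_mul, one_mul]
    omega
  have hK : (n + 1) / ℓ + 1 ≤ 3 * (n + 1) := (Nat.le_mul_of_pos_right _ hℓ0).trans hKℓ
  have h2m : ∀ e, 2 ^ e ≤ m ^ e := fun e => Nat.pow_le_pow_left hm2 e
  have hC₀m : C₀ ≤ m ^ C₀ := Nat.lt_two_pow_self.le.trans (h2m _)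
  have hC₀7 : 1000 ≤ C₀ := by omega
  refine blocks_solve c (ℓ := ℓ) (S := C₀ * (n + 1)) (H := Nat.log 2 (2 * ℓ)) T hσ hσn hℓ
    (hlt (c + 13) _ (by omega) ?_) (hlt (C₀ + 1) _ (by omega) ?_) (hlt 7 _ (by omega) ?_)
    (fun h hh => (Nat.le_log_iff_pow_le (by omega) (by omega)).2 hh) (fun h hh => ?_) ?_ fun q => ?_
  · rw [pow_succ m]
    exact Nat.mul_le_mul (h2m _) (by omega)
  · rw [pow_succ m]
    exact Nat.mul_le_mul hC₀m (by omega)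
  · exact le_trans (by norm_num) (h2m 7)
  · have hR1 : 2 ^ (h + (c + 11)) ≤ m ^ (c + 13) := by
      calc 2 ^ (h + (c + 11)) = 2 ^ h * 2 ^ (c + 11) := by rw [pow_add]
        _ ≤ (m * m) * m ^ (c + 11) :=
          Nat.mul_le_mul (hh.trans (Nat.mul_le_mul hm2 (by omega))) (h2m _)
        _ = m ^ (c + 13) := by ring
    have hR2 : ((n + 1) / ℓ + 1) * 2 ^ (h + (c + 11)) ≤ 6 * 2 ^ (c + 11) * (n + 1) := by
      calc ((n + 1) / ℓ + 1) * 2 ^ (h + (c + 11))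
          = 2 ^ (c + 11) * (((n + 1) / ℓ + 1) * 2 ^ h) := by rw [pow_add]; ring
        _ ≤ 2 ^ (c + 11) * (((n + 1) / ℓ + 1) * (2 * ℓ)) := by gcongr
        _ = 2 * 2 ^ (c + 11) * (((n + 1) / ℓ + 1) * ℓ) := by ring
        _ ≤ 2 * 2 ^ (c + 11) * (3 * (n + 1)) := by gcongr
        _ = _ := by ring
    have hA := Nat.mul_le_mul_left (c + 22) hR2
    have e0 : C₀ * (n + 1) = 1000 * ((c + 22) * (6 * 2 ^ (c + 11) * (n + 1))) + 1000 * (n + 1) := by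
      rw [hC₀]; ring
    refine ⟨hlt ((c + 2) * (c + 13)) _ (by omega) ?_, hlt (2 * (c + 13)) _ (by omega) ?_, ?_, ?_⟩
    · calc 2 ^ ((c + 2) * (h + (c + 11))) = (2 ^ (h + (c + 11))) ^ (c + 2) := by
            rw [mul_comm, pow_mul]
        _ ≤ (m ^ (c + 13)) ^ (c + 2) := Nat.pow_le_pow_left hR1 _
        _ = _ := by rw [mul_comm, pow_mul]
    · calc _ ≤ m ^ (c + 13) * m ^ (c + 13) := Nat.mul_le_mul hR1 hR1
        _ = _ := by rw [← pow_add, two_mul]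
    · have e1 : ((n + 1) / ℓ + 1) * ((5 * (c + 2) + 20) * 2 ^ (h + (c + 11))) ≤
          5 * ((c + 22) * (((n + 1) / ℓ + 1) * 2 ^ (h + (c + 11)))) := by
        calc _ = (5 * (c + 2) + 20) * (((n + 1) / ℓ + 1) * 2 ^ (h + (c + 11))) := by ring
          _ ≤ (5 * (c + 22)) * (((n + 1) / ℓ + 1) * 2 ^ (h + (c + 11))) :=
            Nat.mul_le_mul_right _ (by omega)
          _ = _ := by ring
      rw [e0, ← hn]
      generalize ((n + 1) / ℓ + 1) * ((5 * (c + 2) + 20) * 2 ^ (h + (c + 11))) = V at e1 ⊢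
      generalize (c + 22) * (((n + 1) / ℓ + 1) * 2 ^ (h + (c + 11))) = X at hA e1
      generalize (c + 22) * (6 * 2 ^ (c + 11) * (n + 1)) = Y at hA ⊢
      omega
    · have e1 : ((n + 1) / ℓ + 1) * ((c + 2 + 20) * 1000 * 2 ^ (h + (c + 11)) + 28) =
          1000 * ((c + 22) * (((n + 1) / ℓ + 1) * 2 ^ (h + (c + 11)))) +
          28 * ((n + 1) / ℓ + 1) := by ring
      have e2 : ((n + 1) / ℓ + 1) * (ℓ * 60 + 48) = 60 * (((n + 1) / ℓ + 1) * ℓ) +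
        48 * ((n + 1) / ℓ + 1) := by ring
      rw [e0, ← hn, e1, e2]
      generalize (c + 22) * (((n + 1) / ℓ + 1) * 2 ^ (h + (c + 11))) = X at hA ⊢
      generalize (c + 22) * (6 * 2 ^ (c + 11) * (n + 1)) = Y at hA ⊢
      omega
  · push_cast
    have h1 : (0 : ℝ) ≤ 1000 * (c + 20) * (n + 1) := by positivity
    nlinarith
  · obtain ⟨hy, hJ⟩ := clog_le_of_two_pow_le (κ := c + 11) hσ
      ((Nat.pow_log_le_self 2 (by omega : 2 * ℓ ≠ 0)).trans (by omega : 2 * ℓ ≤ 2 * σ))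
    generalize Nat.clog 2 (Nat.log 2 (2 * ℓ) + (c + 11)) = J at hJ
    generalize Real.logb 2 (Real.logb 2 (σ : ℝ)) = y at hy hJ
    have hC1 : (1000 : ℝ) ≤ C₀ := by exact_mod_cast hC₀7
    have hc : (0 : ℝ) ≤ c := Nat.cast_nonneg c
    have hq : (0 : ℝ) ≤ q := Nat.cast_nonneg q
    push_cast at hJ ⊢
    have hB : ((c : ℝ) + 2) * 240 + J * 280 + 300 + 10 ≤ (1000 * (c + 20)) * (1 + y) := by
      nlinarith
    have h1 : (q : ℝ) * (((c : ℝ) + 2) * 240 + J * 280 + 300 + 10) ≤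
        q * ((1000 * (c + 20)) * (1 + y)) := mul_le_mul_of_nonneg_left hB hq
    have h2 : (0 : ℝ) ≤ ((C₀ : ℝ) - 1000) * (q + 1) * (1 + y) :=
      mul_nonneg (mul_nonneg (by linarith) (by linarith)) (by linarith)
    have h3 : (1 : ℝ) ≤ (q + 1) * (1 + y) :=
      one_le_mul_of_one_le_of_one_le (by linarith) (by linarith)
    have h4 : (0 : ℝ) ≤ 1000 * (c + 20) * (1 + y) := by positivity
    nlinarith

end WordRAM

theorem corollary1 :
    -- preprocessing time and space `O(n σ ^ ε)`, query time `O(m)`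
    (∀ ε : ℝ, 0 < ε →
      ∃ (pre qry : WordRAM.Prog) (k : ℕ) (C : ℝ), 1 ≤ k ∧
        ∀ (σ : ℕ) (T : List (Fin σ)) (w : ℕ), 1 ≤ σ →
          (T.length + σ + 1) ^ k ≤ 2 ^ w →
          SolvesSubsequenceIndexing pre qry w T
            (C * ((T.length : ℝ) + 1) * (σ : ℝ) ^ ε)
            (fun m => C * ((m : ℝ) + 1))) ∧
    -- preprocessing time and space `O(n)`, query time `O(m log log σ)`
    (∀ c : ℕ,
      ∃ (pre qry : WordRAM.Prog) (k : ℕ) (C : ℝ), 1 ≤ k ∧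
        ∀ (σ : ℕ) (T : List (Fin σ)) (w : ℕ), 1 ≤ σ →
          σ ≤ (T.length + 1) ^ c →
          (T.length + σ + 1) ^ k ≤ 2 ^ w →
          SolvesSubsequenceIndexing pre qry w T
            (C * ((T.length : ℝ) + 1))
            (fun m => C * ((m : ℝ) + 1) * (1 + Real.logb 2 (Real.logb 2 (σ : ℝ))))) := by
  exact ⟨WordRAM.persistent_trie, WordRAM.block_structure⟩
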